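/- **Conventions.** Fix $n,\ell\ge 0$. Rings are commutative with unit. For $0\le i\le \ell$ let $X^*_i=(X^*_{i,0},\dots,X^*_{i,n})$ be $n+1$ indeterminates, thought of as the coefficients of a linear form in homogeneous coordinates $X_i=(X_{i,0},\dots,X_{i,n})$ of $\mathbb P^n$, and let $X^*_{\le\ell}=(X^*_0,\dots,X^*_\ell)$. The space $\mathbb P^n(K)$ carries the Zariski topology. *Chow forms of algebraic sets.* Let $K$ be an algebraically closed field and $W\subseteq\mathbb P^n(K)$ Zariski closed. A polynomial $C\in K[X^*_{\le \ell}]$ is a *Chow form for $W$* if for all linear forms $\lambda_0,\dots,\lambda_\ell$ over $K$ $$C(\lambda_0,\dots,\lambda_\ell)=0\iff W\cap V(\lambda_0,\dots,\lambda_\ell)\neq\emptyset .$$ If moreover $C$ is irreducible, it is called *the* Chow form $C_W$ of $W$; it is then unique up to a factor in $K^\times$. *Splittable polynomials and the wedge.* For $D\ge 1$, a homogeneous $g=\sum_\alpha a_\alpha {X^*}^\alpha\in A[X^*]$ of degree $D$ is *splittable* if $(a_\alpha)$ satisfies every polynomial relation over $\mathbb Z$ satisfied by the coefficients of the generic product $\prod_{t<D}(X^*\cdot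 Y_t)$, where the $Y_t$ are vectors of $n+1$ indeterminates; for $D=0$ every constant is splittable. If $f\in A[X]$ is homogeneous of degree $d$ and $g\in A[X^*]$ is splittable of degree $D$, with $A$ reduced, then $f\wedge g$ denotes the (unique, if it exists) element $w\in A$ such that for every homomorphism from $A$ to an algebraically closed field $L$, if $g$ splits as $y\prod_{t<D}(X^*\cdot x_t)$ over $L$, then $w$ is mapped to $y^d\prod_{t<D}f(x_t)$ (with $0^0=1$). For $R\in A[X^*_{\le\ell}]$ splittable as a polynomial in $X^*_i$ and $f\in A[X_i]$ homogeneous, $f\wedge R$ is formed with respect to $X_i$ and $X^*_i$, the other indeterminates being treated as coefficients. *Resultants and abstract Chow forms.* Let $I\subseteq\{0,\dots,\ell\}$. A polynomial $R$ in the groups $X^*_i$, $i\in I$, over a reduced ring $A$ is a *resultant* over $A$ in these groups if for every $i\in I$: (1) $R$ is splittable as a polynomial in $X^*_i$; (2) for every reduced $A$-algebra $B$ and every homogeneous $f\in B[X_i]$, the polynomial $f\wedge R$ exists over $B$ and is a resultant over $B$ in the groups $X^*_j$, $j\in I\setminus\{i\}$; (3) if moreover $j\in I\setminus\{i\}$ and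 $g\in B[X_j]$ is homogeneous, then $g\wedge f\wedge R=f\wedge g\wedge R$. (If $I=\emptyset$, every element of $A$ is a resultant. Zero polynomials are taken with the degrees they inherit, $f\wedge R$ having degree $\deg f\cdot\deg_{X^*_j}R$ in $X^*_j$.) A polynomial $C\in A[X^*_{\le\ell}]$ is *alternating* if for all $i\ne j$ it is unchanged when $X^*_i$ is replaced by $X^*_i+ZX^*_j$, where $Z$ is a new indeterminate. A *Chow form* in dimension $\ell$ over $A$ is an alternating resultant $C\in A[X^*_{\le \ell}]$ in all the groups $X^*_0,\dots,X^*_\ell$. **Theorem.** Let $K$ be an algebraically closed field, $n,\ell\ge 0$, and $C\in K[X^*_{\le\ell}]\setminus\{0\}$. Then $C$ is a Chow form if and only if it is a Chow form for some Zariski closed set $W\subseteq\mathbb P^n(K)$. Moreover, if $C$ is a Chow form for the Zariski closed set $W\subseteq\mathbb P^n(K)$, then every irreducible component $U$ of $W$ has a Chow form $C_U$ (in dimension $\ell$), and the irreducible factors of $C$ are, up to factors in $K^\times$, exactly the polynomials $C_U$, where $U$ varies over the irreducible components of $W$. In particular, $W$ is the only Zariski closed subset of $\mathbb P^n(K)$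 for which $C$ is a Chow form, and $W$ is of pure dimension $\ell$ (every irreducible component of $W$ has dimension $\ell$). -/

import Mathlib

open scoped LinearAlgebra.Projectivization

universe u

namespace ChowForms

noncomputable section

/-! ### Projective space with its Zariski topology -/

/-- The set `ℙⁿ(K)` of `K`-rational points of projective `n`-space. -/
def ProjSpace (K : Type u) [Field K] (n : ℕ) : Type u := ℙ K (Fin (n + 1) → K)

/-- The vector of homogeneous coordinates of a point (some choice of it). -/
def ProjSpace.coords {K : Type u} [Field K] {n : ℕ} (x : ProjSpace K n) : Fin (n + 1) → K :=
  Projectivization.rep x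

/-- The common zero set in `ℙⁿ(K)` of a set of polynomials
(used for sets of homogeneous polynomials only). -/
def zeroLocus {K : Type u} [Field K] {n : ℕ} (S : Set (MvPolynomial (Fin (n + 1)) K)) :
    Set (ProjSpace K n) :=
  {x | ∀ f ∈ S, MvPolynomial.eval x.coords f = 0}

/-- An algebraic subset of `ℙⁿ(K)`: the zero set of a set of homogeneous polynomials. -/
def IsAlgebraicSet {K : Type u} [Field K] {n : ℕ} (W : Set (ProjSpace K n)) : Prop :=
  ∃ S : Set (MvPolynomial (Fin (n + 1)) K), (∀ f ∈ S, ∃ d, f.IsHomogeneous d) ∧ W = zeroLocus S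

/-- The Zariski topology on `ℙⁿ(K)`: the closed sets are the algebraic sets. -/
instance zariskiTopology {K : Type u} [Field K] {n : ℕ} : TopologicalSpace (ProjSpace K n) :=
  TopologicalSpace.ofClosed {W | IsAlgebraicSet W}
    ⟨{1}, by
      rintro f rfl
      exact ⟨0, MvPolynomial.isHomogeneous_one _ _⟩, by
      ext x
      simp [zeroLocus]⟩
    (by
      intro A hA
      refine ⟨{f | (∃ d, f.IsHomogeneous d) ∧
        ∃ W ∈ A, ∀ x ∈ W, MvPolynomial.eval x.coords f = 0}, fun f hf => hf.1, ?_⟩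
      ext x
      constructor
      · rintro hx f ⟨-, W, hW, hf⟩
        exact hf x (hx W hW)
      · intro hx W hW
        obtain ⟨S, hS, rfl⟩ := hA hW
        exact fun f hf => hx f ⟨hS f hf, _, hW, fun y hy => hy f hf⟩)
    (by
      rintro _ ⟨S, hS, rfl⟩ _ ⟨T, hT, rfl⟩
      refine ⟨{h | ∃ f ∈ S, ∃ g ∈ T, h = f * g}, ?_, ?_⟩
      · rintro _ ⟨f, hf, g, hg, rfl⟩
        obtain ⟨d, hd⟩ := hS f hf
        obtain ⟨e, he⟩ := hT g hg
        exact ⟨d + e, hd.mul he⟩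
      · ext x
        constructor
        · rintro (hx | hx) _ ⟨f, hf, g, hg, rfl⟩
          · simp [hx f hf]
          · simp [hx g hg]
        · intro hx
          by_contra hcon
          simp only [Set.mem_union, not_or] at hcon
          obtain ⟨h1, h2⟩ := hcon
          simp only [zeroLocus, Set.mem_ofPred_eq, not_forall] at h1 h2
          obtain ⟨f, hf, hf0⟩ := h1
          obtain ⟨g, hg, hg0⟩ := h2
          have h := hx (f * g) ⟨f, hf, g, hg, rfl⟩
          rw [map_mul] at h
          exact (mul_ne_zero hf0 hg0) h)

theorem isClosed_iff_isAlgebraicSet {K : Type u} [Field K] {n : ℕ} (W : Set (ProjSpace K n)) :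
    IsClosed W ↔ IsAlgebraicSet W := by
  rw [← isOpen_compl_iff]
  change (Wᶜᶜ ∈ {W | IsAlgebraicSet W}) ↔ _
  rw [compl_compl]
  rfl

/-- The irreducible components of a subset `W` of a topological space: the maximal irreducible
subsets of `W` (closed, if `W` is closed). -/
def componentsOf {T : Type u} [TopologicalSpace T] (W : Set T) : Set (Set T) :=
  {U | Maximal (fun V => IsIrreducible V ∧ V ⊆ W) U}

/-- All irreducible components of `W` have (Krull) dimension `ℓ`. -/
def HasPureDimension {T : Type u} [TopologicalSpace T] (W : Set T) (ℓ : ℕ) : Prop :=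
  ∀ U ∈ componentsOf W, topologicalKrullDim U = ℓ

/-! ### Chow forms of algebraic sets -/

/-- The indeterminates `X*₀, …, X*_ℓ`, where each `X*ᵢ` stands for the `n + 1` coefficients
`X*ᵢ₀, …, X*ᵢₙ` of a linear form in `n + 1` homogeneous coordinates. -/
abbrev Idx (ℓ n : ℕ) : Type := Fin (ℓ + 1) × Fin (n + 1)

/-- `C` is a Chow form in dimension `ℓ` for `W ⊆ ℙⁿ(K)`: for all linear forms `lam 0, …, lam ℓ`,
`C` vanishes at their coefficients if and only if they have a common zero in `W`. -/
def IsChowFormFor {K : Type u} [Field K] {n ℓ : ℕ} (W : Set (ProjSpace K n))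
    (C : MvPolynomial (Idx ℓ n) K) : Prop :=
  ∀ lam : Fin (ℓ + 1) → Fin (n + 1) → K,
    MvPolynomial.eval (fun p : Idx ℓ n => lam p.1 p.2) C = 0 ↔
      ∃ x ∈ W, ∀ i, ∑ k, lam i k * x.coords k = 0

/-- `C` is the Chow form `C_W` of `W` (unique up to a nonzero constant): an irreducible Chow form
for `W`. -/
def IsIrredChowFormFor {K : Type u} [Field K] {n ℓ : ℕ} (W : Set (ProjSpace K n))
    (C : MvPolynomial (Idx ℓ n) K) : Prop :=
  Irreducible C ∧ IsChowFormFor W C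

/-! ### Splittable polynomials and the wedge operation -/

/-- The product `∏_{i < D} (X* · xᵢ)` of `D` linear forms, with coefficient vectors `xᵢ`. -/
def prodLinear {A : Type u} [CommRing A] {n : ℕ} (D : ℕ) (x : Fin D → Fin (n + 1) → A) :
    MvPolynomial (Fin (n + 1)) A :=
  ∏ i, ∑ k, MvPolynomial.C (x i k) * MvPolynomial.X k

/-- The elementary homogeneous symmetric polynomial `σ_α` in `D` groups of `n + 1` indeterminates:
the coefficient of `X*^α` in `G_D = ∏_{i < D} (X* · Xᵢ)`, with indeterminate vectors `Xᵢ`. -/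
def elemSymm (n D : ℕ) (α : Fin (n + 1) →₀ ℕ) : MvPolynomial (Fin D × Fin (n + 1)) ℤ :=
  MvPolynomial.coeff α
    (prodLinear D (fun i k => (MvPolynomial.X (i, k) : MvPolynomial (Fin D × Fin (n + 1)) ℤ)))

/-- `g ∈ A[X*]` is homogeneous of degree `D` and splittable: `D = 0`, or the coefficients of `g`
satisfy all polynomial relations over `ℤ` that the `σ_α` satisfy. -/
def IsSplittable {A : Type u} [CommRing A] {n : ℕ} (D : ℕ) (g : MvPolynomial (Fin (n + 1)) A) :
    Prop :=
  g.IsHomogeneous D ∧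
    (D = 0 ∨ ∀ Q : MvPolynomial (Fin (n + 1) →₀ ℕ) ℤ,
      MvPolynomial.aeval (elemSymm n D) Q = 0 →
        MvPolynomial.aeval (fun α => MvPolynomial.coeff α g) Q = 0)

/-- `w = f ∧ g`, where `f ∈ A[X]` is homogeneous of degree `d` and `g ∈ A[X*]` is splittable of
degree `D`: under every homomorphism `ψ` from `A` to an algebraically closed field, `g` splits as
`y ∏_{i < D} (X* · xᵢ)`, and `w` takes the value `y ^ d ∏_{i < D} f(xᵢ)`, which does not depend on
the splitting. If `A` is reduced then this determines `w`. -/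
def IsWedge {A : Type u} [CommRing A] {n : ℕ} (d D : ℕ) (f g : MvPolynomial (Fin (n + 1)) A)
    (w : A) : Prop :=
  ∀ (L : Type u) [Field L] [IsAlgClosed L] (ψ : A →+* L),
    ∃ (y : L) (x : Fin D → Fin (n + 1) → L),
      MvPolynomial.map ψ g = MvPolynomial.C y * prodLinear D x ∧
      ψ w = y ^ d * ∏ i, MvPolynomial.eval (x i) (MvPolynomial.map ψ f)

/-- A polynomial in `X*₀, …, X*_ℓ` viewed as a polynomial in `X*ᵢ`, whose coefficients are
polynomials in the other groups of indeterminates. -/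
def asPolyIn {A : Type u} [CommRing A] {ℓ n : ℕ} (i : Fin (ℓ + 1)) (R : MvPolynomial (Idx ℓ n) A) :
    MvPolynomial (Fin (n + 1)) (MvPolynomial (Idx ℓ n) A) :=
  MvPolynomial.aeval (fun p : Idx ℓ n =>
    if p.1 = i then MvPolynomial.X p.2 else MvPolynomial.C (MvPolynomial.X p)) R

/-- `w = f ∧ᵢ R`, the wedge of `f ∈ A[Xᵢ]` (homogeneous of degree `d`) and `R` (of degree `D` in
`X*ᵢ`) relative to the duality between `Xᵢ` and `X*ᵢ`. -/
def IsWedgeAt {A : Type u} [CommRing A] {ℓ n : ℕ} (i : Fin (ℓ + 1)) (d D : ℕ)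
    (f : MvPolynomial (Fin (n + 1)) A) (R w : MvPolynomial (Idx ℓ n) A) : Prop :=
  IsWedge d D (MvPolynomial.map MvPolynomial.C f) (asPolyIn i R) w

/-! ### Resultants and Chow forms -/

/-- `R` is a resultant over `A`, of degree `D i` in `X*ᵢ` for each `i ∈ I`, in the groups of
indeterminates `X*ᵢ` with `i ∈ I`. For every `i ∈ I` it is required that
* `R` is splittable as a polynomial in `X*ᵢ`;
* for every (reduced) `A`-algebra `B` and every homogeneous `f ∈ B[Xᵢ]`, `f ∧ R` exists and is a
  resultant over `B` in the groups `X*ⱼ` with `j ∈ I ∖ {i}`, of degree `deg f * D j` in `X*ⱼ`;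
* if moreover `j ∈ I ∖ {i}` and `g ∈ B[Xⱼ]` is homogeneous, then `g ∧ f ∧ R = f ∧ g ∧ R`.

The groups `X*ᵢ` with `i ∉ I` play no role if they do not occur in `R`, and `X*ᵢ` never occurs in
`f ∧ᵢ R`. The degrees are carried along because the zero polynomial has no degree of its own. -/
def IsResultantOn {ℓ n : ℕ} (I : Finset (Fin (ℓ + 1))) (D : Fin (ℓ + 1) → ℕ)
    (A : Type u) [CommRing A] (R : MvPolynomial (Idx ℓ n) A) : Prop :=
  ∀ i, ∀ _hi : i ∈ I,
    IsSplittable (D i) (asPolyIn i R) ∧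
    ∀ (B : Type u) [CommRing B] [IsReduced B] [Algebra A B] (d : ℕ)
      (f : MvPolynomial (Fin (n + 1)) B), f.IsHomogeneous d →
      (∃ w : MvPolynomial (Idx ℓ n) B,
        IsWedgeAt i d (D i) f (MvPolynomial.map (algebraMap A B) R) w ∧
        IsResultantOn (I.erase i) (fun j => d * D j) B w) ∧
      ∀ j ∈ I.erase i, ∀ (e : ℕ) (g : MvPolynomial (Fin (n + 1)) B), g.IsHomogeneous e →
        ∀ wf wg wgf wfg : MvPolynomial (Idx ℓ n) B,
          IsWedgeAt i d (D i) f (MvPolynomial.map (algebraMap A B) R) wf →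
          IsWedgeAt j e (d * D j) g wf wgf →
          IsWedgeAt j e (D j) g (MvPolynomial.map (algebraMap A B) R) wg →
          IsWedgeAt i d (e * D i) f wg wfg →
          wgf = wfg
termination_by I.card
decreasing_by exact Finset.card_erase_lt_of_mem _hi

/-- `R ∈ A[X*₀, …, X*_ℓ]` is a resultant over the reduced ring `A`. -/
def IsResultant {ℓ n : ℕ} {A : Type u} [CommRing A] (R : MvPolynomial (Idx ℓ n) A) : Prop :=
  ∃ D : Fin (ℓ + 1) → ℕ, IsResultantOn Finset.univ D A R

/-- `R ∈ A[X*₀, …, X*_ℓ]` is alternating: for all `i ≠ j` it does not change if `X*ᵢ` is replaced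
by `X*ᵢ + Z X*ⱼ`, for a new indeterminate `Z`. -/
def IsAlternating {ℓ n : ℕ} {A : Type u} [CommRing A] (R : MvPolynomial (Idx ℓ n) A) : Prop :=
  ∀ i j : Fin (ℓ + 1), i ≠ j →
    MvPolynomial.aeval (fun p : Idx ℓ n =>
      if p.1 = i then
        Polynomial.C (MvPolynomial.X p) + Polynomial.X * Polynomial.C (MvPolynomial.X (j, p.2))
      else (Polynomial.C (MvPolynomial.X p) : Polynomial (MvPolynomial (Idx ℓ n) A))) R =
    Polynomial.C R

/-- A Chow form in dimension `ℓ`: an alternating resultant. -/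
def IsChowForm {ℓ n : ℕ} {A : Type u} [CommRing A] (C : MvPolynomial (Idx ℓ n) A) : Prop :=
  IsAlternating C ∧ IsResultant C

end

end ChowForms

universe v₁ v₂ v₃

namespace ChowForms
noncomputable section

/-! ### Divisibility and zeros of polynomials -/

/-! Three arguments are combined: the geometry of Chow forms of closed sets, the proof that such a
form is a resultant, and the construction of a closed set from an abstract Chow form.

Geometry. Over an algebraically closed field an irreducible polynomial divides whatever vanishes at
its zeros (`dvd_of_forall_eval_eq_zero`), and by elimination theory (`exists_elimination`) a system
of forms without common zero on a closed set is separated from the systems with one by a polynomial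
in the coefficients. For an irreducible cone `Z` the incidence variety of points of `Z` and systems
through them is irreducible, because over each chart it is parametrised by `Z` times an affine
space; so the ideal of its image is prime (`LinSys.isPrime_elimIdeal`). This matches the irreducible
factors of `C` with the components of `W`. A closed set is determined by its Chow form, since linear
forms without common zero on it can be moved so that they all pass through a given point outside
(`exists_hyperplanes_through`). The dimension is `ℓ` because some `ℓ + 1` linear forms have no
common zero on a component whereas any `ℓ` have one, and hyperplane sections turn this into lengths
of chains (`height_le_of_missed`, `le_height_of_meets`).

From sets to resultants. Products of Chow forms are Chow forms, so let `Z` be irreducible with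
irreducible form `Φ`. The wedge with `f` of degree `e` is obtained by inserting the coefficients of
`f` into the elimination form `Φ'` of the systems whose `i`-th member has degree `e` instead of `1`
(`IsForm.exists_raise`), normalised by `Φ' = Φ ^ e` at `e`-th powers of linear forms. The crux is
that `Φ'` has the same degree in the `i`-th group as `Φ`. It comes from
`exists_aeval_eq_zero_of_forall_hyperplane`: if a polynomial of degree `d` over `F` vanishes on the
hyperplane dual to a normalised point `z`, then elements of `F[z]` have degree at most `d` over `F`,
in every characteristic. Over algebraically closed fields `Φ` and `Φ'` then split over the same
finite set of points (`IsForm.exists_splitting`). The normalisation makes two successive raisings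
commute (`IsForm.eq_of_subst_eq`), and induction on the set of groups gives `IsForm.isResultantOn`.

From abstract forms to sets. The candidate `chowSet C` consists of the points `x` such that `C`
vanishes at all systems through `x`; it is closed because the linear forms through `x` are the
contractions of `x` with alternating matrices. It remains to find a point of it on each system where
`C` vanishes. By elimination it is enough to do this at a generic zero `m` of an irreducible factor.
As a polynomial in one group `i` occurring in this factor, `C` splits at `m` into points; one of
them lies on the `i`-th form, and alternation puts all of them on the other forms. Let `z` be such a
point. The groups of `m` can be replaced successively by arbitrary forms through `z`, provided that
each `m j` is generic on the hyperplane of forms through `z` over the closure of `z` and the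
remaining groups (`aeval_eq_zero_of_sum_mul_eq_zero`).

If it were not, then after enlarging the base field `z` would have transcendence degree two, with
basis two coordinates `a`, `b` of `m j` (`false_of_transcendence_degree_two`). There is a
hypersurface `f` through `z` defined over the closure of `ab`. The wedge `f ∧ C` vanishes at `m` and
splits as a polynomial in `X*ⱼ` over that closure; but `a` and `b` satisfy no nontrivial linear
relation over it, so `f ∧ C` vanishes for all values of `a` and `b`. Specialising them to the base
field yields points there on `f`. These lie in finitely many members of a pencil of hyperplanes
avoiding all points of the splitting, which is absurd. -/

theorem _root_.Polynomial.exists_mul_add_mul_eq_C_of_irreducible {R : Type*} [CommRing R] [IsDomain R]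
    [UniqueFactorizationMonoid R] {f g : Polynomial R} (hf : Irreducible f) (hd : f.natDegree ≠ 0)
    (hfg : ¬ f ∣ g) : ∃ a b : Polynomial R, ∃ c : R, c ≠ 0 ∧ a * f + b * g = Polynomial.C c := by
  obtain ⟨p, q, -, -, h⟩ := Polynomial.exists_mul_add_mul_eq_C_resultant f g le_rfl le_rfl
    (Or.inl hd)
  refine ⟨p, q, f.resultant g, ?_, by rw [← h]; ring⟩
  -- By Gauss's lemma `f` stays irreducible over the fraction field and still does not divide `g`,
  -- so both are coprime there and the resultant is not zero.
  have hinj := IsFractionRing.injective R (FractionRing R)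
  have hprim := hf.isPrimitive hd
  have hirr := (hprim.irreducible_iff_irreducible_map_fraction_map (K := FractionRing R)).1 hf
  have hco : IsCoprime (f.map (algebraMap R (FractionRing R)))
      (g.map (algebraMap R (FractionRing R))) := by
    refine (hirr.coprime_iff_not_dvd).2 fun hdvd => hfg ?_
    exact hprim.dvd_of_fraction_map_dvd_fraction_map hdvd
  intro h0
  apply Polynomial.resultant_ne_zero _ _ hco
  rw [Polynomial.natDegree_map_eq_of_injective hinj, Polynomial.natDegree_map_eq_of_injective hinj,
    Polynomial.resultant_map_map, h0, map_zero]

section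
variable {σ : Type*} {R : Type*} [CommRing R]

/-- Polynomials as polynomials in one distinguished variable. -/
def splitVar [DecidableEq σ] (R : Type*) [CommRing R] (s : σ) :
    MvPolynomial σ R ≃ₐ[R] Polynomial (MvPolynomial {b // b ≠ s} R) :=
  (MvPolynomial.renameEquiv R (Equiv.optionSubtypeNe s).symm).trans
    (MvPolynomial.optionEquivLeft R {b // b ≠ s})

theorem splitVar_X_self [DecidableEq σ] (s : σ) :
    splitVar R s (MvPolynomial.X s) = Polynomial.X := by
  simp [splitVar]

theorem splitVar_X_of_ne [DecidableEq σ] (s : σ) (b : {b // b ≠ s}) :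
    splitVar R s (MvPolynomial.X b.1) = Polynomial.C (MvPolynomial.X b) := by
  simp [splitVar, Equiv.optionSubtypeNe_symm_of_ne b.2]

theorem splitVar_rename [DecidableEq σ] (s : σ) (p : MvPolynomial {b // b ≠ s} R) :
    splitVar R s (MvPolynomial.rename Subtype.val p) = Polynomial.C p := by
  induction p using MvPolynomial.induction_on with
  | C a => simp [splitVar]
  | add p q hp hq => simp [hp, hq]
  | mul_X p b hp => rw [map_mul, map_mul, hp, MvPolynomial.rename_X, splitVar_X_of_ne, map_mul]

theorem splitVar_natDegree [DecidableEq σ] (s : σ) (p : MvPolynomial σ R) :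
    (splitVar R s p).natDegree = p.degreeOf s :=
  (MvPolynomial.degreeOf_eq_natDegree s p).symm

theorem aeval_eq_splitVar [DecidableEq σ] {A : Type*} [CommRing A] [Algebra R A] (s : σ)
    (x : σ → A) (p : MvPolynomial σ R) :
    MvPolynomial.aeval x p =
      Polynomial.eval (x s) ((splitVar R s p).map
        (MvPolynomial.aeval (fun b : {b // b ≠ s} => x b.1)).toRingHom) := by
  have : MvPolynomial.aeval x = (Polynomial.eval₂AlgHom (R := R)
      (MvPolynomial.aeval (fun b : {b // b ≠ s} => x b.1)) (x s) (fun _ => Commute.all _ _)).comp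
      (splitVar R s).toAlgHom := by
    ext b
    by_cases hb : b = s
    · subst hb
      simp [splitVar_X_self]
    · have := splitVar_X_of_ne (R := R) s ⟨b, hb⟩
      simp only at this
      simp [this]
  rw [this, Polynomial.eval_map]
  rfl

end

/-- A polynomial not divisible by an irreducible polynomial involving the variable `s` yields a
nonzero combination that does not involve `s`. -/
theorem exists_bezout_of_irreducible {σ : Type*} {K : Type*} [Field K] {s : σ}
    {Ψ P : MvPolynomial σ K} (hΨ : Irreducible Ψ) (hs : Ψ.degreeOf s ≠ 0) (h : ¬ Ψ ∣ P) :
    ∃ (a b : MvPolynomial σ K) (c : MvPolynomial {b // b ≠ s} K), c ≠ 0 ∧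
      a * Ψ + b * P = MvPolynomial.rename Subtype.val c := by
  classical
  obtain ⟨a, b, c, hc, habc⟩ := Polynomial.exists_mul_add_mul_eq_C_of_irreducible
    (f := splitVar K s Ψ) (g := splitVar K s P)
    ((MulEquiv.irreducible_iff (splitVar K s)).2 hΨ) (by rwa [splitVar_natDegree])
    (fun hd => h ((map_dvd_iff (splitVar K s)).1 hd))
  refine ⟨(splitVar K s).symm a, (splitVar K s).symm b, c, hc, ?_⟩
  apply (splitVar K s).injective
  rw [splitVar_rename]
  simpa using habc

theorem exists_degreeOf_ne_zero {σ : Type*} {K : Type*} [Field K] {Ψ : MvPolynomial σ K}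
    (hΨ : Irreducible Ψ) : ∃ s, Ψ.degreeOf s ≠ 0 := by
  by_contra! h
  have h0 : Ψ.totalDegree = 0 := by
    rw [MvPolynomial.totalDegree_eq_zero_iff]
    intro m hm x
    have := MvPolynomial.le_degreeOf_of_mem_support x hm
    rw [h x] at this
    omega
  rw [MvPolynomial.totalDegree_eq_zero_iff_eq_C] at h0
  rw [h0] at hΨ
  by_cases hc : Ψ.coeff 0 = 0
  · rw [hc, map_zero] at hΨ
    exact hΨ.ne_zero rfl
  · exact hΨ.not_isUnit ((isUnit_iff_ne_zero.2 hc).map MvPolynomial.C)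

theorem exists_eval_ne_zero {σ : Type*} {K : Type*} [Field K] [Infinite K] {p : MvPolynomial σ K}
    (hp : p ≠ 0) : ∃ x, MvPolynomial.eval x p ≠ 0 := by
  by_contra! h
  exact hp (MvPolynomial.funext fun x => by simpa using h x)

/-- Over an algebraically closed field, an irreducible polynomial divides every polynomial that
vanishes at its zeros. -/
theorem dvd_of_forall_eval_eq_zero {σ : Type*} {K : Type*} [Field K] [IsAlgClosed K]
    {Ψ P : MvPolynomial σ K} (hΨ : Irreducible Ψ)
    (h : ∀ x, MvPolynomial.eval x Ψ = 0 → MvPolynomial.eval x P = 0) : Ψ ∣ P := by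
  classical
  have : Infinite K := IsAlgClosed.instInfinite
  by_contra hnd
  obtain ⟨s, hs⟩ := exists_degreeOf_ne_zero hΨ
  obtain ⟨a, b, c, hc, habc⟩ := exists_bezout_of_irreducible hΨ hs hnd
  have hl : (splitVar K s Ψ).leadingCoeff ≠ 0 := by
    rw [Polynomial.leadingCoeff_ne_zero]
    simpa using hΨ.ne_zero
  -- At `y` the leading coefficient survives, so `Ψ` acquires a root in the variable `s`. There `Ψ`
  -- and hence `P` vanish, and so would their combination `c`.
  obtain ⟨y, hy⟩ := exists_eval_ne_zero (mul_ne_zero hc hl)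
  rw [map_mul] at hy
  have hdeg : ((splitVar K s Ψ).map (MvPolynomial.aeval (R := K) y).toRingHom).degree ≠ 0 := by
    rw [Polynomial.degree_map_eq_of_leadingCoeff_ne_zero]
    · intro h0
      apply hs
      rw [← splitVar_natDegree, Polynomial.natDegree_eq_of_degree_eq_some h0]
      rfl
    · simpa [MvPolynomial.aeval_eq_eval] using right_ne_zero_of_mul hy
  obtain ⟨z, hz⟩ := IsAlgClosed.exists_root _ hdeg
  let x : σ → K := fun b => if hb : b = s then z else y ⟨b, hb⟩
  have hxy : (fun b : {b // b ≠ s} => x b.1) = y := by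
    funext b
    simp [x, b.2]
  have h1 : MvPolynomial.eval x Ψ = 0 := by
    have := aeval_eq_splitVar s x Ψ
    rw [hxy] at this
    rw [← MvPolynomial.aeval_eq_eval]
    simpa [x] using this.trans (by simpa [x] using hz)
  have h2 := congrArg (MvPolynomial.eval x) habc
  rw [map_add, map_mul, map_mul, h1, h x h1, MvPolynomial.eval_rename] at h2
  apply left_ne_zero_of_mul hy
  rw [← hxy]
  simpa [Function.comp_def] using h2.symm

end
end ChowForms

namespace ChowForms
noncomputable section

/-! ### Elimination theory -/

open MvPolynomial in
attribute [local instance] MvPolynomial.gradedAlgebra in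
theorem homogeneousComponent_mem_span {τ R : Type*} [CommRing R] {T : Set (MvPolynomial τ R)}
    (hT : ∀ t ∈ T, ∃ d, t.IsHomogeneous d) {p : MvPolynomial τ R} (hp : p ∈ Ideal.span T) (M : ℕ) :
    MvPolynomial.homogeneousComponent M p ∈ Ideal.span T := by
  have h : (Ideal.span T).IsHomogeneous (MvPolynomial.homogeneousSubmodule τ R) :=
    Ideal.homogeneous_span _ _ fun t ht => by
      obtain ⟨d, hd⟩ := hT t ht
      exact ⟨d, hd⟩
  have := h M hp
  rw [← MvPolynomial.decomposition.decompose'_apply]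
  exact this

/-- Monomial multipliers are absorbed by the ideal before extension, so only the scalars of `L` are
new. This reduces elimination to linear algebra in one degree. -/
theorem mem_span_of_mem_map_span {τ R L : Type*} [CommRing R] [CommRing L] (ψ : R →+* L)
    (I : Ideal (MvPolynomial τ R)) {q : MvPolynomial τ L} (hq : q ∈ I.map (MvPolynomial.map ψ)) :
    q ∈ Submodule.span L (MvPolynomial.map ψ '' (I : Set (MvPolynomial τ R))) := by
  refine Submodule.span_induction (p := fun q _ => q ∈ Submodule.span L _) ?_ ?_ ?_ ?_ hq
  · exact fun x hx => Submodule.subset_span hx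
  · exact Submodule.zero_mem _
  · exact fun x y _ _ hx hy => Submodule.add_mem _ hx hy
  · intro a x _ hx
    induction a using MvPolynomial.induction_on' with
    | add p q hp hq => rw [add_smul]; exact Submodule.add_mem _ hp hq
    | monomial m a =>
      refine Submodule.span_induction (p := fun x _ => MvPolynomial.monomial m a • x ∈
        Submodule.span L _) ?_ ?_ ?_ ?_ hx
      · rintro _ ⟨p, hp, rfl⟩
        have : MvPolynomial.monomial m a • MvPolynomial.map ψ p =
            a • MvPolynomial.map ψ (MvPolynomial.monomial m 1 * p) := by
          rw [map_mul, MvPolynomial.map_monomial, map_one, smul_eq_mul, ← smul_mul_assoc,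
            MvPolynomial.smul_monomial, smul_eq_mul, mul_one]
        rw [this]
        exact Submodule.smul_mem _ _ (Submodule.subset_span ⟨_, I.mul_mem_left _ hp, rfl⟩)
      · simp
      · intro x y _ _ hx hy
        rw [smul_add]; exact Submodule.add_mem _ hx hy
      · intro c x _ hx
        rw [smul_comm]; exact Submodule.smul_mem _ _ hx

/-- The main theorem of elimination theory: if a homogeneous system over `R` has no nontrivial
solution over some specialisation, then this is witnessed by an element of the elimination ideal. -/
theorem exists_elimination {τ R L : Type*} [Fintype τ] [CommRing R] [Field L] [IsAlgClosed L]
    (T : Set (MvPolynomial τ R)) (hT : ∀ t ∈ T, ∃ d, t.IsHomogeneous d) (ψ : R →+* L)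
    (h : ∀ x : τ → L, (∀ t ∈ T, MvPolynomial.eval₂ ψ x t = 0) → x = 0) :
    ∃ P : R, ψ P ≠ 0 ∧ ∃ N, ∀ i, MvPolynomial.C P * MvPolynomial.X i ^ N ∈ Ideal.span T := by
  classical
  have hN : ∀ i : τ, ∃ N, (MvPolynomial.X i : MvPolynomial τ L) ^ N ∈
      (Ideal.span T).map (MvPolynomial.map ψ) := by
    intro i
    rw [← Ideal.mem_radical_iff, ← MvPolynomial.vanishingIdeal_zeroLocus_eq_radical (K := L)]
    intro x hx
    rw [Ideal.map_span, MvPolynomial.zeroLocus_span] at hx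
    rw [h x fun t ht => ?_]
    · simp
    · have := hx _ ⟨t, ht, rfl⟩
      rwa [MvPolynomial.aeval_eq_eval, MvPolynomial.eval_map] at this
  choose N hN using hN
  -- By the pigeonhole principle every monomial of degree `M` has an exponent at least `N i` for
  -- some `i`, so it lies in the extended ideal.
  set M := ∑ i, N i + 1
  let ι : Type _ := {α : τ →₀ ℕ // α ∈ Finset.finsuppAntidiag Finset.univ M}
  have : Fintype ι := Finset.fintypeCoeSort (Finset.finsuppAntidiag Finset.univ M)
  have hι : ∀ α : τ →₀ ℕ, α ∈ Finset.finsuppAntidiag Finset.univ M ↔ α.degree = M := by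
    intro α
    rw [Finset.mem_finsuppAntidiag, Finsupp.degree_eq_sum]
    simp
  have hmono : ∀ α : ι, (MvPolynomial.monomial α.1 1 : MvPolynomial τ L) ∈
      (Ideal.span T).map (MvPolynomial.map ψ) := by
    rintro ⟨α, hα⟩
    rw [hι, Finsupp.degree_eq_sum] at hα
    obtain ⟨i, hi⟩ : ∃ i, N i ≤ α i := by
      by_contra! hlt
      have := Finset.sum_le_sum fun i (_ : i ∈ Finset.univ) => (hlt i).le
      omega
    have : (MvPolynomial.monomial α 1 : MvPolynomial τ L) =
        MvPolynomial.monomial (α - Finsupp.single i (N i)) 1 * MvPolynomial.X i ^ N i := by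
      rw [MvPolynomial.X_pow_eq_monomial, MvPolynomial.monomial_mul, one_mul,
        tsub_add_cancel_of_le (by simpa using hi)]
    rw [this]
    exact Ideal.mul_mem_left _ _ (hN i)
  let cf : MvPolynomial τ L →ₗ[L] (ι → L) := LinearMap.pi fun α => MvPolynomial.lcoeff L α.1
  -- Coefficient vectors of specialised members of the ideal of degree `M`. They span the space of
  -- all forms of degree `M`, so a basis can be selected among them.
  let G : Set (ι → L) := {v | ∃ p ∈ Ideal.span T, p.IsHomogeneous M ∧ v = cf (MvPolynomial.map ψ p)}
  have hG : ⊤ ≤ Submodule.span L G := by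
    have h1 : ∀ q ∈ Submodule.span L
        (MvPolynomial.map ψ '' (Ideal.span T : Set (MvPolynomial τ R))), cf q ∈ Submodule.span L G := by
      intro q hq
      have : Submodule.span L (MvPolynomial.map ψ '' (Ideal.span T : Set (MvPolynomial τ R))) ≤
          (Submodule.span L G).comap cf := by
        rw [Submodule.span_le]
        rintro _ ⟨p, hp, rfl⟩
        refine Submodule.subset_span ⟨_, homogeneousComponent_mem_span hT hp M,
          MvPolynomial.homogeneousComponent_isHomogeneous M p, ?_⟩
        ext α
        have := (hι _).1 α.2
        simp [cf, MvPolynomial.coeff_map, MvPolynomial.coeff_homogeneousComponent, this]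
      exact this hq
    rw [← (Pi.basisFun L ι).span_eq, Submodule.span_le]
    rintro _ ⟨α, rfl⟩
    have h2 := h1 _ (mem_span_of_mem_map_span ψ _ (hmono α))
    convert! h2 using 1
    ext β
    simp only [cf, Pi.basisFun_apply, LinearMap.pi_apply, MvPolynomial.lcoeff_apply,
      MvPolynomial.coeff_monomial, Pi.single_apply]
    exact if_congr (by rw [eq_comm, Subtype.ext_iff]) rfl rfl
  let b0 := Module.Basis.ofSpan hG
  let b := b0.reindex (b0.indexEquiv (Pi.basisFun L ι))
  have hb : ∀ β, b β ∈ G := by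
    intro β
    simp only [b, Module.Basis.reindex_apply]
    exact Module.Basis.ofSpan_subset hG ⟨_, rfl⟩
  choose p hp hph hpb using hb
  -- The witness is `det A`: it survives specialisation because the rows become a basis, and the
  -- adjugate expresses `det A` times a monomial of degree `M` by the `p β`.
  let A : Matrix ι ι R := fun β α => (p β).coeff α.1
  refine ⟨A.det, ?_, M, fun i => ?_⟩
  · have h1 : (A.map ψ) = Matrix.of b := by
      ext β α
      rw [Matrix.of_apply, hpb]
      simp only [A, cf, LinearMap.pi_apply, MvPolynomial.lcoeff_apply, MvPolynomial.coeff_map]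
      rfl
    rw [RingHom.map_det]
    have h2 : IsUnit (A.map ψ) := by
      rw [← Matrix.linearIndependent_rows_iff_isUnit]
      rw [h1]
      exact b.linearIndependent
    exact ((Matrix.isUnit_iff_isUnit_det _).1 h2).ne_zero
  · let α : ι := ⟨Finsupp.single i M, by rw [hι]; simp⟩
    have h1 : MvPolynomial.C A.det * MvPolynomial.X i ^ M =
        ∑ β, MvPolynomial.C (A.adjugate α β) * p β := by
      ext γ
      rw [MvPolynomial.coeff_C_mul, MvPolynomial.X_pow_eq_monomial, MvPolynomial.coeff_monomial,
        MvPolynomial.coeff_sum]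
      by_cases hγ : γ.degree = M
      · have h2 := congrFun (congrFun (Matrix.adjugate_mul A) α) ⟨γ, (hι γ).2 hγ⟩
        rw [Matrix.mul_apply] at h2
        simp only [MvPolynomial.coeff_C_mul]
        refine Eq.trans ?_ h2.symm
        simp [Matrix.one_apply, α, Subtype.ext_iff]
      · rw [if_neg, mul_zero, eq_comm]
        · refine Finset.sum_eq_zero fun β _ => ?_
          rw [MvPolynomial.coeff_C_mul, (hph β).coeff_eq_zero hγ, mul_zero]
        · rintro rfl
          simp at hγ
    rw [h1]
    exact Ideal.sum_mem _ fun β _ => Ideal.mul_mem_left _ _ (hp β)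

/-- The converse of elimination: a nontrivial solution has a nonzero coordinate, where `P * X i ^ N`
can only vanish through `P`. -/
theorem eq_zero_of_mem_span {τ R L : Type*} [CommRing R] [Field L] {T : Set (MvPolynomial τ R)}
    {P : R} {N : ℕ} (hP : ∀ i, MvPolynomial.C P * MvPolynomial.X i ^ N ∈ Ideal.span T)
    (ψ : R →+* L) {x : τ → L} (hx : x ≠ 0) (hT : ∀ t ∈ T, MvPolynomial.eval₂ ψ x t = 0) :
    ψ P = 0 := by
  obtain ⟨i, hi⟩ := Function.ne_iff.1 hx
  have h1 : Ideal.span T ≤ RingHom.ker (MvPolynomial.eval₂Hom ψ x) :=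
    Ideal.span_le.2 fun t ht => hT t ht
  have h2 := h1 (hP i)
  rw [RingHom.mem_ker] at h2
  simp only [MvPolynomial.coe_eval₂Hom, MvPolynomial.eval₂_mul, MvPolynomial.eval₂_C,
    MvPolynomial.eval₂_pow, MvPolynomial.eval₂_X] at h2
  exact (mul_eq_zero.1 h2).resolve_right (pow_ne_zero _ hi)

end
end ChowForms

namespace ChowForms
noncomputable section

/-! ### Products of linear forms -/

/-- A linear form in the variables in `s`. -/
def linearForm {σ A : Type*} [CommRing A] (s : Finset σ) (x : σ → A) : MvPolynomial σ A :=
  ∑ k ∈ s, MvPolynomial.C (x k) * MvPolynomial.X k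

section linearForm
variable {σ : Type*} {L : Type*} [Field L] {s : Finset σ}

theorem coeff_linearForm {A : Type*} [CommRing A] [DecidableEq σ] (s : Finset σ) (x : σ → A)
    {k : σ} (hk : k ∈ s) :
    (linearForm s x).coeff (Finsupp.single k 1) = x k := by
  rw [linearForm, MvPolynomial.coeff_sum, Finset.sum_eq_single_of_mem k hk]
  · simp
  · intro b _ hb
    simp [MvPolynomial.coeff_C_mul, MvPolynomial.coeff_X, Finsupp.single_left_inj, hb]

theorem isHomogeneous_linearForm {A : Type*} [CommRing A] (s : Finset σ) (x : σ → A) :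
    (linearForm s x).IsHomogeneous 1 :=
  MvPolynomial.IsHomogeneous.sum _ _ _ fun k _ => by
    simpa using (MvPolynomial.isHomogeneous_C σ (x k)).mul (MvPolynomial.isHomogeneous_X A k)

theorem eval_linearForm {A : Type*} [CommRing A] (s : Finset σ) (x u : σ → A) :
    MvPolynomial.eval u (linearForm s x) = ∑ k ∈ s, x k * u k := by
  simp [linearForm]

theorem linearForm_ne_zero {x : σ → L} {k : σ} (hk : k ∈ s) (hx : x k ≠ 0) :
    linearForm s x ≠ 0 := by
  classical
  intro h
  rw [← coeff_linearForm s x hk, h, MvPolynomial.coeff_zero] at hx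
  exact hx rfl

theorem irreducible_linearForm {x : σ → L} {k : σ} (hk : k ∈ s) (hx : x k ≠ 0) :
    Irreducible (linearForm s x) := by
  have h0 := linearForm_ne_zero hk hx
  have hdeg : (linearForm s x).totalDegree = 1 := (isHomogeneous_linearForm s x).totalDegree h0
  have key : ∀ a : MvPolynomial σ L, a ≠ 0 → a.totalDegree = 0 → IsUnit a := by
    intro a ha h
    rw [MvPolynomial.totalDegree_eq_zero_iff_eq_C] at h
    rw [h]
    refine (isUnit_iff_ne_zero.2 fun hc => ha ?_).map MvPolynomial.C
    rw [h, hc, map_zero]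
  refine ⟨fun hu => ?_, fun a b hab => ?_⟩
  · rw [MvPolynomial.isUnit_iff_totalDegree_of_isReduced] at hu
    omega
  · have ha : a ≠ 0 := by rintro rfl; simp [hab] at h0
    have hb : b ≠ 0 := by rintro rfl; simp [hab] at h0
    have := MvPolynomial.totalDegree_mul_of_isDomain ha hb
    rw [← hab, hdeg] at this
    rcases Nat.eq_zero_or_pos a.totalDegree with h | h
    · exact Or.inl (key a ha h)
    · exact Or.inr (key b hb (by omega))

theorem exists_eq_mul_of_linearForm_dvd {x y : σ → L} {k : σ} (hk : k ∈ s) (hx : x k ≠ 0)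
    (h : linearForm s x ∣ linearForm s y) : ∃ c, ∀ j ∈ s, y j = c * x j := by
  classical
  obtain ⟨q, hq⟩ := h
  by_cases hy : linearForm s y = 0
  · refine ⟨0, fun j hj => ?_⟩
    rw [← coeff_linearForm s y hj, hy]
    simp
  · have hx0 := linearForm_ne_zero hk hx
    have hq0 : q ≠ 0 := by rintro rfl; simp [hq] at hy
    have := MvPolynomial.totalDegree_mul_of_isDomain hx0 hq0
    rw [← hq, (isHomogeneous_linearForm s y).totalDegree hy,
      (isHomogeneous_linearForm s x).totalDegree hx0] at this
    have h0 : q.totalDegree = 0 := by omega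
    rw [MvPolynomial.totalDegree_eq_zero_iff_eq_C] at h0
    refine ⟨q.coeff 0, fun j hj => ?_⟩
    rw [← coeff_linearForm s y hj, hq, h0, mul_comm, MvPolynomial.coeff_C_mul,
      coeff_linearForm s x hj]
    simp

end linearForm

theorem prodLinear_eq {A : Type u} [CommRing A] {n : ℕ} (D : ℕ) (x : Fin D → Fin (n + 1) → A) :
    prodLinear D x = ∏ i, linearForm Finset.univ (x i) := rfl

theorem isHomogeneous_prodLinear {A : Type u} [CommRing A] {n : ℕ} (D : ℕ)
    (x : Fin D → Fin (n + 1) → A) : (prodLinear D x).IsHomogeneous D := by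
  rw [prodLinear_eq]
  simpa using MvPolynomial.IsHomogeneous.prod Finset.univ (fun i => linearForm Finset.univ (x i))
    (fun _ => 1) (fun i _ => isHomogeneous_linearForm _ _)

theorem eval_prodLinear {A : Type u} [CommRing A] {n : ℕ} (D : ℕ) (x : Fin D → Fin (n + 1) → A)
    (μ : Fin (n + 1) → A) :
    MvPolynomial.eval μ (prodLinear D x) = ∏ i, ∑ k, x i k * μ k := by
  rw [prodLinear_eq, map_prod]
  exact Finset.prod_congr rfl fun i _ => eval_linearForm _ _ _

theorem map_prodLinear {A B : Type u} [CommRing A] [CommRing B] {n : ℕ} (φ : A →+* B) (D : ℕ)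
    (x : Fin D → Fin (n + 1) → A) :
    MvPolynomial.map φ (prodLinear D x) = prodLinear D fun i k => φ (x i k) := by
  simp [prodLinear]

theorem eval_smul_of_isHomogeneous {A σ : Type*} [CommRing A] {d : ℕ} {f : MvPolynomial σ A}
    (hf : f.IsHomogeneous d) (c : A) (x : σ → A) :
    MvPolynomial.eval (fun k => c * x k) f = c ^ d * MvPolynomial.eval x f := by
  rw [MvPolynomial.eval_eq, MvPolynomial.eval_eq, Finset.mul_sum]
  refine Finset.sum_congr rfl fun m hm => ?_
  have hd : ∑ i ∈ m.support, m i = d := by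
    have := hf (MvPolynomial.mem_support_iff.1 hm)
    rw [Finsupp.weight_apply, Finsupp.sum] at this
    simpa using this
  simp only [mul_pow, Finset.prod_mul_distrib, Finset.prod_pow_eq_pow_sum, hd]
  ring

/-- The value of the wedge does not depend on the splitting. -/
theorem wedge_value_unique {L : Type u} [Field L] {n d D : ℕ} {f : MvPolynomial (Fin (n + 1)) L}
    (hf : f.IsHomogeneous d) {y y' : L} {x x' : Fin D → Fin (n + 1) → L}
    (h : MvPolynomial.C y * prodLinear D x = MvPolynomial.C y' * prodLinear D x') :
    y ^ d * ∏ i, MvPolynomial.eval (x i) f = y' ^ d * ∏ i, MvPolynomial.eval (x' i) f := by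
  -- For `d = 0` the form `f` is a constant and the value is its `D`-th power, even if `y = 0`,
  -- because `0 ^ 0 = 1`.
  rcases Nat.eq_zero_or_pos d with rfl | hd
  · have h0 : f.totalDegree = 0 := by
      rw [MvPolynomial.totalDegree_eq_zero_iff]
      intro m hm x
      have := hf (MvPolynomial.mem_support_iff.1 hm)
      rw [Finsupp.weight_apply, Finsupp.sum, Finset.sum_eq_zero_iff] at this
      by_contra hx
      simpa [hx] using this x (Finsupp.mem_support_iff.2 hx)
    rw [MvPolynomial.totalDegree_eq_zero_iff_eq_C] at h0
    rw [h0]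
    simp
  have hzero : ∀ (y : L) (x : Fin D → Fin (n + 1) → L), MvPolynomial.C y * prodLinear D x = 0 →
      y ^ d * ∏ i, MvPolynomial.eval (x i) f = 0 := by
    intro y x h0
    rcases mul_eq_zero.1 h0 with h0 | h0
    · rw [MvPolynomial.C_eq_zero] at h0
      rw [h0, zero_pow hd.ne', zero_mul]
    · rw [prodLinear_eq, Finset.prod_eq_zero_iff] at h0
      obtain ⟨i, -, hi⟩ := h0
      have hx : x i = fun k => 0 * x i k := by
        funext k
        rw [← coeff_linearForm Finset.univ (x i) (Finset.mem_univ k), hi]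
        simp
      rw [Finset.prod_eq_zero (Finset.mem_univ i), mul_zero]
      rw [hx, eval_smul_of_isHomogeneous hf, zero_pow hd.ne', zero_mul]
  by_cases h0 : MvPolynomial.C y * prodLinear D x = 0
  · rw [hzero y x h0, hzero y' x' (h ▸ h0)]
  clear hzero
  induction D generalizing y y' with
  | zero =>
    simp only [prodLinear, Finset.univ_eq_empty, Finset.prod_empty, mul_one] at h ⊢
    rw [MvPolynomial.C_injective _ _ h]
  | succ D ih =>
    have hx0 : linearForm Finset.univ (x 0) ≠ 0 := by
      intro hx
      apply h0
      rw [prodLinear_eq, Fin.prod_univ_succ, hx, zero_mul, mul_zero]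
    obtain ⟨k, hk⟩ : ∃ k, x 0 k ≠ 0 := by
      by_contra! hall
      exact hx0 (by simp [linearForm, hall])
    have hirr := irreducible_linearForm (Finset.mem_univ k) hk
    have hy' : y' ≠ 0 := by
      rintro rfl
      simp [h] at h0
    -- Unique factorisation: the first factor on one side is proportional to some factor on the
    -- other. Cancel both; homogeneity of `f` turns the factor `c` into `c ^ d`.
    have hdvd : linearForm Finset.univ (x 0) ∣ prodLinear (D + 1) x' := by
      rw [← (((isUnit_iff_ne_zero.2 hy').map (MvPolynomial.C (σ := Fin (n + 1)))).dvd_mul_left), ← h,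
        prodLinear_eq, Fin.prod_univ_succ]
      exact Dvd.intro_left (MvPolynomial.C y * ∏ i : Fin D, linearForm Finset.univ (x i.succ))
        (by ring)
    rw [prodLinear_eq, Prime.dvd_finsetProd_iff hirr.prime] at hdvd
    obtain ⟨j, -, hj⟩ := hdvd
    obtain ⟨c, hc⟩ := exists_eq_mul_of_linearForm_dvd (Finset.mem_univ k) hk hj
    have hxj : x' j = fun k => c * x 0 k := funext fun k => hc k (Finset.mem_univ k)
    have hlj : linearForm Finset.univ (x' j) =
        MvPolynomial.C c * linearForm Finset.univ (x 0) := by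
      rw [hxj]
      simp only [linearForm, map_mul, Finset.mul_sum, mul_assoc]
    have h1 : MvPolynomial.C y * prodLinear D (fun i => x i.succ) =
        MvPolynomial.C (y' * c) * prodLinear D (fun i => x' (j.succAbove i)) := by
      apply mul_left_cancel₀ hx0
      rw [prodLinear_eq, prodLinear_eq, Fin.prod_univ_succ, Fin.prod_univ_succAbove _ j, hlj] at h
      rw [prodLinear_eq, prodLinear_eq, map_mul]
      linear_combination h
    have h2 := ih h1 (by
      intro h3
      apply h0
      rw [prodLinear_eq, Fin.prod_univ_succ]
      rw [prodLinear_eq] at h3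
      linear_combination linearForm Finset.univ (x 0) * h3)
    rw [Fin.prod_univ_succ, Fin.prod_univ_succAbove (fun i => MvPolynomial.eval (x' i) f) j, hxj,
      eval_smul_of_isHomogeneous hf]
    linear_combination MvPolynomial.eval (x 0) f * h2

/-- In a reduced ring the primes intersect in zero, and each is the kernel of the map to an
algebraic closure of its residue field. -/
theorem eq_of_forall_hom_eq {A : Type u} [CommRing A] [IsReduced A] {a b : A}
    (h : ∀ (L : Type u) [Field L] [IsAlgClosed L] (ψ : A →+* L), ψ a = ψ b) : a = b := by
  rw [← sub_eq_zero]
  apply IsReduced.eq_zero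
  rw [nilpotent_iff_mem_prime]
  intro p hp
  let ψ : A →+* AlgebraicClosure (FractionRing (A ⧸ p)) :=
    (algebraMap (FractionRing (A ⧸ p)) _).comp ((algebraMap (A ⧸ p) _).comp (Ideal.Quotient.mk p))
  have h1 := h _ ψ
  rw [← sub_eq_zero, ← map_sub] at h1
  rw [← Ideal.Quotient.eq_zero_iff_mem]
  refine IsFractionRing.injective (A ⧸ p) (FractionRing (A ⧸ p)) ?_
  refine (algebraMap (FractionRing (A ⧸ p)) (AlgebraicClosure (FractionRing (A ⧸ p)))).injective ?_
  rw [map_zero, map_zero]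
  exact h1

theorem IsWedge.unique {A : Type u} [CommRing A] [IsReduced A] {n d D : ℕ}
    {f g : MvPolynomial (Fin (n + 1)) A} (hf : f.IsHomogeneous d) {w w' : A}
    (h : IsWedge d D f g w) (h' : IsWedge d D f g w') : w = w' := by
  refine eq_of_forall_hom_eq fun L _ _ ψ => ?_
  obtain ⟨y, x, hg, hw⟩ := h L ψ
  obtain ⟨y', x', hg', hw'⟩ := h' L ψ
  rw [hw, hw']
  exact wedge_value_unique (hf.map ψ) (hg ▸ hg')

/-- A split polynomial is a specialisation of the generic product, hence satisfies its relations,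
and equations in a reduced ring may be tested at geometric points. -/
theorem isSplittable_of_forall_hom {A : Type u} [CommRing A] [IsReduced A] {n D : ℕ}
    {g : MvPolynomial (Fin (n + 1)) A}
    (h : ∀ (L : Type u) [Field L] [IsAlgClosed L] (ψ : A →+* L),
      ∃ (y : L) (x : Fin D → Fin (n + 1) → L),
        MvPolynomial.map ψ g = MvPolynomial.C y * prodLinear D x) : IsSplittable D g := by
  refine ⟨fun m hm => ?_, ?_⟩
  · by_contra hD
    apply hm
    refine eq_of_forall_hom_eq fun L _ _ ψ => ?_
    obtain ⟨y, x, hg⟩ := h L ψ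
    rw [← MvPolynomial.coeff_map, hg, MvPolynomial.coeff_C_mul, map_zero]
    rw [(isHomogeneous_prodLinear D x).coeff_eq_zero, mul_zero]
    rwa [Finsupp.degree_eq_weight_one]
  · rcases D with _ | D
    · exact Or.inl rfl
    refine Or.inr fun Q hQ => eq_of_forall_hom_eq fun L _ _ ψ => ?_
    obtain ⟨y, x, hg⟩ := h L ψ
    -- The generic product has no scalar, so `y` is absorbed into the first factor, which exists
    -- because the degree is positive.
    let x' : Fin (D + 1) → Fin (n + 1) → L := Fin.cons (fun k => y * x 0 k) fun i => x i.succ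
    have hg' : MvPolynomial.map ψ g = prodLinear (D + 1) x' := by
      rw [hg, prodLinear_eq, prodLinear_eq, Fin.prod_univ_succ, Fin.prod_univ_succ, ← mul_assoc]
      congr 1
      simp only [x', linearForm, Fin.cons_zero, map_mul, Finset.mul_sum, mul_assoc]
    let φ : MvPolynomial (Fin (D + 1) × Fin (n + 1)) ℤ →+* L :=
      MvPolynomial.eval₂Hom (Int.castRingHom L) fun p => x' p.1 p.2
    have h1 : ∀ α, φ (elemSymm n (D + 1) α) = ψ (g.coeff α) := by
      intro α
      have : MvPolynomial.map φ (prodLinear (D + 1) fun i k => MvPolynomial.X (i, k)) =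
          MvPolynomial.map ψ g := by
        rw [hg']
        simp [prodLinear, φ]
      rw [elemSymm, ← MvPolynomial.coeff_map, this, MvPolynomial.coeff_map]
    have h2 := congrArg φ hQ
    rw [map_zero] at h2 ⊢
    rw [← h2]
    have e : ψ.comp (MvPolynomial.aeval fun α => g.coeff α : _ →ₐ[ℤ] A).toRingHom =
        φ.comp (MvPolynomial.aeval (elemSymm n (D + 1)) : _ →ₐ[ℤ] _).toRingHom := by
      ext α
      · simp
      · simpa using (h1 α).symm
    exact DFunLike.congr_fun e Q

end
end ChowForms

namespace ChowForms
noncomputable section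

/-! ### Closed subsets of projective space missing a hypersurface -/

theorem eval_smul_eq_zero {τ L : Type*} [CommRing L] {f : MvPolynomial τ L} {d : ℕ} (hf : f.IsHomogeneous d) {x : τ → L}
    (h : MvPolynomial.eval x f = 0) (c : L) : MvPolynomial.eval (c • x) f = 0 := by
  have := eval_smul_of_isHomogeneous hf c x
  rw [h, mul_zero] at this
  exact this

section
variable {τ : Type*} [Fintype τ] {L : Type*} [Field L] [IsAlgClosed L]
  {S : Set (MvPolynomial τ L)}

/-- A projective set inside an affine one is finite. For each coordinate `k`, elimination bounds the
values of `a = 1 / x k` on the locus `f = 1`, where `a ^ e * x k ^ e = f(x)`. The system has no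
solution at `a = 0`, so the eliminant is a nonzero polynomial in `a`. -/
theorem finite_of_forall_eval_ne_zero (hS : ∀ f ∈ S, ∃ d, f.IsHomogeneous d) {e : ℕ} (he : e ≠ 0)
    {f : MvPolynomial τ L} (hf : f.IsHomogeneous e)
    (h : ∀ x : τ → L, x ≠ 0 → (∀ g ∈ S, MvPolynomial.eval x g = 0) → MvPolynomial.eval x f ≠ 0) :
    {x : τ → L | (∀ g ∈ S, MvPolynomial.eval x g = 0) ∧ MvPolynomial.eval x f = 1}.Finite := by
  have key : ∀ k : τ, ∃ V : Set L, V.Finite ∧ ∀ x : τ → L, (∀ g ∈ S, MvPolynomial.eval x g = 0) →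
      MvPolynomial.eval x f = 1 → x k ∈ V := by
    intro k
    let t : MvPolynomial τ (Polynomial L) := MvPolynomial.C (Polynomial.X ^ e) *
      MvPolynomial.X k ^ e - MvPolynomial.map Polynomial.C f
    let T : Set (MvPolynomial τ (Polynomial L)) := insert t (MvPolynomial.map Polynomial.C '' S)
    have hev : ∀ (a : L) (x : τ → L) (g : MvPolynomial τ L),
        MvPolynomial.eval₂ (Polynomial.evalRingHom a) x (MvPolynomial.map Polynomial.C g) =
          MvPolynomial.eval x g := by
      intro a x g
      rw [MvPolynomial.eval₂_map, MvPolynomial.eval, MvPolynomial.coe_eval₂Hom]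
      congr 1
      ext c
      simp
    have hevt : ∀ (a : L) (x : τ → L), MvPolynomial.eval₂ (Polynomial.evalRingHom a) x t =
        a ^ e * x k ^ e - MvPolynomial.eval x f := by
      intro a x
      simp only [t, MvPolynomial.eval₂_sub, hev, MvPolynomial.eval₂_mul, MvPolynomial.eval₂_C,
        MvPolynomial.eval₂_pow, MvPolynomial.eval₂_X]
      simp
    obtain ⟨P, hP0, N, hN⟩ := exists_elimination T (by
      rintro _ (rfl | ⟨g, hg, rfl⟩)
      · refine ⟨e, MvPolynomial.IsHomogeneous.sub ?_ (hf.map _)⟩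
        simpa using (MvPolynomial.isHomogeneous_C τ (Polynomial.X ^ e)).mul
          ((MvPolynomial.isHomogeneous_X (Polynomial L) k).pow e)
      · obtain ⟨d, hd⟩ := hS g hg
        exact ⟨d, hd.map _⟩) (Polynomial.evalRingHom 0) (by
      intro x hx
      by_contra hx0
      refine h x hx0 (fun g hg => ?_) ?_
      · rw [← hev 0]
        exact hx _ (Set.mem_insert_of_mem _ ⟨g, hg, rfl⟩)
      · have := hx t (Set.mem_insert _ _)
        rw [hevt, zero_pow he] at this
        simpa using this)
    have hP : P ≠ 0 := by rintro rfl; simp at hP0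
    refine ⟨insert 0 (Inv.inv ⁻¹' {a | P.IsRoot a}), ?_, fun x hx hfx => ?_⟩
    · exact ((Polynomial.finite_setOfPred_isRoot hP).preimage inv_injective.injOn).insert 0
    · by_cases hk : x k = 0
      · exact Or.inl hk
      · refine Or.inr ?_
        have hx0 : x ≠ 0 := fun h0 => hk (by simp [h0])
        refine eq_zero_of_mem_span hN (Polynomial.evalRingHom (x k)⁻¹) hx0 ?_
        rintro _ (rfl | ⟨g, hg, rfl⟩)
        · rw [hevt, hfx, ← mul_pow, inv_mul_cancel₀ hk, one_pow, sub_self]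
        · rw [hev]
          exact hx g hg
  choose V hV hVx using key
  exact (Set.Finite.pi hV).subset fun x hx k _ => hVx k x hx.1 hx.2

/-- A closed set missing a hypersurface misses a hyperplane through any given point outside. -/
theorem exists_hyperplane_of_hypersurface (hS : ∀ f ∈ S, ∃ d, f.IsHomogeneous d) {e : ℕ}
    (he : e ≠ 0) {f : MvPolynomial τ L} (hf : f.IsHomogeneous e)
    (h : ∀ x : τ → L, x ≠ 0 → (∀ g ∈ S, MvPolynomial.eval x g = 0) → MvPolynomial.eval x f ≠ 0)
    (x₀ : τ → L) (hx₀ : ∀ c : L, (∀ g ∈ S, MvPolynomial.eval (c • x₀) g = 0) → c • x₀ = 0) :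
    ∃ lam : τ → L, ∑ k, lam k * x₀ k = 0 ∧
      ∀ x : τ → L, x ≠ 0 → (∀ g ∈ S, MvPolynomial.eval x g = 0) → ∑ k, lam k * x k ≠ 0 := by
  classical
  have : Infinite L := IsAlgClosed.instInfinite
  have hfin := finite_of_forall_eval_ne_zero hS he hf h
  let φ (y : τ → L) : (τ → L) →ₗ[L] L := ∑ k, y k • LinearMap.proj k
  have hφ : ∀ (y lam : τ → L), φ y lam = ∑ k, lam k * y k := by
    intro y lam
    simp [φ, mul_comm]
  -- `H` is the space of linear forms through `x₀`. Those that also vanish at a normalised point `y`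
  -- of the closed set form a proper subspace, since `y` is not a multiple of `x₀`, and `H` over an
  -- infinite field is not a finite union of proper subspaces.
  let H : Subspace L (τ → L) := LinearMap.ker (φ x₀)
  let B : (τ → L) → Subspace L H := fun y => LinearMap.ker ((φ y).comp H.subtype)
  have hB : ∀ y ∈ hfin.toFinset, B y ≠ ⊤ := by
    intro y hy htop
    rw [Set.Finite.mem_toFinset] at hy
    have hall : ∀ lam : τ → L, ∑ k, lam k * x₀ k = 0 → ∑ k, lam k * y k = 0 := by
      intro lam hlam
      have : (⟨lam, by rw [LinearMap.mem_ker, hφ]; exact hlam⟩ : H) ∈ B y := htop ▸ trivial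
      rw [LinearMap.mem_ker] at this
      rw [← hφ]
      exact this
    have hy0 : y ≠ 0 := by
      rintro rfl
      have h1 := eval_smul_of_isHomogeneous hf 0 (0 : τ → L)
      simp only [zero_mul, zero_pow he] at h1
      have h2 := hy.2
      exact zero_ne_one (h1.symm.trans h2)
    have hsingle : ∀ (a : τ) (c : L) (z : τ → L),
        ∑ k, (Pi.single a c : τ → L) k * z k = c * z a := by
      intro a c z
      rw [Finset.sum_eq_single a (fun b _ hb => by rw [Pi.single_eq_of_ne hb, zero_mul])
        (fun ha => absurd (Finset.mem_univ a) ha), Pi.single_eq_same]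
    obtain ⟨c, hc⟩ : ∃ c : L, y = c • x₀ := by
      by_cases hz : x₀ = 0
      · exfalso
        apply hy0
        funext a
        have := hall (Pi.single a 1) (by simp [hz])
        rwa [hsingle, one_mul] at this
      · obtain ⟨a, ha⟩ := Function.ne_iff.1 hz
        refine ⟨y a / x₀ a, funext fun b => ?_⟩
        have ha : x₀ a ≠ 0 := ha
        have := hall (Pi.single b (x₀ a) - Pi.single a (x₀ b)) (by
          simp only [Pi.sub_apply, sub_mul, Finset.sum_sub_distrib, hsingle]
          ring)
        simp only [Pi.sub_apply, sub_mul, Finset.sum_sub_distrib, hsingle] at this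
        rw [Pi.smul_apply, smul_eq_mul]
        field_simp
        linear_combination this
    rw [hc] at hy hy0
    exact hy0 (hx₀ c hy.1)
  have hne := Subspace.biUnion_ne_univ_of_top_notMem (s := hfin.toFinset.image B) (by
    rw [Finset.mem_image]
    rintro ⟨y, hy, hyt⟩
    exact hB y hy hyt)
  rw [Set.ne_univ_iff_exists_notMem] at hne
  obtain ⟨lam, hlam⟩ := hne
  simp only [Finset.mem_image, Set.Finite.mem_toFinset, Set.iUnion_exists, Set.mem_iUnion,
    not_exists] at hlam
  refine ⟨lam.1, by rw [← hφ]; exact lam.2, fun x hx hxS hx0 => ?_⟩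
  obtain ⟨c, hc⟩ := IsAlgClosed.exists_pow_nat_eq (MvPolynomial.eval x f)⁻¹ (Nat.pos_of_ne_zero he)
  refine hlam (B (c • x)) (c • x) ⟨⟨fun g hg => ?_, ?_⟩, rfl⟩ ?_
  · obtain ⟨d, hd⟩ := hS g hg
    exact eval_smul_eq_zero hd (hxS g hg) c
  · have := eval_smul_of_isHomogeneous hf c x
    rw [hc, inv_mul_cancel₀ (h x hx hxS)] at this
    exact this
  · change _ = _
    change φ (c • x) lam.1 = 0
    rw [hφ]
    simp only [Pi.smul_apply, smul_eq_mul, mul_left_comm _ c, ← Finset.mul_sum, hx0, mul_zero]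

/-- If finitely many hyperplanes have no common point on a closed set, then the same holds for
suitable hyperplanes through any given point outside that set. -/
theorem exists_hyperplanes_through (hS : ∀ f ∈ S, ∃ d, f.IsHomogeneous d) {ι : Type*}
    (lam : ι → τ → L)
    (h : ∀ x : τ → L, x ≠ 0 → (∀ g ∈ S, MvPolynomial.eval x g = 0) → ∃ i, ∑ k, lam i k * x k ≠ 0)
    (x₀ : τ → L) (hx₀ : ¬ ∀ g ∈ S, MvPolynomial.eval x₀ g = 0) :
    ∃ lam' : ι → τ → L, (∀ i, ∑ k, lam' i k * x₀ k = 0) ∧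
      ∀ x : τ → L, x ≠ 0 → (∀ g ∈ S, MvPolynomial.eval x g = 0) →
        ∃ i, ∑ k, lam' i k * x k ≠ 0 := by
  classical
  by_cases hall : ∀ i, ∑ k, lam i k * x₀ k = 0
  · exact ⟨lam, hall, h⟩
  push Not at hall
  obtain ⟨a, ha⟩ := hall
  -- Subtracting multiples of the `a`-th form makes the others pass through `x₀`. It remains to
  -- replace the `a`-th form, which has no zero on the set cut out by the modified ones.
  let m : ι → τ → L := fun i k =>
    lam i k - (∑ k, lam i k * x₀ k) / (∑ k, lam a k * x₀ k) * lam a k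
  have hm : ∀ (i : ι) (x : τ → L), ∑ k, m i k * x k = ∑ k, lam i k * x k -
      (∑ k, lam i k * x₀ k) / (∑ k, lam a k * x₀ k) * ∑ k, lam a k * x k := by
    intro i x
    simp only [m, sub_mul, Finset.sum_sub_distrib, mul_assoc, Finset.mul_sum]
  let S' : Set (MvPolynomial τ L) := S ∪ (fun i => linearForm Finset.univ (m i)) '' {i | i ≠ a}
  obtain ⟨ν, hν0, hν⟩ := exists_hyperplane_of_hypersurface (S := S') (by
      rintro f (hf | ⟨i, -, rfl⟩)
      · exact hS f hf
      · exact ⟨1, isHomogeneous_linearForm _ _⟩) one_ne_zero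
    (isHomogeneous_linearForm Finset.univ (lam a)) (by
      intro x hx hxS h0
      rw [eval_linearForm] at h0
      obtain ⟨i, hi⟩ := h x hx fun g hg => hxS g (Or.inl hg)
      apply hi
      by_cases hia : i = a
      · rw [hia, h0]
      · have := hxS _ (Or.inr ⟨i, hia, rfl⟩)
        rw [eval_linearForm, hm, h0, mul_zero, sub_zero] at this
        exact this) x₀ (by
      intro c hc
      by_contra hne
      apply hx₀
      intro g hg
      have hc0 : c ≠ 0 := by rintro rfl; simp at hne
      obtain ⟨d, hd⟩ := hS g hg
      have := eval_smul_eq_zero hd (hc g (Or.inl hg)) c⁻¹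
      rwa [smul_smul, inv_mul_cancel₀ hc0, one_smul] at this)
  refine ⟨fun i => if i = a then ν else m i, fun i => ?_, fun x hx hxS => ?_⟩
  · by_cases hia : i = a
    · simpa [hia] using hν0
    · simp only [hia, if_false, hm]
      rw [div_mul_cancel₀ _ ha, sub_self]
  · by_contra! hcon
    refine hν x hx ?_ (by simpa using hcon a)
    rintro g (hg | ⟨i, hi, rfl⟩)
    · exact hxS g hg
    · rw [eval_linearForm]
      have := hcon i
      simpa only [if_neg hi] using this

end
end
end ChowForms

namespace ChowForms
noncomputable section

/-! ### Closed cones -/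

section
variable {τ : Type*} {K : Type*} [Field K]

theorem Polynomial.eq_zero_of_forall_ne_zero {A : Type*} [CommRing A] [IsDomain A] [Infinite A]
    {p : Polynomial A} (h : ∀ c : A, c ≠ 0 → p.eval c = 0) : p = 0 := by
  refine Polynomial.eq_zero_of_infinite_isRoot p ((Set.finite_singleton 0).infinite_compl.mono ?_)
  exact fun c hc => h c hc

/-- The polynomial `c ↦ f (c x)`. -/
def evalLine (f : MvPolynomial τ K) (x : τ → K) : Polynomial K :=
  ∑ j ∈ Finset.range (f.totalDegree + 1),
    Polynomial.monomial j (MvPolynomial.eval x (MvPolynomial.homogeneousComponent j f))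

theorem eval_evalLine (f : MvPolynomial τ K) (x : τ → K) (c : K) :
    (evalLine f x).eval c = MvPolynomial.eval (c • x) f := by
  conv_rhs => rw [← f.sum_homogeneousComponent]
  rw [evalLine, Polynomial.eval_finsetSum, map_sum]
  refine Finset.sum_congr rfl fun j _ => ?_
  rw [Polynomial.eval_monomial, mul_comm]
  exact (eval_smul_of_isHomogeneous (MvPolynomial.homogeneousComponent_isHomogeneous j f) c x).symm

theorem coeff_evalLine (f : MvPolynomial τ K) (x : τ → K) (j : ℕ) :
    (evalLine f x).coeff j = MvPolynomial.eval x (MvPolynomial.homogeneousComponent j f) := by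
  rw [evalLine, Polynomial.finsetSum_coeff]
  simp only [Polynomial.coeff_monomial]
  rw [Finset.sum_ite_eq']
  split_ifs with h
  · rfl
  · rw [MvPolynomial.homogeneousComponent_eq_zero, map_zero]
    simpa using h

/-- The homogeneous polynomials vanishing on a set. -/
def homVanishing (Z : Set (τ → K)) : Set (MvPolynomial τ K) :=
  {f | (∃ d, f.IsHomogeneous d) ∧ ∀ x ∈ Z, MvPolynomial.eval x f = 0}

/-- The set of nonzero representatives of the points of a projective algebraic set. -/
structure IsClosedCone (Z : Set (τ → K)) : Prop where
  ne_zero : ∀ x ∈ Z, x ≠ 0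
  smul_mem : ∀ x ∈ Z, ∀ c : K, c ≠ 0 → c • x ∈ Z
  mem_of_forall : ∀ x, x ≠ 0 → (∀ f ∈ homVanishing Z, MvPolynomial.eval x f = 0) → x ∈ Z

/-- The cone of an irreducible projective algebraic set. -/
structure IsConeVariety (Z : Set (τ → K)) : Prop extends IsClosedCone Z where
  nonempty : Z.Nonempty
  prime : ∀ f g : MvPolynomial τ K, (∀ x ∈ Z, MvPolynomial.eval x (f * g) = 0) →
    (∀ x ∈ Z, MvPolynomial.eval x f = 0) ∨ ∀ x ∈ Z, MvPolynomial.eval x g = 0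

/-- The points of a closed cone over an extension field. -/
def conePoints (Z : Set (τ → K)) (L : Type*) [Field L] [Algebra K L] : Set (τ → L) :=
  {x | x ≠ 0 ∧ ∀ f ∈ homVanishing Z, MvPolynomial.aeval x f = 0}

theorem IsClosedCone.conePoints_self {Z : Set (τ → K)} (hZ : IsClosedCone Z) :
    conePoints Z K = Z := by
  ext x
  constructor
  · rintro ⟨h0, h⟩
    refine hZ.mem_of_forall x h0 fun f hf => ?_
    rw [← MvPolynomial.aeval_eq_eval]
    exact h f hf
  · intro hx
    refine ⟨hZ.ne_zero x hx, fun f hf => ?_⟩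
    rw [MvPolynomial.aeval_eq_eval]
    exact hf.2 x hx

/-- Along the line through a point of the cone, `f` is a polynomial in the scaling parameter with
infinitely many zeros, and its coefficients are the values of the homogeneous components. -/
theorem IsClosedCone.homogeneousComponent_mem [Infinite K] {Z : Set (τ → K)} (hZ : IsClosedCone Z)
    {f : MvPolynomial τ K} (hf : ∀ x ∈ Z, MvPolynomial.eval x f = 0) (j : ℕ) :
    MvPolynomial.homogeneousComponent j f ∈ homVanishing Z := by
  refine ⟨⟨j, MvPolynomial.homogeneousComponent_isHomogeneous j f⟩, fun x hx => ?_⟩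
  have : evalLine f x = 0 := Polynomial.eq_zero_of_forall_ne_zero fun c hc => by
    rw [eval_evalLine]
    exact hf _ (hZ.smul_mem x hx c hc)
  rw [← coeff_evalLine, this, Polynomial.coeff_zero]

theorem IsClosedCone.aeval_eq_zero [Infinite K] {Z : Set (τ → K)} (hZ : IsClosedCone Z)
    {f : MvPolynomial τ K} (hf : ∀ x ∈ Z, MvPolynomial.eval x f = 0) {L : Type*} [Field L]
    [Algebra K L] {x : τ → L} (hx : x ∈ conePoints Z L) : MvPolynomial.aeval x f = 0 := by
  rw [← f.sum_homogeneousComponent, map_sum]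
  exact Finset.sum_eq_zero fun j _ => hx.2 _ (hZ.homogeneousComponent_mem hf j)

end

/-! ### The cone of a subset of projective space -/

section
variable {K : Type u} [Field K] {n : ℕ}

/-- The set of all homogeneous coordinate vectors of the points of a subset of `ℙⁿ`. -/
def cone (W : Set (ProjSpace K n)) : Set (Fin (n + 1) → K) :=
  {v | ∃ h : v ≠ 0, (Projectivization.mk K v h : ProjSpace K n) ∈ W}

theorem ProjSpace.coords_ne_zero (x : ProjSpace K n) : x.coords ≠ 0 := Projectivization.rep_nonzero x

theorem ProjSpace.mk_coords (x : ProjSpace K n) :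
    (Projectivization.mk K x.coords x.coords_ne_zero : ProjSpace K n) = x :=
  Projectivization.mk_rep x

theorem coords_mem_cone {W : Set (ProjSpace K n)} {x : ProjSpace K n} :
    x.coords ∈ cone W ↔ x ∈ W := by
  constructor
  · rintro ⟨h, hx⟩
    rwa [x.mk_coords] at hx
  · intro hx
    exact ⟨x.coords_ne_zero, by rwa [x.mk_coords]⟩

theorem exists_smul_eq_coords (v : Fin (n + 1) → K) (hv : v ≠ 0) :
    ∃ c : K, c ≠ 0 ∧ ProjSpace.coords (Projectivization.mk K v hv) = c • v := by
  obtain ⟨a, ha⟩ := Projectivization.exists_smul_eq_mk_rep K v hv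
  exact ⟨a, a.ne_zero, ha.symm⟩

theorem smul_mem_cone {W : Set (ProjSpace K n)} {v : Fin (n + 1) → K} (hv : v ∈ cone W) {c : K}
    (hc : c ≠ 0) : c • v ∈ cone W := by
  obtain ⟨h, hW⟩ := hv
  refine ⟨smul_ne_zero hc h, ?_⟩
  have : (Projectivization.mk K (c • v) (smul_ne_zero hc h) : ProjSpace K n) =
      Projectivization.mk K v h := by
    refine (Projectivization.mk_eq_mk_iff' K _ _ _ _).2 ⟨c, rfl⟩
  rwa [this]

theorem cone_mono {W W' : Set (ProjSpace K n)} (h : W ⊆ W') : cone W ⊆ cone W' :=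
  fun _ ⟨h0, hx⟩ => ⟨h0, h hx⟩

theorem cone_subset_cone_iff {W W' : Set (ProjSpace K n)} : cone W ⊆ cone W' ↔ W ⊆ W' :=
  ⟨fun h _ hx => coords_mem_cone.1 (h (coords_mem_cone.2 hx)), cone_mono⟩

theorem mem_cone_zeroLocus {S : Set (MvPolynomial (Fin (n + 1)) K)}
    (hS : ∀ f ∈ S, ∃ d, f.IsHomogeneous d) {v : Fin (n + 1) → K} :
    v ∈ cone (zeroLocus S) ↔ v ≠ 0 ∧ ∀ f ∈ S, MvPolynomial.eval v f = 0 := by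
  constructor
  · rintro ⟨h0, hv⟩
    refine ⟨h0, fun f hf => ?_⟩
    obtain ⟨c, hc, hcv⟩ := exists_smul_eq_coords v h0
    obtain ⟨d, hd⟩ := hS f hf
    have := eval_smul_eq_zero hd (hv f hf) c⁻¹
    rwa [hcv, smul_smul, inv_mul_cancel₀ hc, one_smul] at this
  · rintro ⟨h0, hv⟩
    refine ⟨h0, fun f hf => ?_⟩
    obtain ⟨c, hc, hcv⟩ := exists_smul_eq_coords v h0
    obtain ⟨d, hd⟩ := hS f hf
    rw [hcv]
    exact eval_smul_eq_zero hd (hv f hf) c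

theorem isClosedCone_of_forall {τ K : Type*} [Field K] {S : Set (MvPolynomial τ K)}
    (hS : ∀ f ∈ S, ∃ d, f.IsHomogeneous d) {Z : Set (τ → K)}
    (hZ : ∀ v, v ∈ Z ↔ v ≠ 0 ∧ ∀ f ∈ S, MvPolynomial.eval v f = 0) : IsClosedCone Z where
  ne_zero x hx := ((hZ x).1 hx).1
  smul_mem x hx c hc := by
    rw [hZ] at hx ⊢
    refine ⟨smul_ne_zero hc hx.1, fun f hf => ?_⟩
    obtain ⟨d, hd⟩ := hS f hf
    exact eval_smul_eq_zero hd (hx.2 f hf) c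
  mem_of_forall x h0 hx :=
    (hZ x).2 ⟨h0, fun f hf => hx f ⟨hS f hf, fun y hy => ((hZ y).1 hy).2 f hf⟩⟩

theorem isClosedCone_cone {W : Set (ProjSpace K n)} (hW : IsClosed W) : IsClosedCone (cone W) := by
  rw [isClosed_iff_isAlgebraicSet] at hW
  obtain ⟨S, hS, rfl⟩ := hW
  exact isClosedCone_of_forall hS fun v => mem_cone_zeroLocus hS

theorem isClosed_zeroLocus {S : Set (MvPolynomial (Fin (n + 1)) K)}
    (hS : ∀ f ∈ S, ∃ d, f.IsHomogeneous d) : IsClosed (zeroLocus S) :=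
  (isClosed_iff_isAlgebraicSet _).2 ⟨S, hS, rfl⟩

/-- If `f * g` vanishes on the cone, then on each line through a point one of the polynomials `c ↦ f
(c x)`, `c ↦ g (c x)` is zero. So `W` is covered by the two closed sets given by the homogeneous
components. -/
theorem isConeVariety_cone [Infinite K] {W : Set (ProjSpace K n)} (hW : IsClosed W)
    (hirr : IsIrreducible W) : IsConeVariety (cone W) where
  toIsClosedCone := isClosedCone_cone hW
  nonempty := by
    obtain ⟨x, hx⟩ := hirr.1
    exact ⟨_, coords_mem_cone.2 hx⟩
  prime f g hfg := by
    let A (f : MvPolynomial (Fin (n + 1)) K) : Set (ProjSpace K n) :=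
      zeroLocus (Set.range fun j => MvPolynomial.homogeneousComponent j f)
    have hA : ∀ f, IsClosed (A f) := fun f => isClosed_zeroLocus (by
      rintro _ ⟨j, rfl⟩
      exact ⟨j, MvPolynomial.homogeneousComponent_isHomogeneous j f⟩)
    have hline : ∀ (f : MvPolynomial (Fin (n + 1)) K) (x : ProjSpace K n),
        evalLine f x.coords = 0 → x ∈ A f := by
      rintro f x h _ ⟨j, rfl⟩
      rw [← coeff_evalLine, h, Polynomial.coeff_zero]
    have hvan : ∀ f, W ⊆ A f → ∀ v ∈ cone W, MvPolynomial.eval v f = 0 := by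
      rintro f h v hv
      have h1 : v ∈ cone (A f) := cone_mono h hv
      rw [mem_cone_zeroLocus (by
        rintro _ ⟨j, rfl⟩
        exact ⟨j, MvPolynomial.homogeneousComponent_isHomogeneous j f⟩)] at h1
      rw [← f.sum_homogeneousComponent, map_sum]
      exact Finset.sum_eq_zero fun j _ => h1.2 _ ⟨j, rfl⟩
    have hsub : W ⊆ A f ∪ A g := by
      intro x hx
      have : evalLine f x.coords * evalLine g x.coords = 0 := by
        refine Polynomial.eq_zero_of_forall_ne_zero fun c hc => ?_
        rw [Polynomial.eval_mul, eval_evalLine, eval_evalLine, ← map_mul]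
        exact hfg _ (smul_mem_cone (coords_mem_cone.2 hx) hc)
      rcases mul_eq_zero.1 this with h | h
      · exact Or.inl (hline f x h)
      · exact Or.inr (hline g x h)
    rcases isPreirreducible_iff_isClosed_union_isClosed.1 hirr.2 _ _ (hA f) (hA g) hsub with h | h
    · exact Or.inl (hvan f h)
    · exact Or.inr (hvan g h)

/-- Hilbert's basis theorem: closed sets embed, order reversed, into the ideals of the polynomial
ring. -/
instance noetherianSpace_projSpace : TopologicalSpace.NoetherianSpace (ProjSpace K n) := by
  refine ((TopologicalSpace.noetherianSpace_TFAE (ProjSpace K n)).out 0 1).2 ?_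
  let φ (W : TopologicalSpace.Closeds (ProjSpace K n)) : Ideal (MvPolynomial (Fin (n + 1)) K) :=
    MvPolynomial.vanishingIdeal K (cone (W : Set (ProjSpace K n)))
  have hφ : StrictAnti φ := by
    intro W W' h
    refine lt_of_le_of_ne (MvPolynomial.vanishingIdeal_anti_mono (cone_mono h.le)) fun heq => ?_
    apply h.not_ge
    change (W' : Set (ProjSpace K n)) ⊆ W
    rw [← cone_subset_cone_iff]
    intro v hv
    refine (isClosedCone_cone W.isClosed).mem_of_forall v
      ((isClosedCone_cone W'.isClosed).ne_zero v hv) fun f hf => ?_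
    have hfW : f ∈ φ W := fun x hx => hf.2 x hx
    exact (heq ▸ hfW : f ∈ φ W') v hv
  exact ⟨StrictAnti.wellFoundedLT hφ |>.wf⟩

end
end
end ChowForms

namespace ChowForms
noncomputable section

/-! ### Linear systems of hypersurfaces and incidence varieties -/

/-- Families of linear systems on projective space, each spanned by homogeneous polynomials among
which are the powers of the coordinates. The coefficients are indexed by `σ`. -/
structure LinSys (σ τ ι K : Type*) [Field K] where
  s : ι → Finset σ
  disj : ∀ i j p, p ∈ s i → p ∈ s j → i = j
  m : σ → MvPolynomial τ K
  deg : ι → ℕ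
  hom : ∀ i, ∀ p ∈ s i, (m p).IsHomogeneous (deg i)
  pv : τ → ι → σ
  pv_mem : ∀ k i, pv k i ∈ s i
  m_pv : ∀ k i, m (pv k i) = MvPolynomial.X k ^ deg i

section
variable {σ τ ι K : Type*} [Field K]

/-- The value at `(x, u)` of a polynomial in `x` and `u`. -/
def evalPair {L : Type*} [Field L] [Algebra K L] (x : τ → L) (u : σ → L) :
    MvPolynomial σ (MvPolynomial τ K) →+* L :=
  MvPolynomial.eval₂Hom ((MvPolynomial.aeval x : MvPolynomial τ K →ₐ[K] L) : _ →+* L) u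

theorem evalPair_X {L : Type*} [Field L] [Algebra K L] (x : τ → L) (u : σ → L) (q : σ) :
    evalPair (K := K) x u (MvPolynomial.X q) = u q := by simp [evalPair]

theorem evalPair_C {L : Type*} [Field L] [Algebra K L] (x : τ → L) (u : σ → L)
    (f : MvPolynomial τ K) : evalPair x u (MvPolynomial.C f) = MvPolynomial.aeval x f := by
  simp [evalPair]

theorem evalPair_map_C {L : Type*} [Field L] [Algebra K L] (x : τ → L) (u : σ → L)
    (f : MvPolynomial σ K) :
    evalPair x u (MvPolynomial.map MvPolynomial.C f) = MvPolynomial.aeval u f := by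
  rw [evalPair, MvPolynomial.coe_eval₂Hom, MvPolynomial.eval₂_map, MvPolynomial.aeval_def]
  congr 1
  ext c
  simp

theorem evalPair_eq_sum {L : Type*} [Field L] [Algebra K L] (x : τ → L) (u : σ → L)
    (F : MvPolynomial σ (MvPolynomial τ K)) :
    evalPair x u F = ∑ d ∈ F.support, MvPolynomial.aeval x (F.coeff d) * d.prod fun q e => u q ^ e :=
  rfl

theorem IsClosedCone.coeff_eq_zero_of_evalPair [Infinite K] {Z : Set (τ → K)}
    {F : MvPolynomial σ (MvPolynomial τ K)}
    (hF : ∀ x ∈ Z, ∀ u : σ → K, evalPair x u F = 0) (d : σ →₀ ℕ) :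
    ∀ x ∈ Z, MvPolynomial.eval x (F.coeff d) = 0 := by
  intro x hx
  have : MvPolynomial.map (MvPolynomial.eval x) F = 0 := by
    refine MvPolynomial.funext fun u => ?_
    rw [MvPolynomial.eval_map, map_zero]
    have h1 := hF x hx u
    rw [evalPair, MvPolynomial.coe_eval₂Hom] at h1
    rw [← h1]
    congr 1
  rw [← MvPolynomial.coeff_map, this, MvPolynomial.coeff_zero]

theorem IsClosedCone.evalPair_eq_zero [Infinite K] {Z : Set (τ → K)} (hZ : IsClosedCone Z)
    {F : MvPolynomial σ (MvPolynomial τ K)}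
    (hF : ∀ x ∈ Z, ∀ u : σ → K, evalPair x u F = 0) {L : Type*} [Field L] [Algebra K L]
    {x : τ → L} (hx : x ∈ conePoints Z L) (u : σ → L) : evalPair x u F = 0 := by
  rw [evalPair_eq_sum]
  refine Finset.sum_eq_zero fun d _ => ?_
  rw [hZ.aeval_eq_zero (IsClosedCone.coeff_eq_zero_of_evalPair hF d) hx, zero_mul]

/-- The product of `Z` with an affine space is irreducible: its coordinate ring is a polynomial ring
over the domain of functions on `Z`. -/
theorem IsConeVariety.evalPair_prime [Infinite K] {Z : Set (τ → K)} (hZ : IsConeVariety Z)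
    {F G : MvPolynomial σ (MvPolynomial τ K)}
    (h : ∀ x ∈ Z, ∀ u : σ → K, evalPair x u (F * G) = 0) :
    (∀ x ∈ Z, ∀ u : σ → K, evalPair x u F = 0) ∨ ∀ x ∈ Z, ∀ u : σ → K, evalPair x u G = 0 := by
  let 𝔭 : Ideal (MvPolynomial τ K) := MvPolynomial.vanishingIdeal K Z
  have h𝔭 : ∀ f, f ∈ 𝔭 ↔ ∀ x ∈ Z, MvPolynomial.eval x f = 0 := fun f => Iff.rfl
  have : 𝔭.IsPrime := by
    refine ⟨fun htop => ?_, fun {f g} hfg => hZ.prime f g hfg⟩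
    obtain ⟨x, hx⟩ := hZ.nonempty
    have h1 : (1 : MvPolynomial τ K) ∈ 𝔭 := htop ▸ trivial
    simpa using (h𝔭 1).1 h1 x hx
  have hmap : ∀ A : MvPolynomial σ (MvPolynomial τ K),
      MvPolynomial.map (Ideal.Quotient.mk 𝔭) A = 0 ↔
        ∀ x ∈ Z, ∀ u : σ → K, evalPair x u A = 0 := by
    intro A
    constructor
    · intro hA x hx u
      rw [evalPair_eq_sum]
      refine Finset.sum_eq_zero fun d _ => ?_
      have : MvPolynomial.coeff d (MvPolynomial.map (Ideal.Quotient.mk 𝔭) A) = 0 := by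
        rw [hA, MvPolynomial.coeff_zero]
      rw [MvPolynomial.coeff_map, Ideal.Quotient.eq_zero_iff_mem, h𝔭] at this
      rw [MvPolynomial.aeval_eq_eval, this x hx, zero_mul]
    · intro hA
      ext d
      rw [MvPolynomial.coeff_map, MvPolynomial.coeff_zero, Ideal.Quotient.eq_zero_iff_mem, h𝔭]
      exact IsClosedCone.coeff_eq_zero_of_evalPair hA d
  rw [← hmap, ← hmap]
  rw [← hmap, map_mul] at h
  exact mul_eq_zero.1 h

namespace LinSys
variable (Λ : LinSys σ τ ι K)

/-- The value at `x` of the `i`-th polynomial with coefficients `u`. -/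
def val {L : Type*} [Field L] [Algebra K L] (u : σ → L) (x : τ → L) (i : ι) : L :=
  ∑ p ∈ Λ.s i, u p * MvPolynomial.aeval x (Λ.m p)

theorem aeval_m_pv {L : Type*} [Field L] [Algebra K L] (x : τ → L) (k : τ) (i : ι) :
    MvPolynomial.aeval x (Λ.m (Λ.pv k i)) = x k ^ Λ.deg i := by
  rw [Λ.m_pv, map_pow, MvPolynomial.aeval_X]

/-- The `i`-th polynomial with indeterminate coefficients. -/
def form (i : ι) : MvPolynomial τ (MvPolynomial σ K) :=
  ∑ p ∈ Λ.s i, MvPolynomial.C (MvPolynomial.X p) * MvPolynomial.map MvPolynomial.C (Λ.m p)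

theorem eval₂_map_C {L : Type*} [Field L] [Algebra K L] (u : σ → L) (x : τ → L)
    (g : MvPolynomial τ K) :
    MvPolynomial.eval₂ (MvPolynomial.aeval u : _ →ₐ[K] L).toRingHom x
      (MvPolynomial.map MvPolynomial.C g) = MvPolynomial.aeval x g := by
  rw [MvPolynomial.eval₂_map, MvPolynomial.aeval_def]
  congr 1
  ext c
  simp

theorem eval₂_form {L : Type*} [Field L] [Algebra K L] (u : σ → L) (x : τ → L) (i : ι) :
    MvPolynomial.eval₂ (MvPolynomial.aeval u : _ →ₐ[K] L).toRingHom x (Λ.form i) =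
      Λ.val u x i := by
  rw [form, val, MvPolynomial.eval₂_sum]
  refine Finset.sum_congr rfl fun p _ => ?_
  rw [MvPolynomial.eval₂_mul, eval₂_map_C, MvPolynomial.eval₂_C]
  simp

/-- Elimination applied to the equations of `Z` together with the forms with indeterminate
coefficients: a system without zero on `Z` is detected by an element of the elimination ideal. -/
theorem exists_elimination_of_forall_val_ne_zero {L : Type*} [Field L] [Algebra K L] [Fintype τ]
    [IsAlgClosed L] {Z : Set (τ → K)} (hZ : IsClosedCone Z)
    (u : σ → L) (h : ∀ x ∈ conePoints Z L, ∃ i, Λ.val u x i ≠ 0) :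
    ∃ P : MvPolynomial σ K, MvPolynomial.aeval u P ≠ 0 ∧
      ∀ x ∈ Z, ∀ u : σ → K, (∀ i, Λ.val u x i = 0) → MvPolynomial.eval u P = 0 := by
  let T : Set (MvPolynomial τ (MvPolynomial σ K)) :=
    MvPolynomial.map MvPolynomial.C '' homVanishing Z ∪ Set.range Λ.form
  obtain ⟨P, hP0, N, hN⟩ := exists_elimination T (by
    rintro _ (⟨g, ⟨⟨d, hd⟩, -⟩, rfl⟩ | ⟨i, rfl⟩)
    · exact ⟨d, hd.map _⟩
    · refine ⟨Λ.deg i, MvPolynomial.IsHomogeneous.sum _ _ _ fun p hp => ?_⟩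
      simpa using (MvPolynomial.isHomogeneous_C τ (MvPolynomial.X p)).mul ((Λ.hom i p hp).map _))
    (MvPolynomial.aeval u : _ →ₐ[K] L).toRingHom (by
    intro x hx
    by_contra hx0
    obtain ⟨i, hi⟩ := h x ⟨hx0, fun f hf => by
      rw [← eval₂_map_C u]
      exact hx _ (Or.inl ⟨f, hf, rfl⟩)⟩
    apply hi
    rw [← eval₂_form]
    exact hx _ (Or.inr ⟨i, rfl⟩))
  refine ⟨P, hP0, fun x hx v hv => ?_⟩
  rw [← MvPolynomial.aeval_eq_eval]
  refine eq_zero_of_mem_span hN (MvPolynomial.aeval v : _ →ₐ[K] K).toRingHom (hZ.ne_zero x hx) ?_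
  rintro _ (⟨g, hg, rfl⟩ | ⟨i, rfl⟩)
  · rw [eval₂_map_C, MvPolynomial.aeval_eq_eval]
    exact hg.2 x hx
  · rw [eval₂_form]
    exact hv i

variable [Fintype ι]

open Classical in
/-- Solving the incidence relations for the coefficients of the powers of the `k`-th coordinate,
after clearing denominators. -/
def solve (k : τ) (q : σ) : MvPolynomial σ (MvPolynomial τ K) :=
  if h : ∃ i, q = Λ.pv k i then
    - MvPolynomial.C (MvPolynomial.X k ^ ∑ j ∈ Finset.univ.erase h.choose, Λ.deg j) *
      ∑ p ∈ (Λ.s h.choose).erase q, MvPolynomial.X p * MvPolynomial.C (Λ.m p)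
  else MvPolynomial.C (MvPolynomial.X k ^ ∑ j, Λ.deg j) * MvPolynomial.X q

variable {L : Type*} [Field L] [Algebra K L]

open Classical in
theorem evalPair_solve_pv (k : τ) (i : ι) (x : τ → L) (u : σ → L) :
    evalPair x u (Λ.solve k (Λ.pv k i)) = - x k ^ (∑ j ∈ Finset.univ.erase i, Λ.deg j) *
      ∑ p ∈ (Λ.s i).erase (Λ.pv k i), u p * MvPolynomial.aeval x (Λ.m p) := by
  have h : ∃ i', Λ.pv k i = Λ.pv k i' := ⟨i, rfl⟩
  have hi : h.choose = i := by
    have h1 := Λ.pv_mem k h.choose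
    rw [← h.choose_spec] at h1
    exact Λ.disj _ _ _ h1 (Λ.pv_mem k i)
  rw [solve, dif_pos h]
  simp only [hi, map_mul, map_neg, map_sum, evalPair_C, evalPair_X, map_pow, MvPolynomial.aeval_X]

theorem evalPair_solve_of_ne (k : τ) {q : σ} (hq : ∀ i, q ≠ Λ.pv k i) (x : τ → L) (u : σ → L) :
    evalPair x u (Λ.solve k q) = x k ^ (∑ j, Λ.deg j) * u q := by
  have h : ¬ ∃ i, q = Λ.pv k i := fun ⟨i, hi⟩ => hq i hi
  rw [solve, dif_neg h]
  simp only [map_mul, evalPair_C, evalPair_X, map_pow, MvPolynomial.aeval_X]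

theorem val_solve (k : τ) (x : τ → L) (u : σ → L) (i : ι) :
    Λ.val (fun q => evalPair x u (Λ.solve k q)) x i = 0 := by
  classical
  rw [val, ← Finset.add_sum_erase _ _ (Λ.pv_mem k i), Λ.evalPair_solve_pv, Λ.aeval_m_pv]
  have : ∑ q ∈ (Λ.s i).erase (Λ.pv k i), evalPair x u (Λ.solve k q) *
      MvPolynomial.aeval x (Λ.m q) = x k ^ (∑ j, Λ.deg j) *
        ∑ q ∈ (Λ.s i).erase (Λ.pv k i), u q * MvPolynomial.aeval x (Λ.m q) := by
    rw [Finset.mul_sum]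
    refine Finset.sum_congr rfl fun q hq => ?_
    rw [Λ.evalPair_solve_of_ne k, mul_assoc]
    rintro j rfl
    obtain ⟨h1, h2⟩ := Finset.mem_erase.1 hq
    exact h1 (by rw [Λ.disj _ _ _ h2 (Λ.pv_mem k j)])
  rw [this, ← Finset.add_sum_erase _ _ (Finset.mem_univ i), pow_add]
  ring

/-- Over the chart `x k ≠ 0` the incidence variety is covered by `Z` times an affine space; the
factor in the argument undoes the cleared denominators. -/
theorem exists_eq_solve (k : τ) (x : τ → L) (hx : x k ≠ 0) (u : σ → L)
    (hu : ∀ i, Λ.val u x i = 0) :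
    (fun q => evalPair x (fun p => (x k ^ (∑ j, Λ.deg j))⁻¹ * u p) (Λ.solve k q)) = u := by
  classical
  funext q
  by_cases h : ∃ i, q = Λ.pv k i
  · obtain ⟨i, rfl⟩ := h
    have h1 := hu i
    rw [val, ← Finset.add_sum_erase _ _ (Λ.pv_mem k i), Λ.aeval_m_pv] at h1
    rw [Λ.evalPair_solve_pv]
    simp only [mul_assoc]
    rw [← Finset.mul_sum, eq_neg_of_add_eq_zero_right h1,
      ← Finset.add_sum_erase _ _ (Finset.mem_univ i), pow_add]
    have h2 := pow_ne_zero (Λ.deg i) hx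
    have h3 := pow_ne_zero (∑ j ∈ Finset.univ.erase i, Λ.deg j) hx
    field_simp
  · push Not at h
    rw [Λ.evalPair_solve_of_ne k h, mul_inv_cancel_left₀ (pow_ne_zero _ hx)]

/-- The substitution that parametrises the incidence variety. -/
def solveHom (k : τ) : MvPolynomial σ (MvPolynomial τ K) →ₐ[MvPolynomial τ K]
    MvPolynomial σ (MvPolynomial τ K) := MvPolynomial.aeval (Λ.solve k)

theorem evalPair_solveHom (k : τ) (x : τ → L) (u : σ → L) (F : MvPolynomial σ (MvPolynomial τ K)) :
    evalPair x u (Λ.solveHom k F) = evalPair x (fun q => evalPair x u (Λ.solve k q)) F := by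
  have : (evalPair x u).comp (Λ.solveHom k).toRingHom =
      evalPair (K := K) x (fun q => evalPair x u (Λ.solve k q)) := by
    refine MvPolynomial.ringHom_ext (fun f => ?_) fun q => ?_
    · simp [evalPair_C, solveHom, MvPolynomial.algebraMap_eq]
    · simp [evalPair_X, solveHom]
  exact congrArg (fun h => h F) this

/-- A polynomial vanishes on the incidence variety. -/
def VanishesOnIncidence (Z : Set (τ → K)) (F : MvPolynomial σ (MvPolynomial τ K)) : Prop :=
  ∀ x ∈ Z, ∀ u : σ → K, (∀ i, Λ.val u x i = 0) → evalPair x u F = 0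

variable {Λ}

/-- Pulled back along the parametrisation, the vanishing concerns `Z` times an affine space, where
it extends from `K`-points to `L`-points coefficient by coefficient. -/
theorem VanishesOnIncidence.evalPair_eq_zero [Infinite K] {Z : Set (τ → K)} (hZ : IsClosedCone Z)
    {F : MvPolynomial σ (MvPolynomial τ K)} (hF : Λ.VanishesOnIncidence Z F) {x : τ → L}
    (hx : x ∈ conePoints Z L) {u : σ → L} (hu : ∀ i, Λ.val u x i = 0) : evalPair x u F = 0 := by
  obtain ⟨k, hk⟩ := Function.ne_iff.1 hx.1
  rw [← Λ.exists_eq_solve k x hk u hu, ← Λ.evalPair_solveHom]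
  refine hZ.evalPair_eq_zero (fun y hy v => ?_) hx _
  rw [Λ.evalPair_solveHom]
  exact hF y hy _ (Λ.val_solve k y v)

/-- The incidence variety is irreducible because one of its charts is, and nothing is lost by
restricting to a chart that meets `Z`. -/
theorem VanishesOnIncidence.of_mul [Infinite K] {Z : Set (τ → K)} (hZ : IsConeVariety Z)
    {F G : MvPolynomial σ (MvPolynomial τ K)} (h : Λ.VanishesOnIncidence Z (F * G)) :
    Λ.VanishesOnIncidence Z F ∨ Λ.VanishesOnIncidence Z G := by
  obtain ⟨x₀, hx₀⟩ := hZ.nonempty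
  obtain ⟨k, hk⟩ := Function.ne_iff.1 (hZ.ne_zero x₀ hx₀)
  have key : ∀ A : MvPolynomial σ (MvPolynomial τ K),
      (∀ x ∈ Z, ∀ u : σ → K, evalPair x u (Λ.solveHom k A) = 0) →
        Λ.VanishesOnIncidence Z A := by
    intro A hA x hx u hu
    have hA' : ∀ x ∈ Z, x k ≠ 0 → ∀ u, (∀ i, Λ.val u x i = 0) → evalPair x u A = 0 := by
      intro x hx hxk u hu
      rw [← Λ.exists_eq_solve k x hxk u hu, ← Λ.evalPair_solveHom]
      exact hA x hx _
    obtain ⟨k', hk'⟩ := Function.ne_iff.1 (hZ.ne_zero x hx)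
    rw [← Λ.exists_eq_solve k' x hk' u hu, ← Λ.evalPair_solveHom]
    -- To pass to another chart, multiply by the coordinate `X k`: the product vanishes everywhere,
    -- and `X k` does not vanish identically on `Z`.
    have hmul : ∀ x ∈ Z, ∀ u : σ → K,
        evalPair x u (MvPolynomial.C (MvPolynomial.X k) * Λ.solveHom k' A) = 0 := by
      intro x hx u
      rw [map_mul, evalPair_C, MvPolynomial.aeval_X]
      by_cases hxk : x k = 0
      · rw [hxk, zero_mul]
      · rw [Λ.evalPair_solveHom, hA' x hx hxk _ (Λ.val_solve k' x u), mul_zero]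
    rcases hZ.evalPair_prime hmul with h1 | h1
    · exfalso
      have := h1 x₀ hx₀ 0
      rw [evalPair_C, MvPolynomial.aeval_X] at this
      exact hk this
    · exact h1 x hx _
  have hFG : ∀ x ∈ Z, ∀ u : σ → K, evalPair x u (Λ.solveHom k F * Λ.solveHom k G) = 0 := by
    intro x hx u
    rw [← map_mul, Λ.evalPair_solveHom]
    exact h x hx _ (Λ.val_solve k x u)
  exact (hZ.evalPair_prime hFG).imp (key F) (key G)

variable (Λ)

/-- The ideal of the image of the incidence variety in the space of coefficients. -/
def elimIdeal (Z : Set (τ → K)) : Ideal (MvPolynomial σ K) where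
  carrier := {P | ∀ x ∈ Z, ∀ u : σ → K, (∀ i, Λ.val u x i = 0) → MvPolynomial.eval u P = 0}
  zero_mem' := by simp
  add_mem' := by
    intro P Q hP hQ x hx u hu
    rw [map_add, hP x hx u hu, hQ x hx u hu, add_zero]
  smul_mem' := by
    intro P Q hQ x hx u hu
    rw [smul_eq_mul, map_mul, hQ x hx u hu, mul_zero]

theorem mem_elimIdeal {σ τ ι K : Type*} [Field K] (Λ : LinSys σ τ ι K) {Z : Set (τ → K)} {P : MvPolynomial σ K} : P ∈ Λ.elimIdeal Z ↔
    ∀ x ∈ Z, ∀ u : σ → K, (∀ i, Λ.val u x i = 0) → MvPolynomial.eval u P = 0 := Iff.rfl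

theorem mem_elimIdeal_iff_vanishes {σ τ ι K : Type*} [Field K] (Λ : LinSys σ τ ι K) {Z : Set (τ → K)} {P : MvPolynomial σ K} :
    P ∈ Λ.elimIdeal Z ↔ Λ.VanishesOnIncidence Z (MvPolynomial.map MvPolynomial.C P) := by
  simp only [mem_elimIdeal, VanishesOnIncidence, evalPair_map_C, MvPolynomial.aeval_eq_eval]

theorem isPrime_elimIdeal [Infinite K] {Z : Set (τ → K)} (hZ : IsConeVariety Z) :
    (Λ.elimIdeal Z).IsPrime := by
  refine ⟨fun htop => ?_, fun {P Q} h => ?_⟩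
  · obtain ⟨x, hx⟩ := hZ.nonempty
    have h1 : (1 : MvPolynomial σ K) ∈ Λ.elimIdeal Z := htop ▸ trivial
    simpa using h1 x hx 0 fun i => by simp [val]
  · rw [mem_elimIdeal_iff_vanishes, map_mul] at h
    rw [mem_elimIdeal_iff_vanishes, mem_elimIdeal_iff_vanishes]
    exact h.of_mul hZ

theorem aeval_eq_zero_of_mem_elimIdeal [Infinite K] {Z : Set (τ → K)} (hZ : IsClosedCone Z)
    {P : MvPolynomial σ K} (hP : P ∈ Λ.elimIdeal Z) {x : τ → L} (hx : x ∈ conePoints Z L)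
    {u : σ → L} (hu : ∀ i, Λ.val u x i = 0) : MvPolynomial.aeval u P = 0 := by
  rw [← evalPair_map_C x u]
  exact ((Λ.mem_elimIdeal_iff_vanishes).1 hP).evalPair_eq_zero hZ hx hu

end LinSys
end
end
end ChowForms

namespace ChowForms
noncomputable section

/-! ### Scaling groups of variables -/

section
variable {σ K : Type*} [Field K]

open Classical in
/-- Scaling the variables in `G` by a new variable. -/
def scaleHom (G : Set σ) : MvPolynomial σ K →ₐ[K] Polynomial (MvPolynomial σ K) :=
  MvPolynomial.aeval fun p =>
    if p ∈ G then Polynomial.X * Polynomial.C (MvPolynomial.X p) else Polynomial.C (MvPolynomial.X p)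

/-- `P` is homogeneous of degree `k` in the variables in `G`. -/
def IsHomogIn (G : Set σ) (k : ℕ) (P : MvPolynomial σ K) : Prop :=
  scaleHom G P = Polynomial.C P * Polynomial.X ^ k

open Classical in
theorem aeval_scaleHom {A : Type*} [CommRing A] [Algebra K A] (G : Set σ) (P : MvPolynomial σ K)
    (u : σ → A) (c : A) :
    (scaleHom G P).eval₂ (MvPolynomial.aeval u : _ →ₐ[K] A).toRingHom c =
      MvPolynomial.aeval (fun p => if p ∈ G then c * u p else u p) P := by
  have : (Polynomial.eval₂RingHom (MvPolynomial.aeval u : _ →ₐ[K] A).toRingHom c).comp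
      (scaleHom G).toRingHom =
      (MvPolynomial.aeval (fun p => if p ∈ G then c * u p else u p) : _ →ₐ[K] A).toRingHom := by
    refine MvPolynomial.ringHom_ext (fun f => ?_) fun q => ?_
    · simp [scaleHom, Polynomial.algebraMap_apply, MvPolynomial.algebraMap_eq]
    · by_cases h : q ∈ G
      · simp [scaleHom, h, mul_comm (u q) c]
      · simp [scaleHom, h]
  exact congrArg (fun h => h P) this

open Classical in
theorem IsHomogIn.aeval_eq {G : Set σ} {k : ℕ} {P : MvPolynomial σ K} (h : IsHomogIn G k P)
    {A : Type*} [CommRing A] [Algebra K A] (u : σ → A) (c : A) :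
    MvPolynomial.aeval (fun p => if p ∈ G then c * u p else u p) P =
      c ^ k * MvPolynomial.aeval u P := by
  rw [← aeval_scaleHom, h, Polynomial.eval₂_mul, Polynomial.eval₂_C, Polynomial.eval₂_X_pow,
    mul_comm]
  rfl

/-- Highest and lowest degrees are both additive, so they must agree for each factor of a monomial.
-/
theorem Polynomial.exists_eq_C_mul_X_pow_of_mul_eq {A : Type*} [CommRing A] [IsDomain A]
    {p q : Polynomial A} {a : A} (ha : a ≠ 0) {m : ℕ}
    (h : p * q = Polynomial.C a * Polynomial.X ^ m) :
    ∃ b k, p = Polynomial.C b * Polynomial.X ^ k := by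
  have hne : Polynomial.C a * Polynomial.X ^ m ≠ 0 := by simp [ha]
  have hp : p ≠ 0 := by rintro rfl; exact hne (by rw [← h, zero_mul])
  have hq : q ≠ 0 := by rintro rfl; exact hne (by rw [← h, mul_zero])
  have h1 := congrArg Polynomial.natDegree h
  have h2 := congrArg Polynomial.natTrailingDegree h
  rw [Polynomial.natDegree_mul hp hq, Polynomial.natDegree_C_mul_X_pow m a ha] at h1
  rw [Polynomial.natTrailingDegree_mul hp hq, Polynomial.C_mul_X_pow_eq_monomial,
    Polynomial.natTrailingDegree_monomial ha] at h2
  have h3 := Polynomial.natTrailingDegree_le_natDegree p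
  have h4 := Polynomial.natTrailingDegree_le_natDegree q
  refine ⟨p.coeff p.natDegree, p.natDegree, ?_⟩
  ext j
  rw [Polynomial.coeff_C_mul_X_pow]
  split_ifs with hj
  · rw [hj]
  · rcases lt_or_gt_of_ne hj with h5 | h5
    · exact Polynomial.coeff_eq_zero_of_lt_natTrailingDegree (by omega)
    · exact Polynomial.coeff_eq_zero_of_natDegree_lt h5

theorem scaleHom_eval_one (G : Set σ) (P : MvPolynomial σ K) : (scaleHom G P).eval 1 = P := by
  have := aeval_scaleHom G P (MvPolynomial.X : σ → MvPolynomial σ K) 1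
  simp only [one_mul, ite_self] at this
  have h2 : (MvPolynomial.aeval MvPolynomial.X : MvPolynomial σ K →ₐ[K] MvPolynomial σ K) =
    AlgHom.id K _ := MvPolynomial.aeval_X_left
  rw [h2] at this
  exact this

theorem IsHomogIn.le_of_dvd {G : Set σ} {j k : ℕ} {P Q : MvPolynomial σ K} (hP : IsHomogIn G j P)
    (hQ : IsHomogIn G k Q) (h : P ∣ Q) (hQ0 : Q ≠ 0) : j ≤ k := by
  obtain ⟨R, rfl⟩ := h
  have hP0 := left_ne_zero_of_mul hQ0
  have h1 := congrArg Polynomial.natDegree hQ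
  rw [map_mul, hP, Polynomial.natDegree_C_mul_X_pow _ _ hQ0] at h1
  have h2 : scaleHom G R ≠ 0 := by
    intro h0
    have := scaleHom_eval_one G R
    rw [h0, Polynomial.eval_zero] at this
    exact hQ0 (by rw [← this, mul_zero])
  rw [Polynomial.natDegree_mul (by simp [hP0]) h2, Polynomial.natDegree_C_mul_X_pow _ _ hP0] at h1
  omega

theorem IsHomogIn.mul {G : Set σ} {j k : ℕ} {P Q : MvPolynomial σ K} (hP : IsHomogIn G j P)
    (hQ : IsHomogIn G k Q) : IsHomogIn G (j + k) (P * Q) := by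
  rw [IsHomogIn, map_mul, hP, hQ, Polynomial.C_mul, pow_add]
  ring

theorem IsHomogIn.pow {G : Set σ} {j : ℕ} {P : MvPolynomial σ K} (hP : IsHomogIn G j P) (r : ℕ) :
    IsHomogIn G (j * r) (P ^ r) := by
  rw [IsHomogIn, map_pow, hP, Polynomial.C_pow, mul_pow, pow_mul]

theorem isHomogIn_C (G : Set σ) (c : K) : IsHomogIn G 0 (MvPolynomial.C c : MvPolynomial σ K) := by
  rw [IsHomogIn, pow_zero, mul_one]
  exact (scaleHom G).commutes c

theorem IsHomogIn.unique {G : Set σ} {j k : ℕ} {P : MvPolynomial σ K} (hP : IsHomogIn G j P)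
    (hP' : IsHomogIn G k P) (h0 : P ≠ 0) : j = k :=
  le_antisymm (hP.le_of_dvd hP' dvd_rfl h0) (hP'.le_of_dvd hP dvd_rfl h0)

open Classical in
-- Since the zero set is stable under scaling the group `G`, `P` divides all its components with
-- respect to `G`. In particular it is a factor of its top component, and factors of homogeneous
-- polynomials are homogeneous.
theorem exists_isHomogIn [IsAlgClosed K] {P : MvPolynomial σ K} (hP : Irreducible P) (G : Set σ)
    (h : ∀ u : σ → K, MvPolynomial.eval u P = 0 → ∀ c : K, c ≠ 0 →
      MvPolynomial.eval (fun p => if p ∈ G then c * u p else u p) P = 0) :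
    ∃ k, IsHomogIn G k P := by
  have : Infinite K := IsAlgClosed.instInfinite
  have hdvd : ∀ m, P ∣ (scaleHom G P).coeff m := by
    intro m
    refine dvd_of_forall_eval_eq_zero hP fun u hu => ?_
    have : (scaleHom G P).map (MvPolynomial.eval u) = 0 := by
      refine Polynomial.eq_zero_of_forall_ne_zero fun c hc => ?_
      have h1 := aeval_scaleHom G P u c
      rw [MvPolynomial.aeval_eq_eval, h u hu c hc] at h1
      rw [Polynomial.eval_map, ← h1]
      congr 1
    rw [← Polynomial.coeff_map, this, Polynomial.coeff_zero]
  have hne : scaleHom G P ≠ 0 := by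
    intro h0
    have := scaleHom_eval_one G P
    rw [h0, Polynomial.eval_zero] at this
    exact hP.ne_zero this.symm
  have hcomm : ∀ m, scaleHom G ((scaleHom G P).coeff m) =
      Polynomial.C ((scaleHom G P).coeff m) * Polynomial.X ^ m := by
    intro m
    have hq : ∀ (u : σ → K) (c : K), ((scaleHom G P).map (MvPolynomial.eval u)).eval c =
        MvPolynomial.eval (fun p => if p ∈ G then c * u p else u p) P := by
      intro u c
      rw [← MvPolynomial.aeval_eq_eval, ← aeval_scaleHom, Polynomial.eval_map]
      congr 1
    have hq' : ∀ (u : σ → K) (c : K), (scaleHom G P).map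
        (MvPolynomial.eval (fun p => if p ∈ G then c * u p else u p)) =
        ((scaleHom G P).map (MvPolynomial.eval u)).comp (Polynomial.C c * Polynomial.X) := by
      intro u c
      refine Polynomial.funext fun t => ?_
      rw [Polynomial.eval_comp, hq, hq]
      congr 2
      funext p
      by_cases hp : p ∈ G
      · simp [hp, mul_left_comm, mul_assoc]
      · simp [hp]
    have hinj : ∀ f g : Polynomial (MvPolynomial σ K), (∀ (u : σ → K) (c : K),
        (f.map (MvPolynomial.eval u)).eval c = (g.map (MvPolynomial.eval u)).eval c) → f = g := by
      intro f g hfg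
      ext1 j
      refine MvPolynomial.funext fun u => ?_
      rw [← Polynomial.coeff_map, ← Polynomial.coeff_map, Polynomial.funext (hfg u)]
    refine hinj _ _ fun u c => ?_
    have h1 := aeval_scaleHom G ((scaleHom G P).coeff m) u c
    rw [MvPolynomial.aeval_eq_eval] at h1
    rw [Polynomial.eval_map]
    refine Eq.trans ?_ (h1.trans ?_)
    · congr 1
    · rw [← Polynomial.coeff_map, hq', Polynomial.comp_C_mul_X_coeff, Polynomial.coeff_map]
      simp only [Polynomial.eval_map, Polynomial.eval₂_C, Polynomial.eval₂_pow,
        Polynomial.eval₂_X, Polynomial.eval₂_mul]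
  obtain ⟨Q, hQ⟩ := hdvd (scaleHom G P).natDegree
  have h5 := hcomm (scaleHom G P).natDegree
  have h6 : (scaleHom G P).coeff (scaleHom G P).natDegree ≠ 0 := by
    rwa [Polynomial.coeff_natDegree, Polynomial.leadingCoeff_ne_zero]
  nth_rewrite 1 [hQ] at h5
  rw [map_mul] at h5
  obtain ⟨b, k, hk⟩ := Polynomial.exists_eq_C_mul_X_pow_of_mul_eq h6 h5
  refine ⟨k, ?_⟩
  have := scaleHom_eval_one G P
  rw [hk, Polynomial.eval_mul, Polynomial.eval_C, Polynomial.eval_pow, Polynomial.eval_X, one_pow,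
    mul_one] at this
  rw [IsHomogIn, hk, this]

end

/-! ### Elimination forms -/

namespace LinSys

section
variable {σ τ ι K : Type*} [Field K] (Λ : LinSys σ τ ι K) {Z : Set (τ → K)}

/-- `P` is an elimination form: its zeros are the coefficients for which the system has a solution
on `Z`. -/
def IsElim (Z : Set (τ → K)) (P : MvPolynomial σ K) : Prop :=
  ∀ u : σ → K, MvPolynomial.eval u P = 0 ↔ ∃ x ∈ Z, ∀ i, Λ.val u x i = 0

variable {Λ}

theorem IsElim.mem {P : MvPolynomial σ K} (h : Λ.IsElim Z P) : P ∈ Λ.elimIdeal Z :=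
  fun x hx u hu => (h u).2 ⟨x, hx, hu⟩

/-- `G` is a set of variables that contains those of the `i`-th system and no others. -/
def IsGroup (Λ : LinSys σ τ ι K) (i : ι) (G : Set σ) : Prop :=
  (∀ p ∈ Λ.s i, p ∈ G) ∧ ∀ j, j ≠ i → ∀ p ∈ Λ.s j, p ∉ G

open Classical in
theorem val_scale {i : ι} {G : Set σ} (hG : Λ.IsGroup i G) {L : Type*} [Field L] [Algebra K L]
    (u : σ → L) (c : L) (x : τ → L) (j : ι) :
    Λ.val (fun p => if p ∈ G then c * u p else u p) x j =
      if j = i then c * Λ.val u x j else Λ.val u x j := by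
  split_ifs with h
  · subst h
    rw [val, val, Finset.mul_sum]
    refine Finset.sum_congr rfl fun p hp => ?_
    simp only [if_pos (hG.1 p hp), mul_assoc]
  · refine Finset.sum_congr rfl fun p hp => ?_
    simp only [if_neg (hG.2 j h p hp)]

variable [IsAlgClosed K]

theorem IsElim.dvd {P Q : MvPolynomial σ K} (h : Λ.IsElim Z P) (hP : Irreducible P)
    (hQ : Q ∈ Λ.elimIdeal Z) : P ∣ Q :=
  dvd_of_forall_eval_eq_zero hP fun u hu => by
    obtain ⟨x, hx, hxu⟩ := (h u).1 hu
    exact hQ x hx u hxu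

/-- If `P` generates the elimination ideal, a zero of `P` kills the whole ideal, while elimination
provides a member not vanishing at a system without zero on `Z`. -/
theorem isElim_of_forall_dvd [Fintype τ] {P : MvPolynomial σ K} (hZ : IsClosedCone Z)
    (hP : P ∈ Λ.elimIdeal Z) (h : ∀ Q ∈ Λ.elimIdeal Z, P ∣ Q) : Λ.IsElim Z P := by
  intro u
  refine ⟨fun hu => ?_, fun ⟨x, hx, hxu⟩ => hP x hx u hxu⟩
  by_contra! hcon
  obtain ⟨Q, hQ0, hQ⟩ := Λ.exists_elimination_of_forall_val_ne_zero (L := K) hZ u (by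
    rw [hZ.conePoints_self]
    exact hcon)
  obtain ⟨R, rfl⟩ := h Q hQ
  rw [MvPolynomial.aeval_eq_eval, map_mul, hu, zero_mul] at hQ0
  exact hQ0 rfl

/-- An irreducible elimination form generates the elimination ideal, so its meaning persists over
algebraically closed extension fields. -/
theorem IsElim.aeval_eq_zero_iff [Fintype τ] [Fintype ι] {P : MvPolynomial σ K}
    (h : Λ.IsElim Z P) (hP : Irreducible P) (hZ : IsClosedCone Z) {L : Type*} [Field L]
    [IsAlgClosed L] [Algebra K L] (u : σ → L) :
    MvPolynomial.aeval u P = 0 ↔ ∃ x ∈ conePoints Z L, ∀ i, Λ.val u x i = 0 := by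
  have : Infinite K := IsAlgClosed.instInfinite
  constructor
  · intro hu
    by_contra! hcon
    obtain ⟨Q, hQ0, hQ⟩ := Λ.exists_elimination_of_forall_val_ne_zero hZ u hcon
    obtain ⟨R, rfl⟩ := h.dvd hP hQ
    rw [map_mul, hu, zero_mul] at hQ0
    exact hQ0 rfl
  · rintro ⟨x, hx, hxu⟩
    exact Λ.aeval_eq_zero_of_mem_elimIdeal hZ h.mem hx hxu

theorem IsElim.associated {P Q : MvPolynomial σ K} (h : Λ.IsElim Z P) (hP : Irreducible P)
    (h' : Λ.IsElim Z Q) (hQ : Irreducible Q) : Associated P Q :=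
  associated_of_dvd_dvd (h.dvd hP h'.mem) (h'.dvd hQ h.mem)

theorem IsElim.exists_isHomogIn {P : MvPolynomial σ K} (h : Λ.IsElim Z P) (hP : Irreducible P)
    {i : ι} {G : Set σ} (hG : Λ.IsGroup i G) : ∃ k, IsHomogIn G k P := by
  classical
  refine ChowForms.exists_isHomogIn hP G fun u hu c _ => ?_
  obtain ⟨x, hx, hxu⟩ := (h u).1 hu
  refine (h _).2 ⟨x, hx, fun j => ?_⟩
  rw [val_scale hG]
  simp [hxu j]

end

/-- Families of linear forms. -/
def linear (ι τ K : Type*) [Field K] [Fintype τ] : LinSys (ι × τ) τ ι K where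
  s i := {i} ×ˢ Finset.univ
  disj i j p hi hj := by
    simp only [Finset.mem_product, Finset.mem_singleton] at hi hj
    rw [← hi.1, ← hj.1]
  m p := MvPolynomial.X p.2
  deg _ := 1
  hom _ _ _ := MvPolynomial.isHomogeneous_X _ _
  pv k i := (i, k)
  pv_mem _ _ := by simp
  m_pv _ _ := by simp

theorem val_linear {ι τ K : Type*} [Field K] [Fintype τ] {L : Type*} [Field L] [Algebra K L]
    (u : ι × τ → L) (x : τ → L) (i : ι) :
    (linear ι τ K).val u x i = ∑ k, u (i, k) * x k := by
  rw [val, linear, Finset.sum_product]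
  simp

end LinSys
end
end ChowForms

namespace ChowForms
noncomputable section

/-! ### Linear forms without common zeros on hypersurface sections -/

section
variable {ι τ K : Type*} [Fintype ι] [Fintype τ] [Field K] [IsAlgClosed K]

/-- If linear forms have no common zero on a variety, then one form less suffices on any
hypersurface section. -/
theorem IsConeVariety.exists_linear_forms_of_hypersurface {Z : Set (τ → K)} (hZ : IsConeVariety Z)
    (lam : ι → τ → K) (hlam : ∀ x ∈ Z, ∃ i, ∑ k, lam i k * x k ≠ 0) {e : ℕ} (he : e ≠ 0)
    {f : MvPolynomial τ K} (hf : f.IsHomogeneous e) (hfZ : ∃ x ∈ Z, MvPolynomial.eval x f ≠ 0)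
    (i₀ : ι) : ∃ μ : ι → τ → K, ∀ x ∈ Z, MvPolynomial.eval x f = 0 →
      ∃ i, i ≠ i₀ ∧ ∑ k, μ i k * x k ≠ 0 := by
  classical
  have : Infinite K := IsAlgClosed.instInfinite
  let ℓ (i : ι) : MvPolynomial τ K := linearForm Finset.univ (lam i)
  have hℓ : ∀ i x, MvPolynomial.eval x (ℓ i) = ∑ k, lam i k * x k := fun i x =>
    eval_linearForm _ _ _
  -- Eliminate `x` from `ℓ i (x) ^ e = b i * f(x)`. At `b = 0` there is no solution on `Z`, so the
  -- eliminant `P` satisfies `P(0) ≠ 0`.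
  let t (i : ι) : MvPolynomial τ (MvPolynomial ι K) :=
    MvPolynomial.map MvPolynomial.C (ℓ i ^ e) -
      MvPolynomial.C (MvPolynomial.X i) * MvPolynomial.map MvPolynomial.C f
  let T : Set (MvPolynomial τ (MvPolynomial ι K)) :=
    MvPolynomial.map MvPolynomial.C '' homVanishing Z ∪ Set.range t
  have ht : ∀ (b : ι → K) (x : τ → K) (i : ι),
      MvPolynomial.eval₂ (MvPolynomial.aeval b : _ →ₐ[K] K).toRingHom x (t i) =
        (∑ k, lam i k * x k) ^ e - b i * MvPolynomial.eval x f := by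
    intro b x i
    rw [MvPolynomial.eval₂_sub, MvPolynomial.eval₂_mul, LinSys.eval₂_map_C, LinSys.eval₂_map_C,
      MvPolynomial.eval₂_C, MvPolynomial.aeval_eq_eval, map_pow, hℓ]
    simp
  obtain ⟨P, hP0, N, hN⟩ := exists_elimination T (by
    rintro _ (⟨g, ⟨⟨d, hd⟩, -⟩, rfl⟩ | ⟨i, rfl⟩)
    · exact ⟨d, hd.map _⟩
    · refine ⟨e, MvPolynomial.IsHomogeneous.sub ?_ ?_⟩
      · have := (isHomogeneous_linearForm Finset.univ (lam i)).pow e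
        rw [one_mul] at this
        exact this.map _
      · simpa using (MvPolynomial.isHomogeneous_C τ (MvPolynomial.X i)).mul (hf.map _))
    (MvPolynomial.aeval (0 : ι → K) : _ →ₐ[K] K).toRingHom (by
    intro x hx
    by_contra hx0
    obtain ⟨i, hi⟩ := hlam x (hZ.mem_of_forall x hx0 fun g hg => by
      rw [← MvPolynomial.aeval_eq_eval, ← LinSys.eval₂_map_C (0 : ι → K)]
      exact hx _ (Or.inl ⟨g, hg, rfl⟩))
    have := hx _ (Or.inr ⟨i, rfl⟩)
    rw [ht, Pi.zero_apply, zero_mul, sub_zero] at this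
    exact hi (eq_zero_of_pow_eq_zero this))
  have hP0 : MvPolynomial.eval 0 P ≠ 0 := hP0
  have hPZ : ∀ x ∈ Z, ∀ b : ι → K,
      (∀ i, (∑ k, lam i k * x k) ^ e = b i * MvPolynomial.eval x f) →
      MvPolynomial.eval b P = 0 := by
    intro x hx b hb
    refine eq_zero_of_mem_span hN (MvPolynomial.aeval b : _ →ₐ[K] K).toRingHom (hZ.ne_zero x hx) ?_
    rintro _ (⟨g, hg, rfl⟩ | ⟨i, rfl⟩)
    · rw [LinSys.eval₂_map_C, MvPolynomial.aeval_eq_eval]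
      exact hg.2 x hx
    · rw [ht, hb, sub_self]
  set D := P.totalDegree with hD
  let A (m : ℕ) : MvPolynomial ι K := MvPolynomial.homogeneousComponent m P
  have hA : ∀ m, (A m).IsHomogeneous m := fun m =>
    MvPolynomial.homogeneousComponent_isHomogeneous m P
  -- `P(ℓ ^ e / f)` with denominators cleared. It vanishes on `Z`, and on the section `f = 0` only
  -- the top part `A D (ℓ ^ e)` remains.
  let Q : MvPolynomial τ K := ∑ m ∈ Finset.range (D + 1),
    MvPolynomial.aeval (fun i => ℓ i ^ e) (A m) * f ^ (D - m)
  have hev : ∀ x m, MvPolynomial.eval x (MvPolynomial.aeval (fun i => ℓ i ^ e) (A m)) =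
      MvPolynomial.eval (fun i => (∑ k, lam i k * x k) ^ e) (A m) := by
    intro x m
    rw [MvPolynomial.map_aeval, MvPolynomial.eval]
    simp only [MvPolynomial.coe_eval₂Hom, map_pow]
    congr 1
    · ext c
      simp
    · funext i
      rw [← hℓ, MvPolynomial.eval, MvPolynomial.coe_eval₂Hom]
  have hfQ : ∀ x ∈ Z, MvPolynomial.eval x (f * Q) = 0 := by
    intro x hx
    by_cases hfx : MvPolynomial.eval x f = 0
    · rw [map_mul, hfx, zero_mul]
    rw [map_mul, map_sum]
    refine mul_eq_zero_of_right _ ?_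
    have h1 := hPZ x hx (fun i => (MvPolynomial.eval x f)⁻¹ * (∑ k, lam i k * x k) ^ e)
      (fun i => by field_simp)
    rw [← P.sum_homogeneousComponent, map_sum] at h1
    have h2 : ∀ m ∈ Finset.range (D + 1),
        MvPolynomial.eval x (MvPolynomial.aeval (fun i => ℓ i ^ e) (A m) * f ^ (D - m)) =
        MvPolynomial.eval x f ^ D * MvPolynomial.eval
          (fun i => (MvPolynomial.eval x f)⁻¹ * (∑ k, lam i k * x k) ^ e) (A m) := by
      intro m hm
      rw [Finset.mem_range, Nat.lt_succ_iff] at hm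
      rw [map_mul, hev, map_pow, eval_smul_of_isHomogeneous (hA m), inv_pow, ← mul_assoc,
        mul_comm, pow_sub₀ _ hfx hm]
    rw [Finset.sum_congr rfl h2, ← Finset.mul_sum]
    exact mul_eq_zero_of_right _ h1
  have hQ : ∀ x ∈ Z, MvPolynomial.eval x Q = 0 := by
    rcases hZ.prime f Q hfQ with h | h
    · obtain ⟨x, hx, hfx⟩ := hfZ
      exact absurd (h x hx) hfx
    · exact h
  have hP : P ≠ 0 := by
    rintro rfl
    simp at hP0
  have hAD : A D ≠ 0 := by
    intro h0
    obtain ⟨m, hm, hmD⟩ := Finset.exists_mem_eq_sup P.support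
      (MvPolynomial.support_nonempty.2 hP) (fun s => s.sum fun _ e => e)
    have := congrArg (MvPolynomial.coeff m) h0
    rw [MvPolynomial.coeff_homogeneousComponent, MvPolynomial.coeff_zero, if_pos] at this
    · exact MvPolynomial.mem_support_iff.1 hm this
    · rw [hD, MvPolynomial.totalDegree, hmD]
      rfl
  have hD0 : D ≠ 0 := by
    intro h0
    obtain ⟨x, hx⟩ := hZ.nonempty
    have h1 := hQ x hx
    have h2 : P = A 0 := by
      conv_lhs => rw [← P.sum_homogeneousComponent, ← hD, h0]
      simp [A]
    simp only [Q, h0, zero_add, Finset.range_one, Finset.sum_singleton, Nat.sub_zero, pow_zero,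
      mul_one, hev] at h1
    have h3 : P = MvPolynomial.C (P.coeff 0) := MvPolynomial.totalDegree_eq_zero_iff_eq_C.1 h0
    rw [← h2, h3, MvPolynomial.eval_C] at h1
    rw [h3, MvPolynomial.eval_C] at hP0
    exact hP0 h1
  -- With `c i ^ e = b i`, the new forms vanish together exactly when `(ℓ i)` is proportional to `(c
  -- i)`. On `f = 0` this would make `A D (b)` vanish, unless all `ℓ i` vanish, which is excluded.
  obtain ⟨b, hb⟩ := exists_eval_ne_zero (mul_ne_zero hAD (MvPolynomial.X_ne_zero i₀))
  rw [map_mul, MvPolynomial.eval_X] at hb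
  obtain ⟨hbA, hb0⟩ := mul_ne_zero_iff.1 hb
  choose c hc using fun i => IsAlgClosed.exists_pow_nat_eq (b i) (Nat.pos_of_ne_zero he)
  have hc0 : c i₀ ≠ 0 := by
    intro h0
    rw [← hc, h0, zero_pow he] at hb0
    exact hb0 rfl
  refine ⟨fun i k => lam i k - c i / c i₀ * lam i₀ k, fun x hx hfx => ?_⟩
  by_contra! hcon
  have hprop : ∀ i, ∑ k, lam i k * x k = (∑ k, lam i₀ k * x k) / c i₀ * c i := by
    intro i
    by_cases hi : i = i₀
    · rw [hi, div_mul_cancel₀ _ hc0]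
    · have := hcon i hi
      simp only [sub_mul, Finset.sum_sub_distrib, mul_assoc, ← Finset.mul_sum] at this
      rw [sub_eq_zero.1 this]
      ring
  have h1 := hQ x hx
  rw [map_sum, Finset.sum_eq_single D] at h1
  · rw [map_mul, Nat.sub_self, pow_zero, map_one, mul_one, hev] at h1
    have h2 : (fun i => (∑ k, lam i k * x k) ^ e) =
        fun i => ((∑ k, lam i₀ k * x k) / c i₀) ^ e * b i := by
      funext i
      rw [hprop, mul_pow, hc]
    rw [h2, eval_smul_of_isHomogeneous (hA D)] at h1
    rcases mul_eq_zero.1 h1 with h3 | h3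
    · have h4 := eq_zero_of_pow_eq_zero (eq_zero_of_pow_eq_zero h3)
      obtain ⟨i, hi⟩ := hlam x hx
      rw [hprop, h4, zero_mul] at hi
      exact hi rfl
    · exact hbA h3
  · intro m hm hmD
    rw [Finset.mem_range, Nat.lt_succ_iff] at hm
    rw [map_mul, map_pow, hfx, zero_pow (by omega), mul_zero]
  · intro h
    simp at h

end
end
end ChowForms

namespace ChowForms
noncomputable section

/-! ### Consequences of the existence of an irreducible Chow form -/

section
variable {ι τ K : Type*} [Fintype τ] [Field K] [IsAlgClosed K]

/-- A system of linear forms without zeros on a closed cone can be chosen to vanish at a given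
point outside. -/
theorem IsClosedCone.mem_of_forall_meets {Z : Set (τ → K)} (hZ : IsClosedCone Z)
    (lam : ι → τ → K) (hlam : ∀ x ∈ Z, ∃ i, ∑ k, lam i k * x k ≠ 0) {x₀ : τ → K} (hx₀ : x₀ ≠ 0)
    (h : ∀ mu : ι → τ → K, (∀ i, ∑ k, mu i k * x₀ k = 0) → ∃ x ∈ Z, ∀ i, ∑ k, mu i k * x k = 0) :
    x₀ ∈ Z := by
  by_contra hmem
  obtain ⟨mu, h0, hmu⟩ := exists_hyperplanes_through (S := homVanishing Z) (fun f hf => hf.1) lam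
    (fun x hx hxZ => hlam x (hZ.mem_of_forall x hx hxZ)) x₀
    (fun hx => hmem (hZ.mem_of_forall x₀ hx₀ hx))
  obtain ⟨x, hx, hxm⟩ := h mu h0
  obtain ⟨i, hi⟩ := hmu x (hZ.ne_zero x hx) (fun f hf => hf.2 x hx)
  exact hi (hxm i)

/-- If a linear system of forms with one group removed has no zero on `Z`, then irreducible
elimination forms do not involve that group. -/
theorem degreeOf_eq_zero_of_isElim {Z : Set (τ → K)} (hZ : IsClosedCone Z)
    {P : MvPolynomial (ι × τ) K} (hP : Irreducible P) (hPZ : (LinSys.linear ι τ K).IsElim Z P)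
    (u : ι → τ → K) (i : ι) (h : ∀ x ∈ Z, ∃ j, j ≠ i ∧ ∑ k, u j k * x k ≠ 0) (k : τ) :
    P.degreeOf (i, k) = 0 := by
  classical
  obtain ⟨Q, hQ0, hQ⟩ :=
    (LinSys.linear {j // j ≠ i} τ K).exists_elimination_of_forall_val_ne_zero (L := K) hZ
      (fun p => u p.1 p.2) (by
        rw [hZ.conePoints_self]
        intro x hx
        obtain ⟨j, hj, hjx⟩ := h x hx
        exact ⟨⟨j, hj⟩, by rwa [LinSys.val_linear]⟩)
  let φ : {j // j ≠ i} × τ → ι × τ := fun p => (p.1, p.2)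
  have hφ : Function.Injective φ := by
    rintro ⟨a, b⟩ ⟨c, d⟩ h
    simp only [φ, Prod.mk.injEq] at h
    exact Prod.ext (Subtype.ext h.1) h.2
  have hmem : MvPolynomial.rename φ Q ∈ (LinSys.linear ι τ K).elimIdeal Z := by
    intro x hx v hv
    rw [MvPolynomial.eval_rename]
    refine hQ x hx _ fun j => ?_
    have := hv j
    rw [LinSys.val_linear] at this ⊢
    exact this
  obtain ⟨R, hR⟩ := hPZ.dvd hP hmem
  have hQne : MvPolynomial.rename φ Q ≠ 0 := by
    rw [Ne, MvPolynomial.rename_eq_zero_iff_of_injective _ hφ]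
    rintro rfl
    simp at hQ0
  have hdeg : (MvPolynomial.rename φ Q).degreeOf (i, k) = 0 := by
    by_contra hne
    have hv := MvPolynomial.vars_rename φ Q
      (show (i, k) ∈ _ by
        rw [MvPolynomial.vars_def, Multiset.mem_toFinset, ← Multiset.count_ne_zero,
          ← MvPolynomial.degreeOf_def]
        exact hne)
    rw [Finset.mem_image] at hv
    obtain ⟨p, -, hp⟩ := hv
    exact p.1.2 (congrArg Prod.fst hp)
  rw [hR, MvPolynomial.degreeOf_mul_eq (left_ne_zero_of_mul (hR ▸ hQne))
    (right_ne_zero_of_mul (hR ▸ hQne))] at hdeg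
  omega

/-- If the forms other than the `i`-th had no common zero, the same would hold, after a
transposition of the groups, for a group that occurs in `P`, contrary to
`degreeOf_eq_zero_of_isElim`. -/
theorem exists_zero_of_isElim {Z : Set (τ → K)} (hZ : IsClosedCone Z)
    {P : MvPolynomial (ι × τ) K} (hP : Irreducible P) (hPZ : (LinSys.linear ι τ K).IsElim Z P)
    (u : ι → τ → K) (i : ι) : ∃ x ∈ Z, ∀ j, j ≠ i → ∑ k, u j k * x k = 0 := by
  classical
  by_contra! hcon
  obtain ⟨⟨i', k⟩, hik⟩ := exists_degreeOf_ne_zero hP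
  refine hik (degreeOf_eq_zero_of_isElim hZ hP hPZ (fun j => u (Equiv.swap i i' j)) i' ?_ k)
  intro x hx
  obtain ⟨j, hj, hjx⟩ := hcon x hx
  refine ⟨Equiv.swap i i' j, fun h => hj ?_, by rwa [Equiv.swap_apply_self]⟩
  rw [← Equiv.swap_apply_self i i' j, h, Equiv.swap_apply_right]

end

/-! ### Dimension -/

section
variable {K : Type u} [Field K] [IsAlgClosed K] {n : ℕ}

/-- An equation of `y` that does not vanish on `Y` defines a hypersurface section of `Y` containing
`y`, on which one form less suffices. -/
theorem exists_linear_forms_of_lt {r : ℕ}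
    {y Y : TopologicalSpace.IrreducibleCloseds (ProjSpace K n)} (hy : y < Y)
    (lam : Fin (r + 1) → Fin (n + 1) → K)
    (h : ∀ x ∈ cone (Y : Set (ProjSpace K n)), ∃ i, ∑ k, lam i k * x k ≠ 0) :
    ∃ mu : Fin r → Fin (n + 1) → K,
      ∀ x ∈ cone (y : Set (ProjSpace K n)), ∃ i, ∑ k, mu i k * x k ≠ 0 := by
  have : Infinite K := IsAlgClosed.instInfinite
  obtain ⟨v, hvY, hvy⟩ := Set.not_subset.1 fun hs => hy.not_ge (cone_subset_cone_iff.1 hs)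
  have hY := isConeVariety_cone Y.isClosed Y.isIrreducible
  have hyc := isConeVariety_cone y.isClosed y.isIrreducible
  have : ∃ f ∈ homVanishing (cone (y : Set (ProjSpace K n))), MvPolynomial.eval v f ≠ 0 := by
    by_contra! hcon
    exact hvy (hyc.mem_of_forall v (hY.ne_zero v hvY) hcon)
  obtain ⟨f, ⟨⟨d, hd⟩, hf⟩, hfv⟩ := this
  have hd0 : d ≠ 0 := by
    rintro rfl
    obtain ⟨w, hw⟩ := hyc.nonempty
    have h1 := eval_smul_of_isHomogeneous hd 0 w
    have h2 := eval_smul_of_isHomogeneous hd 0 v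
    simp only [zero_mul, pow_zero, one_mul] at h1 h2
    rw [hf w hw] at h1
    exact hfv (h2.symm.trans h1)
  obtain ⟨μ, hμ⟩ :=
    hY.exists_linear_forms_of_hypersurface lam h hd0 hd ⟨v, hvY, hfv⟩ (Fin.last r)
  refine ⟨fun i => μ i.castSucc, fun x hx => ?_⟩
  obtain ⟨i, hi, hix⟩ := hμ x (cone_mono hy.le hx) (hf x hx)
  obtain ⟨j, rfl⟩ := Fin.exists_castSucc_eq.2 hi
  exact ⟨j, hix⟩

/-- Each step down in a chain saves one linear form, and no forms at all always have a common zero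
on a nonempty set. -/
theorem height_le_of_missed {r : ℕ} (Y : TopologicalSpace.IrreducibleCloseds (ProjSpace K n))
    (lam : Fin (r + 1) → Fin (n + 1) → K)
    (h : ∀ x ∈ cone (Y : Set (ProjSpace K n)), ∃ i, ∑ k, lam i k * x k ≠ 0) :
    Order.height Y ≤ r := by
  have : Infinite K := IsAlgClosed.instInfinite
  induction r generalizing Y with
  | zero =>
    rw [Order.height_le_coe_iff]
    intro y hy
    exfalso
    obtain ⟨mu, hmu⟩ := exists_linear_forms_of_lt hy lam h
    obtain ⟨w, hw⟩ := (isConeVariety_cone y.isClosed y.isIrreducible).nonempty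
    obtain ⟨i, -⟩ := hmu w hw
    exact i.elim0
  | succ r ih =>
    rw [Order.height_le_coe_iff]
    intro y hy
    obtain ⟨mu, hmu⟩ := exists_linear_forms_of_lt hy lam h
    refine (ih y mu hmu).trans_lt ?_
    exact_mod_cast Nat.lt_succ_self r

theorem cone_inter {K : Type u} [Field K] {n : ℕ} {W W' : Set (ProjSpace K n)} : cone (W ∩ W') = cone W ∩ cone W' := by
  ext v
  exact ⟨fun ⟨h, h1, h2⟩ => ⟨⟨h, h1⟩, ⟨h, h2⟩⟩, fun ⟨⟨h, h1⟩, ⟨_, h2⟩⟩ => ⟨h, h1, h2⟩⟩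

/-- Cut `Y` by a coordinate hyperplane not containing it: some component of the section still meets
all systems with one form less, and it lies strictly below `Y`. -/
theorem le_height_of_meets {r : ℕ} (Y : TopologicalSpace.IrreducibleCloseds (ProjSpace K n))
    (h : ∀ lam : Fin r → Fin (n + 1) → K,
      ∃ x ∈ cone (Y : Set (ProjSpace K n)), ∀ i, ∑ k, lam i k * x k = 0) :
    r ≤ Order.height Y := by
  classical
  have : Infinite K := IsAlgClosed.instInfinite
  induction r generalizing Y with
  | zero => simp
  | succ r ih =>
    have hY := isConeVariety_cone Y.isClosed Y.isIrreducible
    obtain ⟨v, hv⟩ := hY.nonempty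
    obtain ⟨a, ha⟩ := Function.ne_iff.1 (hY.ne_zero v hv)
    let S : Set (MvPolynomial (Fin (n + 1)) K) := {MvPolynomial.X a}
    have hS : ∀ f ∈ S, ∃ d, f.IsHomogeneous d := by
      rintro f rfl
      exact ⟨1, MvPolynomial.isHomogeneous_X _ _⟩
    have hcl : IsClosed ((Y : Set (ProjSpace K n)) ∩ zeroLocus S) :=
      Y.isClosed.inter (isClosed_zeroLocus hS)
    obtain ⟨T, hTf, hTc, hTi, hT⟩ :=
      TopologicalSpace.NoetherianSpace.exists_finite_set_isClosed_irreducible hcl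
    -- Otherwise each component `t` has a nonzero eliminant, and a system where none of the finitely
    -- many eliminants vanishes, joined with `X a`, would have no zero on `Y`.
    have key : ∃ t ∈ T, ∀ lam : Fin r → Fin (n + 1) → K,
        ∃ x ∈ cone t, ∀ i, ∑ k, lam i k * x k = 0 := by
      by_contra! hcon
      have hP : ∀ t ∈ T, ∃ P : MvPolynomial (Fin r × Fin (n + 1)) K, P ≠ 0 ∧
          ∀ x ∈ cone t, ∀ u : Fin r × Fin (n + 1) → K,
            (∀ i, (LinSys.linear (Fin r) (Fin (n + 1)) K).val u x i = 0) →
              MvPolynomial.eval u P = 0 := by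
        intro t ht
        obtain ⟨lam, hlam⟩ := hcon t ht
        have htc := isClosedCone_cone (hTc t ht)
        obtain ⟨P, hP0, hP⟩ := (LinSys.linear (Fin r)
          (Fin (n + 1)) K).exists_elimination_of_forall_val_ne_zero (L := K) htc
            (fun p => lam p.1 p.2) (by
              rw [htc.conePoints_self]
              intro x hx
              obtain ⟨i, hi⟩ := hlam x hx
              exact ⟨i, by rwa [LinSys.val_linear]⟩)
        exact ⟨P, fun h0 => hP0 (by rw [h0, map_zero]), hP⟩
      choose! P hP0 hP using hP
      obtain ⟨u, hu⟩ := exists_eval_ne_zero (p := ∏ t ∈ hTf.toFinset, P t)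
        (Finset.prod_ne_zero_iff.2 fun t ht => hP0 t (hTf.mem_toFinset.1 ht))
      rw [map_prod, Finset.prod_ne_zero_iff] at hu
      obtain ⟨x, hx, hxu⟩ := h (Fin.cons (Pi.single a 1) fun i k => u (i, k))
      have hxa : x a = 0 := by
        have := hxu 0
        rw [Fin.cons_zero, Finset.sum_eq_single a (fun b _ hb => by
          rw [Pi.single_eq_of_ne hb, zero_mul]) (fun h => absurd (Finset.mem_univ a) h),
          Pi.single_eq_same, one_mul] at this
        exact this
      have hxT : x ∈ cone ((Y : Set (ProjSpace K n)) ∩ zeroLocus S) := by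
        rw [cone_inter]
        refine ⟨hx, (mem_cone_zeroLocus hS).2 ⟨hY.ne_zero x hx, ?_⟩⟩
        rintro f rfl
        rw [MvPolynomial.eval_X, hxa]
      rw [hT] at hxT
      obtain ⟨hx0, t, ht, hxt⟩ := hxT
      refine hu t (hTf.mem_toFinset.2 ht) (hP t ht x ⟨hx0, hxt⟩ u fun i => ?_)
      rw [LinSys.val_linear]
      have := hxu i.succ
      rwa [Fin.cons_succ] at this
    obtain ⟨t, ht, htm⟩ := key
    let y : TopologicalSpace.IrreducibleCloseds (ProjSpace K n) := ⟨t, hTi t ht, hTc t ht⟩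
    have htY : t ⊆ (Y : Set (ProjSpace K n)) ∩ zeroLocus S := by
      rw [hT]
      exact Set.subset_sUnion_of_mem ht
    have hy : y < Y := by
      refine lt_of_le_of_ne (fun x hx => (htY hx).1) fun heq => ?_
      obtain ⟨hv0, hvY⟩ := hv
      have : (Projectivization.mk K v hv0 : ProjSpace K n) ∈ y := by
        rw [heq]
        exact hvY
      have h1 := ((mem_cone_zeroLocus hS).1 ⟨hv0, (htY this).2⟩).2 _ rfl
      rw [MvPolynomial.eval_X] at h1
      exact ha h1
    have h1 := ih y htm
    have h2 := Order.height_add_one_le hy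
    push_cast
    exact (add_le_add_left h1 1).trans h2

/-- Chains of irreducible closed subsets of the subspace `Y` correspond to chains below `Y` in the
ambient space, as `Y` is closed. -/
theorem topologicalKrullDim_eq_height {X : Type*} [TopologicalSpace X]
    (Y : TopologicalSpace.IrreducibleCloseds X) :
    topologicalKrullDim (Y : Set X) = Order.height Y := by
  rw [Order.height_eq_krullDim_Iic]
  have hind : Topology.IsInducing (Subtype.val : ↥(Y : Set X) → X) := Topology.IsInducing.subtypeVal
  have hemb : Topology.IsClosedEmbedding (Subtype.val : ↥(Y : Set X) → X) :=
    Y.isClosed.isClosedEmbedding_subtypeVal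
  refine le_antisymm ?_ ?_
  · refine Order.krullDim_le_of_strictMono (fun s => ⟨s.map Subtype.val hind.continuous, ?_⟩) ?_
    · refine closure_minimal ?_ Y.isClosed
      rintro _ ⟨x, -, rfl⟩
      exact x.2
    · exact fun a b hab => TopologicalSpace.IrreducibleCloseds.map_strictMono_of_isInducing hind hab
  · refine Order.krullDim_le_of_strictMono (fun s => ⟨Subtype.val ⁻¹' (s.1 : Set X), ?_,
      s.1.isClosed.preimage hind.continuous⟩) ?_
    · obtain ⟨x, hx⟩ := s.1.isIrreducible.1
      refine ⟨⟨⟨x, s.2 hx⟩, hx⟩, ?_⟩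
      rw [isPreirreducible_iff_isClosed_union_isClosed]
      intro A B hA hB hAB
      have := isPreirreducible_iff_isClosed_union_isClosed.1 s.1.isIrreducible.2 _ _
        (hemb.isClosedMap A hA) (hemb.isClosedMap B hB) (by
          intro z hz
          rcases hAB (show (⟨z, s.2 hz⟩ : (Y : Set X)) ∈ _ from hz) with h | h
          · exact Or.inl ⟨_, h, rfl⟩
          · exact Or.inr ⟨_, h, rfl⟩)
      refine this.imp (fun h z hz => ?_) (fun h z hz => ?_)
      · obtain ⟨w, hw, hwz⟩ := h hz
        rwa [← Subtype.ext hwz]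
      · obtain ⟨w, hw, hwz⟩ := h hz
        rwa [← Subtype.ext hwz]
    · intro a b hab
      refine lt_of_le_of_ne (fun z hz => hab.le hz) fun heq => hab.not_ge fun z hz => ?_
      have hzb : (⟨z, b.2 hz⟩ : (Y : Set X)) ∈ (Subtype.val ⁻¹' (b.1 : Set X) : Set (Y : Set X)) :=
        hz
      have h2 := congrArg TopologicalSpace.IrreducibleCloseds.carrier heq
      exact (Set.ext_iff.1 h2 _).2 hzb

end
end
end ChowForms

namespace ChowForms
noncomputable section

/-! ### Factors of Chow forms and irreducible components -/

theorem exists_irreducible_factor_mem {R : Type*} [CommRing R] [IsDomain R]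
    [UniqueFactorizationMonoid R] {I : Ideal R} (hI : I.IsPrime) {a : R} (ha : a ∈ I)
    (ha0 : a ≠ 0) : ∃ p, Irreducible p ∧ p ∣ a ∧ p ∈ I := by
  obtain ⟨s, hs, hsa⟩ := UniqueFactorizationMonoid.exists_prime_factors a ha0
  obtain ⟨v, hv⟩ := hsa
  have : s.prod ∈ I := by
    rw [← hv] at ha
    exact (hI.mem_or_mem ha).resolve_right fun h =>
      hI.ne_top (Ideal.eq_top_of_isUnit_mem I h v.isUnit)
  obtain ⟨p, hp, hpI⟩ := (hI.multiset_prod_mem_iff_exists_mem s).1 this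
  exact ⟨p, (hs p hp).irreducible, (Multiset.dvd_prod hp).trans ⟨v, hv.symm⟩, hpI⟩

section
variable {K : Type u} [Field K] [IsAlgClosed K] {n ℓ : ℕ}

theorem isChowFormFor_iff_isElim {K : Type u} [Field K] {n ℓ : ℕ} {W : Set (ProjSpace K n)} {C : MvPolynomial (Idx ℓ n) K} :
    IsChowFormFor W C ↔ (LinSys.linear (Fin (ℓ + 1)) (Fin (n + 1)) K).IsElim (cone W) C := by
  have hcone : ∀ lam : Fin (ℓ + 1) → Fin (n + 1) → K,
      (∃ x ∈ W, ∀ i, ∑ k, lam i k * x.coords k = 0) ↔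
        ∃ x ∈ cone W, ∀ i, ∑ k, lam i k * x k = 0 := by
    intro lam
    constructor
    · rintro ⟨x, hx, h⟩
      exact ⟨_, coords_mem_cone.2 hx, h⟩
    · rintro ⟨v, ⟨hv, hvW⟩, h⟩
      obtain ⟨c, hc, hcv⟩ := exists_smul_eq_coords v hv
      refine ⟨_, hvW, fun i => ?_⟩
      rw [hcv]
      simp only [Pi.smul_apply, smul_eq_mul, mul_left_comm _ c, ← Finset.mul_sum, h i, mul_zero]
  constructor
  · intro h u
    have := h fun i k => u (i, k)
    rw [hcone] at this
    simpa only [LinSys.val_linear] using this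
  · intro h lam
    have := h fun p => lam p.1 p.2
    rw [hcone]
    simpa only [LinSys.val_linear] using this

theorem exists_linear_forms_of_isElim {τ ι : Type*} [Fintype τ] {Z : Set (τ → K)}
    {C : MvPolynomial (ι × τ) K} (hC : C ≠ 0) (h : (LinSys.linear ι τ K).IsElim Z C) :
    ∃ lam : ι → τ → K, ∀ x ∈ Z, ∃ i, ∑ k, lam i k * x k ≠ 0 := by
  have : Infinite K := IsAlgClosed.instInfinite
  obtain ⟨u, hu⟩ := exists_eval_ne_zero hC
  refine ⟨fun i k => u (i, k), fun x hx => ?_⟩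
  by_contra! hcon
  exact hu ((h u).2 ⟨x, hx, fun i => by rw [LinSys.val_linear]; exact hcon i⟩)

/-- A closed set with a nonzero Chow form contains all sets whose incident systems of linear forms
are zeros of the Chow form. -/
theorem subset_of_isElim {τ ι : Type*} [Fintype τ] {Z Z' : Set (τ → K)} (hZ : IsClosedCone Z)
    {C : MvPolynomial (ι × τ) K} (hC : C ≠ 0) (h : (LinSys.linear ι τ K).IsElim Z C)
    (hZ' : IsClosedCone Z') (hmem : C ∈ (LinSys.linear ι τ K).elimIdeal Z') : Z' ⊆ Z := by
  obtain ⟨lam, hlam⟩ := exists_linear_forms_of_isElim hC h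
  intro x₀ hx₀
  refine hZ.mem_of_forall_meets lam hlam (hZ'.ne_zero x₀ hx₀) fun mu hmu => ?_
  have h1 := hmem x₀ hx₀ (fun p => mu p.1 p.2) fun i => by rw [LinSys.val_linear]; exact hmu i
  obtain ⟨x, hx, hxm⟩ := (h _).1 h1
  refine ⟨x, hx, fun i => ?_⟩
  have := hxm i
  rwa [LinSys.val_linear] at this

theorem isClosed_of_mem_componentsOf {T : Type u} [TopologicalSpace T] {W U : Set T}
    (hW : IsClosed W) (hU : U ∈ componentsOf W) : IsClosed U := by
  have : closure U ⊆ U := hU.2 ⟨hU.1.1.closure, closure_minimal hU.1.2 hW⟩ subset_closure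
  exact closure_subset_iff_isClosed.1 this

variable {W : Set (ProjSpace K n)} {C : MvPolynomial (Idx ℓ n) K}

/-- The zeros of `P` are covered by the systems meeting the finitely many irreducible pieces of `W`.
As `P` is prime, it divides the entire elimination ideal of one piece. -/
theorem exists_isChowFormFor_of_irreducible_factor (hW : IsClosed W) (hC0 : C ≠ 0)
    (hC : IsChowFormFor W C)
    {P : MvPolynomial (Idx ℓ n) K} (hP : Irreducible P) (hPC : P ∣ C) :
    ∃ t : Set (ProjSpace K n), IsClosed t ∧ IsIrreducible t ∧ t ⊆ W ∧ IsChowFormFor t P := by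
  classical
  have : Infinite K := IsAlgClosed.instInfinite
  obtain ⟨S, hSf, hSc, hSi, hS⟩ :=
    TopologicalSpace.NoetherianSpace.exists_finite_set_isClosed_irreducible hW
  rw [isChowFormFor_iff_isElim] at hC
  set Λ := LinSys.linear (Fin (ℓ + 1)) (Fin (n + 1)) K
  have key : ∃ t ∈ S, ∀ Q ∈ Λ.elimIdeal (cone t), P ∣ Q := by
    by_contra! hcon
    choose! Q hQ hQP using hcon
    have hprod : P ∣ ∏ t ∈ hSf.toFinset, Q t := by
      refine dvd_of_forall_eval_eq_zero hP fun u hu => ?_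
      obtain ⟨R, rfl⟩ := hPC
      obtain ⟨x, ⟨hx0, hx⟩, hxu⟩ := (hC u).1 (by rw [map_mul, hu, zero_mul])
      rw [hS] at hx
      obtain ⟨t, ht, hxt⟩ := hx
      rw [map_prod]
      exact Finset.prod_eq_zero (hSf.mem_toFinset.2 ht) (hQ t ht x ⟨hx0, hxt⟩ u hxu)
    obtain ⟨t, ht, htP⟩ := (Prime.dvd_finsetProd_iff hP.prime _).1 hprod
    exact hQP t (hSf.mem_toFinset.1 ht) htP
  obtain ⟨t, ht, htP⟩ := key
  have htW : t ⊆ W := by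
    rw [hS]
    exact Set.subset_sUnion_of_mem ht
  refine ⟨t, hSc t ht, hSi t ht, htW, ?_⟩
  rw [isChowFormFor_iff_isElim]
  refine LinSys.isElim_of_forall_dvd (isClosedCone_cone (hSc t ht)) ?_ htP
  -- `P` also belongs to this ideal: being prime it contains an irreducible factor of `C`, which is
  -- divisible by `P` and hence associated to it.
  have hprime := Λ.isPrime_elimIdeal (isConeVariety_cone (hSc t ht) (hSi t ht))
  have hCt : C ∈ Λ.elimIdeal (cone t) := fun x hx u hu => hC.mem x (cone_mono htW hx) u hu
  obtain ⟨p, hp, hpC, hpt⟩ := exists_irreducible_factor_mem hprime hCt hC0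
  obtain ⟨R, hR⟩ := hP.dvd_symm hp (htP p hpt)
  rw [hR]
  exact Ideal.mul_mem_right _ _ hpt

theorem exists_irreducible_factor_of_subset (hC0 : C ≠ 0)
    (hC : IsChowFormFor W C) {t : Set (ProjSpace K n)} (htc : IsClosed t) (hti : IsIrreducible t)
    (htW : t ⊆ W) : ∃ P, Irreducible P ∧ P ∣ C ∧
      P ∈ (LinSys.linear (Fin (ℓ + 1)) (Fin (n + 1)) K).elimIdeal (cone t) := by
  have : Infinite K := IsAlgClosed.instInfinite
  rw [isChowFormFor_iff_isElim] at hC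
  exact exists_irreducible_factor_mem
    ((LinSys.linear (Fin (ℓ + 1)) (Fin (n + 1)) K).isPrime_elimIdeal (isConeVariety_cone htc hti))
    (fun x hx u hu => hC.mem x (cone_mono htW hx) u hu) hC0

/-- A factor of `C` in the elimination ideal of `U` is the Chow form of some irreducible `t` in `W`.
Then `U ⊆ t`, and maximality of `U` gives equality. -/
theorem exists_isIrredChowFormFor_of_mem_componentsOf (hW : IsClosed W) (hC0 : C ≠ 0)
    (hC : IsChowFormFor W C) {U : Set (ProjSpace K n)} (hU : U ∈ componentsOf W) :
    ∃ P, IsIrredChowFormFor U P ∧ P ∣ C := by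
  have hUc := isClosed_of_mem_componentsOf hW hU
  obtain ⟨P, hP, hPC, hPU⟩ := exists_irreducible_factor_of_subset hC0 hC hUc hU.1.1 hU.1.2
  obtain ⟨t, htc, hti, htW, ht⟩ := exists_isChowFormFor_of_irreducible_factor hW hC0 hC hP hPC
  have hUt : U ⊆ t := cone_subset_cone_iff.1 (subset_of_isElim (isClosedCone_cone htc) hP.ne_zero
    (isChowFormFor_iff_isElim.1 ht) (isClosedCone_cone hUc) hPU)
  have : U = t := hUt.antisymm (hU.2 ⟨hti, htW⟩ hUt)
  exact ⟨P, ⟨hP, this ▸ ht⟩, hPC⟩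

/-- If `t`, with Chow form `P`, lay in a larger irreducible subset, the factor of `C` attached to
the closure of the latter would be a multiple of `P`, hence associated to it, and so the larger set
would lie in `t`. -/
theorem exists_mem_componentsOf_of_irreducible_factor (hW : IsClosed W) (hC0 : C ≠ 0)
    (hC : IsChowFormFor W C) {P : MvPolynomial (Idx ℓ n) K} (hP : Irreducible P) (hPC : P ∣ C) :
    ∃ U ∈ componentsOf W, IsIrredChowFormFor U P := by
  obtain ⟨t, htc, hti, htW, ht⟩ := exists_isChowFormFor_of_irreducible_factor hW hC0 hC hP hPC
  refine ⟨t, ⟨⟨hti, htW⟩, fun V hV htV => ?_⟩, hP, ht⟩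
  refine subset_closure.trans ?_
  have hVW := closure_minimal hV.2 hW
  obtain ⟨P', hP', hPC', hPV⟩ :=
    exists_irreducible_factor_of_subset hC0 hC isClosed_closure hV.1.closure hVW
  rw [isChowFormFor_iff_isElim] at ht
  have h1 : P ∣ P' := ht.dvd hP fun x hx u hu =>
    hPV x (cone_mono (htV.trans subset_closure) hx) u hu
  obtain ⟨R, rfl⟩ := hP'.dvd_symm hP' dvd_rfl |>.trans (hP.dvd_symm hP' h1)
  exact cone_subset_cone_iff.1 (subset_of_isElim (isClosedCone_cone htc) hP.ne_zero ht
    (isClosedCone_cone isClosed_closure) (Ideal.mul_mem_right _ _ hPV))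

theorem isChowFormFor_unique {W' : Set (ProjSpace K n)} (hC0 : C ≠ 0) (hW : IsClosed W)
    (hC : IsChowFormFor W C) (hW' : IsClosed W') (hC' : IsChowFormFor W' C) : W' = W := by
  rw [isChowFormFor_iff_isElim] at hC hC'
  exact Set.Subset.antisymm
    (cone_subset_cone_iff.1 (subset_of_isElim (isClosedCone_cone hW) hC0 hC
      (isClosedCone_cone hW') hC'.mem))
    (cone_subset_cone_iff.1 (subset_of_isElim (isClosedCone_cone hW') hC0 hC'
      (isClosedCone_cone hW) hC.mem))

/-- A system with `P ≠ 0` consists of `ℓ + 1` forms without common zero on `U`, whereas any `ℓ`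
forms, completed by the zero form, do meet `U`. -/
theorem topologicalKrullDim_of_isIrredChowFormFor {U : Set (ProjSpace K n)} (hU : IsClosed U)
    (hUi : IsIrreducible U) {P : MvPolynomial (Idx ℓ n) K} (hP : IsIrredChowFormFor U P) :
    topologicalKrullDim U = ℓ := by
  let Y : TopologicalSpace.IrreducibleCloseds (ProjSpace K n) := ⟨U, hUi, hU⟩
  have hP1 := isChowFormFor_iff_isElim.1 hP.2
  have h1 : Order.height Y ≤ ℓ := by
    obtain ⟨lam, hlam⟩ := exists_linear_forms_of_isElim hP.1.ne_zero hP1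
    exact height_le_of_missed Y lam hlam
  have h2 : ℓ ≤ Order.height Y := by
    refine le_height_of_meets Y fun lam => ?_
    obtain ⟨x, hx, hxl⟩ := exists_zero_of_isElim (isClosedCone_cone hU) hP.1 hP1
      (Fin.snoc (α := fun _ => Fin (n + 1) → K) lam 0) (Fin.last ℓ)
    refine ⟨x, hx, fun i => ?_⟩
    have := hxl i.castSucc (Fin.castSucc_lt_last i).ne
    simpa only [Fin.snoc_castSucc] using this
  have h3 := topologicalKrullDim_eq_height Y
  rw [le_antisymm h1 h2] at h3
  exact h3

theorem isIrredChowFormFor_iff (hW : IsClosed W) (hC0 : C ≠ 0) (hC : IsChowFormFor W C)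
    (P : MvPolynomial (Idx ℓ n) K) :
    (Irreducible P ∧ P ∣ C) ↔ ∃ U ∈ componentsOf W, IsIrredChowFormFor U P := by
  constructor
  · rintro ⟨hP, hPC⟩
    exact exists_mem_componentsOf_of_irreducible_factor hW hC0 hC hP hPC
  · rintro ⟨U, hU, hP⟩
    obtain ⟨Q, hQ, hQC⟩ := exists_isIrredChowFormFor_of_mem_componentsOf hW hC0 hC hU
    exact ⟨hP.1, ((isChowFormFor_iff_isElim.1 hP.2).dvd hP.1
      (isChowFormFor_iff_isElim.1 hQ.2).mem).trans hQC⟩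

theorem hasPureDimension_of_isChowFormFor (hW : IsClosed W) (hC0 : C ≠ 0)
    (hC : IsChowFormFor W C) : HasPureDimension W ℓ := by
  intro U hU
  obtain ⟨P, hP, -⟩ := exists_isIrredChowFormFor_of_mem_componentsOf hW hC0 hC hU
  exact topologicalKrullDim_of_isIrredChowFormFor (isClosed_of_mem_componentsOf hW hU) hU.1.1 hP

end
end
end ChowForms

namespace ChowForms
noncomputable section

/-! ### Degrees of elements over a field of definition of a union of hyperplanes -/

section
variable {τ F A : Type*} [Fintype τ] [Field F] [CommRing A] [Algebra F A]

/-- The chain rule along a line. -/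
theorem derivative_aeval_line (a v : τ → A) (G : MvPolynomial τ F) :
    Polynomial.derivative (MvPolynomial.aeval
      (fun k => Polynomial.C (a k) + Polynomial.C (v k) * Polynomial.X) G) =
    ∑ k, Polynomial.C (v k) * MvPolynomial.aeval
      (fun k => Polynomial.C (a k) + Polynomial.C (v k) * Polynomial.X)
        (MvPolynomial.pderiv k G) := by
  classical
  induction G using MvPolynomial.induction_on with
  | C c =>
    simp only [MvPolynomial.pderiv_C, map_zero, mul_zero, Finset.sum_const_zero]
    rw [MvPolynomial.algHom_C, Polynomial.algebraMap_apply, Polynomial.derivative_C]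
  | add p q hp hq => simp only [map_add, hp, hq, mul_add, Finset.sum_add_distrib]
  | mul_X p i hp =>
    rw [map_mul, Polynomial.derivative_mul, hp, Finset.sum_mul]
    have h1 : ∀ k : τ, Polynomial.C (v k) * MvPolynomial.aeval
        (fun k => Polynomial.C (a k) + Polynomial.C (v k) * Polynomial.X)
          (MvPolynomial.pderiv k (p * (MvPolynomial.X i : MvPolynomial τ F))) =
        Polynomial.C (v k) * MvPolynomial.aeval
          (fun k => Polynomial.C (a k) + Polynomial.C (v k) * Polynomial.X)
            (MvPolynomial.pderiv k p) * MvPolynomial.aeval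
          (fun k => Polynomial.C (a k) + Polynomial.C (v k) * Polynomial.X)
            (MvPolynomial.X i : MvPolynomial τ F) +
        if k = i then MvPolynomial.aeval
          (fun k => Polynomial.C (a k) + Polynomial.C (v k) * Polynomial.X) p *
            Polynomial.C (v k) else 0 := by
      intro k
      rw [MvPolynomial.pderiv_mul, MvPolynomial.pderiv_X, map_add, map_mul, map_mul, mul_add,
        ← mul_assoc]
      congr 1
      split_ifs with hk
      · subst hk
        rw [Pi.single_eq_same, map_one, mul_one, mul_comm]
      · rw [Pi.single_eq_of_ne' hk, map_zero, mul_zero, mul_zero]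
    rw [Finset.sum_congr rfl fun k _ => h1 k, Finset.sum_add_distrib, Finset.sum_ite_eq',
      if_pos (Finset.mem_univ i)]
    congr 2
    rw [MvPolynomial.aeval_X]
    simp

end

theorem totalDegree_pderiv_lt {τ F : Type*} [Field F] {G : MvPolynomial τ F} {k : τ}
    (h : MvPolynomial.pderiv k G ≠ 0) : (MvPolynomial.pderiv k G).totalDegree < G.totalDegree := by
  classical
  obtain ⟨m, hm, hmD⟩ := Finset.exists_mem_eq_sup _
      (MvPolynomial.support_nonempty.2 h) (fun s => s.sum fun _ e => e)
  rw [MvPolynomial.totalDegree, hmD]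
  rw [MvPolynomial.mem_support_iff, MvPolynomial.coeff_pderiv] at hm
  have h1 := MvPolynomial.le_totalDegree (MvPolynomial.mem_support_iff.2 (left_ne_zero_of_mul hm))
  rw [Finsupp.sum_add_index' (by simp) (by simp), Finsupp.sum_single_index rfl] at h1
  omega

/-- Vanishing derivatives force all exponents to be divisible by `p`. The coefficients are kept, so
`F` need not be perfect. -/
theorem exists_expand_eq {τ F : Type*} [Fintype τ] [Field F] {G : MvPolynomial τ F} {p : ℕ}
    [CharP F p] (h : ∀ k, MvPolynomial.pderiv k G = 0) :
    ∃ G₁, G = MvPolynomial.expand p G₁ := by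
  classical
  have hdvd : ∀ m ∈ G.support, ∀ k, p ∣ m k := by
    intro m hm k
    by_cases hk : m k = 0
    · rw [hk]
      exact dvd_zero p
    have h1 := MvPolynomial.coeff_pderiv (i := k) G (m - Finsupp.single k 1)
    have h2 : m - Finsupp.single k 1 + Finsupp.single k 1 = m :=
      tsub_add_cancel_of_le (Finsupp.single_le_iff.2 (Nat.one_le_iff_ne_zero.2 hk))
    rw [h k, MvPolynomial.coeff_zero, h2] at h1
    have h3 := (mul_eq_zero.1 h1.symm).resolve_left (MvPolynomial.mem_support_iff.1 hm)
    rw [← CharP.cast_eq_zero_iff F p]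
    rw [← h3, Finsupp.tsub_apply, Finsupp.single_eq_same]
    rw [Nat.cast_sub (Nat.one_le_iff_ne_zero.2 hk)]
    simp
  refine ⟨∑ m ∈ G.support, MvPolynomial.monomial (m.mapRange (· / p) (Nat.zero_div p)) (G.coeff m),
    ?_⟩
  conv_lhs => rw [G.as_sum]
  rw [map_sum]
  refine Finset.sum_congr rfl fun m hm => ?_
  have h1 : p • m.mapRange (· / p) (Nat.zero_div p) = m := by
    ext k
    exact Nat.mul_div_cancel' (hdvd m hm k)
  rw [MvPolynomial.expand_monomial, h1]

/-- If `G` vanishes simply on the hyperplane dual to `z`, its gradient there is proportional to `z`.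
At a general point with `F`-rational coordinates outside `k₀`, the remaining coordinate `ρ` is a
root of a polynomial of degree at most `d`, and the gradient shows `z` to be rational over `F(ρ)`.
If the gradient vanishes on the hyperplane, a nonzero derivative of smaller degree or, in
characteristic `p`, a `p`-th root of the variables allows induction on `d`. -/
theorem exists_aeval_eq_zero_of_forall_hyperplane {τ F Ω : Type*} [Fintype τ] [Field F] [Field Ω]
    [IsAlgClosed Ω] [Algebra F Ω] [Infinite F] (k₀ : τ) (d : ℕ) (z : τ → Ω) (hz : z k₀ = 1)
    (G : MvPolynomial τ F) (hG : G ≠ 0) (hd : G.totalDegree = d)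
    (hGz : ∀ μ : τ → Ω, ∑ k, μ k * z k = 0 → MvPolynomial.aeval μ G = 0) (w : Ω)
    (hw : w ∈ Algebra.adjoin F (Set.range z)) :
    ∃ h : Polynomial F, h ≠ 0 ∧ h.natDegree ≤ d ∧ Polynomial.aeval w h = 0 := by
  classical
  have hinf : Infinite Ω := IsAlgClosed.instInfinite
  induction d using Nat.strong_induction_on generalizing z G w with
  | _ d ih =>
  have hrel : ∀ k, ∀ μ : τ → Ω, ∑ k, μ k * z k = 0 →
      MvPolynomial.aeval μ (MvPolynomial.pderiv k G) =
        z k * MvPolynomial.aeval μ (MvPolynomial.pderiv k₀ G) := by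
    intro k μ hμ
    -- A direction inside the hyperplane. The derivative of `G` along it vanishes, which compares
    -- the `k`-th and the `k₀`-th partial derivatives.
    let v : τ → Ω := Pi.single k 1 - Pi.single k₀ (z k)
    have hv : ∑ j, v j * z j = 0 := by
      simp only [v, Pi.sub_apply, sub_mul, Finset.sum_sub_distrib, Pi.single_apply, ite_mul,
        zero_mul, Finset.sum_ite_eq', Finset.mem_univ, if_true, hz]
      ring
    have hcomp : ∀ (t : Ω) (H : MvPolynomial τ F), (MvPolynomial.aeval
        (fun k => Polynomial.C (μ k) + Polynomial.C (v k) * Polynomial.X) H).eval t =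
        MvPolynomial.aeval (fun k => μ k + v k * t) H := by
      intro t H
      rw [← Polynomial.coe_aeval_eq_eval, ← AlgHom.coe_restrictScalars' F, ← AlgHom.comp_apply,
        MvPolynomial.comp_aeval]
      simp
    have hφ : MvPolynomial.aeval
        (fun k => Polynomial.C (μ k) + Polynomial.C (v k) * Polynomial.X) G = 0 := by
      refine Polynomial.funext fun t => ?_
      rw [hcomp, Polynomial.eval_zero]
      refine hGz _ ?_
      simp only [add_mul, Finset.sum_add_distrib, hμ, zero_add]
      rw [← mul_zero t, ← hv, Finset.mul_sum]
      exact Finset.sum_congr rfl fun j _ => by ring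
    have hder := derivative_aeval_line μ v G
    rw [hφ, Polynomial.derivative_zero] at hder
    have h0 := congrArg (Polynomial.eval 0) hder
    rw [Polynomial.eval_zero, Polynomial.eval_finsetSum] at h0
    simp only [Polynomial.eval_mul, Polynomial.eval_C, hcomp, mul_zero, add_zero] at h0
    simp only [v, Pi.sub_apply, sub_mul, Finset.sum_sub_distrib, Pi.single_apply, ite_mul,
        zero_mul, Finset.sum_ite_eq', Finset.mem_univ, if_true, one_mul] at h0
    exact (sub_eq_zero.1 h0.symm)
  have hsmall : ∀ k, MvPolynomial.pderiv k G ≠ 0 → (∀ μ : τ → Ω, ∑ k, μ k * z k = 0 →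
      MvPolynomial.aeval μ (MvPolynomial.pderiv k G) = 0) →
      ∃ h : Polynomial F, h ≠ 0 ∧ h.natDegree ≤ d ∧ Polynomial.aeval w h = 0 := by
    intro k hk hker
    have hlt := totalDegree_pderiv_lt hk
    rw [hd] at hlt
    obtain ⟨h, h0, hdeg, hh⟩ := ih _ hlt z hz _ hk rfl hker w hw
    exact ⟨h, h0, hdeg.trans hlt.le, hh⟩
  by_cases hker : ∀ μ : τ → Ω, ∑ k, μ k * z k = 0 →
      MvPolynomial.aeval μ (MvPolynomial.pderiv k₀ G) = 0
  · by_cases hall : ∀ k, MvPolynomial.pderiv k G = 0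
    swap
    · push Not at hall
      obtain ⟨k, hk⟩ := hall
      refine hsmall k hk fun μ hμ => ?_
      rw [hrel k μ hμ, hker μ hμ, mul_zero]
    obtain ⟨p, hpF⟩ := CharP.exists F
    have hconst : G.totalDegree ≠ 0 := by
      intro h0
      rw [MvPolynomial.totalDegree_eq_zero_iff_eq_C] at h0
      have := hGz 0 (by simp)
      rw [h0, MvPolynomial.algHom_C, map_eq_zero] at this
      exact hG (by rw [h0, this, map_zero])
    have hp : p ≠ 0 := by
      rintro rfl
      have := CharP.charP_to_charZero F
      apply hconst
      rw [MvPolynomial.totalDegree_eq_zero_iff]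
      intro m hm k
      by_contra hk
      have h1 := MvPolynomial.coeff_pderiv (i := k) G (m - Finsupp.single k 1)
      have h2 : m - Finsupp.single k 1 + Finsupp.single k 1 = m :=
        tsub_add_cancel_of_le (Finsupp.single_le_iff.2 (Nat.one_le_iff_ne_zero.2 hk))
      rw [hall k, MvPolynomial.coeff_zero, h2] at h1
      have h3 := (mul_eq_zero.1 h1.symm).resolve_left (MvPolynomial.mem_support_iff.1 hm)
      exact Nat.cast_add_one_ne_zero _ h3
    have hpp : p.Prime := (CharP.char_is_prime_or_zero F p).resolve_right hp
    have : Fact p.Prime := ⟨hpp⟩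
    have hpΩ : CharP Ω p := charP_of_injective_algebraMap (algebraMap F Ω).injective p
    -- All derivatives vanish: `G` is `G₁` in the `p`-th powers of the variables, and `G₁` vanishes
    -- on the hyperplane dual to the point `z ^ p`. An equation for `w ^ p` gives one for `w`, with
    -- degree multiplied by `p`.
    obtain ⟨G₁, rfl⟩ := exists_expand_eq hall
    rw [MvPolynomial.totalDegree_expand] at hd hconst
    have hlt : G₁.totalDegree < d := by
      rw [← hd]
      have := hpp.two_le
      have : G₁.totalDegree ≠ 0 := left_ne_zero_of_mul hconst
      nlinarith [Nat.pos_of_ne_zero this]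
    have hwp : ∀ w ∈ Algebra.adjoin F (Set.range z),
        w ^ p ∈ Algebra.adjoin F (Set.range fun k => z k ^ p) := by
      clear! w
      intro w hw
      induction hw using Algebra.adjoin_induction with
      | mem x hx =>
        obtain ⟨k, rfl⟩ := hx
        exact Algebra.subset_adjoin ⟨k, rfl⟩
      | algebraMap r =>
        rw [← map_pow]
        exact Subalgebra.algebraMap_mem _ _
      | add x y _ _ hx hy =>
        rw [add_pow_char]
        exact add_mem hx hy
      | mul x y _ _ hx hy =>
        rw [mul_pow]
        exact mul_mem hx hy
    obtain ⟨h, h0, hdeg, hh⟩ := ih _ hlt (fun k => z k ^ p) (by simp [hz]) G₁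
      (by rintro rfl; simp at hG) rfl (by
        intro μ hμ
        choose ν hν using fun k => IsAlgClosed.exists_pow_nat_eq (μ k) hpp.pos
        have h1 := hGz ν (by
          have : (∑ k, ν k * z k) ^ p = 0 := by
            rw [sum_pow_char, ← hμ]
            exact Finset.sum_congr rfl fun k _ => by rw [mul_pow, hν]
          exact eq_zero_of_pow_eq_zero this)
        rw [MvPolynomial.aeval_expand] at h1
        rw [← h1]
        congr 2
        funext k
        exact (hν k).symm) (w ^ p) (hwp w hw)
    refine ⟨Polynomial.expand F p h, (Polynomial.expand_ne_zero hpp.pos).2 h0, ?_, ?_⟩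
    · rw [Polynomial.natDegree_expand, ← hd]
      exact Nat.mul_le_mul_right _ hdeg
    · rw [Polynomial.expand_aeval, hh]
  · push Not at hker
    obtain ⟨μ₀, hμ₀, hμ₀'⟩ := hker
    -- Projection onto the hyperplane: as `z k₀ = 1`, the other coordinates can be chosen freely, in
    -- particular in the infinite field `F`.
    let σ₀ (μ : τ → Ω) : τ → Ω := Function.update μ k₀ (-∑ k ∈ Finset.univ.erase k₀, μ k * z k)
    have hσ₀ : ∀ μ, ∑ k, σ₀ μ k * z k = 0 := by
      intro μ
      rw [← Finset.add_sum_erase _ _ (Finset.mem_univ k₀)]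
      simp only [σ₀, Function.update_self, hz, mul_one]
      rw [neg_add_eq_zero]
      exact Finset.sum_congr rfl fun k hk => by
        rw [Function.update_of_ne (Finset.ne_of_mem_erase hk)]
    obtain ⟨a, ha⟩ : ∃ a : τ → F, MvPolynomial.aeval (σ₀ fun k => algebraMap F Ω (a k))
        (MvPolynomial.pderiv k₀ G) ≠ 0 := by
      let s : τ → MvPolynomial τ Ω := Function.update MvPolynomial.X k₀
        (-∑ k ∈ Finset.univ.erase k₀, MvPolynomial.X k * MvPolynomial.C (z k))
      let q : MvPolynomial τ Ω := MvPolynomial.aeval s (MvPolynomial.pderiv k₀ G)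
      have hq : ∀ μ, MvPolynomial.eval μ q =
          MvPolynomial.aeval (σ₀ μ) (MvPolynomial.pderiv k₀ G) := by
        intro μ
        rw [← MvPolynomial.aeval_eq_eval]
        change (MvPolynomial.aeval μ : MvPolynomial τ Ω →ₐ[Ω] Ω).restrictScalars F q = _
        rw [← AlgHom.comp_apply, MvPolynomial.comp_aeval]
        congr 2
        funext k
        by_cases hk : k = k₀
        · subst hk
          simp [s, σ₀]
        · simp [s, σ₀, hk]
      by_contra! hcon
      have hq0 : q = 0 := by
        refine MvPolynomial.funext_set (fun _ => Set.range (algebraMap F Ω))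
          (fun _ => Set.infinite_range_of_injective (algebraMap F Ω).injective) fun x hx => ?_
        choose a ha using fun k => hx k trivial
        have := hcon a
        rw [← hq] at this
        rw [map_zero, ← this]
        congr 2
        funext k
        exact (ha k).symm
      have h1 := hq μ₀
      have h2 : σ₀ μ₀ = μ₀ := by
        rw [Function.update_eq_self_iff]
        rw [← Finset.add_sum_erase _ _ (Finset.mem_univ k₀), hz, mul_one] at hμ₀
        exact (eq_neg_of_add_eq_zero_left hμ₀).symm
      rw [hq0, map_zero, h2] at h1
      exact hμ₀' h1.symm
    set ρ : Ω := σ₀ (fun k => algebraMap F Ω (a k)) k₀ with hρ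
    let v : τ → F := Pi.single k₀ 1
    let a' : τ → F := Function.update a k₀ 0
    let g : MvPolynomial τ F → Polynomial F := fun H => MvPolynomial.aeval
      (fun k => Polynomial.C (a' k) + Polynomial.C (v k) * Polynomial.X) H
    have hg : ∀ H, Polynomial.aeval ρ (g H) =
        MvPolynomial.aeval (σ₀ fun k => algebraMap F Ω (a k)) H := by
      intro H
      rw [← AlgHom.comp_apply, MvPolynomial.comp_aeval]
      congr 2
      funext k
      by_cases hk : k = k₀
      · subst hk
        simp [a', v, hρ]
      · simp [a', v, hk, σ₀]
    have hder : Polynomial.derivative (g G) = g (MvPolynomial.pderiv k₀ G) := by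
      rw [derivative_aeval_line, Finset.sum_eq_single k₀
        (fun b _ hb => by simp [v, Pi.single_eq_of_ne hb])
        (fun h => absurd (Finset.mem_univ k₀) h)]
      simp [v, g]
    have hg0 : g G ≠ 0 := by
      intro h0
      rw [h0, Polynomial.derivative_zero] at hder
      rw [← hg, ← hder, map_zero] at ha
      exact ha rfl
    have hgdeg : (g G).natDegree ≤ d := by
      have := MvPolynomial.aeval_natDegree_le (n := 1) G hd.le
        (fun k => Polynomial.C (a' k) + Polynomial.C (v k) * Polynomial.X) (fun k => by
          compute_degree)
      rwa [mul_one] at this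
    have hroot : Polynomial.aeval ρ (g G) = 0 := by
      rw [hg]
      exact hGz _ (hσ₀ _)
    have hint : IsIntegral F ρ := IsAlgebraic.isIntegral ⟨g G, hg0, hroot⟩
    -- Each `z k` is a quotient of partial derivatives at a point with coordinates in `F(ρ)`.
    have hzmem : ∀ k, z k ∈ IntermediateField.adjoin F {ρ} := by
      intro k
      have h1 := hrel k _ (hσ₀ fun k => algebraMap F Ω (a k))
      rw [eq_div_of_mul_eq ha h1.symm, ← hg, ← hg]
      have hmem : ∀ q : Polynomial F, Polynomial.aeval ρ q ∈ IntermediateField.adjoin F {ρ} :=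
        fun q => IntermediateField.algebra_adjoin_le_adjoin F _
          (Polynomial.aeval_mem_adjoin_singleton F ρ)
      exact div_mem (hmem _) (hmem _)
    have hwmem : w ∈ IntermediateField.adjoin F {ρ} := by
      have : Algebra.adjoin F (Set.range z) ≤
          (IntermediateField.adjoin F {ρ}).toSubalgebra :=
        Algebra.adjoin_le (by rintro _ ⟨k, rfl⟩; exact hzmem k)
      exact this hw
    have hfd := IntermediateField.adjoin.finiteDimensional hint
    refine ⟨minpoly F (⟨w, hwmem⟩ : IntermediateField.adjoin F {ρ}),
      minpoly.ne_zero (IsIntegral.of_finite F _), ?_, ?_⟩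
    · refine (minpoly.natDegree_le _).trans ?_
      rw [IntermediateField.adjoin.finrank hint]
      exact (Polynomial.natDegree_le_of_dvd (minpoly.dvd F ρ hroot) hg0).trans hgdeg
    · have h1 := minpoly.aeval F (⟨w, hwmem⟩ : IntermediateField.adjoin F {ρ})
      have h2 := congrArg (algebraMap (IntermediateField.adjoin F {ρ}) Ω) h1
      rw [← Polynomial.aeval_algebraMap_apply, map_zero] at h2
      exact h2

end
end ChowForms

namespace ChowForms
noncomputable section

/-! ### Systems of forms of given degrees -/

theorem degree_eq_one_iff {τ : Type*} (α : τ →₀ ℕ) :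
    α.degree = 1 ↔ ∃ k, α = Finsupp.single k 1 := by
  classical
  constructor
  · intro h
    have h0 : α ≠ 0 := by
      rintro rfl
      simp at h
    obtain ⟨k, hk⟩ := Finsupp.ne_iff.1 h0
    refine ⟨k, ?_⟩
    have hle : Finsupp.single k 1 ≤ α := by
      rw [Finsupp.single_le_iff]
      exact Nat.one_le_iff_ne_zero.2 hk
    obtain ⟨β, rfl⟩ := exists_add_of_le hle
    rw [map_add, Finsupp.degree_single] at h
    have : β.degree = 0 := by omega
    rw [Finsupp.degree_eq_zero_iff] at this
    rw [this, add_zero]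
  · rintro ⟨k, rfl⟩
    exact Finsupp.degree_single _ _

theorem aeval_C_comp {σ σ' K : Type*} [Field K] (g : σ → MvPolynomial σ' K)
    (P : MvPolynomial σ K) :
    MvPolynomial.aeval (fun p => Polynomial.C (g p)) P =
      (Polynomial.C (MvPolynomial.aeval g P) : Polynomial (MvPolynomial σ' K)) := by
  induction P using MvPolynomial.induction_on with
  | C a => simp [Polynomial.algebraMap_apply, MvPolynomial.algebraMap_eq]
  | add p q hp hq => rw [map_add, map_add, hp, hq, Polynomial.C_add]
  | mul_X p q hp => rw [map_mul, map_mul, hp, MvPolynomial.aeval_X, MvPolynomial.aeval_X,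
      Polynomial.C_mul]

theorem isHomogeneous_of_eval_smul {τ F : Type*} [Field F] [Infinite F] {f : MvPolynomial τ F}
    {D : ℕ} (h : ∀ (c : F) (x : τ → F),
      MvPolynomial.eval (fun k => c * x k) f = c ^ D * MvPolynomial.eval x f) :
    f.IsHomogeneous D := by
  have h1 : ∀ j, j ≠ D → MvPolynomial.homogeneousComponent j f = 0 := by
    intro j hj
    refine MvPolynomial.funext fun x => ?_
    have : evalLine f x = Polynomial.monomial D (MvPolynomial.eval x f) := by
      refine Polynomial.funext fun c => ?_
      rw [eval_evalLine, Polynomial.eval_monomial, mul_comm]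
      exact h c x
    rw [← coeff_evalLine, this, Polynomial.coeff_monomial, if_neg hj.symm, map_zero]
  have h2 : f = MvPolynomial.homogeneousComponent D f := by
    conv_lhs => rw [← f.sum_homogeneousComponent]
    rw [Finset.sum_eq_single D (fun j _ hj => h1 j hj)]
    intro hD
    rw [MvPolynomial.homogeneousComponent_eq_zero]
    simpa using hD
  rw [h2]
  exact MvPolynomial.homogeneousComponent_isHomogeneous D f

/-- A polynomial with the zeros of an irreducible polynomial is a multiple of a power of it. -/
theorem exists_eq_C_mul_pow {σ K : Type*} [Field K] [IsAlgClosed K] {P A : MvPolynomial σ K}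
    (hP : Irreducible P) (hA : A ≠ 0)
    (h : ∀ u, MvPolynomial.eval u A = 0 → MvPolynomial.eval u P = 0) :
    ∃ (c : K) (r : ℕ), c ≠ 0 ∧ A = MvPolynomial.C c * P ^ r := by
  obtain ⟨r, B, hB, hAB⟩ := WfDvdMonoid.max_power_factor hA hP
  have hB0 : B ≠ 0 := by
    rintro rfl
    exact hA (by rw [hAB, mul_zero])
  have hunit : IsUnit B := by
    by_contra hnu
    obtain ⟨q, hq, hqB⟩ := WfDvdMonoid.exists_irreducible_factor hnu hB0
    have hqP : q ∣ P := dvd_of_forall_eval_eq_zero hq fun u hu => h u (by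
      obtain ⟨R, rfl⟩ := hqB
      rw [hAB, map_mul, map_mul, hu, zero_mul, mul_zero])
    exact hB ((hq.dvd_symm hP hqP).trans hqB)
  obtain ⟨c, hc, rfl⟩ := (MvPolynomial.isUnit_iff_eq_C_of_isReduced.1 hunit)
  exact ⟨c, r, hc.ne_zero, by rw [hAB, mul_comm]⟩

section
variable {ι τ K : Type*} [Field K]

open Classical in
/-- Replacing the coefficients of the `i`-th form. -/
def replace {A : Type*} [CommRing A] (u : ι × (τ →₀ ℕ) → A) (i : ι) (f : MvPolynomial τ A) :
    ι × (τ →₀ ℕ) → A :=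
  fun p => if p.1 = i then MvPolynomial.coeff p.2 f else u p

open Classical in
theorem replace_eq_ite {A : Type*} [CommRing A] (u : ι × (τ →₀ ℕ) → A) (i : ι)
    (f : MvPolynomial τ A) (c : A) :
    (fun p => if p ∈ {p : ι × (τ →₀ ℕ) | p.1 = i} then c * replace u i f p else replace u i f p) =
      replace u i (MvPolynomial.C c * f) := by
  funext p
  by_cases hp : p.1 = i
  · simp [replace, hp]
  · simp [replace, hp]

theorem comp_replace {A B : Type*} [CommRing A] [CommRing B] (φ : A →+* B)
    (u : ι × (τ →₀ ℕ) → A) (i : ι) (f : MvPolynomial τ A) :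
    (fun p => φ (replace u i f p)) = replace (fun p => φ (u p)) i (MvPolynomial.map φ f) := by
  funext p
  by_cases hp : p.1 = i
  · simp [replace, hp, MvPolynomial.coeff_map]
  · simp [replace, hp]

/-- Substituting the coefficients of `f` for those of the `i`-th form. -/
def subst (i : ι) (f : MvPolynomial τ (MvPolynomial (ι × (τ →₀ ℕ)) K)) :
    MvPolynomial (ι × (τ →₀ ℕ)) K →ₐ[K] MvPolynomial (ι × (τ →₀ ℕ)) K :=
  MvPolynomial.aeval (replace MvPolynomial.X i f)

theorem aeval_subst {A : Type*} [CommRing A] [Algebra K A] (i : ι)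
    (f : MvPolynomial τ (MvPolynomial (ι × (τ →₀ ℕ)) K)) (Φ : MvPolynomial (ι × (τ →₀ ℕ)) K)
    (u : ι × (τ →₀ ℕ) → A) :
    MvPolynomial.aeval u (subst i f Φ) = MvPolynomial.aeval (replace u i
      (MvPolynomial.map (MvPolynomial.aeval u : MvPolynomial (ι × (τ →₀ ℕ)) K →ₐ[K] A).toRingHom f)) Φ := by
  rw [subst, ← AlgHom.comp_apply, MvPolynomial.comp_aeval]
  congr 2
  refine (comp_replace (MvPolynomial.aeval u : MvPolynomial (ι × (τ →₀ ℕ)) K →ₐ[K] A).toRingHom _ _ _).trans ?_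
  simp

theorem isHomogIn_subst_self {i : ι} {f : MvPolynomial τ (MvPolynomial (ι × (τ →₀ ℕ)) K)} {r : ℕ}
    (hf : ∀ α, IsHomogIn {p | p.1 = i} r (f.coeff α)) {Φ : MvPolynomial (ι × (τ →₀ ℕ)) K} {δ : ℕ}
    (hΦ : IsHomogIn {p | p.1 = i} δ Φ) : IsHomogIn {p | p.1 = i} (r * δ) (subst i f Φ) := by
  classical
  rw [IsHomogIn, subst, ← AlgHom.comp_apply, MvPolynomial.comp_aeval]
  have h1 : (fun p : ι × (τ →₀ ℕ) => scaleHom (K := K) {p : ι × (τ →₀ ℕ) | p.1 = i}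
      (replace MvPolynomial.X i f p)) =
      fun p => if p ∈ {p : ι × (τ →₀ ℕ) | p.1 = i} then
        Polynomial.X ^ r * Polynomial.C (replace MvPolynomial.X i f p)
        else Polynomial.C (replace MvPolynomial.X i f p) := by
    funext p
    by_cases hp : p.1 = i
    · have := hf p.2
      rw [IsHomogIn] at this
      simp only [replace, hp, if_true, Set.mem_ofPred_eq, this]
      rw [mul_comm]
    · simp [replace, hp, scaleHom]
  rw [h1, hΦ.aeval_eq, ← pow_mul, mul_comm]
  rw [aeval_C_comp]

theorem isHomogIn_subst_of_ne {i j : ι} (hij : j ≠ i)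
    {f : MvPolynomial τ (MvPolynomial (ι × (τ →₀ ℕ)) K)}
    (hf : ∀ α, IsHomogIn {p | p.1 = j} 0 (f.coeff α)) {Φ : MvPolynomial (ι × (τ →₀ ℕ)) K} {δ : ℕ}
    (hΦ : IsHomogIn {p | p.1 = j} δ Φ) : IsHomogIn {p | p.1 = j} δ (subst i f Φ) := by
  classical
  rw [IsHomogIn, subst, ← AlgHom.comp_apply, MvPolynomial.comp_aeval]
  have h1 : (fun p : ι × (τ →₀ ℕ) => scaleHom (K := K) {p : ι × (τ →₀ ℕ) | p.1 = j}
      (replace MvPolynomial.X i f p)) =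
      fun p => if p ∈ {p : ι × (τ →₀ ℕ) | p.1 = j} then
        Polynomial.X * Polynomial.C (replace MvPolynomial.X i f p)
        else Polynomial.C (replace MvPolynomial.X i f p) := by
    funext p
    by_cases hp : p.1 = i
    · have := hf p.2
      rw [IsHomogIn, pow_zero, mul_one] at this
      have hpj : ¬ p.1 = j := fun h => hij (h.symm.trans hp)
      simp only [replace, hp, if_true, Set.mem_ofPred_eq, this]
      rw [if_neg hij.symm]
    · simp [replace, hp, scaleHom]
  rw [h1, hΦ.aeval_eq, mul_comm]
  rw [aeval_C_comp]

end

section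
variable {ι τ K : Type*} [Fintype τ] [Field K]

open Classical in
/-- Families of forms of given degrees; the coefficient of the monomial `x ^ α` in the `i`-th form
is indexed by `(i, α)`. -/
def formSys (K : Type*) [Field K] (d : ι → ℕ) : LinSys (ι × (τ →₀ ℕ)) τ ι K where
  s i := {i} ×ˢ Finset.finsuppAntidiag Finset.univ (d i)
  disj i j p hi hj := by
    simp only [Finset.mem_product, Finset.mem_singleton] at hi hj
    rw [← hi.1, ← hj.1]
  m p := MvPolynomial.monomial p.2 1
  deg := d
  hom i p hp := by
    rw [Finset.mem_product, Finset.mem_finsuppAntidiag'] at hp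
    refine MvPolynomial.isHomogeneous_monomial _ ?_
    exact hp.2.1
  pv k i := (i, Finsupp.single k (d i))
  pv_mem k i := by
    rw [Finset.mem_product, Finset.mem_finsuppAntidiag']
    simp
  m_pv k i := by rw [MvPolynomial.X_pow_eq_monomial]

theorem mem_formSys_s {d : ι → ℕ} {i : ι} {p : ι × (τ →₀ ℕ)} :
    p ∈ (formSys K d).s i ↔ p.1 = i ∧ p.2.degree = d i := by
  classical
  simp only [formSys, Finset.mem_product, Finset.mem_singleton, Finset.mem_finsuppAntidiag',
    Finset.subset_univ, and_true]
  rfl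

theorem isGroup_formSys (d : ι → ℕ) (i : ι) :
    (formSys (τ := τ) K d).IsGroup i {p | p.1 = i} := by
  constructor
  · intro p hp
    exact (mem_formSys_s.1 hp).1
  · intro j hj p hp h
    exact hj ((mem_formSys_s.1 hp).1.symm.trans h)

/-- The linear part of the `i`-th form. -/
def linPart {A : Type*} [CommRing A] (u : ι × (τ →₀ ℕ) → A) (i : ι) : MvPolynomial τ A :=
  linearForm Finset.univ fun k => u (i, Finsupp.single k 1)

theorem val_formSys_eq_sum {L : Type*} [Field L] [Algebra K L] (d : ι → ℕ)
    (u : ι × (τ →₀ ℕ) → L) (x : τ → L) (i : ι) (s : Finset (τ →₀ ℕ))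
    (hs : ∀ α, α ∈ s ↔ α.degree = d i) :
    (formSys K d).val u x i = ∑ α ∈ s, u (i, α) * α.prod fun k e => x k ^ e := by
  classical
  have : (formSys (τ := τ) K d).s i = {i} ×ˢ s := by
    ext p
    rw [mem_formSys_s, Finset.mem_product, Finset.mem_singleton, hs]
  rw [LinSys.val, this, Finset.sum_product, Finset.sum_singleton]
  refine Finset.sum_congr rfl fun α _ => ?_
  rw [formSys, MvPolynomial.aeval_monomial, map_one, one_mul]

theorem val_replace_self {L : Type*} [Field L] [Algebra K L] {d : ι → ℕ}
    (u : ι × (τ →₀ ℕ) → L) (x : τ → L) (i : ι) {f : MvPolynomial τ L} (hf : f.IsHomogeneous (d i)) :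
    (formSys K d).val (replace u i f) x i = MvPolynomial.eval x f := by
  classical
  rw [val_formSys_eq_sum d _ x i (Finset.finsuppAntidiag Finset.univ (d i)) (fun α => by
    rw [Finset.mem_finsuppAntidiag']
    simp
    rfl), MvPolynomial.eval_eq]
  symm
  refine (Finset.sum_subset (fun α hα => ?_) fun α _ hα => ?_).trans
    (Finset.sum_congr rfl fun α _ => ?_)
  · rw [Finset.mem_finsuppAntidiag']
    have := hf (MvPolynomial.mem_support_iff.1 hα)
    have h1 : (Finsupp.weight fun _ => 1) α = d i := this
    rw [← Finsupp.degree_eq_weight_one] at h1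
    exact ⟨h1, Finset.subset_univ _⟩
  · rw [MvPolynomial.notMem_support_iff.1 hα, zero_mul]
  · rw [replace, if_pos rfl]
    rfl

theorem val_replace_of_ne {L : Type*} [Field L] [Algebra K L] {d d' : ι → ℕ}
    (u : ι × (τ →₀ ℕ) → L) (x : τ → L) {i j : ι} (hj : j ≠ i) (hd : d j = d' j)
    (f : MvPolynomial τ L) :
    (formSys K d').val (replace u i f) x j = (formSys K d).val u x j := by
  classical
  rw [LinSys.val, LinSys.val]
  have : (formSys (τ := τ) K d').s j = (formSys K d).s j := by
    ext p
    rw [mem_formSys_s, mem_formSys_s, hd]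
  rw [this]
  refine Finset.sum_congr rfl fun p hp => ?_
  rw [replace, if_neg (by rw [(mem_formSys_s.1 hp).1]; exact hj)]
  rfl

theorem val_eq_eval_linPart {L : Type*} [Field L] [Algebra K L] {d : ι → ℕ}
    (u : ι × (τ →₀ ℕ) → L) (x : τ → L) {i : ι} (hd : d i = 1) :
    (formSys K d).val u x i = MvPolynomial.eval x (linPart u i) := by
  classical
  rw [val_formSys_eq_sum d _ x i (Finset.univ.image fun k => Finsupp.single k 1) (fun α => by
    rw [hd, degree_eq_one_iff]
    simp [eq_comm]), Finset.sum_image (fun a _ b _ h => Finsupp.single_left_injective one_ne_zero h),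
    linPart, eval_linearForm]
  refine Finset.sum_congr rfl fun k _ => ?_
  rw [Finsupp.prod_single_index (h := fun k e => x k ^ e) (pow_zero _), pow_one]


end
end
end ChowForms

namespace ChowForms
noncomputable section

/-! ### Generic points of incidence varieties -/

/-- A generic point of a prime ideal. -/
theorem exists_ringHom_isAlgClosed {R : Type u} [CommRing R] (J : Ideal R) [J.IsPrime] :
    ∃ (Ω : Type u) (_ : Field Ω) (_ : IsAlgClosed Ω) (φ : R →+* Ω), ∀ r, φ r = 0 ↔ r ∈ J := by
  refine ⟨AlgebraicClosure (FractionRing (R ⧸ J)), inferInstance, inferInstance,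
    ((algebraMap (FractionRing (R ⧸ J)) (AlgebraicClosure (FractionRing (R ⧸ J)))).comp
      (algebraMap (R ⧸ J) (FractionRing (R ⧸ J)))).comp (Ideal.Quotient.mk J), fun r => ?_⟩
  rw [RingHom.comp_apply, RingHom.comp_apply, map_eq_zero,
    map_eq_zero_iff _ (IsFractionRing.injective (R ⧸ J) _), Ideal.Quotient.eq_zero_iff_mem]

/-- The polynomials vanishing on the incidence variety form a prime ideal. The generic point is
given by the images of the coordinates in an algebraic closure of its residue field. -/
theorem LinSys.exists_generic_point {σ : Type v₁} {τ : Type v₂} {ι : Type*} {K : Type v₃} [Field K]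
    [Infinite K] [Fintype ι] (Λ : LinSys σ τ ι K) {Z : Set (τ → K)} (hZ : IsConeVariety Z) :
    ∃ (Ω : Type (max v₁ v₂ v₃)) (_ : Field Ω) (_ : IsAlgClosed Ω) (_ : Algebra K Ω)
      (x : τ → Ω) (u : σ → Ω), x ∈ conePoints Z Ω ∧ (∀ i, Λ.val u x i = 0) ∧
      ∀ F, evalPair x u F = 0 ↔ Λ.VanishesOnIncidence Z F := by
  let J : Ideal (MvPolynomial σ (MvPolynomial τ K)) :=
    { carrier := {F | Λ.VanishesOnIncidence Z F}
      zero_mem' := fun x _ u _ => map_zero _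
      add_mem' := fun {F G} hF hG x hx u hu => by rw [map_add, hF x hx u hu, hG x hx u hu, add_zero]
      smul_mem' := fun F G hG x hx u hu => by
        rw [smul_eq_mul, map_mul, hG x hx u hu, mul_zero] }
  have hJ : J.IsPrime := by
    refine ⟨fun htop => ?_, fun {F G} h => LinSys.VanishesOnIncidence.of_mul hZ h⟩
    obtain ⟨x, hx⟩ := hZ.nonempty
    have h1 : (1 : MvPolynomial σ (MvPolynomial τ K)) ∈ J := htop ▸ trivial
    have h2 := h1 x hx 0 fun i => by simp [LinSys.val]
    rw [map_one] at h2
    exact one_ne_zero h2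
  obtain ⟨Ω, _, _, φ₀, hφ⟩ := exists_ringHom_isAlgClosed J
  let _ : Algebra K Ω := (φ₀.comp (algebraMap K (MvPolynomial σ (MvPolynomial τ K)))).toAlgebra
  let φ : MvPolynomial σ (MvPolynomial τ K) →ₐ[K] Ω := { φ₀ with commutes' := fun _ => rfl }
  replace hφ : ∀ F, φ F = 0 ↔ F ∈ J := hφ
  let x : τ → Ω := fun k => φ (MvPolynomial.C (MvPolynomial.X k))
  let u : σ → Ω := fun q => φ (MvPolynomial.X q)
  have hx : ∀ f : MvPolynomial τ K, MvPolynomial.aeval x f = φ (MvPolynomial.C f) := by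
    intro f
    induction f using MvPolynomial.induction_on with
    | C a =>
      rw [MvPolynomial.aeval_C]
      exact (φ.commutes a).symm
    | add p q hp hq => rw [map_add, map_add, map_add, hp, hq]
    | mul_X p q hp => rw [map_mul, map_mul, map_mul, hp, MvPolynomial.aeval_X]
  have hpair : ∀ F, evalPair x u F = φ F := by
    have : evalPair x u = (φ : MvPolynomial σ (MvPolynomial τ K) →+* Ω) :=
      MvPolynomial.ringHom_ext (fun f => by rw [evalPair_C, hx]; rfl) fun q => evalPair_X x u q
    intro F
    exact congrArg (fun h => h F) this
  refine ⟨Ω, inferInstance, inferInstance, inferInstance, x, u, ⟨?_, fun f hf => ?_⟩, fun i => ?_,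
    fun F => ?_⟩
  · obtain ⟨y, hy⟩ := hZ.nonempty
    obtain ⟨k, hk⟩ := Function.ne_iff.1 (hZ.ne_zero y hy)
    intro h0
    have h1 := (hφ _).1 (congrFun h0 k) y hy 0 fun i => by simp [LinSys.val]
    rw [evalPair_C, MvPolynomial.aeval_X] at h1
    exact hk h1
  · rw [hx, hφ]
    intro y hy v _
    rw [evalPair_C, MvPolynomial.aeval_eq_eval]
    exact hf.2 y hy
  · have : Λ.val u x i = φ (∑ p ∈ Λ.s i, MvPolynomial.X p * MvPolynomial.C (Λ.m p)) := by
      rw [LinSys.val, map_sum]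
      refine Finset.sum_congr rfl fun p _ => ?_
      rw [hx, map_mul]
    rw [this, hφ]
    intro y hy v hv
    rw [map_sum, ← hv i]
    refine Finset.sum_congr rfl fun p _ => ?_
    rw [map_mul, evalPair_X, evalPair_C]
  · rw [hpair, hφ]
    rfl

/-! ### Families of forms -/

section
variable {ι τ : Type*}

/-- The coefficients of a family of polynomials. -/
def coeffs {A : Type*} [CommRing A] (F : ι → MvPolynomial τ A) : ι × (τ →₀ ℕ) → A :=
  fun p => MvPolynomial.coeff p.2 (F p.1)

theorem replace_coeffs [DecidableEq ι] {A : Type*} [CommRing A] (F : ι → MvPolynomial τ A) (i : ι)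
    (f : MvPolynomial τ A) : replace (coeffs F) i f = coeffs (Function.update F i f) := by
  funext p
  by_cases hp : p.1 = i
  · simp [replace, coeffs, hp]
  · simp [replace, coeffs, hp]

theorem replace_congr {A : Type*} [CommRing A] {u u' : ι × (τ →₀ ℕ) → A} {i : ι}
    (h : ∀ p, p.1 ≠ i → u p = u' p) (f : MvPolynomial τ A) : replace u i f = replace u' i f := by
  funext p
  by_cases hp : p.1 = i
  · simp [replace, hp]
  · simp [replace, hp, h p hp]

theorem replace_replace {A : Type*} [CommRing A] (u : ι × (τ →₀ ℕ) → A) (i : ι)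
    (f g : MvPolynomial τ A) : replace (replace u i f) i g = replace u i g :=
  replace_congr (fun p hp => by simp [replace, hp]) g

theorem map_coeffs {A B : Type*} [CommRing A] [CommRing B] (φ : A →+* B)
    (F : ι → MvPolynomial τ A) :
    (fun p => φ (coeffs F p)) = coeffs fun i => MvPolynomial.map φ (F i) := by
  funext p
  exact (MvPolynomial.coeff_map _ _ _).symm

theorem IsHomogIn.aeval_replace {K : Type*} [Field K] {D : ℕ} {i : ι} {Φ : MvPolynomial (ι × (τ →₀ ℕ)) K}
    (hΦ : IsHomogIn {p | p.1 = i} D Φ) {A : Type*} [CommRing A] [Algebra K A]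
    (u : ι × (τ →₀ ℕ) → A) (c : A) (f : MvPolynomial τ A) :
    MvPolynomial.aeval (replace u i (MvPolynomial.C c * f)) Φ =
      c ^ D * MvPolynomial.aeval (replace u i f) Φ := by
  rw [← replace_eq_ite, hΦ.aeval_eq]

variable {K : Type*} [Field K] [Fintype τ]

theorem val_coeffs {L : Type*} [Field L] [Algebra K L] {d : ι → ℕ} (F : ι → MvPolynomial τ L)
    (x : τ → L) (i : ι) (hF : (F i).IsHomogeneous (d i)) :
    (formSys K d).val (coeffs F) x i = MvPolynomial.eval x (F i) := by
  classical
  rw [← val_replace_self (K := K) (coeffs F) x i hF, replace_coeffs, Function.update_eq_self]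

theorem linPart_replace_linearForm {A : Type*} [CommRing A] (u : ι × (τ →₀ ℕ) → A) (i : ι)
    (x : τ → A) : linPart (replace u i (linearForm Finset.univ x)) i =
      linearForm Finset.univ x := by
  classical
  rw [linPart]
  congr 1
  funext k
  rw [replace, if_pos rfl]
  exact coeff_linearForm _ _ (Finset.mem_univ k)

/-- An irreducible polynomial that vanishes exactly at the coefficients of the families of forms of
degrees `d` that have a common zero on `Z`. It is homogeneous of degree `D i` in the coefficients
of the `i`-th form. -/
structure IsForm (Z : Set (τ → K)) (d D : ι → ℕ) (Φ : MvPolynomial (ι × (τ →₀ ℕ)) K) : Prop where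
  irreducible : Irreducible Φ
  isElim : (formSys K d).IsElim Z Φ
  isHomogIn : ∀ i, IsHomogIn {p | p.1 = i} (D i) Φ
  degree_ne_zero : ∀ i, D i ≠ 0

/-- Setting the `i`-th form to zero annihilates `Φ`, since its degree in that group is positive. -/
theorem IsForm.exists_zero {Z : Set (τ → K)} {d D : ι → ℕ} {Φ : MvPolynomial (ι × (τ →₀ ℕ)) K}
    (hΦ : IsForm Z d D Φ) (i : ι) (u : ι × (τ →₀ ℕ) → K) :
    ∃ x ∈ Z, ∀ j, j ≠ i → (formSys K d).val u x j = 0 := by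
  have h1 : MvPolynomial.eval (replace u i 0) Φ = 0 := by
    have := (hΦ.isHomogIn i).aeval_replace u 0 0
    rw [mul_zero, zero_pow (hΦ.degree_ne_zero i), zero_mul, MvPolynomial.aeval_eq_eval] at this
    exact this
  obtain ⟨x, hx, hxu⟩ := (hΦ.isElim _).1 h1
  refine ⟨x, hx, fun j hj => ?_⟩
  rw [← hxu j, val_replace_of_ne u x hj rfl]

variable [IsAlgClosed K] {Z : Set (τ → K)} {d D : ι → ℕ} {Φ : MvPolynomial (ι × (τ →₀ ℕ)) K}

/-- A polynomial in the ideal of the image of the incidence variety involves the coefficient of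
`X k₀ ^ e`. -/
theorem IsForm.eq_zero_of_rename_mem [DecidableEq ι] (hΦ : IsForm Z d D Φ) {i : ι} (hdi : d i = 1)
    {e : ℕ} {k₀ : τ} {u₁ : ι × (τ →₀ ℕ) → K}
    (hu₁ : MvPolynomial.eval (replace u₁ i (MvPolynomial.X k₀)) Φ ≠ 0)
    {v₀ : ι × (τ →₀ ℕ)} (hv₀ : v₀ = (i, Finsupp.single k₀ e)) {c : MvPolynomial {b // b ≠ v₀} K}
    (hc : MvPolynomial.rename Subtype.val c ∈
      (formSys K (Function.update d i e)).elimIdeal Z) : c = 0 := by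
  classical
  have : Infinite K := IsAlgClosed.instInfinite
  -- Where the second factor is not zero, the other forms have a common zero `x` on `Z` with `x k₀ ≠
  -- 0`. The coefficient of `X k₀ ^ e` can then be adjusted so that the `i`-th form vanishes at `x`,
  -- and `c` does not notice the adjustment.
  have hmul : MvPolynomial.rename Subtype.val c * subst i (MvPolynomial.X k₀) Φ = 0 := by
    refine MvPolynomial.funext fun u => ?_
    rw [map_mul, map_zero, mul_eq_zero, or_iff_not_imp_right]
    intro hu
    rw [← MvPolynomial.aeval_eq_eval, aeval_subst, MvPolynomial.map_X, MvPolynomial.aeval_eq_eval]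
      at hu
    obtain ⟨x, hx, hxu⟩ := hΦ.exists_zero i u
    have hxk : x k₀ ≠ 0 := by
      intro h0
      refine hu ((hΦ.isElim _).2 ⟨x, hx, fun j => ?_⟩)
      by_cases hj : j = i
      · subst hj
        rw [val_replace_self u x j (by rw [hdi]; exact MvPolynomial.isHomogeneous_X _ _),
          MvPolynomial.eval_X, h0]
      · rw [val_replace_of_ne u x hj rfl, hxu j hj]
    set Λ := formSys (τ := τ) K (Function.update d i e) with hΛ
    let t : K := - (∑ p ∈ (Λ.s i).erase v₀, u p * MvPolynomial.aeval x (Λ.m p)) / x k₀ ^ e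
    have hval : ∀ j, Λ.val (Function.update u v₀ t) x j = 0 := by
      intro j
      by_cases hj : j = i
      · subst hj
        have hmem : v₀ ∈ Λ.s j := by
          rw [mem_formSys_s]
          simp [hv₀]
        have hm : MvPolynomial.aeval x (Λ.m v₀) = x k₀ ^ e := by
          rw [hΛ, formSys, hv₀, MvPolynomial.aeval_monomial, map_one, one_mul,
            Finsupp.prod_single_index (h := fun k e => x k ^ e) (pow_zero _)]
        rw [LinSys.val, ← Finset.add_sum_erase _ _ hmem, Function.update_self, hm,
          div_mul_cancel₀ _ (pow_ne_zero _ hxk)]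
        have : ∑ p ∈ (Λ.s j).erase v₀, Function.update u v₀ t p * MvPolynomial.aeval x (Λ.m p) =
            ∑ p ∈ (Λ.s j).erase v₀, u p * MvPolynomial.aeval x (Λ.m p) :=
          Finset.sum_congr rfl fun p hp => by
            rw [Function.update_of_ne (Finset.ne_of_mem_erase hp)]
        rw [this, neg_add_cancel]
      · have hne : ∀ p : ι × (τ →₀ ℕ), p.1 = j → p ≠ v₀ := by
          intro p hp h
          exact hj (hp.symm.trans (by rw [h, hv₀]))
        rw [← hxu j hj, LinSys.val, LinSys.val]
        have hs : Λ.s j = (formSys (τ := τ) K d).s j := by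
          ext p
          rw [mem_formSys_s, mem_formSys_s, Function.update_of_ne hj]
        rw [hs]
        refine Finset.sum_congr rfl fun p hp => ?_
        rw [Function.update_of_ne (hne p (mem_formSys_s.1 hp).1)]
        rfl
    have h1 := hc x hx _ hval
    rw [MvPolynomial.eval_rename] at h1
    rw [MvPolynomial.eval_rename, ← h1]
    congr 2
    funext b
    exact (Function.update_of_ne b.2 _ _).symm
  rcases mul_eq_zero.1 hmul with h | h
  · exact (map_eq_zero_iff _ (MvPolynomial.rename_injective _ Subtype.val_injective)).1 h
  · exfalso
    apply hu₁
    rw [← MvPolynomial.aeval_eq_eval]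
    have := aeval_subst i (MvPolynomial.X k₀) Φ u₁
    rw [MvPolynomial.map_X, h, map_zero] at this
    exact this.symm

end
end
end ChowForms

namespace ChowForms
noncomputable section

/-! ### Raising the degree of one form -/

theorem map_linearForm {σ A B : Type*} [CommRing A] [CommRing B] (φ : A →+* B) (s : Finset σ)
    (x : σ → A) :
    MvPolynomial.map φ (linearForm s x) = linearForm s fun k => φ (x k) := by
  simp [linearForm]

theorem linearForm_smul {σ A : Type*} [CommRing A] (s : Finset σ) (c : A) (x : σ → A) :
    linearForm s (fun k => c * x k) = MvPolynomial.C c * linearForm s x := by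
  simp [linearForm, Finset.mul_sum, mul_assoc]

theorem linearForm_single {σ A : Type*} [CommRing A] [Fintype σ] [DecidableEq σ] (k : σ) :
    linearForm Finset.univ (Pi.single k 1) = (MvPolynomial.X k : MvPolynomial σ A) := by
  rw [linearForm, Finset.sum_eq_single k]
  · simp
  · intro j _ hj
    simp [Pi.single_eq_of_ne hj]
  · simp

/-- Clearing denominators in an algebraic relation. -/
theorem exists_aeval_eq_zero_of_fractionRing {R Ω : Type*} [CommRing R] [IsDomain R] [Field Ω]
    (φ : R →+* Ω) (hφ : Function.Injective φ) {h : Polynomial (FractionRing R)} (h0 : h ≠ 0)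
    {w : Ω} (hw : h.eval₂ (IsFractionRing.lift hφ) w = 0) :
    ∃ h₁ : Polynomial R, h₁ ≠ 0 ∧ h₁.natDegree ≤ h.natDegree ∧ h₁.eval₂ φ w = 0 := by
  refine ⟨IsLocalization.integerNormalization (nonZeroDivisors R) h, ?_, ?_, ?_⟩
  · rwa [Ne, IsFractionRing.integerNormalization_eq_zero_iff]
  · exact Polynomial.natDegree_le_natDegree (Polynomial.degree_mono
      (IsLocalization.integerNormalization_support _ h))
  · have := IsLocalization.integerNormalization_eval₂_eq_zero (nonZeroDivisors R)
      (IsFractionRing.lift hφ) h hw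
    have hcomp : (IsFractionRing.lift hφ).comp (algebraMap R (FractionRing R)) = φ := by
      ext r
      exact IsFractionRing.lift_algebraMap hφ r
    rwa [hcomp] at this

section
variable {ι : Type v₁} {τ : Type v₂} {K : Type v₃} [Fintype τ] [Fintype ι] [DecidableEq ι]
  [Field K] [IsAlgClosed K] {Z : Set (τ → K)} {d D : ι → ℕ} {Φ : MvPolynomial (ι × (τ →₀ ℕ)) K}

/-- Let `F` be generated by all coefficients but `v₀` at a generic point `(x, u)` of the incidence
variety. With generic linear `i`-th member, `Φ` is a polynomial of degree `D i` over `F` vanishing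
on the hyperplane dual to `x`, and `u v₀` is a polynomial in the normalised coordinates of `x`. So
it has degree at most `D i` over `F`. -/
theorem IsForm.exists_mem_elimIdeal (hZ : IsConeVariety Z) (hΦ : IsForm Z d D Φ) {i : ι}
    (hdi : d i = 1) {e : ℕ} {k₀ : τ} (hk₀ : ∃ x ∈ Z, x k₀ ≠ 0) {u₁ : ι × (τ →₀ ℕ) → K}
    (hu₁ : MvPolynomial.eval (replace u₁ i (MvPolynomial.X k₀)) Φ ≠ 0)
    {v₀ : ι × (τ →₀ ℕ)} (hv₀ : v₀ = (i, Finsupp.single k₀ e)) :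
    ∃ H ∈ (formSys K (Function.update d i e)).elimIdeal Z, H ≠ 0 ∧ H.degreeOf v₀ ≤ D i := by
  classical
  have : Infinite K := IsAlgClosed.instInfinite
  set Λ := formSys (τ := τ) K (Function.update d i e) with hΛ
  obtain ⟨Ω, _, _, _, x, u, hx, hxu, hgen⟩ := Λ.exists_generic_point hZ
  have hker : ∀ P : MvPolynomial (ι × (τ →₀ ℕ)) K,
      MvPolynomial.aeval u P = 0 ↔ P ∈ Λ.elimIdeal Z := by
    intro P
    rw [Λ.mem_elimIdeal_iff_vanishes, ← hgen, evalPair_map_C]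
  have hxk : x k₀ ≠ 0 := by
    intro h0
    have h1 := (hgen (MvPolynomial.C (MvPolynomial.X k₀))).1 (by
      rw [evalPair_C, MvPolynomial.aeval_X, h0])
    obtain ⟨y, hy, hyk⟩ := hk₀
    have h2 := h1 y hy 0 fun i => by simp [LinSys.val]
    rw [evalPair_C, MvPolynomial.aeval_X] at h2
    exact hyk h2
  let R := MvPolynomial {b // b ≠ v₀} K
  let φ : R →ₐ[K] Ω := MvPolynomial.aeval fun b : {b // b ≠ v₀} => u b.1
  -- The coefficients other than `v₀` are independent at the generic point, because no nonzero
  -- member of the elimination ideal avoids `v₀`.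
  have hφ : Function.Injective (φ : R →+* Ω) := by
    rw [injective_iff_map_eq_zero]
    intro c hc
    refine hΦ.eq_zero_of_rename_mem hdi hu₁ hv₀ ((hker _).1 ?_)
    rw [MvPolynomial.aeval_rename]
    exact hc
  let F := FractionRing R
  let _ : Algebra F Ω := (IsFractionRing.lift hφ : F →+* Ω).toAlgebra
  have hlift : ∀ r : R, algebraMap F Ω (algebraMap R F r) = φ r :=
    fun r => IsFractionRing.lift_algebraMap hφ r
  have : Infinite F := Infinite.of_injective _ (IsFractionRing.injective R F)
  have htow : IsScalarTower K F Ω := IsScalarTower.of_algebraMap_eq fun a => by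
    rw [IsScalarTower.algebraMap_apply K R F, hlift]
    exact (φ.commutes a).symm
  let uR : ι × (τ →₀ ℕ) → R := fun p => if h : p ≠ v₀ then MvPolynomial.X ⟨p, h⟩ else 0
  let uF : ι × (τ →₀ ℕ) → F := fun p => algebraMap R F (uR p)
  have huF : ∀ p, p ≠ v₀ → algebraMap F Ω (uF p) = u p := by
    intro p hp
    rw [hlift]
    simp only [uR, dif_pos hp]
    exact MvPolynomial.aeval_X _ _
  have hne : ∀ p : ι × (τ →₀ ℕ), p.1 ≠ i → p ≠ v₀ := by
    intro p hp h
    exact hp (by rw [h, hv₀])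
  let G : MvPolynomial τ F := MvPolynomial.aeval
    (replace (fun p => MvPolynomial.C (uF p)) i (linearForm Finset.univ MvPolynomial.X)) Φ
  have hGA : ∀ (A : Type (max v₁ v₂ v₃)) [CommRing A] [Algebra K A] [Algebra F A]
      [IsScalarTower K F A] (μ : τ → A),
      MvPolynomial.aeval μ G = MvPolynomial.aeval
        (replace (fun p => algebraMap F A (uF p)) i (linearForm Finset.univ μ)) Φ := by
    intro A _ _ _ _ μ
    have h1 : MvPolynomial.aeval μ G =
      (((MvPolynomial.aeval μ : MvPolynomial τ F →ₐ[F] A).restrictScalars K).comp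
        (MvPolynomial.aeval (replace (fun p => MvPolynomial.C (uF p)) i
          (linearForm Finset.univ MvPolynomial.X)))) Φ := rfl
    rw [h1, MvPolynomial.comp_aeval]
    congr 2
    refine (comp_replace (MvPolynomial.aeval μ : MvPolynomial τ F →ₐ[F] A).toRingHom _ _ _).trans ?_
    rw [map_linearForm]
    simp
  have hGhom : G.IsHomogeneous (D i) := by
    refine isHomogeneous_of_eval_smul fun c μ => ?_
    rw [← MvPolynomial.aeval_eq_eval, ← MvPolynomial.aeval_eq_eval, hGA F, hGA F, linearForm_smul,
      (hΦ.isHomogIn i).aeval_replace]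
  have hG0 : G ≠ 0 := by
    intro h0
    have h1 := hGA F (Pi.single k₀ 1)
    rw [h0, map_zero, linearForm_single] at h1
    have h2 : MvPolynomial.aeval (replace uF i (MvPolynomial.X k₀)) Φ =
        algebraMap R F (MvPolynomial.aeval (replace uR i (MvPolynomial.X k₀)) Φ) := by
      have h3 := comp_replace (algebraMap R F) uR i (MvPolynomial.X k₀)
      rw [MvPolynomial.map_X] at h3
      rw [← h3]
      exact MvPolynomial.aeval_algebraMap_apply F (replace uR i (MvPolynomial.X k₀)) Φ
    have h4 : MvPolynomial.aeval (replace uR i (MvPolynomial.X k₀)) Φ = 0 :=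
      (map_eq_zero_iff _ (IsFractionRing.injective R F)).1 (h2.symm.trans h1.symm)
    apply hu₁
    have h5 : (MvPolynomial.aeval (fun b : {b // b ≠ v₀} => u₁ b.1) : R →ₐ[K] K)
        (MvPolynomial.aeval (replace uR i (MvPolynomial.X k₀)) Φ) = 0 := by rw [h4, map_zero]
    rw [← AlgHom.comp_apply, MvPolynomial.comp_aeval] at h5
    rw [← MvPolynomial.aeval_eq_eval, ← h5]
    congr 2
    refine ((comp_replace (MvPolynomial.aeval (fun b : {b // b ≠ v₀} => u₁ b.1) :
      R →ₐ[K] K).toRingHom _ _ _).trans ?_).symm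
    rw [MvPolynomial.map_X]
    refine replace_congr (fun p hp => ?_) _
    simp only [uR, dif_pos (hne p hp)]
    exact MvPolynomial.aeval_X _ _
  let z : τ → Ω := fun k => x k / x k₀
  obtain ⟨h, h0, hdeg, hh⟩ := exists_aeval_eq_zero_of_forall_hyperplane k₀ (D i) z
    (div_self hxk) G hG0 (hGhom.totalDegree hG0) (by
      intro μ hμ
      rw [hGA Ω]
      have h1 : replace (fun p => algebraMap F Ω (uF p)) i (linearForm Finset.univ μ) =
          replace u i (linearForm Finset.univ μ) :=
        replace_congr (fun p hp => huF p (hne p hp)) _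
      rw [h1]
      refine LinSys.aeval_eq_zero_of_mem_elimIdeal _ hZ.toIsClosedCone hΦ.isElim.mem hx fun j => ?_
      by_cases hj : j = i
      · subst hj
        rw [val_replace_self u x j (by rw [hdi]; exact isHomogeneous_linearForm _ _),
          eval_linearForm]
        have h2 : ∑ k, μ k * x k = (∑ k, μ k * z k) * x k₀ := by
          rw [Finset.sum_mul]
          refine Finset.sum_congr rfl fun k _ => ?_
          rw [mul_assoc, div_mul_cancel₀ _ hxk]
        rw [h2, hμ, zero_mul]
      · rw [val_replace_of_ne u x hj (Function.update_of_ne hj _ _)]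
        exact hxu j) (u v₀) (by
      have hmem : v₀ ∈ Λ.s i := by
        rw [mem_formSys_s]
        simp [hv₀]
      have hm : ∀ p, MvPolynomial.aeval x (Λ.m p) = p.2.prod fun k e => x k ^ e := by
        intro p
        rw [hΛ, formSys, MvPolynomial.aeval_monomial, map_one, one_mul]
      have hz : ∀ p ∈ Λ.s i, (MvPolynomial.aeval x (Λ.m p)) =
          x k₀ ^ e * p.2.prod fun k e => z k ^ e := by
        intro p hp
        have hxz : ∀ k, x k = x k₀ * z k := fun k => (mul_div_cancel₀ _ hxk).symm
        have hpd : p.2.degree = e := by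
          rw [(mem_formSys_s.1 hp).2, Function.update_self]
        rw [hm, Finsupp.prod, Finsupp.prod, ← hpd, Finsupp.degree_apply, ← Finset.prod_pow_eq_pow_sum,
          ← Finset.prod_mul_distrib]
        refine Finset.prod_congr rfl fun k _ => ?_
        rw [← mul_pow, ← hxz]
      have hz1 : z k₀ = 1 := div_self hxk
      have h1 := hxu i
      rw [LinSys.val, Finset.sum_congr rfl fun p hp => by rw [hz p hp, mul_left_comm],
        ← Finset.mul_sum, mul_eq_zero, or_iff_right (pow_ne_zero _ hxk),
        ← Finset.add_sum_erase _ _ hmem, hv₀,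
        Finsupp.prod_single_index (h := fun k e => z k ^ e) (pow_zero _),
        hz1, one_pow, mul_one, ← hv₀] at h1
      -- The `i`-th equation, divided by `x k₀ ^ e`, has `u v₀` with coefficient `1` because `z k₀ =
      -- 1`.
      rw [eq_neg_of_add_eq_zero_left h1]
      refine neg_mem (sum_mem fun p hp => mul_mem ?_ (prod_mem fun k _ => pow_mem ?_ _))
      · rw [← huF p (Finset.ne_of_mem_erase hp)]
        exact Subalgebra.algebraMap_mem _ _
      · exact Algebra.subset_adjoin ⟨k, rfl⟩)
  obtain ⟨h₁, h₁0, h₁deg, hh₁⟩ := exists_aeval_eq_zero_of_fractionRing (φ : R →+* Ω) hφ h0 hh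
  refine ⟨(splitVar K v₀).symm h₁, (hker _).1 ?_, ?_, ?_⟩
  · rw [aeval_eq_splitVar v₀, AlgEquiv.apply_symm_apply, Polynomial.eval_map]
    exact hh₁
  · simpa using h₁0
  · rw [← splitVar_natDegree, AlgEquiv.apply_symm_apply]
    exact h₁deg.trans hdeg

end
end
end ChowForms

namespace ChowForms
noncomputable section

/-! ### Homogeneity in a group of variables -/

section
variable {σ K τ : Type*} [Field K] {G : Set σ}

theorem IsHomogIn.sum {ι : Type*} {s : Finset ι} {k : ℕ} {P : ι → MvPolynomial σ K}
    (h : ∀ a ∈ s, IsHomogIn G k (P a)) : IsHomogIn G k (∑ a ∈ s, P a) := by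
  rw [IsHomogIn, map_sum, Finset.sum_congr rfl h, map_sum, Finset.sum_mul]

theorem isHomogIn_zero (k : ℕ) : IsHomogIn G k (0 : MvPolynomial σ K) := by
  rw [IsHomogIn, map_zero, map_zero, zero_mul]

theorem isHomogIn_one : IsHomogIn G 0 (1 : MvPolynomial σ K) := by
  simpa using isHomogIn_C G (1 : K)

theorem isHomogIn_X_of_mem {p : σ} (hp : p ∈ G) :
    IsHomogIn G 1 (MvPolynomial.X p : MvPolynomial σ K) := by
  rw [IsHomogIn, scaleHom, MvPolynomial.aeval_X, if_pos hp, pow_one, mul_comm]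

theorem isHomogIn_X_of_notMem {p : σ} (hp : p ∉ G) :
    IsHomogIn G 0 (MvPolynomial.X p : MvPolynomial σ K) := by
  rw [IsHomogIn, scaleHom, MvPolynomial.aeval_X, if_neg hp, pow_zero, mul_one]

theorem isHomogIn_coeff_mul {r s : ℕ} {f g : MvPolynomial τ (MvPolynomial σ K)}
    (hf : ∀ α, IsHomogIn G r (f.coeff α)) (hg : ∀ α, IsHomogIn G s (g.coeff α)) (α : τ →₀ ℕ) :
    IsHomogIn G (r + s) ((f * g).coeff α) := by
  classical
  rw [MvPolynomial.coeff_mul]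
  exact IsHomogIn.sum fun p _ => (hf _).mul (hg _)

theorem isHomogIn_coeff_pow {r : ℕ} {f : MvPolynomial τ (MvPolynomial σ K)}
    (hf : ∀ α, IsHomogIn G r (f.coeff α)) (e : ℕ) (α : τ →₀ ℕ) :
    IsHomogIn G (e * r) ((f ^ e).coeff α) := by
  classical
  induction e generalizing α with
  | zero =>
    rw [pow_zero, zero_mul, MvPolynomial.coeff_one]
    split_ifs
    exacts [isHomogIn_one, isHomogIn_zero _]
  | succ e ih =>
    rw [pow_succ, add_mul, one_mul]
    exact isHomogIn_coeff_mul ih hf α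

theorem isHomogIn_coeff_X (k : τ) (α : τ →₀ ℕ) : IsHomogIn G 0
    ((MvPolynomial.X k : MvPolynomial τ (MvPolynomial σ K)).coeff α) := by
  classical
  rw [MvPolynomial.coeff_X]
  split_ifs
  exacts [isHomogIn_one, isHomogIn_zero _]

end

/-! ### The raised form and its degrees -/

section
variable {ι : Type v₁} {τ : Type v₂} {K : Type v₃} [Fintype τ] [Field K]

theorem isHomogIn_coeff_linPart_self (i : ι) (α : τ →₀ ℕ) : IsHomogIn {p | p.1 = i} 1
    ((linPart (MvPolynomial.X : ι × (τ →₀ ℕ) → MvPolynomial _ K) i).coeff α) := by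
  classical
  rw [linPart, linearForm, MvPolynomial.coeff_sum]
  refine IsHomogIn.sum fun k _ => ?_
  rw [MvPolynomial.coeff_C_mul, MvPolynomial.coeff_X]
  split_ifs
  · rw [mul_one]
    exact isHomogIn_X_of_mem (p := (i, Finsupp.single k 1)) rfl
  · rw [mul_zero]
    exact isHomogIn_zero _

theorem isHomogIn_coeff_linPart_of_ne {i j : ι} (hj : j ≠ i) (α : τ →₀ ℕ) :
    IsHomogIn {p | p.1 = j} 0
      ((linPart (MvPolynomial.X : ι × (τ →₀ ℕ) → MvPolynomial _ K) i).coeff α) := by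
  classical
  rw [linPart, linearForm, MvPolynomial.coeff_sum]
  refine IsHomogIn.sum fun k _ => ?_
  rw [MvPolynomial.coeff_C_mul, MvPolynomial.coeff_X]
  split_ifs
  · rw [mul_one]
    exact isHomogIn_X_of_notMem (p := (i, Finsupp.single k 1)) hj.symm
  · rw [mul_zero]
    exact isHomogIn_zero _

theorem map_linPart_X {A : Type*} [CommRing A] [Algebra K A] (i : ι) (u : ι × (τ →₀ ℕ) → A) :
    MvPolynomial.map (MvPolynomial.aeval u : MvPolynomial (ι × (τ →₀ ℕ)) K →ₐ[K] A).toRingHom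
      (linPart MvPolynomial.X i) = linPart u i := by
  rw [linPart, map_linearForm]
  simp [linPart]

theorem isHomogeneous_linPart {A : Type*} [CommRing A] (i : ι) (u : ι × (τ →₀ ℕ) → A) :
    (linPart u i).IsHomogeneous 1 := isHomogeneous_linearForm _ _

theorem IsForm.of_irreducible_of_isElim [IsAlgClosed K] {Z : Set (τ → K)} {d D : ι → ℕ}
    {Ψ : MvPolynomial (ι × (τ →₀ ℕ)) K} (hΨ : Irreducible Ψ) (h : (formSys K d).IsElim Z Ψ)
    (hD : ∀ i, IsHomogIn {p | p.1 = i} (D i) Ψ) (hD0 : ∀ i, D i ≠ 0) {c : K} (hc : c ≠ 0) :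
    IsForm Z d D (MvPolynomial.C c * Ψ) := by
  have hu : IsUnit (MvPolynomial.C c : MvPolynomial (ι × (τ →₀ ℕ)) K) :=
    (isUnit_iff_ne_zero.2 hc).map MvPolynomial.C
  refine ⟨(irreducible_isUnit_mul hu).2 hΨ, fun u => ?_, fun i => ?_, hD0⟩
  · rw [← h u, map_mul, MvPolynomial.eval_C, mul_eq_zero, or_iff_right hc]
  · have := (isHomogIn_C {p : ι × (τ →₀ ℕ) | p.1 = i} c).mul (hD i)
    rwa [zero_add] at this

theorem eval_subst_eq_zero_iff [DecidableEq ι] {Z : Set (τ → K)} {d : ι → ℕ} {i : ι} {e : ℕ}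
    {Ψ : MvPolynomial (ι × (τ →₀ ℕ)) K} (hΨ : (formSys K (Function.update d i e)).IsElim Z Ψ)
    {f : MvPolynomial τ (MvPolynomial (ι × (τ →₀ ℕ)) K)} (hf : f.IsHomogeneous e)
    (u : ι × (τ →₀ ℕ) → K) : MvPolynomial.eval u (subst i f Ψ) = 0 ↔ ∃ x ∈ Z,
      MvPolynomial.eval x (MvPolynomial.map (MvPolynomial.eval u) f) = 0 ∧
        ∀ j, j ≠ i → (formSys K d).val u x j = 0 := by
  have hm : (MvPolynomial.aeval u : MvPolynomial (ι × (τ →₀ ℕ)) K →ₐ[K] K).toRingHom =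
      MvPolynomial.eval u := rfl
  rw [← MvPolynomial.aeval_eq_eval, aeval_subst, MvPolynomial.aeval_eq_eval, hΨ, hm]
  refine exists_congr fun x => and_congr_right fun hx => ?_
  have h1 : (formSys K (Function.update d i e)).val (replace u i
      (MvPolynomial.map (MvPolynomial.eval u) f)) x i =
        MvPolynomial.eval x (MvPolynomial.map (MvPolynomial.eval u) f) :=
    val_replace_self _ _ _ (by rw [Function.update_self]; exact hf.map _)
  have h2 : ∀ j, j ≠ i → (formSys K (Function.update d i e)).val (replace u i
      (MvPolynomial.map (MvPolynomial.eval u) f)) x j = (formSys K d).val u x j :=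
    fun j hj => val_replace_of_ne _ _ hj (Function.update_of_ne hj _ _).symm _
  constructor
  · intro h
    exact ⟨h1.symm.trans (h i), fun j hj => (h2 j hj).symm.trans (h j)⟩
  · rintro ⟨h3, h4⟩ j
    by_cases hj : j = i
    · rw [hj, h1, h3]
    · rw [h2 j hj, h4 j hj]

theorem eval_eq_zero_iff_of_isElim {Z : Set (τ → K)} {d : ι → ℕ}
    {Φ : MvPolynomial (ι × (τ →₀ ℕ)) K} {i : ι} (hdi : d i = 1) (hΦ : (formSys K d).IsElim Z Φ)
    (u : ι × (τ →₀ ℕ) → K) : MvPolynomial.eval u Φ = 0 ↔ ∃ x ∈ Z,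
      MvPolynomial.eval x (linPart u i) = 0 ∧ ∀ j, j ≠ i → (formSys K d).val u x j = 0 := by
  rw [hΦ]
  refine exists_congr fun x => and_congr_right fun _ => ?_
  rw [← val_eq_eval_linPart (K := K) u x hdi]
  exact ⟨fun h => ⟨h i, fun j _ => h j⟩, fun ⟨h, h'⟩ j => by
    by_cases hj : j = i
    · rw [hj, h]
    · exact h' j hj⟩

/-- Insert `T * X k₀ ^ e` as the `i`-th form: only the variable `v₀` receives `T`, and the value is
a nonzero multiple of `T ^ δ`. -/
theorem le_degreeOf_of_isHomogIn {ι τ K : Type*} [Field K] {i : ι} {e : ℕ} {k₀ : τ} {v₀ : ι × (τ →₀ ℕ)}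
    (hv₀ : v₀ = (i, Finsupp.single k₀ e)) {δ : ℕ} {Ψ : MvPolynomial (ι × (τ →₀ ℕ)) K}
    (hδ : IsHomogIn {p | p.1 = i} δ Ψ) {u₁ : ι × (τ →₀ ℕ) → K}
    (hu₁ : MvPolynomial.eval (replace u₁ i (MvPolynomial.X k₀ ^ e)) Ψ ≠ 0) :
    δ ≤ Ψ.degreeOf v₀ := by
  classical
  let w : ι × (τ →₀ ℕ) → Polynomial K :=
    replace (fun p => Polynomial.C (u₁ p)) i (MvPolynomial.X k₀ ^ e)
  have hw : w = fun p => algebraMap K (Polynomial K) (replace u₁ i (MvPolynomial.X k₀ ^ e) p) := by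
    refine ((comp_replace (algebraMap K (Polynomial K)) _ _ _).trans ?_).symm
    rw [map_pow, MvPolynomial.map_X]
    rfl
  have h1 := hδ.aeval_replace (fun p => Polynomial.C (u₁ p)) Polynomial.X (MvPolynomial.X k₀ ^ e)
  have h2 : MvPolynomial.aeval w Ψ =
      Polynomial.C (MvPolynomial.eval (replace u₁ i (MvPolynomial.X k₀ ^ e)) Ψ) := by
    rw [hw]
    exact MvPolynomial.aeval_algebraMap_apply (Polynomial K) _ Ψ
  rw [show replace (fun p => Polynomial.C (u₁ p)) i (MvPolynomial.X k₀ ^ e) = w from rfl, h2,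
    aeval_eq_splitVar v₀] at h1
  have h3 : replace (fun p => Polynomial.C (u₁ p)) i
      (MvPolynomial.C Polynomial.X * MvPolynomial.X k₀ ^ e) v₀ = Polynomial.X := by
    rw [replace, hv₀, if_pos rfl, MvPolynomial.coeff_C_mul, MvPolynomial.X_pow_eq_monomial,
      MvPolynomial.coeff_monomial, if_pos rfl, mul_one]
  have h4 : (MvPolynomial.aeval (fun b : {b // b ≠ v₀} => replace (fun p => Polynomial.C (u₁ p)) i
      (MvPolynomial.C Polynomial.X * MvPolynomial.X k₀ ^ e) b.1) :
        MvPolynomial {b // b ≠ v₀} K →ₐ[K] Polynomial K).toRingHom = Polynomial.C.comp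
      (MvPolynomial.eval fun b : {b // b ≠ v₀} => replace u₁ i 0 b.1) := by
    refine MvPolynomial.ringHom_ext (fun a => by simp [Polynomial.algebraMap_eq]) fun b => ?_
    simp only [AlgHom.toRingHom_eq_coe, RingHom.coe_coe, MvPolynomial.aeval_X, RingHom.comp_apply,
      MvPolynomial.eval_X]
    by_cases hb : b.1.1 = i
    · have hb2 : Finsupp.single k₀ e ≠ b.1.2 := fun h => b.2 (by
        exact (Prod.ext hb h.symm : b.1 = (i, Finsupp.single k₀ e)).trans hv₀.symm)
      simp [replace, hb, MvPolynomial.X_pow_eq_monomial, MvPolynomial.coeff_C_mul, MvPolynomial.coeff_monomial, hb2]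
    · simp [replace, hb]
  rw [h3, h4, ← Polynomial.map_map, Polynomial.eval_map, ← Polynomial.comp,
    Polynomial.comp_X] at h1
  have h5 : (Polynomial.X ^ δ * Polynomial.C
      (MvPolynomial.eval (replace u₁ i (MvPolynomial.X k₀ ^ e)) Ψ)).natDegree = δ := by
    rw [mul_comm, Polynomial.natDegree_C_mul_X_pow _ _ hu₁]
  rw [← splitVar_natDegree, ← h5, ← h1]
  exact Polynomial.natDegree_map_le

variable [Fintype ι] [IsAlgClosed K] {Z : Set (τ → K)} {d D : ι → ℕ}
  {Φ : MvPolynomial (ι × (τ →₀ ℕ)) K}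

/-- A coordinate and forms that avoid the corresponding hyperplane section. -/
theorem IsForm.exists_eval_replace_X_pow_ne_zero (hZ : IsConeVariety Z) (lam : ι → τ → K)
    (hlam : ∀ x ∈ Z, ∃ i, ∑ k, lam i k * x k ≠ 0) (hd : ∀ j, d j ≠ 0) (i : ι) :
    ∃ (k₀ : τ) (u₁ : ι × (τ →₀ ℕ) → K), (∃ x ∈ Z, x k₀ ≠ 0) ∧
      ∀ (d' : ι → ℕ), (∀ j, j ≠ i → d' j = d j) → d' i ≠ 0 →
      ∀ (Ψ : MvPolynomial (ι × (τ →₀ ℕ)) K), (formSys K d').IsElim Z Ψ →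
        MvPolynomial.eval (replace u₁ i (MvPolynomial.X k₀ ^ d' i)) Ψ ≠ 0 := by
  obtain ⟨y, hy⟩ := hZ.nonempty
  obtain ⟨k₀, hk₀⟩ := Function.ne_iff.1 (hZ.ne_zero y hy)
  obtain ⟨μ, hμ⟩ := hZ.exists_linear_forms_of_hypersurface lam hlam one_ne_zero
    (MvPolynomial.isHomogeneous_X K k₀) ⟨y, hy, by rwa [MvPolynomial.eval_X]⟩ i
  -- Powers of linear forms have the zeros of the linear forms themselves, so arbitrary degrees `d
  -- j` are served.
  refine ⟨k₀, coeffs fun j => linearForm Finset.univ (μ j) ^ d j, ⟨y, hy, hk₀⟩,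
    fun d' hd' hi Ψ hΨ h0 => ?_⟩
  obtain ⟨x, hx, hxu⟩ := (hΨ _).1 h0
  have h1 := hxu i
  rw [val_replace_self _ x i (by
    simpa using (MvPolynomial.isHomogeneous_X K k₀).pow (d' i)), map_pow,
    MvPolynomial.eval_X, pow_eq_zero_iff hi] at h1
  obtain ⟨j, hj, hjx⟩ := hμ x hx (by rw [MvPolynomial.eval_X, h1])
  have h2 := hxu j
  rw [val_replace_of_ne (d := d) _ x hj (hd' j hj).symm, val_coeffs _ x j (by
    simpa using (isHomogeneous_linearForm Finset.univ (μ j)).pow (d j)), map_pow,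
    eval_linearForm, pow_eq_zero_iff (hd j)] at h2
  exact hjx h2

/-- The form for the degrees `d` with `d i` raised from `1` to `e`. -/
theorem IsForm.exists_raise [DecidableEq ι] (hZ : IsConeVariety Z) (lam : ι → τ → K)
    (hlam : ∀ x ∈ Z, ∃ i, ∑ k, lam i k * x k ≠ 0) (hd : ∀ j, d j ≠ 0) (hΦ : IsForm Z d D Φ)
    {i : ι} (hdi : d i = 1) {e : ℕ} (he : e ≠ 0) :
    ∃ Φ', IsForm Z (Function.update d i e) (fun j => if j = i then D i else e * D j) Φ' ∧
      subst i (linPart MvPolynomial.X i ^ e) Φ' = Φ ^ e := by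
  classical
  have : Infinite K := IsAlgClosed.instInfinite
  obtain ⟨k₀, u₁, hk₀, hu₁⟩ := IsForm.exists_eval_replace_X_pow_ne_zero hZ lam hlam hd i
  have hu₁Φ := hu₁ d (fun _ _ => rfl) (hd i) Φ hΦ.isElim
  rw [hdi, pow_one] at hu₁Φ
  have hu₁' := fun Ψ => hu₁ (Function.update d i e) (fun j hj => Function.update_of_ne hj _ _)
    (by rwa [Function.update_self]) Ψ
  simp only [Function.update_self] at hu₁'
  obtain ⟨v₀, hv₀⟩ : ∃ v₀ : ι × (τ →₀ ℕ), v₀ = (i, Finsupp.single k₀ e) := ⟨_, rfl⟩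
  obtain ⟨H, hH, hH0, hHD⟩ := hΦ.exists_mem_elimIdeal hZ hdi hk₀ hu₁Φ hv₀
  obtain ⟨Ψ, hΨ, hΨH, hΨI⟩ := exists_irreducible_factor_mem
    ((formSys K (Function.update d i e)).isPrime_elimIdeal hZ) hH hH0
  have hΨv : Ψ.degreeOf v₀ ≠ 0 := by
    intro h0
    rw [← splitVar_natDegree, Polynomial.natDegree_eq_zero] at h0
    obtain ⟨c, hc⟩ := h0
    have h1 : Ψ = MvPolynomial.rename Subtype.val c :=
      (splitVar K v₀).injective (by rw [splitVar_rename, hc])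
    have h2 := hΦ.eq_zero_of_rename_mem hdi hu₁Φ hv₀ (h1 ▸ hΨI)
    exact hΨ.ne_zero (by rw [h1, h2, map_zero])
  -- `Ψ` generates the elimination ideal: a member not divisible by `Ψ` would lead to a nonzero
  -- member free of `v₀`.
  have hΨE : (formSys K (Function.update d i e)).IsElim Z Ψ := by
    refine LinSys.isElim_of_forall_dvd hZ.toIsClosedCone hΨI fun Q hQ => ?_
    by_contra hdvd
    obtain ⟨a, b, c, hc, habc⟩ := exists_bezout_of_irreducible hΨ hΨv hdvd
    refine hc (hΦ.eq_zero_of_rename_mem hdi hu₁Φ hv₀ ?_)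
    rw [← habc]
    exact add_mem (Ideal.mul_mem_left _ _ hΨI) (Ideal.mul_mem_left _ _ hQ)
  choose δ hδ using fun j => hΨE.exists_isHomogIn hΨ (isGroup_formSys (Function.update d i e) j)
  have hlinX : linPart (replace u₁ i (MvPolynomial.X k₀)) i = MvPolynomial.X k₀ := by
    rw [← linearForm_single, linPart_replace_linearForm]
  have hm : ∀ u : ι × (τ →₀ ℕ) → K, MvPolynomial.map (MvPolynomial.eval u)
      (linPart (MvPolynomial.X : ι × (τ →₀ ℕ) → MvPolynomial _ K) i) = linPart u i :=
    map_linPart_X (K := K) i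
  have hlinhom := isHomogeneous_linPart i (MvPolynomial.X : ι × (τ →₀ ℕ) → MvPolynomial _ K)
  have hne : ∀ f : MvPolynomial τ (MvPolynomial (ι × (τ →₀ ℕ)) K),
      MvPolynomial.map (MvPolynomial.eval (replace u₁ i (MvPolynomial.X k₀))) f =
        MvPolynomial.X k₀ ^ e → subst i f Ψ ≠ 0 := by
    intro f hf h0
    apply hu₁' Ψ hΨE
    have := aeval_subst i f Ψ (replace u₁ i (MvPolynomial.X k₀))
    rw [h0, map_zero, replace_replace] at this
    rw [← hf, ← MvPolynomial.aeval_eq_eval]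
    exact this.symm
  obtain ⟨e', rfl⟩ := Nat.exists_eq_succ_of_ne_zero he
  -- Substituting a generic linear form times `X k₀ ^ (e - 1)` keeps the degree `δ i` in the `i`-th
  -- group, and the result vanishes wherever `Φ` does.
  have hDδ : D i ≤ δ i := by
    have h1 : IsHomogIn {p | p.1 = i} (1 * δ i)
        (subst i (linPart MvPolynomial.X i * MvPolynomial.X k₀ ^ e') Ψ) := by
      refine isHomogIn_subst_self (fun α => ?_) (hδ i)
      have := isHomogIn_coeff_mul (isHomogIn_coeff_linPart_self (K := K) i) (isHomogIn_coeff_pow (isHomogIn_coeff_X k₀) e') α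
      simpa using this
    rw [one_mul] at h1
    refine (hΦ.isHomogIn i).le_of_dvd h1 (dvd_of_forall_eval_eq_zero hΦ.irreducible fun u hu => ?_)
      (hne _ ?_)
    · obtain ⟨x, hx, hxl, hxj⟩ := (eval_eq_zero_iff_of_isElim hdi hΦ.isElim u).1 hu
      refine (eval_subst_eq_zero_iff hΨE ?_ u).2 ⟨x, hx, ?_, hxj⟩
      · have := hlinhom.mul ((MvPolynomial.isHomogeneous_X (MvPolynomial (ι × (τ →₀ ℕ)) K) k₀).pow e')
        rwa [one_mul, add_comm] at this
      · rw [map_mul, map_mul, hm, hxl, zero_mul]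
    · rw [map_mul, hm, hlinX, map_pow, MvPolynomial.map_X, pow_succ']
  -- The upper bound is the degree of `H` in `v₀`, which comes from the bound on field degrees.
  have hδD : δ i = D i := le_antisymm ((le_degreeOf_of_isHomogIn hv₀ (hδ i) (hu₁' Ψ hΨE)).trans
    (le_trans (by
      obtain ⟨R, rfl⟩ := hΨH
      rw [← splitVar_natDegree, ← splitVar_natDegree, map_mul, Polynomial.natDegree_mul]
      · exact Nat.le_add_right _ _
      · simpa using hΨ.ne_zero
      · simpa using right_ne_zero_of_mul hH0) hHD)) hDδ
  have hA0 : subst i (linPart MvPolynomial.X i ^ (e' + 1)) Ψ ≠ 0 :=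
    hne _ (by rw [map_pow, hm, hlinX])
  -- At the `e`-th power of a linear form `Ψ` has the same zeros as `Φ`, so it is a power of `Φ` up
  -- to a constant. Comparing degrees in the `i`-th group gives `r = e`, and in the other groups the
  -- degrees of `Ψ`.
  obtain ⟨c, r, hc, hA⟩ := exists_eq_C_mul_pow hΦ.irreducible hA0 fun u hu => by
    obtain ⟨x, hx, hxl, hxj⟩ := (eval_subst_eq_zero_iff hΨE (by
      simpa using hlinhom.pow (e' + 1)) u).1 hu
    refine (eval_eq_zero_iff_of_isElim hdi hΦ.isElim u).2 ⟨x, hx, ?_, hxj⟩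
    rw [map_pow, map_pow, hm] at hxl
    exact pow_eq_zero_iff (Nat.succ_ne_zero e') |>.1 hxl
  have hdeg : ∀ j, IsHomogIn {p | p.1 = j} (D j * r)
      (subst i (linPart MvPolynomial.X i ^ (e' + 1)) Ψ) := by
    intro j
    rw [hA]
    have := (isHomogIn_C {p : ι × (τ →₀ ℕ) | p.1 = j} c).mul ((hΦ.isHomogIn j).pow r)
    rwa [zero_add] at this
  have hr : r = e' + 1 := by
    have h1 : IsHomogIn {p | p.1 = i} ((e' + 1) * δ i)
        (subst i (linPart MvPolynomial.X i ^ (e' + 1)) Ψ) := by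
      refine isHomogIn_subst_self (fun α => ?_) (hδ i)
      have := isHomogIn_coeff_pow (isHomogIn_coeff_linPart_self (K := K) i) (e' + 1) α
      simpa using this
    have h2 := (hdeg i).unique h1 hA0
    rw [hδD, mul_comm] at h2
    exact Nat.eq_of_mul_eq_mul_right (Nat.pos_of_ne_zero (hΦ.degree_ne_zero i)) h2
  have hδj : ∀ j, j ≠ i → δ j = (e' + 1) * D j := by
    intro j hj
    have h1 : IsHomogIn {p | p.1 = j} (δ j)
        (subst i (linPart MvPolynomial.X i ^ (e' + 1)) Ψ) := by
      refine isHomogIn_subst_of_ne hj (fun α => ?_) (hδ j)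
      have := isHomogIn_coeff_pow (isHomogIn_coeff_linPart_of_ne (K := K) hj) (e' + 1) α
      simpa using this
    rw [h1.unique (hdeg j) hA0, hr, mul_comm]
  refine ⟨MvPolynomial.C c⁻¹ * Ψ, IsForm.of_irreducible_of_isElim hΨ hΨE (fun j => ?_)
    (fun j => ?_) (inv_ne_zero hc), ?_⟩
  · split_ifs with hj
    · rw [hj, ← hδD]
      exact hδ i
    · rw [← hδj j hj]
      exact hδ j
  · split_ifs with hj
    · exact hΦ.degree_ne_zero i
    · exact mul_ne_zero he (hΦ.degree_ne_zero j)
  · rw [map_mul, hA, hr, ← mul_assoc]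
    have h1 : ∀ f : MvPolynomial τ (MvPolynomial (ι × (τ →₀ ℕ)) K),
        subst i f (MvPolynomial.C c⁻¹) = MvPolynomial.C c⁻¹ := fun f => (subst i f).commutes c⁻¹
    rw [h1, ← MvPolynomial.C_mul, inv_mul_cancel₀ hc, MvPolynomial.C_1, one_mul]

end
end
end ChowForms

namespace ChowForms
noncomputable section

/-! ### Splitting into linear forms -/

/-- The zeros lie in a finite union of hyperplanes, so each irreducible factor divides the product
of their equations and is proportional to one of them. -/
theorem exists_eq_C_mul_prod_linearForm {σ κ L : Type*} [Field L] [IsAlgClosed L] {s : Finset σ}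
    (T : Finset κ) (v : κ → σ → L) (hv : ∀ a ∈ T, ∃ k ∈ s, v a k ≠ 0) {N : ℕ}
    {p : MvPolynomial σ L} (hp0 : p ≠ 0) (hN : p.IsHomogeneous N)
    (hp : ∀ x, MvPolynomial.eval x p = 0 → ∃ a ∈ T, ∑ k ∈ s, v a k * x k = 0) :
    ∃ (c : L) (x : Fin N → κ), (∀ t, x t ∈ T) ∧
      p = MvPolynomial.C c * ∏ t, linearForm s (v (x t)) := by
  have key : ∃ (c : L) (l : List κ), (∀ a ∈ l, a ∈ T) ∧
      p = MvPolynomial.C c * (l.map fun a => linearForm s (v a)).prod := by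
    clear hN
    induction p using WfDvdMonoid.induction_on_irreducible with
    | zero => exact absurd rfl hp0
    | unit u hu =>
      obtain ⟨c, -, rfl⟩ := MvPolynomial.isUnit_iff_eq_C_of_isReduced.1 hu
      exact ⟨c, [], by simp, by simp⟩
    | mul a i ha hi ih =>
      obtain ⟨c, l, hl, rfl⟩ := ih ha fun x hx => hp x (by rw [map_mul, hx, mul_zero])
      have hdvd : i ∣ ∏ a ∈ T, linearForm s (v a) := by
        refine dvd_of_forall_eval_eq_zero hi fun x hx => ?_
        obtain ⟨a, haT, hax⟩ := hp x (by rw [map_mul, hx, zero_mul])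
        rw [map_prod]
        exact Finset.prod_eq_zero haT (by rw [eval_linearForm, hax])
      obtain ⟨b, hbT, hb⟩ := (hi.prime.dvd_finsetProd_iff _).1 hdvd
      obtain ⟨k, hk, hbk⟩ := hv b hbT
      obtain ⟨w, hw⟩ := hi.associated_of_dvd (irreducible_linearForm hk hbk) hb
      obtain ⟨c', hc', hcw⟩ := MvPolynomial.isUnit_iff_eq_C_of_isReduced.1 w.isUnit
      refine ⟨c * c'⁻¹, b :: l, ?_, ?_⟩
      · simpa [hbT] using hl
      · rw [List.map_cons, List.prod_cons, ← hw, hcw, MvPolynomial.C_mul]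
        have h1 : (MvPolynomial.C c'⁻¹ * MvPolynomial.C c' : MvPolynomial σ L) = 1 := by
          rw [← MvPolynomial.C_mul, inv_mul_cancel₀ hc'.ne_zero, MvPolynomial.C_1]
        linear_combination (- MvPolynomial.C c * i *
          (l.map fun a => linearForm s (v a)).prod) * h1
  obtain ⟨c, l, hl, hpl⟩ := key
  have hprod : (l.map fun a => linearForm s (v a)).prod =
      ∏ t : Fin l.length, linearForm s (v (l.get t)) := by
    rw [← List.prod_ofFn]
    congr 1
    refine List.ext_getElem (by simp) fun j h1 h2 => by simp
  rw [hprod] at hpl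
  have hhom : p.IsHomogeneous l.length := by
    rw [hpl]
    have := (MvPolynomial.isHomogeneous_C σ c).mul (MvPolynomial.IsHomogeneous.prod Finset.univ
      (fun t : Fin l.length => linearForm s (v (l.get t))) (fun _ => 1)
      fun t _ => isHomogeneous_linearForm _ _)
    simpa using this
  obtain rfl := hN.inj_right hhom hp0
  exact ⟨c, l.get, fun t => hl _ (List.get_mem _ _), hpl⟩

/-- The quotient `a / b` is algebraic over the algebraically closed field `L`, hence constant. -/
theorem exists_eq_C_mul_of_pow_eq_pow {σ L : Type*} [Field L] [IsAlgClosed L] {e : ℕ} (he : e ≠ 0)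
    {a b : MvPolynomial σ L} (hb : b ≠ 0) (h : a ^ e = b ^ e) :
    ∃ ω : L, ω ^ e = 1 ∧ a = MvPolynomial.C ω * b := by
  let Q := FractionRing (MvPolynomial σ L)
  have hinj := IsFractionRing.injective (MvPolynomial σ L) Q
  have hb' : algebraMap (MvPolynomial σ L) Q b ≠ 0 := by rwa [Ne, map_eq_zero_iff _ hinj]
  let t : Q := algebraMap _ Q a / algebraMap _ Q b
  have ht : t ^ e = 1 := by
    rw [div_pow, ← map_pow, ← map_pow, h, map_pow, div_self (pow_ne_zero _ hb')]
  have hint : IsIntegral L t := ⟨Polynomial.X ^ e - 1, Polynomial.monic_X_pow_sub_C 1 he, by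
    rw [Polynomial.eval₂_sub, Polynomial.eval₂_X_pow, Polynomial.eval₂_one, ht, sub_self]⟩
  obtain ⟨ω, hω⟩ := minpoly.mem_range_of_degree_eq_one L t
    (IsAlgClosed.degree_eq_one_of_irreducible L (minpoly.irreducible hint))
  refine ⟨ω, ?_, ?_⟩
  · apply (algebraMap L Q).injective
    rw [map_pow, hω, ht, map_one]
  · apply hinj
    rw [map_mul, ← MvPolynomial.algebraMap_eq, ← IsScalarTower.algebraMap_apply, hω,
      div_mul_cancel₀ _ hb']

theorem prod_pow_mul {τ L : Type*} [CommRing L] (α : τ →₀ ℕ) (c : L) (x : τ → L) :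
    (α.prod fun k e => (c * x k) ^ e) = c ^ α.degree * α.prod fun k e => x k ^ e := by
  rw [Finsupp.prod, Finsupp.prod, Finsupp.degree_apply, ← Finset.prod_pow_eq_pow_sum,
    ← Finset.prod_mul_distrib]
  exact Finset.prod_congr rfl fun k _ => mul_pow _ _ _

/-! ### Splitting of elimination forms -/

section
variable {ι : Type*} {K : Type u} [Field K] {n : ℕ} {Z : Set (Fin (n + 1) → K)} {d D D' : ι → ℕ}
  {Φ Φ' : MvPolynomial (ι × (Fin (n + 1) →₀ ℕ)) K} {L : Type u} [Field L] [Algebra K L]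

/-- The common zeros on `Z` of all forms except the `i`-th. -/
def residualPoints (Z : Set (Fin (n + 1) → K)) (d : ι → ℕ) (i : ι)
    (u : ι × (Fin (n + 1) →₀ ℕ) → L) : Set (Fin (n + 1) → L) :=
  {x ∈ conePoints Z L | ∀ j, j ≠ i → (formSys K d).val u x j = 0}

theorem exists_equations_residualPoints (Z : Set (Fin (n + 1) → K)) (d : ι → ℕ) (i : ι)
    (u : ι × (Fin (n + 1) →₀ ℕ) → L) : ∃ S : Set (MvPolynomial (Fin (n + 1)) L),
      (∀ f ∈ S, ∃ d, f.IsHomogeneous d) ∧ ∀ x, x ∈ residualPoints Z d i u ↔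
        x ≠ 0 ∧ ∀ f ∈ S, MvPolynomial.eval x f = 0 := by
  let F : ι → MvPolynomial (Fin (n + 1)) L := fun j => ∑ p ∈ (formSys K d).s j,
    MvPolynomial.C (u p) * MvPolynomial.map (algebraMap K L) ((formSys K d).m p)
  have hF : ∀ x j, MvPolynomial.eval x (F j) = (formSys K d).val u x j := by
    intro x j
    rw [map_sum, LinSys.val]
    refine Finset.sum_congr rfl fun p _ => ?_
    rw [map_mul, MvPolynomial.eval_C, MvPolynomial.eval_map, MvPolynomial.aeval_def]
  refine ⟨MvPolynomial.map (algebraMap K L) '' homVanishing Z ∪ F '' {j | j ≠ i}, ?_, fun x => ?_⟩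
  · rintro _ (⟨f, ⟨⟨d, hd⟩, -⟩, rfl⟩ | ⟨j, -, rfl⟩)
    · exact ⟨d, hd.map _⟩
    · refine ⟨d j, MvPolynomial.IsHomogeneous.sum _ _ _ fun p hp => ?_⟩
      have := (MvPolynomial.isHomogeneous_C (Fin (n + 1)) (u p)).mul
        (((formSys K d).hom j p hp).map (algebraMap K L))
      rwa [zero_add] at this
  · constructor
    · rintro ⟨⟨hx0, hx⟩, hj⟩
      refine ⟨hx0, ?_⟩
      rintro _ (⟨f, hf, rfl⟩ | ⟨j, hji, rfl⟩)
      · rw [MvPolynomial.eval_map, ← MvPolynomial.aeval_def]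
        exact hx f hf
      · rw [hF]
        exact hj j hji
    · rintro ⟨hx0, hx⟩
      refine ⟨⟨hx0, fun f hf => ?_⟩, fun j hj => ?_⟩
      · rw [MvPolynomial.aeval_def, ← MvPolynomial.eval_map]
        exact hx _ (Or.inl ⟨f, hf, rfl⟩)
      · rw [← hF]
        exact hx _ (Or.inr ⟨j, hj, rfl⟩)

theorem eval_aeval_replace_C (Φ : MvPolynomial (ι × (Fin (n + 1) →₀ ℕ)) K) (i : ι)
    (u : ι × (Fin (n + 1) →₀ ℕ) → L) (μ : Fin (n + 1) → L) :
    MvPolynomial.eval μ (MvPolynomial.aeval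
      (replace (fun p => MvPolynomial.C (u p)) i (linearForm Finset.univ MvPolynomial.X)) Φ) =
    MvPolynomial.aeval (replace u i (linearForm Finset.univ μ)) Φ := by
  have h1 : MvPolynomial.eval μ (MvPolynomial.aeval
      (replace (fun p => MvPolynomial.C (u p)) i (linearForm Finset.univ MvPolynomial.X)) Φ) =
      (((MvPolynomial.aeval μ : MvPolynomial (Fin (n + 1)) L →ₐ[L] L).restrictScalars K).comp
        (MvPolynomial.aeval (replace (fun p => MvPolynomial.C (u p)) i
          (linearForm Finset.univ MvPolynomial.X)))) Φ := by
    rw [AlgHom.comp_apply, AlgHom.restrictScalars_apply, MvPolynomial.aeval_eq_eval]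
  rw [h1, MvPolynomial.comp_aeval]
  congr 2
  refine (comp_replace (MvPolynomial.aeval μ : MvPolynomial (Fin (n + 1)) L →ₐ[L] L).toRingHom
    _ _ _).trans ?_
  rw [map_linearForm]
  simp

theorem eval_aeval_ite [DecidableEq ι] (Φ : MvPolynomial (ι × (Fin (n + 1) →₀ ℕ)) K) (i : ι)
    (u : ι × (Fin (n + 1) →₀ ℕ) → L) (v : (Fin (n + 1) →₀ ℕ) → L) :
    MvPolynomial.eval v (MvPolynomial.aeval (fun p => if p.1 = i then MvPolynomial.X p.2 else
      (MvPolynomial.C (u p) : MvPolynomial (Fin (n + 1) →₀ ℕ) L)) Φ) =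
    MvPolynomial.aeval (fun p => if p.1 = i then v p.2 else u p) Φ := by
  have h1 : MvPolynomial.eval v (MvPolynomial.aeval (fun p => if p.1 = i then MvPolynomial.X p.2 else
      (MvPolynomial.C (u p) : MvPolynomial (Fin (n + 1) →₀ ℕ) L)) Φ) =
      (((MvPolynomial.aeval v : MvPolynomial (Fin (n + 1) →₀ ℕ) L →ₐ[L] L).restrictScalars K).comp
        (MvPolynomial.aeval (fun p => if p.1 = i then MvPolynomial.X p.2 else
      (MvPolynomial.C (u p) : MvPolynomial (Fin (n + 1) →₀ ℕ) L)))) Φ := by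
    rw [AlgHom.comp_apply, AlgHom.restrictScalars_apply, MvPolynomial.aeval_eq_eval]
  rw [h1, MvPolynomial.comp_aeval]
  congr 2
  funext p
  by_cases hp : p.1 = i
  · simp [hp]
  · simp [hp]

variable [Fintype ι] [IsAlgClosed K] [IsAlgClosed L]

theorem IsForm.aeval_eq_zero_iff (hZ : IsConeVariety Z) (hΦ : IsForm Z d D Φ) {i : ι}
    {d' : ι → ℕ} (hd : ∀ j, j ≠ i → d j = d' j) (w u : ι × (Fin (n + 1) →₀ ℕ) → L)
    (hwu : ∀ p, p.1 ≠ i → w p = u p) :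
    MvPolynomial.aeval w Φ = 0 ↔ ∃ x ∈ residualPoints Z d' i u, (formSys K d).val w x i = 0 := by
  have hval : ∀ x j, j ≠ i → (formSys K d).val w x j = (formSys K d').val u x j := by
    intro x j hj
    rw [LinSys.val, LinSys.val]
    have : (formSys (τ := Fin (n + 1)) K d).s j = (formSys K d').s j := by
      ext p
      rw [mem_formSys_s, mem_formSys_s, hd j hj]
    rw [this]
    refine Finset.sum_congr rfl fun p hp => ?_
    rw [hwu p (by rw [(mem_formSys_s.1 hp).1]; exact hj)]
    rfl
  rw [hΦ.isElim.aeval_eq_zero_iff hΦ.irreducible hZ.toIsClosedCone]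
  constructor
  · rintro ⟨x, hx, hxw⟩
    exact ⟨x, ⟨hx, fun j hj => (hval x j hj).symm.trans (hxw j)⟩, hxw i⟩
  · rintro ⟨x, ⟨hx, hxu⟩, hxi⟩
    refine ⟨x, hx, fun j => ?_⟩
    by_cases hj : j = i
    · rw [hj, hxi]
    · rw [hval x j hj, hxu j hj]

/-- Up to scaling there are only finitely many residual points, the common zeros of all other forms,
unless `Φ` vanishes identically in the `i`-th group. Both `Φ` and `Φ'` are products of evaluations
at such points, and the relation at `e`-th powers identifies the two products. -/
theorem IsForm.exists_splitting [DecidableEq ι] (hZ : IsConeVariety Z) (hΦ : IsForm Z d D Φ) {i : ι}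
    (hdi : d i = 1) {e : ℕ} (he : e ≠ 0) (hΦ' : IsForm Z (Function.update d i e) D' Φ')
    (hD' : D' i = D i) (hS : subst i (linPart MvPolynomial.X i ^ e) Φ' = Φ ^ e)
    (u : ι × (Fin (n + 1) →₀ ℕ) → L) :
    ∃ (y : L) (x : Fin (D i) → Fin (n + 1) → L),
      MvPolynomial.aeval (replace (fun p => MvPolynomial.C (u p)) i
        (linearForm Finset.univ MvPolynomial.X)) Φ = MvPolynomial.C y * prodLinear (D i) x ∧
      ∀ f : MvPolynomial (Fin (n + 1)) L, f.IsHomogeneous e →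
        MvPolynomial.aeval (replace u i f) Φ' = y ^ e * ∏ t, MvPolynomial.eval (x t) f := by
  classical
  have : Infinite L := IsAlgClosed.instInfinite
  set g : MvPolynomial (Fin (n + 1)) L := MvPolynomial.aeval
    (replace (fun p => MvPolynomial.C (u p)) i (linearForm Finset.univ MvPolynomial.X)) Φ with hg
  obtain ⟨S, hS1, hS2⟩ := exists_equations_residualPoints Z d i u
  have hgμ : ∀ μ, MvPolynomial.eval μ g = 0 ↔ ∃ x ∈ residualPoints Z d i u, ∑ k, μ k * x k = 0 := by
    intro μ
    rw [hg, eval_aeval_replace_C, hΦ.aeval_eq_zero_iff hZ (fun _ _ => rfl) _ u fun p hp => by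
      rw [replace, if_neg hp]]
    refine exists_congr fun x => and_congr_right fun _ => ?_
    rw [val_replace_self u x i (by rw [hdi]; exact isHomogeneous_linearForm _ _), eval_linearForm]
  have hupd : ∀ j, j ≠ i → Function.update d i e j = d j :=
    fun j hj => Function.update_of_ne hj _ _
  have hhf : ∀ f : MvPolynomial (Fin (n + 1)) L, f.IsHomogeneous e →
      (MvPolynomial.aeval (replace u i f) Φ' = 0 ↔
        ∃ x ∈ residualPoints Z d i u, MvPolynomial.eval x f = 0) := by
    intro f hf
    rw [hΦ'.aeval_eq_zero_iff hZ hupd _ u fun p hp => by rw [replace, if_neg hp]]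
    refine exists_congr fun x => and_congr_right fun _ => ?_
    rw [val_replace_self u x i (by rw [Function.update_self]; exact hf)]
  -- Here `y = 0`, and `Φ'` must vanish at every `f`: otherwise the residual points would miss the
  -- hypersurface `f`, hence also some hyperplane, while `g = 0` says that they meet every
  -- hyperplane.
  by_cases hg0 : g = 0
  · obtain ⟨D₀, hD₀⟩ := Nat.exists_eq_succ_of_ne_zero (hΦ.degree_ne_zero i)
    refine ⟨0, fun _ _ => 0, by rw [hg0, map_zero, zero_mul], fun f hf => ?_⟩
    rw [zero_pow he, zero_mul, hhf f hf]
    by_contra! hcon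
    obtain ⟨lam, -, hlam⟩ := exists_hyperplane_of_hypersurface hS1 he hf
      (fun x hx0 hx => hcon x ((hS2 x).2 ⟨hx0, hx⟩)) 0 (by simp)
    obtain ⟨x, hx, hxl⟩ := (hgμ lam).1 (by rw [hg0, map_zero])
    exact hlam x ((hS2 x).1 hx).1 ((hS2 x).1 hx).2 hxl
  obtain ⟨μ₀, hμ₀⟩ := exists_eval_ne_zero hg0
  have hμ₀' : ∀ x ∈ residualPoints Z d i u, ∑ k, μ₀ k * x k ≠ 0 := fun x hx h =>
    hμ₀ ((hgμ μ₀).2 ⟨x, hx, h⟩)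
  have hfin := finite_of_forall_eval_ne_zero hS1 one_ne_zero
    (isHomogeneous_linearForm Finset.univ μ₀) fun x hx0 hx => by
      rw [eval_linearForm]
      exact hμ₀' x ((hS2 x).2 ⟨hx0, hx⟩)
  set T := hfin.toFinset with hT
  have hmemT : ∀ x, x ∈ T ↔ x ∈ residualPoints Z d i u ∧ ∑ k, μ₀ k * x k = 1 := by
    intro x
    rw [hT, Set.Finite.mem_toFinset, hS2, Set.mem_ofPred_eq, eval_linearForm]
    constructor
    · rintro ⟨h1, h2⟩
      refine ⟨⟨?_, h1⟩, h2⟩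
      rintro rfl
      simp at h2
    · rintro ⟨⟨-, h1⟩, h2⟩
      exact ⟨h1, h2⟩
  have hscale : ∀ x ∈ residualPoints Z d i u, ∃ c : L, (fun k => c * x k) ∈ T := by
    intro x hx
    refine ⟨(∑ k, μ₀ k * x k)⁻¹, (hmemT _).2 ⟨(hS2 _).2 ⟨?_, fun f hf => ?_⟩, ?_⟩⟩
    · obtain ⟨k, hk⟩ := Function.ne_iff.1 ((hS2 x).1 hx).1
      exact Function.ne_iff.2 ⟨k, mul_ne_zero (inv_ne_zero (hμ₀' x hx)) hk⟩
    · obtain ⟨m, hm⟩ := hS1 f hf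
      rw [eval_smul_of_isHomogeneous hm, ((hS2 x).1 hx).2 f hf, mul_zero]
    · simp only [mul_left_comm (μ₀ _)]
      rw [← Finset.mul_sum, inv_mul_cancel₀ (hμ₀' x hx)]
  have hTne : ∀ x ∈ T, ∃ k, x k ≠ 0 := fun x hx =>
    Function.ne_iff.1 ((hS2 x).1 ((hmemT x).1 hx).1).1
  have hghom : g.IsHomogeneous (D i) := by
    refine isHomogeneous_of_eval_smul fun c μ => ?_
    rw [hg, eval_aeval_replace_C, eval_aeval_replace_C, linearForm_smul,
      (hΦ.isHomogIn i).aeval_replace]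
  obtain ⟨y, x, hx, hgx⟩ := exists_eq_C_mul_prod_linearForm (s := Finset.univ) T (fun x => x)
    (fun x hx => by
      obtain ⟨k, hk⟩ := hTne x hx
      exact ⟨k, Finset.mem_univ _, hk⟩) hg0 hghom (fun μ hμ => by
      obtain ⟨x, hx, hxμ⟩ := (hgμ μ).1 hμ
      obtain ⟨c, hc⟩ := hscale x hx
      refine ⟨_, hc, ?_⟩
      rw [← mul_zero c, ← hxμ, Finset.mul_sum]
      exact Finset.sum_congr rfl fun k _ => by ring)
  rw [← prodLinear_eq] at hgx
  refine ⟨y, x, hgx, fun f hf => ?_⟩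
  -- `Φ'` as a polynomial in the coefficients of the `i`-th form. Its linear factors are evaluations
  -- of that form at points of `T`.
  set h : MvPolynomial (Fin (n + 1) →₀ ℕ) L := MvPolynomial.aeval (fun p => if p.1 = i then
    MvPolynomial.X p.2 else (MvPolynomial.C (u p) : MvPolynomial (Fin (n + 1) →₀ ℕ) L)) Φ' with hh
  have heval : ∀ f : MvPolynomial (Fin (n + 1)) L, MvPolynomial.eval (fun α => f.coeff α) h =
      MvPolynomial.aeval (replace u i f) Φ' := by
    intro f
    rw [hh, eval_aeval_ite]
    congr 2
    funext p
    simp [replace]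
  have hpow : ∀ μ, MvPolynomial.aeval (replace u i (linearForm Finset.univ μ ^ e)) Φ' =
      MvPolynomial.eval μ g ^ e := by
    intro μ
    rw [hg, eval_aeval_replace_C, ← map_pow, ← hS, aeval_subst, replace_replace, map_pow,
      map_linPart_X, linPart_replace_linearForm]
  have hh0 : h ≠ 0 := by
    intro h0
    have := hpow μ₀
    rw [← heval, h0, map_zero] at this
    exact pow_ne_zero e hμ₀ this.symm
  have hhhom : h.IsHomogeneous (D i) := by
    refine isHomogeneous_of_eval_smul fun c v => ?_
    rw [hh, eval_aeval_ite, eval_aeval_ite, ← hD', ← (hΦ'.isHomogIn i).aeval_eq]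
    congr 2
    funext p
    by_cases hp : p.1 = i
    · simp [hp]
    · simp [hp]
  let A : Finset (Fin (n + 1) →₀ ℕ) := Finset.finsuppAntidiag Finset.univ e
  have hA : ∀ α, α ∈ A ↔ α.degree = Function.update d i e i := by
    intro α
    rw [Finset.mem_finsuppAntidiag', Function.update_self]
    simp
    rfl
  obtain ⟨z, x', hx', hhx⟩ := exists_eq_C_mul_prod_linearForm (s := A) T
    (fun x α => α.prod fun k e => x k ^ e) (fun x hx => by
      obtain ⟨k, hk⟩ := hTne x hx
      refine ⟨Finsupp.single k e, (hA _).2 (by simp), ?_⟩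
      rw [Finsupp.prod_single_index (h := fun k e => x k ^ e) (pow_zero _)]
      exact pow_ne_zero _ hk) hh0 hhhom (fun v hv => by
      rw [hh, eval_aeval_ite, hΦ'.aeval_eq_zero_iff hZ hupd _ u fun p hp => by
        rw [if_neg hp]] at hv
      obtain ⟨x, hx, hxv⟩ := hv
      rw [val_formSys_eq_sum _ _ _ _ A hA] at hxv
      obtain ⟨c, hc⟩ := hscale x hx
      refine ⟨_, hc, ?_⟩
      rw [← mul_zero (c ^ e), ← hxv, Finset.mul_sum]
      refine Finset.sum_congr rfl fun α hα => ?_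
      rw [prod_pow_mul, (hA α).1 hα, Function.update_self]
      simp only [if_true]
      ring)
  have hhx' : ∀ f : MvPolynomial (Fin (n + 1)) L, f.IsHomogeneous e →
      MvPolynomial.aeval (replace u i f) Φ' = z * ∏ t, MvPolynomial.eval (x' t) f := by
    intro f hf
    rw [← heval, hhx, map_mul, MvPolynomial.eval_C, map_prod]
    congr 1
    refine Finset.prod_congr rfl fun t _ => ?_
    rw [eval_linearForm, ← val_replace_self (K := K) (d := Function.update d i e) u (x' t) i (by
      rwa [Function.update_self]), val_formSys_eq_sum _ _ _ _ A hA]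
    refine Finset.sum_congr rfl fun α _ => ?_
    rw [replace, if_pos rfl, mul_comm]
  -- With an `e`-th root `ζ` of the constant, the two products of linear forms have equal `e`-th
  -- powers. They differ by an `e`-th root of unity, which disappears in `y ^ e`.
  obtain ⟨ζ, hζ⟩ := IsAlgClosed.exists_pow_nat_eq z (Nat.pos_of_ne_zero he)
  obtain ⟨ω, hω, hprod⟩ := exists_eq_C_mul_of_pow_eq_pow he hg0
    (a := MvPolynomial.C ζ * prodLinear (D i) x') (by
      refine MvPolynomial.funext fun μ => ?_
      rw [map_pow, map_pow, ← hpow, hhx' _ (by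
        simpa using (isHomogeneous_linearForm Finset.univ μ).pow e), map_mul, mul_pow,
        MvPolynomial.eval_C, hζ, eval_prodLinear, ← Finset.prod_pow]
      congr 1
      refine Finset.prod_congr rfl fun t _ => ?_
      rw [map_pow, eval_linearForm]
      congr 1
      exact Finset.sum_congr rfl fun k _ => mul_comm _ _)
  rw [hgx, ← mul_assoc, ← MvPolynomial.C_mul] at hprod
  have := wedge_value_unique hf hprod
  rw [hhx' f hf, ← hζ, this, mul_pow, hω, one_mul]

end
end
end ChowForms

namespace ChowForms
noncomputable section

/-! ### Alternation of geometric Chow forms -/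

/-- Degrees in each variable are additive, so factors of a renamed polynomial involve renamed
variables only. -/
theorem irreducible_rename {σ σ' K : Type*} [Field K] {f : σ → σ'} (hf : Function.Injective f)
    {p : MvPolynomial σ K} (hp : Irreducible p) : Irreducible (MvPolynomial.rename f p) := by
  classical
  have hinj := MvPolynomial.rename_injective (R := K) f hf
  have hunit : ∀ q : MvPolynomial σ K, IsUnit q → IsUnit (MvPolynomial.rename f q) :=
    fun q hq => hq.map _
  have hretr : ∀ q : MvPolynomial σ K, IsUnit (MvPolynomial.rename f q) → IsUnit q := by
    intro q hq
    have := hq.map (MvPolynomial.killCompl hf)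
    rwa [MvPolynomial.killCompl_rename_app] at this
  refine ⟨fun h => hp.not_isUnit (hretr p h), fun {a b} hab => ?_⟩
  have h0 : a * b ≠ 0 := by
    rw [← hab]
    exact (map_ne_zero_iff _ hinj).2 hp.ne_zero
  have hvars : ∀ c, c ∣ a * b → ∃ c', MvPolynomial.rename f c' = c := by
    rintro c ⟨c₁, hc⟩
    refine MvPolynomial.exists_rename_eq_of_vars_subset_range c f hf fun s hs => ?_
    by_contra hsr
    have h1 : (MvPolynomial.rename f p).degreeOf s = 0 := by
      by_contra h2
      have h3 : s ∈ (MvPolynomial.rename f p).vars := by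
        rwa [MvPolynomial.mem_vars_iff_degreeOf_ne_zero]
      have h4 := MvPolynomial.vars_rename f p h3
      obtain ⟨t, -, rfl⟩ := Finset.mem_image.1 h4
      exact hsr ⟨t, rfl⟩
    have hcc : c ≠ 0 ∧ c₁ ≠ 0 := by
      rw [hc] at h0
      exact ⟨left_ne_zero_of_mul h0, right_ne_zero_of_mul h0⟩
    rw [hab, hc, MvPolynomial.degreeOf_mul_eq hcc.1 hcc.2] at h1
    have h2 : c.degreeOf s = 0 := by omega
    exact MvPolynomial.mem_vars_iff_degreeOf_ne_zero.1 hs h2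
  obtain ⟨a', rfl⟩ := hvars a (dvd_mul_right _ _)
  obtain ⟨b', rfl⟩ := hvars b (dvd_mul_left _ _)
  rw [← map_mul] at hab
  exact (hp.isUnit_or_isUnit (hinj hab)).imp (hunit a') (hunit b')

section
variable {K : Type u} [Field K] {n ℓ : ℕ}

/-- Adding a multiple of one linear form to another. -/
def shear (i j : Fin (ℓ + 1)) (c : K) (u : Idx ℓ n → K) : Idx ℓ n → K :=
  fun p => if p.1 = i then u p + c * u (j, p.2) else u p

theorem eval_eval_shear (P : MvPolynomial (Idx ℓ n) K) (i j : Fin (ℓ + 1)) (c : K)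
    (u : Idx ℓ n → K) :
    ((MvPolynomial.aeval (fun p : Idx ℓ n =>
      if p.1 = i then
        Polynomial.C (MvPolynomial.X p) + Polynomial.X * Polynomial.C (MvPolynomial.X (j, p.2))
      else (Polynomial.C (MvPolynomial.X p) : Polynomial (MvPolynomial (Idx ℓ n) K))) P).map
        (MvPolynomial.eval u)).eval c = MvPolynomial.eval (shear i j c u) P := by
  have h : ((Polynomial.evalRingHom c).comp (Polynomial.mapRingHom (MvPolynomial.eval u))).comp
      (MvPolynomial.aeval (fun p : Idx ℓ n =>
      if p.1 = i then
        Polynomial.C (MvPolynomial.X p) + Polynomial.X * Polynomial.C (MvPolynomial.X (j, p.2))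
      else (Polynomial.C (MvPolynomial.X p) : Polynomial (MvPolynomial (Idx ℓ n) K))) :
        _ →ₐ[K] _).toRingHom = MvPolynomial.eval (shear i j c u) := by
    refine MvPolynomial.ringHom_ext (fun a => ?_) fun p => ?_
    · simp [Polynomial.algebraMap_apply, MvPolynomial.algebraMap_eq]
    · by_cases hp : p.1 = i
      · simp only [hp, if_true, RingHom.comp_apply, AlgHom.toRingHom_eq_coe,
          RingHom.coe_coe, MvPolynomial.aeval_X, map_add, map_mul]
        simp [shear, hp]
      · simp [shear, hp]
  exact congrArg (fun φ => φ P) h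

/-- Substituting a sheared family of linear forms. -/
def shearHom (i j : Fin (ℓ + 1)) (c : K) :
    MvPolynomial (Idx ℓ n) K →ₐ[K] MvPolynomial (Idx ℓ n) K :=
  MvPolynomial.aeval fun p => if p.1 = i then
    MvPolynomial.X p + MvPolynomial.C c * MvPolynomial.X (j, p.2) else MvPolynomial.X p

theorem eval_shearHom (i j : Fin (ℓ + 1)) (c : K) (u : Idx ℓ n → K)
    (Q : MvPolynomial (Idx ℓ n) K) :
    MvPolynomial.eval u (shearHom i j c Q) = MvPolynomial.eval (shear i j c u) Q := by
  rw [← MvPolynomial.aeval_eq_eval, ← MvPolynomial.aeval_eq_eval, shearHom, ← AlgHom.comp_apply,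
    MvPolynomial.comp_aeval]
  congr 2
  funext p
  by_cases hp : p.1 = i
  · simp [shear, hp]
  · simp [shear, hp]

theorem shear_shear {i j : Fin (ℓ + 1)} (hij : i ≠ j) (c : K) (u : Idx ℓ n → K) :
    shear i j c (shear i j (-c) u) = u := by
  funext p
  by_cases hp : p.1 = i
  · simp [shear, hp, hij.symm]
  · simp [shear, hp]

theorem isAlternating_of_forall_eval [Infinite K] {P : MvPolynomial (Idx ℓ n) K}
    (h : ∀ i j : Fin (ℓ + 1), i ≠ j → ∀ (c : K) (u : Idx ℓ n → K),
      MvPolynomial.eval (shear i j c u) P = MvPolynomial.eval u P) : IsAlternating P := by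
  intro i j hij
  ext1 m
  refine MvPolynomial.funext fun u => ?_
  rw [← Polynomial.coeff_map, ← Polynomial.coeff_map]
  congr 1
  refine Polynomial.funext fun c => ?_
  rw [eval_eval_shear, h i j hij, Polynomial.map_C, Polynomial.eval_C]

theorem IsAlternating.eval_shear {P : MvPolynomial (Idx ℓ n) K} (h : IsAlternating P)
    {i j : Fin (ℓ + 1)} (hij : i ≠ j) (c : K) (u : Idx ℓ n → K) :
    MvPolynomial.eval (shear i j c u) P = MvPolynomial.eval u P := by
  rw [← eval_eval_shear, h i j hij, Polynomial.map_C, Polynomial.eval_C]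

theorem IsAlternating.mul {P Q : MvPolynomial (Idx ℓ n) K} (hP : IsAlternating P)
    (hQ : IsAlternating Q) : IsAlternating (P * Q) := by
  intro i j hij
  rw [map_mul, hP i j hij, hQ i j hij, Polynomial.C_mul]

theorem isAlternating_C (c : K) : IsAlternating (MvPolynomial.C c : MvPolynomial (Idx ℓ n) K) := by
  intro i j _
  rw [← MvPolynomial.algebraMap_eq, AlgHom.commutes]
  rfl

variable [IsAlgClosed K] {W : Set (ProjSpace K n)}

/-- Adding a multiple of one form to another does not change the common zeros, so `P` is only
multiplied by a nonzero constant. As a function of the multiplier this constant is a polynomial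
without zeros, and it equals `1` at `0`. -/
theorem isAlternating_of_isIrredChowFormFor {P : MvPolynomial (Idx ℓ n) K}
    (hP : IsIrredChowFormFor W P) : IsAlternating P := by
  have : Infinite K := IsAlgClosed.instInfinite
  refine isAlternating_of_forall_eval fun i j hij => ?_
  have hzero : ∀ (c : K) (u : Idx ℓ n → K), MvPolynomial.eval u P = 0 →
      MvPolynomial.eval (shear i j c u) P = 0 := by
    intro c u hu
    obtain ⟨x, hx, hxu⟩ := (hP.2 fun a b => u (a, b)).1 hu
    refine (hP.2 fun a b => shear i j c u (a, b)).2 ⟨x, hx, fun a => ?_⟩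
    by_cases ha : a = i
    · simp only [shear, ha, if_true, add_mul, Finset.sum_add_distrib, hxu i, zero_add, mul_assoc]
      rw [← Finset.mul_sum, hxu j, mul_zero]
    · simp only [shear, ha, if_false, hxu a]
  have hdvd : ∀ c : K, ∃ q, shearHom i j c P = P * q := fun c =>
    dvd_of_forall_eval_eq_zero hP.1 fun u hu => by
      rw [eval_shearHom]
      exact hzero c u hu
  have hconst : ∀ c : K, ∃ k, k ≠ 0 ∧ ∀ u,
      MvPolynomial.eval (shear i j c u) P = k * MvPolynomial.eval u P := by
    intro c
    obtain ⟨q, hq⟩ := hdvd c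
    obtain ⟨q', hq'⟩ := hdvd (-c)
    have h1 : shearHom i j c (shearHom i j (-c) P) = P := by
      refine MvPolynomial.funext fun u => ?_
      rw [eval_shearHom, eval_shearHom]
      have := shear_shear hij (-c) u
      rw [neg_neg] at this
      rw [this]
    rw [hq', map_mul, hq, mul_assoc] at h1
    have h2 : q * shearHom i j c q' = 1 := mul_left_cancel₀ hP.1.ne_zero (by rw [h1, mul_one])
    obtain ⟨k, hk, rfl⟩ := MvPolynomial.isUnit_iff_eq_C_of_isReduced.1
      (IsUnit.of_mul_eq_one _ h2)
    refine ⟨k, hk.ne_zero, fun u => ?_⟩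
    rw [← eval_shearHom, hq, map_mul, MvPolynomial.eval_C, mul_comm]
  obtain ⟨u₀, hu₀⟩ := exists_eval_ne_zero hP.1.ne_zero
  intro c u
  obtain ⟨k, -, hku⟩ := hconst c
  have hk1 : k = 1 := by
    set t := ((MvPolynomial.aeval (fun p : Idx ℓ n =>
      if p.1 = i then
        Polynomial.C (MvPolynomial.X p) + Polynomial.X * Polynomial.C (MvPolynomial.X (j, p.2))
      else (Polynomial.C (MvPolynomial.X p) : Polynomial (MvPolynomial (Idx ℓ n) K))) P).map
        (MvPolynomial.eval u₀)) with ht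
    have hdeg : t.degree = 0 := by
      by_contra h0
      obtain ⟨c', hc'⟩ := IsAlgClosed.exists_root t h0
      rw [Polynomial.IsRoot, ht, eval_eval_shear] at hc'
      obtain ⟨k', hk', hku'⟩ := hconst c'
      rw [hku'] at hc'
      exact mul_ne_zero hk' hu₀ hc'
    have h1 : t.eval c = t.eval 0 := by
      rw [Polynomial.eq_C_of_degree_eq_zero hdeg, Polynomial.eval_C, Polynomial.eval_C]
    rw [ht, eval_eval_shear, eval_eval_shear, hku] at h1
    have h2 : shear i j 0 u₀ = u₀ := by
      funext p
      simp [shear]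
    rw [h2] at h1
    exact mul_right_cancel₀ hu₀ (by rw [h1, one_mul])
  rw [hku, hk1, one_mul]

end
end
end ChowForms

namespace ChowForms
noncomputable section

/-! ### Wedges with constants and products -/

theorem prodLinear_append {A : Type u} [CommRing A] {n D D' : ℕ} (x : Fin D → Fin (n + 1) → A)
    (x' : Fin D' → Fin (n + 1) → A) :
    prodLinear (D + D') (Fin.append x x') = prodLinear D x * prodLinear D' x' := by
  simp only [prodLinear, Fin.prod_univ_add, Fin.append_left, Fin.append_right]

theorem IsWedge.mul {A : Type u} [CommRing A] {n d D D' : ℕ} {f g g' : MvPolynomial (Fin (n + 1)) A}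
    {w w' : A} (h : IsWedge d D f g w) (h' : IsWedge d D' f g' w') :
    IsWedge d (D + D') f (g * g') (w * w') := by
  intro L _ _ ψ
  obtain ⟨y, x, hg, hw⟩ := h L ψ
  obtain ⟨y', x', hg', hw'⟩ := h' L ψ
  refine ⟨y * y', Fin.append x x', ?_, ?_⟩
  · rw [map_mul, hg, hg', prodLinear_append, MvPolynomial.C_mul]
    ring
  · rw [map_mul, hw, hw', Fin.prod_univ_add]
    simp only [Fin.append_left, Fin.append_right]
    ring

theorem isWedge_C {A : Type u} [CommRing A] {n : ℕ} (d : ℕ) (f : MvPolynomial (Fin (n + 1)) A)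
    (c : A) : IsWedge d 0 f (MvPolynomial.C c) (c ^ d) := fun L _ _ ψ =>
  ⟨ψ c, fun t => t.elim0, by simp [prodLinear], by simp⟩

theorem IsWedge.eq_pow_of_C {A : Type u} [CommRing A] [IsReduced A] {n d : ℕ}
    {f : MvPolynomial (Fin (n + 1)) A} {c w : A} (h : IsWedge d 0 f (MvPolynomial.C c) w) :
    w = c ^ d := by
  refine eq_of_forall_hom_eq fun L _ _ ψ => ?_
  obtain ⟨y, x, hg, hw⟩ := h L ψ
  have hy : ψ c = y := by
    apply MvPolynomial.C_injective (Fin (n + 1)) L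
    rw [MvPolynomial.map_C] at hg
    rw [hg]
    simp [prodLinear]
  rw [hw, map_pow, hy, Finset.prod_of_isEmpty, mul_one]

theorem IsWedge.eq_pow_of_degree_zero {A : Type u} [CommRing A] [IsReduced A] {n D : ℕ}
    {g : MvPolynomial (Fin (n + 1)) A} {a w : A} (h : IsWedge 0 D (MvPolynomial.C a) g w) :
    w = a ^ D := by
  refine eq_of_forall_hom_eq fun L _ _ ψ => ?_
  obtain ⟨y, x, hg, hw⟩ := h L ψ
  rw [hw]
  simp

theorem eq_C_of_isHomogeneous_zero {σ A : Type*} [CommRing A] {f : MvPolynomial σ A}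
    (h : f.IsHomogeneous 0) : ∃ a, f = MvPolynomial.C a := by
  refine ⟨f.coeff 0, ?_⟩
  rw [← MvPolynomial.totalDegree_eq_zero_iff_eq_C]
  exact Nat.le_zero.1 h.totalDegree_le

section
variable {A : Type u} [CommRing A] {n ℓ : ℕ}

theorem asPolyIn_C (i : Fin (ℓ + 1)) (c : A) :
    asPolyIn i (MvPolynomial.C c : MvPolynomial (Idx ℓ n) A) =
      MvPolynomial.C (MvPolynomial.C c) := by
  exact (MvPolynomial.aeval fun p : Idx ℓ n => if p.1 = i then MvPolynomial.X p.2 else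
    (MvPolynomial.C (MvPolynomial.X p) : MvPolynomial (Fin (n + 1)) (MvPolynomial (Idx ℓ n) A))
    ).commutes c

theorem asPolyIn_mul (i : Fin (ℓ + 1)) (R R' : MvPolynomial (Idx ℓ n) A) :
    asPolyIn i (R * R') = asPolyIn i R * asPolyIn i R' := map_mul _ _ _

/-- The splittings of resultants over algebraically closed fields. -/
theorem IsResultantOn.exists_splitting [IsReduced A] {I : Finset (Fin (ℓ + 1))}
    {D : Fin (ℓ + 1) → ℕ} {R : MvPolynomial (Idx ℓ n) A} (h : IsResultantOn I D A R)
    {i : Fin (ℓ + 1)} (hi : i ∈ I) (L : Type u) [Field L] [IsAlgClosed L]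
    (ψ : MvPolynomial (Idx ℓ n) A →+* L) : ∃ (y : L) (x : Fin (D i) → Fin (n + 1) → L),
      MvPolynomial.map ψ (asPolyIn i R) = MvPolynomial.C y * prodLinear (D i) x := by
  rw [IsResultantOn] at h
  -- The wedge with the constant `1` is used only because its existence includes a splitting over
  -- each algebraically closed field.
  obtain ⟨⟨w, hw, -⟩, -⟩ := (h i hi).2 A 0 1 (MvPolynomial.isHomogeneous_one _ _)
  obtain ⟨y, x, hx, -⟩ := hw L ψ
  refine ⟨y, x, ?_⟩
  rw [← hx, Algebra.algebraMap_self, MvPolynomial.map_id]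

theorem isResultantOn_C {A : Type u} [CommRing A] [IsReduced A] (I : Finset (Fin (ℓ + 1)))
    (c : A) : IsResultantOn I (fun _ => 0) A (MvPolynomial.C c : MvPolynomial (Idx ℓ n) A) := by
  induction hI : I.card using Nat.strong_induction_on generalizing I A with
  | _ N ih =>
  rw [IsResultantOn]
  intro i hi
  refine ⟨⟨?_, Or.inl rfl⟩, fun B _ _ _ d f hf => ⟨⟨MvPolynomial.C (algebraMap A B c ^ d), ?_, ?_⟩,
    fun j hj e g hg wf wg wgf wfg h1 h2 h3 h4 => ?_⟩⟩
  · rw [asPolyIn_C]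
    exact MvPolynomial.isHomogeneous_C _ _
  · rw [IsWedgeAt, MvPolynomial.map_C, asPolyIn_C, MvPolynomial.C_pow]
    exact isWedge_C _ _ _
  · simp only [mul_zero]
    exact ih _ (hI ▸ Finset.card_erase_lt_of_mem hi) _ _ rfl
  · rw [IsWedgeAt, MvPolynomial.map_C, asPolyIn_C] at h1 h3
    rw [h1.eq_pow_of_C, ← MvPolynomial.C_pow, IsWedgeAt, asPolyIn_C, mul_zero] at h2
    rw [h3.eq_pow_of_C, ← MvPolynomial.C_pow, IsWedgeAt, asPolyIn_C, mul_zero] at h4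
    rw [h2.eq_pow_of_C, h4.eq_pow_of_C, ← MvPolynomial.C_pow, ← MvPolynomial.C_pow, ← pow_mul,
      ← pow_mul, mul_comm]

/-- Splittings are concatenated and wedges are multiplicative. Since wedges are unique over reduced
rings, commutation can be checked on the product wedges. -/
theorem IsResultantOn.mul {A : Type u} [CommRing A] [IsReduced A] {I : Finset (Fin (ℓ + 1))}
    {D D' : Fin (ℓ + 1) → ℕ} {R R' : MvPolynomial (Idx ℓ n) A} (h : IsResultantOn I D A R)
    (h' : IsResultantOn I D' A R') : IsResultantOn I (fun i => D i + D' i) A (R * R') := by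
  induction hI : I.card using Nat.strong_induction_on generalizing I A D D' with
  | _ N ih =>
  rw [IsResultantOn]
  intro i hi
  refine ⟨isSplittable_of_forall_hom fun L _ _ ψ => ?_, fun B _ _ _ d f hf => ?_⟩
  · obtain ⟨y, x, hx⟩ := h.exists_splitting hi L ψ
    obtain ⟨y', x', hx'⟩ := h'.exists_splitting hi L ψ
    refine ⟨y * y', Fin.append x x', ?_⟩
    rw [asPolyIn_mul, map_mul, hx, hx', prodLinear_append, MvPolynomial.C_mul]
    ring
  · rw [IsResultantOn] at h h'
    have hwedge : ∀ {i : Fin (ℓ + 1)} {d E E' : ℕ} {f : MvPolynomial (Fin (n + 1)) B}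
        {Q Q' w w' : MvPolynomial (Idx ℓ n) B}, IsWedgeAt i d E f Q w → IsWedgeAt i d E' f Q' w' →
        IsWedgeAt i d (E + E') f (Q * Q') (w * w') := by
      intro i d E E' f Q Q' w w' h1 h2
      rw [IsWedgeAt, asPolyIn_mul]
      exact IsWedge.mul h1 h2
    obtain ⟨⟨w₁, hw₁, hr₁⟩, hc₁⟩ := (h i hi).2 B d f hf
    obtain ⟨⟨w₂, hw₂, hr₂⟩, hc₂⟩ := (h' i hi).2 B d f hf
    refine ⟨⟨w₁ * w₂, ?_, ?_⟩, fun j hj e g hg wf wg wgf wfg h1 h2 h3 h4 => ?_⟩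
    · rw [map_mul]
      exact hwedge hw₁ hw₂
    · simp only [mul_add]
      exact ih _ (hI ▸ Finset.card_erase_lt_of_mem hi) hr₁ hr₂ rfl
    · have hji := Finset.ne_of_mem_erase hj
      have hij : i ∈ I.erase j := Finset.mem_erase.2 ⟨hji.symm, hi⟩
      obtain ⟨⟨v₁, hv₁, hs₁⟩, -⟩ := (h j (Finset.mem_of_mem_erase hj)).2 B e g hg
      obtain ⟨⟨v₂, hv₂, hs₂⟩, -⟩ := (h' j (Finset.mem_of_mem_erase hj)).2 B e g hg
      rw [map_mul] at h1 h3
      have hfC : (MvPolynomial.map MvPolynomial.C f : MvPolynomial (Fin (n + 1))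
        (MvPolynomial (Idx ℓ n) B)).IsHomogeneous d := hf.map _
      have hgC : (MvPolynomial.map MvPolynomial.C g : MvPolynomial (Fin (n + 1))
        (MvPolynomial (Idx ℓ n) B)).IsHomogeneous e := hg.map _
      have e1 : wf = w₁ * w₂ := IsWedge.unique hfC h1 (hwedge hw₁ hw₂)
      have e3 : wg = v₁ * v₂ := IsWedge.unique hgC h3 (hwedge hv₁ hv₂)
      rw [IsResultantOn] at hr₁ hr₂ hs₁ hs₂
      obtain ⟨⟨a₁, ha₁, -⟩, -⟩ := (hr₁ j hj).2 B e g hg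
      obtain ⟨⟨a₂, ha₂, -⟩, -⟩ := (hr₂ j hj).2 B e g hg
      obtain ⟨⟨b₁, hb₁, -⟩, -⟩ := (hs₁ i hij).2 B d f hf
      obtain ⟨⟨b₂, hb₂, -⟩, -⟩ := (hs₂ i hij).2 B d f hf
      rw [Algebra.algebraMap_self, MvPolynomial.map_id] at ha₁ ha₂ hb₁ hb₂
      rw [e1, mul_add] at h2
      rw [e3, mul_add] at h4
      rw [IsWedge.unique hgC h2 (hwedge ha₁ ha₂), IsWedge.unique hfC h4 (hwedge hb₁ hb₂),
        hc₁ j hj e g hg _ _ _ _ hw₁ ha₁ hv₁ hb₁, hc₂ j hj e g hg _ _ _ _ hw₂ ha₂ hv₂ hb₂]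

theorem IsChowForm.mul {A : Type u} [Field A] {C C' : MvPolynomial (Idx ℓ n) A}
    (h : IsChowForm C) (h' : IsChowForm C') : IsChowForm (C * C') := by
  obtain ⟨h1, D, h2⟩ := h
  obtain ⟨h1', D', h2'⟩ := h'
  exact ⟨h1.mul h1', _, h2.mul h2'⟩

theorem isChowForm_C {A : Type u} [Field A] (c : A) :
    IsChowForm (MvPolynomial.C c : MvPolynomial (Idx ℓ n) A) :=
  ⟨isAlternating_C c, _, isResultantOn_C _ c⟩

/-- Products of Chow forms. -/
theorem isChowForm_of_forall_irreducible_factor {A : Type u} [Field A]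
    {C : MvPolynomial (Idx ℓ n) A} (hC : C ≠ 0)
    (h : ∀ P, Irreducible P → P ∣ C → IsChowForm P) : IsChowForm C := by
  induction C using WfDvdMonoid.induction_on_irreducible with
  | zero => exact absurd rfl hC
  | unit c hc =>
    obtain ⟨a, -, rfl⟩ := MvPolynomial.isUnit_iff_eq_C_of_isReduced.1 hc
    exact isChowForm_C a
  | mul a i ha hi ih =>
    exact (h i hi (dvd_mul_right _ _)).mul (ih ha fun P hP hPa => h P hP (hPa.mul_left _))

end
end
end ChowForms

namespace ChowForms
noncomputable section

/-! ### Resultants of families of forms on a variety -/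

section
variable {K : Type u} [Field K] {n ℓ : ℕ} {A : Type u} [CommRing A]

/-- The `j`-th linear form with indeterminate coefficients. -/
def genericForm (n : ℕ) {ℓ : ℕ} (A : Type u) [CommRing A] (j : Fin (ℓ + 1)) :
    MvPolynomial (Fin (n + 1)) (MvPolynomial (Idx ℓ n) A) :=
  linearForm Finset.univ fun k => MvPolynomial.X (j, k)

/-- A family of forms, generic linear ones for the indices in `I`, the others with coefficients in
`A`. -/
def IsFamily (I : Finset (Fin (ℓ + 1)))
    (G : Fin (ℓ + 1) → MvPolynomial (Fin (n + 1)) (MvPolynomial (Idx ℓ n) A)) : Prop :=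
  (∀ j ∈ I, G j = genericForm n A j) ∧ ∀ j, j ∉ I → ∃ f, G j = MvPolynomial.map MvPolynomial.C f

theorem IsFamily.update {I : Finset (Fin (ℓ + 1))}
    {G : Fin (ℓ + 1) → MvPolynomial (Fin (n + 1)) (MvPolynomial (Idx ℓ n) A)} (hG : IsFamily I G)
    (i : Fin (ℓ + 1)) (f : MvPolynomial (Fin (n + 1)) A) :
    IsFamily (I.erase i) (Function.update G i (MvPolynomial.map MvPolynomial.C f)) := by
  refine ⟨fun j hj => ?_, fun j hj => ?_⟩
  · rw [Function.update_of_ne (Finset.ne_of_mem_erase hj), hG.1 j (Finset.mem_of_mem_erase hj)]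
  · by_cases hji : j = i
    · exact ⟨f, by rw [hji, Function.update_self]⟩
    · rw [Function.update_of_ne hji]
      exact hG.2 j fun h => hj (Finset.mem_erase.2 ⟨hji, h⟩)

theorem IsFamily.map {I : Finset (Fin (ℓ + 1))}
    {G : Fin (ℓ + 1) → MvPolynomial (Fin (n + 1)) (MvPolynomial (Idx ℓ n) A)} (hG : IsFamily I G)
    {B : Type u} [CommRing B] (φ : A →+* B) :
    IsFamily I fun j => MvPolynomial.map (MvPolynomial.map φ) (G j) := by
  refine ⟨fun j hj => ?_, fun j hj => ?_⟩
  · simp only [hG.1 j hj, genericForm, map_linearForm, MvPolynomial.map_X]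
  · obtain ⟨f, hf⟩ := hG.2 j hj
    refine ⟨MvPolynomial.map φ f, ?_⟩
    simp only [hf, MvPolynomial.map_map]
    exact congrArg (fun h => MvPolynomial.map h f) (RingHom.ext fun a => by simp)

/-- Only the `i`-th member of the family involves `X*ᵢ`; all others become constant in it. -/
theorem IsFamily.asPolyIn_coeffs {I : Finset (Fin (ℓ + 1))}
    {G : Fin (ℓ + 1) → MvPolynomial (Fin (n + 1)) (MvPolynomial (Idx ℓ n) A)} (hG : IsFamily I G)
    {i : Fin (ℓ + 1)} (hi : i ∈ I) : (fun p => asPolyIn i (coeffs G p)) =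
      replace (fun p => MvPolynomial.C (coeffs G p)) i (linearForm Finset.univ MvPolynomial.X) := by
  let α : MvPolynomial (Idx ℓ n) A →+* MvPolynomial (Fin (n + 1)) (MvPolynomial (Idx ℓ n) A) :=
    (MvPolynomial.aeval (fun p : Idx ℓ n =>
      if p.1 = i then MvPolynomial.X p.2 else MvPolynomial.C (MvPolynomial.X p)) :
        MvPolynomial (Idx ℓ n) A →ₐ[A] _).toRingHom
  have hα : ∀ p : Idx ℓ n, α (MvPolynomial.X p) =
      if p.1 = i then MvPolynomial.X p.2 else MvPolynomial.C (MvPolynomial.X p) :=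
    fun p => MvPolynomial.aeval_X _ _
  have hne : ∀ j, j ≠ i → MvPolynomial.map α (G j) = MvPolynomial.map MvPolynomial.C (G j) := by
    intro j hj
    by_cases hjI : j ∈ I
    · rw [hG.1 j hjI, genericForm, map_linearForm, map_linearForm]
      simp only [hα, if_neg hj]
    · obtain ⟨f, hf⟩ := hG.2 j hjI
      rw [hf, MvPolynomial.map_map, MvPolynomial.map_map]
      exact congrArg (fun h => MvPolynomial.map h f) (RingHom.ext fun a => asPolyIn_C i a)
  refine (map_coeffs α G).trans ?_
  rw [map_coeffs MvPolynomial.C G, replace_coeffs]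
  congr 1
  funext j
  by_cases hj : j = i
  · subst hj
    rw [Function.update_self, hG.1 j hi, genericForm, map_linearForm]
    simp only [hα, if_true]
  · rw [Function.update_of_ne hj, hne j hj]

variable [Algebra K A] {Φ Φ' : MvPolynomial (Fin (ℓ + 1) × (Fin (n + 1) →₀ ℕ)) K}

theorem IsFamily.asPolyIn_aeval {I : Finset (Fin (ℓ + 1))}
    {G : Fin (ℓ + 1) → MvPolynomial (Fin (n + 1)) (MvPolynomial (Idx ℓ n) A)} (hG : IsFamily I G)
    {i : Fin (ℓ + 1)} (hi : i ∈ I) : asPolyIn i (MvPolynomial.aeval (coeffs G) Φ) =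
      MvPolynomial.aeval (replace (fun p => MvPolynomial.C (coeffs G p)) i
        (linearForm Finset.univ MvPolynomial.X)) Φ := by
  rw [← hG.asPolyIn_coeffs hi]
  have h : asPolyIn i (MvPolynomial.aeval (coeffs G) Φ) =
      (((MvPolynomial.aeval (fun p : Idx ℓ n =>
      if p.1 = i then MvPolynomial.X p.2 else MvPolynomial.C (MvPolynomial.X p)) :
        MvPolynomial (Idx ℓ n) A →ₐ[A] MvPolynomial (Fin (n + 1)) (MvPolynomial (Idx ℓ n) A)
        ).restrictScalars K).comp (MvPolynomial.aeval (coeffs G))) Φ := rfl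
  rw [h, MvPolynomial.comp_aeval]
  rfl

theorem map_aeval_coeffs {B : Type u} [CommRing B] [Algebra K B] [Algebra A B]
    [IsScalarTower K A B] (G : Fin (ℓ + 1) → MvPolynomial (Fin (n + 1)) (MvPolynomial (Idx ℓ n) A)) :
    MvPolynomial.map (algebraMap A B) (MvPolynomial.aeval (coeffs G) Φ) =
      MvPolynomial.aeval (coeffs fun j => MvPolynomial.map (MvPolynomial.map (algebraMap A B)) (G j))
        Φ := by
  rw [← map_coeffs]
  have h : MvPolynomial.map (algebraMap A B) (MvPolynomial.aeval (coeffs G) Φ) =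
      ((MvPolynomial.mapAlgHom (IsScalarTower.toAlgHom K A B)).comp
        (MvPolynomial.aeval (coeffs G))) Φ := rfl
  rw [h, MvPolynomial.comp_aeval]
  rfl

variable [IsAlgClosed K] {Z : Set (Fin (n + 1) → K)} {d D D' : Fin (ℓ + 1) → ℕ}

/-- The wedge with `f` is the raised form at the family with `f` in place of the `i`-th generic
linear form, by the common splitting over algebraically closed fields. -/
theorem IsForm.isWedgeAt (hZ : IsConeVariety Z) (hΦ : IsForm Z d D Φ) {i : Fin (ℓ + 1)}
    (hdi : d i = 1) {e : ℕ} (he : e ≠ 0) (hΦ' : IsForm Z (Function.update d i e) D' Φ')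
    (hD' : D' i = D i) (hS : subst i (linPart MvPolynomial.X i ^ e) Φ' = Φ ^ e)
    {I : Finset (Fin (ℓ + 1))}
    {G : Fin (ℓ + 1) → MvPolynomial (Fin (n + 1)) (MvPolynomial (Idx ℓ n) A)} (hG : IsFamily I G)
    (hi : i ∈ I) {f : MvPolynomial (Fin (n + 1)) A} (hf : f.IsHomogeneous e) :
    IsWedgeAt i e (D i) f (MvPolynomial.aeval (coeffs G) Φ)
      (MvPolynomial.aeval (coeffs (Function.update G i (MvPolynomial.map MvPolynomial.C f))) Φ') := by
  intro L _ _ ψ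
  let _ : Algebra K L := (ψ.comp (algebraMap K (MvPolynomial (Idx ℓ n) A))).toAlgebra
  let ψ' : MvPolynomial (Idx ℓ n) A →ₐ[K] L := { ψ with commutes' := fun _ => rfl }
  obtain ⟨y, x, h1, h2⟩ := hΦ.exists_splitting hZ hdi he hΦ' hD' hS fun p => ψ (coeffs G p)
  refine ⟨y, x, ?_, ?_⟩
  · rw [← h1, hG.asPolyIn_aeval hi]
    have h3 : MvPolynomial.map ψ (MvPolynomial.aeval (replace (fun p =>
        MvPolynomial.C (coeffs G p)) i (linearForm Finset.univ MvPolynomial.X)) Φ) =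
        ((MvPolynomial.mapAlgHom ψ').comp (MvPolynomial.aeval (replace (fun p =>
        MvPolynomial.C (coeffs G p)) i (linearForm Finset.univ MvPolynomial.X)))) Φ := rfl
    rw [h3, MvPolynomial.comp_aeval]
    congr 2
    refine (comp_replace (MvPolynomial.map ψ) _ _ _).trans ?_
    rw [map_linearForm]
    simp only [MvPolynomial.map_C, MvPolynomial.map_X]
  · rw [← h2 _ ((hf.map _).map _), ← replace_coeffs]
    have h3 : ψ (MvPolynomial.aeval (replace (coeffs G) i (MvPolynomial.map MvPolynomial.C f)) Φ') =
        (ψ'.comp (MvPolynomial.aeval (replace (coeffs G) i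
          (MvPolynomial.map MvPolynomial.C f)))) Φ' := rfl
    rw [h3, MvPolynomial.comp_aeval]
    congr 2
    exact comp_replace ψ _ _ _

/-- Raising the degrees of two forms in either order gives the same result. -/
theorem IsForm.eq_of_subst_eq (hΦ : IsForm Z d D Φ) {i j : Fin (ℓ + 1)} (hij : i ≠ j) {e e' : ℕ}
    {Φ₁ Φ₂ Φ₁₂ Φ₂₁ : MvPolynomial (Fin (ℓ + 1) × (Fin (n + 1) →₀ ℕ)) K} {D₁ D₂ : Fin (ℓ + 1) → ℕ}
    (h₁ : subst i (linPart MvPolynomial.X i ^ e) Φ₁ = Φ ^ e)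
    (h₂ : subst j (linPart MvPolynomial.X j ^ e') Φ₂ = Φ ^ e')
    (hΦ₁₂ : IsForm Z (Function.update (Function.update d i e) j e') D₁ Φ₁₂)
    (h₁₂ : subst j (linPart MvPolynomial.X j ^ e') Φ₁₂ = Φ₁ ^ e')
    (hΦ₂₁ : IsForm Z (Function.update (Function.update d j e') i e) D₂ Φ₂₁)
    (h₂₁ : subst i (linPart MvPolynomial.X i ^ e) Φ₂₁ = Φ₂ ^ e) : Φ₁₂ = Φ₂₁ := by
  have hcomm : ∀ Ψ : MvPolynomial (Fin (ℓ + 1) × (Fin (n + 1) →₀ ℕ)) K,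
      subst i (linPart MvPolynomial.X i ^ e) (subst j (linPart MvPolynomial.X j ^ e') Ψ) =
        subst j (linPart MvPolynomial.X j ^ e') (subst i (linPart MvPolynomial.X i ^ e) Ψ) := by
    have hstep : ∀ (a b : Fin (ℓ + 1)) (_ : a ≠ b) (r s : ℕ)
        (Ψ : MvPolynomial (Fin (ℓ + 1) × (Fin (n + 1) →₀ ℕ)) K),
        subst a (linPart MvPolynomial.X a ^ r) (subst b (linPart MvPolynomial.X b ^ s) Ψ) =
          MvPolynomial.aeval (replace (replace MvPolynomial.X a (linPart MvPolynomial.X a ^ r)) b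
            (linPart MvPolynomial.X b ^ s)) Ψ := by
      intro a b hab r s Ψ
      have h := aeval_subst (K := K) b (linPart MvPolynomial.X b ^ s) Ψ
        (replace (MvPolynomial.X : Fin (ℓ + 1) × (Fin (n + 1) →₀ ℕ) → MvPolynomial _ K) a
          (linPart MvPolynomial.X a ^ r))
      rw [map_pow, map_linPart_X] at h
      have h2 : linPart (replace (MvPolynomial.X : Fin (ℓ + 1) × (Fin (n + 1) →₀ ℕ) →
          MvPolynomial _ K) a (linPart MvPolynomial.X a ^ r)) b = linPart MvPolynomial.X b := by
        rw [linPart, linPart]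
        congr 1
        funext k
        rw [replace, if_neg hab.symm]
      rw [h2] at h
      exact h
    intro Ψ
    rw [hstep i j hij, hstep j i hij.symm]
    congr 2
    funext p
    by_cases hpi : p.1 = i
    · have : p.1 ≠ j := fun h => hij (hpi.symm.trans h)
      simp [replace, hpi, hij]
    · simp [replace, hpi]
  rw [Function.update_comm hij] at hΦ₁₂
  -- Both are elimination forms for the same degrees, so they agree up to a constant. Inserting
  -- powers of linear forms in both groups gives `Φ ^ (e * e')` in either case, so the constant is
  -- `1`.
  obtain ⟨w, hw⟩ := hΦ₁₂.isElim.associated hΦ₁₂.irreducible hΦ₂₁.isElim hΦ₂₁.irreducible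
  obtain ⟨c, -, hc⟩ := MvPolynomial.isUnit_iff_eq_C_of_isReduced.1 w.isUnit
  have h := hcomm Φ₂₁
  have h3 : subst i (linPart MvPolynomial.X i ^ e) (subst j (linPart MvPolynomial.X j ^ e') Φ₂₁) =
      Φ ^ (e * e') * MvPolynomial.C c := by
    have hC : ∀ (a : Fin (ℓ + 1)) (f : MvPolynomial (Fin (n + 1))
        (MvPolynomial (Fin (ℓ + 1) × (Fin (n + 1) →₀ ℕ)) K)),
        subst a f (MvPolynomial.C c) = MvPolynomial.C c := fun a f => (subst a f).commutes c
    rw [← hw, hc, map_mul, map_mul, h₁₂, map_pow, h₁, ← pow_mul, hC, hC]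
  rw [h3, h₂₁, map_pow, h₂, ← pow_mul, mul_comm e' e] at h
  have h4 : (MvPolynomial.C c : MvPolynomial (Fin (ℓ + 1) × (Fin (n + 1) →₀ ℕ)) K) = 1 :=
    mul_left_cancel₀ (pow_ne_zero (e * e') hΦ.irreducible.ne_zero) (by rw [h, mul_one])
  rw [← hw, hc, h4, mul_one]

/-- The values of elimination forms are resultants. -/
theorem IsForm.isResultantOn (hZ : IsConeVariety Z) (lam : Fin (ℓ + 1) → Fin (n + 1) → K)
    (hlam : ∀ x ∈ Z, ∃ i, ∑ k, lam i k * x k ≠ 0) {A : Type u} [CommRing A] [IsReduced A]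
    [Algebra K A] (hd : ∀ j, d j ≠ 0) (hΦ : IsForm Z d D Φ) {I : Finset (Fin (ℓ + 1))}
    (hI : ∀ j ∈ I, d j = 1)
    {G : Fin (ℓ + 1) → MvPolynomial (Fin (n + 1)) (MvPolynomial (Idx ℓ n) A)} (hG : IsFamily I G)
    {E : Fin (ℓ + 1) → ℕ} (hE : ∀ j ∈ I, E j = D j) :
    IsResultantOn I E A (MvPolynomial.aeval (coeffs G) Φ) := by
  induction hN : I.card using Nat.strong_induction_on generalizing I A d D E Φ with
  | _ N ih =>
  have hupd : ∀ {d : Fin (ℓ + 1) → ℕ} (_ : ∀ j, d j ≠ 0) (i : Fin (ℓ + 1)) {e : ℕ} (_ : e ≠ 0) (j),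
      Function.update d i e j ≠ 0 := by
    intro d hd i e he j
    by_cases hj : j = i
    · rwa [hj, Function.update_self]
    · rw [Function.update_of_ne hj]
      exact hd j
  rw [IsResultantOn]
  intro i hi
  rw [hE i hi]
  -- The case `e = 1` serves only to provide splittings.
  obtain ⟨Φ₁, hΦ₁, hS₁⟩ := hΦ.exists_raise hZ lam hlam hd (hI i hi) one_ne_zero
  refine ⟨isSplittable_of_forall_hom fun L _ _ ψ => ?_, fun B _ _ _ e f hf => ?_⟩
  · obtain ⟨y, x, h, -⟩ := hΦ.isWedgeAt hZ (hI i hi) one_ne_zero hΦ₁ (if_pos rfl) hS₁ hG hi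
      (MvPolynomial.isHomogeneous_X A 0) L ψ
    exact ⟨y, x, h⟩
  · let _ : Algebra K B := ((algebraMap A B).comp (algebraMap K A)).toAlgebra
    have : IsScalarTower K A B := IsScalarTower.of_algebraMap_eq fun _ => rfl
    rw [map_aeval_coeffs]
    have hGB := hG.map (algebraMap A B)
    set GB := fun j => MvPolynomial.map (MvPolynomial.map (algebraMap A B)) (G j) with hGB'
    have hhomC : ∀ {e : ℕ} {f : MvPolynomial (Fin (n + 1)) B}, f.IsHomogeneous e →
      (MvPolynomial.map MvPolynomial.C f : MvPolynomial (Fin (n + 1))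
        (MvPolynomial (Idx ℓ n) B)).IsHomogeneous e := fun hf => hf.map _
    constructor
    -- Raising needs a positive degree. Wedges with constants are powers of them and are treated
    -- separately.
    · by_cases he : e = 0
      · subst he
        obtain ⟨a, rfl⟩ := eq_C_of_isHomogeneous_zero hf
        refine ⟨MvPolynomial.C (a ^ D i), fun L _ _ ψ => ?_, ?_⟩
        · obtain ⟨y, x, h, -⟩ := hΦ.isWedgeAt hZ (hI i hi) one_ne_zero hΦ₁ (if_pos rfl) hS₁ hGB hi
            (MvPolynomial.isHomogeneous_X B 0) L ψ
          exact ⟨y, x, h, by simp⟩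
        · simp only [zero_mul]
          exact isResultantOn_C _ _
      · obtain ⟨Φ', hΦ', hS⟩ := hΦ.exists_raise hZ lam hlam hd (hI i hi) he
        refine ⟨_, hΦ.isWedgeAt hZ (hI i hi) he hΦ' (if_pos rfl) hS hGB hi hf, ?_⟩
        refine ih _ (hN ▸ Finset.card_erase_lt_of_mem hi) (hupd hd i he) hΦ' (fun j hj => ?_)
          (hGB.update i f) (fun j hj => ?_) rfl
        · rw [Function.update_of_ne (Finset.ne_of_mem_erase hj)]
          exact hI j (Finset.mem_of_mem_erase hj)
        · rw [if_neg (Finset.ne_of_mem_erase hj), hE j (Finset.mem_of_mem_erase hj)]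
    · intro j hj e' g hg wf wg wgf wfg h1 h2 h3 h4
      have hji := Finset.ne_of_mem_erase hj
      have hjI := Finset.mem_of_mem_erase hj
      rw [hE j hjI] at h2 h3
      by_cases he : e = 0
      · subst he
        obtain ⟨a, rfl⟩ := eq_C_of_isHomogeneous_zero hf
        rw [IsWedgeAt, MvPolynomial.map_C] at h1 h4
        rw [h1.eq_pow_of_degree_zero, ← MvPolynomial.C_pow, IsWedgeAt, asPolyIn_C, zero_mul] at h2
        rw [h2.eq_pow_of_C, h4.eq_pow_of_degree_zero, MvPolynomial.C_pow, ← pow_mul, mul_comm]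
      by_cases he' : e' = 0
      · subst he'
        obtain ⟨a, rfl⟩ := eq_C_of_isHomogeneous_zero hg
        rw [IsWedgeAt, MvPolynomial.map_C] at h2 h3
        rw [h3.eq_pow_of_degree_zero, ← MvPolynomial.C_pow, IsWedgeAt, asPolyIn_C, zero_mul] at h4
        rw [h4.eq_pow_of_C, h2.eq_pow_of_degree_zero, MvPolynomial.C_pow, ← pow_mul, mul_comm]
      have hdj : Function.update d i e j = 1 := by rw [Function.update_of_ne hji, hI j hjI]
      have hdi : Function.update d j e' i = 1 := by rw [Function.update_of_ne hji.symm, hI i hi]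
      obtain ⟨Φf, hΦf, hSf⟩ := hΦ.exists_raise hZ lam hlam hd (hI i hi) he
      obtain ⟨Φg, hΦg, hSg⟩ := hΦ.exists_raise hZ lam hlam hd (hI j hjI) he'
      obtain ⟨Φfg, hΦfg, hSfg⟩ := hΦf.exists_raise hZ lam hlam (hupd hd i he) hdj he'
      obtain ⟨Φgf, hΦgf, hSgf⟩ := hΦg.exists_raise hZ lam hlam (hupd hd j he') hdi he
      have k1 := hΦ.isWedgeAt hZ (hI i hi) he hΦf (if_pos rfl) hSf hGB hi hf
      have k3 := hΦ.isWedgeAt hZ (hI j hjI) he' hΦg (if_pos rfl) hSg hGB hjI hg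
      rw [IsWedge.unique (hhomC hf) h1 k1] at h2
      rw [IsWedge.unique (hhomC hg) h3 k3] at h4
      have k2 := hΦf.isWedgeAt hZ hdj he' hΦfg (if_pos rfl) hSfg (hGB.update i f) hj hg
      have k4 := hΦg.isWedgeAt hZ hdi he hΦgf (if_pos rfl) hSgf (hGB.update j g)
        (Finset.mem_erase.2 ⟨hji.symm, hi⟩) hf
      simp only [if_neg hji, if_neg hji.symm] at k2 k4
      rw [IsWedge.unique (hhomC hg) h2 k2, IsWedge.unique (hhomC hf) h4 k4,
        hΦ.eq_of_subst_eq hji.symm hSf hSg hΦfg hSfg hΦgf hSgf, Function.update_comm hji]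

end
end
end ChowForms

namespace ChowForms
noncomputable section

/-! ### Geometric Chow forms are Chow forms -/

section
variable {K : Type u} [Field K] [IsAlgClosed K] {n ℓ : ℕ}

theorem exists_isForm_of_isElim {Z : Set (Fin (n + 1) → K)} (hZ : IsConeVariety Z)
    {P : MvPolynomial (Idx ℓ n) K} (hP : Irreducible P)
    (hPZ : (LinSys.linear (Fin (ℓ + 1)) (Fin (n + 1)) K).IsElim Z P) :
    ∃ D : Fin (ℓ + 1) → ℕ, IsForm Z (fun _ => 1) D
      (MvPolynomial.rename (fun p : Idx ℓ n => (p.1, Finsupp.single p.2 1)) P) := by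
  classical
  have hinj : Function.Injective fun p : Idx ℓ n => (p.1, Finsupp.single p.2 1) := by
    intro p q h
    rw [Prod.mk.injEq] at h
    exact Prod.ext h.1 (Finsupp.single_left_injective one_ne_zero h.2)
  have hirr := irreducible_rename hinj hP
  set Φ := MvPolynomial.rename (fun p : Idx ℓ n => (p.1, Finsupp.single p.2 1)) P with hΦ
  have helim : (formSys K fun _ : Fin (ℓ + 1) => 1).IsElim Z Φ := by
    intro u
    rw [hΦ, MvPolynomial.eval_rename, hPZ]
    refine exists_congr fun x => and_congr_right fun _ => forall_congr' fun i => ?_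
    rw [LinSys.val_linear, val_eq_eval_linPart u x rfl, linPart, eval_linearForm]
    rfl
  choose D hD using fun i => helim.exists_isHomogIn hirr (isGroup_formSys _ i)
  -- If `D i = 0`, the value of the form is unchanged when the `i`-th linear form is set to zero.
  -- But then the remaining ones have a common zero on `Z`, so the value is always zero.
  refine ⟨D, hirr, helim, hD, fun i hi => ?_⟩
  have : Infinite K := IsAlgClosed.instInfinite
  obtain ⟨u, hu⟩ := exists_eval_ne_zero hirr.ne_zero
  apply hu
  have h1 := (hD i).aeval_eq u 0
  rw [hi, pow_zero, one_mul, MvPolynomial.aeval_eq_eval, MvPolynomial.aeval_eq_eval] at h1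
  rw [← h1, helim]
  obtain ⟨x, hx, hxu⟩ := exists_zero_of_isElim hZ.toIsClosedCone hP hPZ
    (fun j k => u (j, Finsupp.single k 1)) i
  refine ⟨x, hx, fun j => ?_⟩
  rw [LinSys.val_scale (isGroup_formSys _ i)]
  split_ifs with hj
  · rw [zero_mul]
  · rw [val_eq_eval_linPart u x rfl, linPart, eval_linearForm]
    exact hxu j hj

/-- At the family of generic linear forms the elimination form for degrees `1` returns `P`. -/
theorem isChowForm_of_isIrredChowFormFor {W : Set (ProjSpace K n)} (hW : IsClosed W)
    (hirr : IsIrreducible W) {P : MvPolynomial (Idx ℓ n) K} (hP : IsIrredChowFormFor W P) :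
    IsChowForm P := by
  have : Infinite K := IsAlgClosed.instInfinite
  refine ⟨isAlternating_of_isIrredChowFormFor hP, ?_⟩
  have hPZ := isChowFormFor_iff_isElim.1 hP.2
  obtain ⟨lam, hlam⟩ := exists_linear_forms_of_isElim hP.1.ne_zero hPZ
  have hZ := isConeVariety_cone hW hirr
  obtain ⟨D, hD⟩ := exists_isForm_of_isElim hZ hP.1 hPZ
  refine ⟨D, ?_⟩
  have h := hD.isResultantOn hZ lam hlam (A := K) (I := Finset.univ) (fun _ => one_ne_zero)
    (fun _ _ => rfl) (G := genericForm n K) ⟨fun _ _ => rfl, fun j hj => absurd (Finset.mem_univ j) hj⟩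
    (fun _ _ => rfl)
  rw [MvPolynomial.aeval_rename] at h
  have h2 : (coeffs (genericForm n K) ∘ fun p : Idx ℓ n => (p.1, Finsupp.single p.2 1)) =
      MvPolynomial.X := by
    classical
    funext p
    exact coeff_linearForm Finset.univ _ (Finset.mem_univ p.2)
  rw [h2, MvPolynomial.aeval_X_left_apply] at h
  exact h

theorem isChowForm_of_isChowFormFor {W : Set (ProjSpace K n)} (hW : IsClosed W)
    {C : MvPolynomial (Idx ℓ n) K} (hC0 : C ≠ 0) (hC : IsChowFormFor W C) : IsChowForm C := by
  refine isChowForm_of_forall_irreducible_factor hC0 fun P hP hPC => ?_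
  obtain ⟨t, htc, hti, -, htP⟩ := exists_isChowFormFor_of_irreducible_factor hW hC0 hC hP hPC
  exact isChowForm_of_isIrredChowFormFor htc hti ⟨hP, htP⟩

end
end
end ChowForms

namespace ChowForms
noncomputable section

/-! ### Relative algebraic closures inside an algebraically closed field -/

/-- The inclusion of images lifts to an injective homomorphism `A → B`, along which equations are
carried over. -/
theorem _root_.IsAlgebraic.of_range_subset {A B E : Type*} [CommRing A] [CommRing B] [CommRing E]
    [Algebra A E] [Algebra B E] (hA : Function.Injective (algebraMap A E))
    (hB : Function.Injective (algebraMap B E))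
    (h : ∀ a, ∃ b, algebraMap B E b = algebraMap A E a) {x : E} (hx : IsAlgebraic A x) :
    IsAlgebraic B x := by
  choose g hg using h
  let γ : A →+* B :=
    { toFun := g
      map_one' := hB (by rw [hg, map_one, map_one])
      map_mul' := fun a b => hB (by rw [hg, map_mul, map_mul, hg, hg])
      map_zero' := hB (by rw [hg, map_zero, map_zero])
      map_add' := fun a b => hB (by rw [hg, map_add, map_add, hg, hg]) }
  have hγ : (algebraMap B E).comp γ = algebraMap A E := RingHom.ext hg
  have hγi : Function.Injective γ := fun a b hab => hA (by rw [← hγ, RingHom.comp_apply, hab]; rfl)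
  obtain ⟨p, hp, hpx⟩ := hx
  refine ⟨p.map γ, (Polynomial.map_ne_zero_iff hγi).2 hp, ?_⟩
  rw [Polynomial.aeval_def, Polynomial.eval₂_map, hγ]
  exact hpx

section Closure
variable {K : Type v₁} {E : Type u} [Field K] [Field E] [Algebra K E]

variable (K) in
/-- The elements of `E` that are algebraic over `K(S)`. -/
def cl (S : Set E) : IntermediateField K E :=
  (algebraicClosure (IntermediateField.adjoin K S) E).restrictScalars K

theorem mem_cl {S : Set E} {x : E} : x ∈ cl K S ↔ IsAlgebraic (Algebra.adjoin K S) x := by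
  rw [← IntermediateField.isAlgebraic_adjoin_iff, ← mem_algebraicClosure_iff]
  rfl

attribute [irreducible] cl

/-- This makes the closure axioms and the exchange property of matroids available for `cl`. -/
theorem coe_cl (S : Set E) : (cl K S : Set E) = (AlgebraicIndependent.matroid K E).closure S := by
  rw [AlgebraicIndependent.matroid_closure_eq]
  ext x
  exact mem_cl

theorem subset_cl (S : Set E) : S ⊆ cl K S := by
  rw [coe_cl]
  exact Matroid.subset_closure _ _ (Set.subset_univ _)

theorem mem_cl_of_mem {S : Set E} {x : E} (hx : x ∈ S) : x ∈ cl K S := subset_cl S hx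

theorem cl_le {S T : Set E} (h : S ⊆ cl K T) : cl K S ≤ cl K T := by
  have : (cl K S : Set E) ⊆ cl K T := by
    rw [coe_cl] at h
    rw [coe_cl, coe_cl]
    exact Matroid.closure_subset_closure_of_subset_closure h
  exact this

theorem cl_mono {S T : Set E} (h : S ⊆ T) : cl K S ≤ cl K T := cl_le (h.trans (subset_cl T))

theorem cl_exchange {S : Set E} {a b : E} (ha : a ∉ cl K S) (hab : a ∈ cl K (insert b S)) :
    b ∈ cl K (insert a S) := by
  rw [← SetLike.mem_coe, coe_cl] at *
  exact Matroid.mem_closure_insert ha hab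

theorem mem_cl_of_isAlgebraic {S : Set E} {x : E} (hx : IsAlgebraic (cl K S) x) : x ∈ cl K S := by
  refine cl_le (S := cl K S) (T := S) subset_rfl ?_
  rw [mem_cl]
  exact hx.of_range_subset (algebraMap (cl K S) E).injective Subtype.val_injective
    fun a => ⟨⟨a, Algebra.subset_adjoin a.2⟩, rfl⟩

instance isAlgClosed_cl [IsAlgClosed E] (S : Set E) : IsAlgClosed (cl K S) := by
  refine IsAlgClosed.of_exists_root _ fun p hp hirr => ?_
  have hdeg : p.degree ≠ 0 := (Polynomial.degree_pos_of_irreducible hirr).ne'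
  obtain ⟨x, hx⟩ := IsAlgClosed.exists_aeval_eq_zero E p hdeg
  have hmem : x ∈ cl K S := mem_cl_of_isAlgebraic ⟨p, hp.ne_zero, hx⟩
  refine ⟨⟨x, hmem⟩, ?_⟩
  have h1 : algebraMap (cl K S) E (p.eval ⟨x, hmem⟩) = 0 := by
    rw [← hx, Polynomial.aeval_def, ← Polynomial.eval₂_at_apply]
    rfl
  exact (map_eq_zero _).1 h1

theorem isAlgebraic_of_mem_cl_union {S T : Set E} {x : E} (hx : x ∈ cl K (S ∪ T)) :
    IsAlgebraic (Algebra.adjoin (cl K S) T) x := by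
  rw [mem_cl] at hx
  refine hx.of_range_subset Subtype.val_injective Subtype.val_injective ?_
  rintro ⟨y, hy⟩
  suffices y ∈ Algebra.adjoin (cl K S) T from ⟨⟨y, this⟩, rfl⟩
  induction hy using Algebra.adjoin_induction with
  | mem y hy =>
    rcases hy with hy | hy
    · exact (Algebra.adjoin (cl K S) T).algebraMap_mem ⟨y, subset_cl S hy⟩
    · exact Algebra.subset_adjoin hy
  | algebraMap r =>
    exact (Algebra.adjoin (cl K S) T).algebraMap_mem (algebraMap K (cl K S) r)
  | add y z _ _ hy hz => exact add_mem hy hz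
  | mul y z _ _ hy hz => exact mul_mem hy hz

theorem mem_cl_union_of_isAlgebraic {S T : Set E} {x : E}
    (hx : IsAlgebraic (Algebra.adjoin (cl K S) T) x) : x ∈ cl K (S ∪ T) := by
  refine mem_cl_of_isAlgebraic (hx.of_range_subset Subtype.val_injective
    (algebraMap (cl K (S ∪ T)) E).injective ?_)
  rintro ⟨y, hy⟩
  suffices y ∈ cl K (S ∪ T) from ⟨⟨y, this⟩, rfl⟩
  induction hy using Algebra.adjoin_induction with
  | mem y hy => exact subset_cl _ (Or.inr hy)
  | algebraMap r => exact cl_mono Set.subset_union_left r.2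
  | add y z _ _ hy hz => exact add_mem hy hz
  | mul y z _ _ hy hz => exact mul_mem hy hz

theorem algebraicIndependent_cl_iff {τ : Type*} {S : Set E} {v : τ → E} :
    AlgebraicIndependent (cl K S) v ↔ ∀ b, v b ∉ cl K (S ∪ v '' {b}ᶜ) := by
  constructor
  · intro h b hb
    exact ((AlgebraicIndependent.iff_transcendental_adjoin_image b).1 h).2
      (isAlgebraic_of_mem_cl_union hb)
  · intro h
    refine algebraicIndependent_of_finite_type' (algebraMap (cl K S) E).injective
      fun t _ _ b hb hbt => h b ?_
    refine cl_mono (Set.union_subset_union_right _ (Set.image_mono ?_))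
      (mem_cl_union_of_isAlgebraic (S := S) (T := v '' t) hbt)
    intro c hc hcb
    rw [Set.mem_singleton_iff] at hcb
    exact hb (hcb ▸ hc)

/-- Two elements that are algebraic over `K(S, a, b)` and independent over `K(S)` can replace
`a` and `b`. -/
theorem cl_insert_insert_le {S : Set E} {a b x y : E} (hx : x ∈ cl K (insert a (insert b S)))
    (hy : y ∈ cl K (insert a (insert b S))) (hx0 : x ∉ cl K S) (hy0 : y ∉ cl K (insert x S)) :
    cl K (insert a (insert b S)) ≤ cl K (insert y (insert x S)) := by
  -- Exchange `a` for `x`, which requires that `x` really depends on `a`, and afterwards `b` for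
  -- `y`. If `x` depends on `b` only, interchange the roles of `a` and `b`.
  have key : ∀ a b, x ∈ cl K (insert a (insert b S)) → y ∈ cl K (insert a (insert b S)) →
      x ∉ cl K (insert b S) → cl K (insert a (insert b S)) ≤ cl K (insert y (insert x S)) := by
    intro a b hx hy hxb
    have ha : a ∈ cl K (insert b (insert x S)) := by
      rw [Set.insert_comm]
      exact cl_exchange hxb hx
    have hle : cl K (insert a (insert b S)) ≤ cl K (insert b (insert x S)) := by
      refine cl_le (Set.insert_subset ha (Set.insert_subset ?_ ?_))
      · exact mem_cl_of_mem (Set.mem_insert _ _)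
      · exact fun s hs => mem_cl_of_mem (Or.inr (Or.inr hs))
    have hb : b ∈ cl K (insert y (insert x S)) := cl_exchange hy0 (hle hy)
    refine hle.trans (cl_le (Set.insert_subset hb ?_))
    exact fun s hs => mem_cl_of_mem (Or.inr hs)
  by_cases hxb : x ∈ cl K (insert b S)
  · have hbx := cl_exchange hx0 hxb
    by_cases hxa : x ∈ cl K (insert a S)
    · have hax := cl_exchange hx0 hxa
      refine absurd (cl_le ?_ hy) hy0
      exact Set.insert_subset hax (Set.insert_subset hbx
        fun s hs => mem_cl_of_mem (Or.inr hs))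
    · rw [Set.insert_comm] at hx hy ⊢
      exact key b a hx hy hxa
  · exact key a b hx hy hxb

end Closure

/-! ### Generic vectors -/

/-- If `u` has a coordinate outside of the subspace `U`, then so has almost every vector
`(1, s, s², …)` an inner product with `u` outside of `U`. -/
theorem finite_setOf_sum_pow_mem {K E : Type*} [Field K] [Field E] [Algebra K E] {n : ℕ}
    (U : Submodule K E) {v : Fin (n + 1) → E} {k : Fin (n + 1)} (hk : v k ∉ U) :
    {s : K | ∑ k : Fin (n + 1), algebraMap K E (s ^ (k : ℕ)) * v k ∈ U}.Finite := by
  classical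
  by_contra hinf
  -- For `n + 1` distinct values the vectors form an invertible Vandermonde matrix, which expresses
  -- every coordinate by inner products in `U`.
  obtain ⟨t, ht, htc⟩ := Set.Infinite.exists_subset_card_eq hinf (n + 1)
  let e := t.equivFinOfCardEq htc
  let s : Fin (n + 1) → K := fun c => (e.symm c : K)
  have hs : Function.Injective s := Subtype.val_injective.comp e.symm.injective
  have hdet : IsUnit (Matrix.vandermonde s).det :=
    isUnit_iff_ne_zero.2 (Matrix.det_vandermonde_ne_zero_iff.2 hs)
  have hmul := Matrix.nonsing_inv_mul _ hdet
  apply hk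
  have hmem : ∀ c, ∑ k : Fin (n + 1), algebraMap K E (s c ^ (k : ℕ)) * v k ∈ U :=
    fun c => ht (e.symm c).2
  have : v k = ∑ c, (Matrix.vandermonde s)⁻¹ k c •
      ∑ k : Fin (n + 1), algebraMap K E (s c ^ (k : ℕ)) * v k := by
    have h1 : ∀ k' : Fin (n + 1), ∑ c, (Matrix.vandermonde s)⁻¹ k c * s c ^ (k' : ℕ) = if k = k' then 1 else 0 := by
      intro k'
      have := congr_fun (congr_fun hmul k) k'
      rw [Matrix.mul_apply, Matrix.one_apply] at this
      simpa [Matrix.vandermonde_apply] using this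
    simp_rw [Finset.smul_sum, Algebra.smul_def, ← mul_assoc, ← map_mul]
    rw [Finset.sum_comm]
    simp_rw [← Finset.sum_mul, ← map_sum, h1]
    simp
  rw [this]
  exact U.sum_mem fun c _ => U.smul_mem _ (hmem c)

/-- Simultaneous version of `finite_setOf_sum_pow_mem`. -/
theorem finite_setOf_exists_sum_pow_mem {K E T : Type*} [Field K] [Field E] [Algebra K E]
    [Finite T] {n : ℕ} (U : T → Submodule K E) (v : T → Fin (n + 1) → E)
    (h : ∀ t, ∃ k, v t k ∉ U t) :
    {s : K | ∃ t, ∑ k : Fin (n + 1), algebraMap K E (s ^ (k : ℕ)) * v t k ∈ U t}.Finite := by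
  have : {s : K | ∃ t, ∑ k : Fin (n + 1), algebraMap K E (s ^ (k : ℕ)) * v t k ∈ U t} =
      ⋃ t, {s : K | ∑ k : Fin (n + 1), algebraMap K E (s ^ (k : ℕ)) * v t k ∈ U t} := by
    ext s
    simp
  rw [this]
  refine Set.finite_iUnion fun t => ?_
  obtain ⟨k, hk⟩ := h t
  exact finite_setOf_sum_pow_mem (U t) hk

/-- An invertible linear substitution preserves algebraic independence. -/
theorem _root_.AlgebraicIndependent.mulVec {k E τ : Type*} [Field k] [Field E] [Algebra k E]
    [Fintype τ] [DecidableEq τ] {μ : τ → E} (hμ : AlgebraicIndependent k μ) {M N : Matrix τ τ k}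
    (hMN : M * N = 1) : AlgebraicIndependent k fun c => ∑ d, algebraMap k E (M c d) * μ d := by
  let s : Matrix τ τ k → MvPolynomial τ k →ₐ[k] MvPolynomial τ k := fun A =>
    MvPolynomial.aeval fun c => ∑ d, MvPolynomial.C (A c d) * MvPolynomial.X d
  have hs : Function.LeftInverse (s N) (s M) := by
    suffices (s N).comp (s M) = AlgHom.id k _ from fun p => DFunLike.congr_fun this p
    refine MvPolynomial.algHom_ext fun c => ?_
    simp only [s, AlgHom.comp_apply, MvPolynomial.aeval_X, map_sum, map_mul,
      MvPolynomial.aeval_C, MvPolynomial.algebraMap_eq, AlgHom.id_apply, Finset.mul_sum, ← mul_assoc]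
    rw [Finset.sum_comm]
    simp_rw [← Finset.sum_mul, ← map_mul, ← map_sum]
    have : ∀ e, ∑ d, M c d * N d e = if c = e then 1 else 0 := fun e => by
      rw [← Matrix.mul_apply, hMN, Matrix.one_apply]
    simp [this]
  rw [AlgebraicIndependent] at hμ ⊢
  have : MvPolynomial.aeval (fun c => ∑ d, algebraMap k E (M c d) * μ d) =
      (MvPolynomial.aeval μ).comp (s M) := by
    refine MvPolynomial.algHom_ext fun c => ?_
    simp [s]
  rw [this, AlgHom.coe_comp]
  exact hμ.comp hs.injective

end
end ChowForms

namespace ChowForms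
noncomputable section

/-! ### Plane curves over function fields -/

section Bivariate

/-- A family of bivariate polynomials without common irreducible factor has common zeros over only
finitely many values of the first coordinate. -/
theorem exists_eval_eq_zero_of_forall_evalEval {k β : Type*} [Field k] (G : β → Polynomial (Polynomial k))
    (h0 : ∃ b, G b ≠ 0)
    (hG : ∀ f, Irreducible f → ∃ b, ¬ f ∣ G b) :
    ∃ B : Polynomial k, B ≠ 0 ∧ ∀ x y : k, (∀ b, (G b).evalEval x y = 0) → B.eval x = 0 := by
  obtain ⟨b₀, hb₀⟩ := h0
  -- Factor one nonzero member. A factor in the first variable alone is put into `B`; any other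
  -- factor together with a member it does not divide contributes their resultant.
  suffices ∀ g : Polynomial (Polynomial k), g ≠ 0 → ∃ B : Polynomial k, B ≠ 0 ∧
      ∀ x y : k, g.evalEval x y = 0 → (∀ b, (G b).evalEval x y = 0) → B.eval x = 0 by
    obtain ⟨B, hB, h⟩ := this _ hb₀
    exact ⟨B, hB, fun x y hxy => h x y (hxy b₀) hxy⟩
  intro g
  induction g using WfDvdMonoid.induction_on_irreducible with
  | zero => exact fun h => absurd rfl h
  | unit g hg =>
    intro _
    refine ⟨1, one_ne_zero, fun x y hxy => ?_⟩
    have := hg.map (Polynomial.evalEvalRingHom x y)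
    rw [Polynomial.coe_evalEvalRingHom, hxy] at this
    exact absurd this not_isUnit_zero
  | mul g f hg hf ih =>
    intro _
    obtain ⟨B, hB, h⟩ := ih hg
    by_cases hd : f.natDegree = 0
    · obtain ⟨c, rfl⟩ := Polynomial.natDegree_eq_zero.1 hd
      refine ⟨c * B, mul_ne_zero (by rintro rfl; simp at hf) hB, fun x y hxy hall => ?_⟩
      rw [Polynomial.evalEval_mul, Polynomial.evalEval_C] at hxy
      rw [Polynomial.eval_mul]
      rcases mul_eq_zero.1 hxy with h1 | h1
      · rw [h1, zero_mul]
      · rw [h x y h1 hall, mul_zero]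
    · obtain ⟨b, hb⟩ := hG f hf
      obtain ⟨p, q, c, hc, hpq⟩ := Polynomial.exists_mul_add_mul_eq_C_of_irreducible hf hd hb
      refine ⟨c * B, mul_ne_zero hc hB, fun x y hxy hall => ?_⟩
      rw [Polynomial.evalEval_mul] at hxy
      rw [Polynomial.eval_mul]
      rcases mul_eq_zero.1 hxy with h1 | h1
      · have := congr_arg (Polynomial.evalEval x y) hpq
        rw [Polynomial.evalEval_add, Polynomial.evalEval_mul, Polynomial.evalEval_mul, h1, hall b,
          Polynomial.evalEval_C, mul_zero, mul_zero, add_zero] at this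
        rw [← this, zero_mul]
      · rw [h x y h1 hall, mul_zero]

/-- The value of a polynomial in three variables at a point over an extension. -/
def eval₃ {k E : Type*} [CommRing k] [CommRing E] (φ : k →+* E) (x y q : E) :
    Polynomial (Polynomial (Polynomial k)) →+* E :=
  Polynomial.eval₂RingHom (Polynomial.eval₂RingHom (Polynomial.eval₂RingHom φ x) y) q

/-- If `q` is algebraic over `k(x, y)`, where `x` and `y` are algebraically independent and `q` is
transcendental over `k`, then it satisfies an equation whose coefficients have, at
`k`-rational points, common zeros over finitely many values of `x` only. -/
theorem exists_eval₃_eq_zero {k E : Type*} [Field k] [Field E] [Algebra k E] {x y q : E}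
    (hxy : Function.Injective (Polynomial.eval₂RingHom
      (Polynomial.eval₂RingHom (algebraMap k E) x) y))
    (hq : ∃ Γ : Polynomial (Polynomial (Polynomial k)), Γ ≠ 0 ∧ eval₃ (algebraMap k E) x y q Γ = 0)
    (hqt : Transcendental k q) :
    ∃ Γ : Polynomial (Polynomial (Polynomial k)), eval₃ (algebraMap k E) x y q Γ = 0 ∧
      ∃ B : Polynomial k, B ≠ 0 ∧ ∀ x' y' : k,
        eval₃ (algebraMap k E) (algebraMap k E x') (algebraMap k E y') q Γ = 0 → B.eval x' = 0 := by
  obtain ⟨Γ₀, h0, hΓ₀⟩ := hq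
  -- An irreducible equation is primitive in the third variable, so no irreducible polynomial in
  -- `x`, `y` divides all its coefficients.
  obtain ⟨Γ, hΓ, -, hΓ0⟩ := exists_irreducible_factor_mem
    (RingHom.ker_isPrime (eval₃ (algebraMap k E) x y q)) (RingHom.mem_ker.2 hΓ₀) h0
  rw [RingHom.mem_ker] at hΓ0
  have hd : Γ.natDegree ≠ 0 := by
    intro hd
    obtain ⟨c, rfl⟩ := Polynomial.natDegree_eq_zero.1 hd
    rw [eval₃, Polynomial.coe_eval₂RingHom, Polynomial.eval₂_C] at hΓ0
    have : c = 0 := hxy (by rw [hΓ0, map_zero])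
    rw [this, map_zero] at hΓ
    exact hΓ.ne_zero rfl
  obtain ⟨B, hB, h⟩ := exists_eval_eq_zero_of_forall_evalEval (fun b => Γ.coeff b)
    ⟨Γ.natDegree, by
      rw [Polynomial.coeff_natDegree]
      exact Polynomial.leadingCoeff_ne_zero.2 hΓ.ne_zero⟩ (by
    intro f hf
    by_contra! hcon
    exact hf.not_isUnit (hΓ.isPrimitive hd f ((Polynomial.C_dvd_iff_dvd_coeff f Γ).2 hcon)))
  refine ⟨Γ, hΓ0, B, hB, fun x' y' hxy' => h x' y' fun b => ?_⟩
  have h1 : (Polynomial.eval₂RingHom (Polynomial.eval₂RingHom (algebraMap k E)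
      (algebraMap k E x')) (algebraMap k E y')) =
      (algebraMap k E).comp (Polynomial.evalEvalRingHom x' y') := by
    ext <;> simp
  -- Over `k`-rational `x'`, `y'` the equation is one for `q` over `k`. As `q` is transcendental,
  -- all coefficients vanish there.
  have h2 : Γ.map (Polynomial.evalEvalRingHom x' y') = 0 := by
    by_contra h3
    refine hqt ⟨_, h3, ?_⟩
    rw [eval₃, h1] at hxy'
    rw [Polynomial.aeval_def, Polynomial.eval₂_map]
    exact hxy'
  have := congr_arg (fun p => p.coeff b) h2
  simpa [Polynomial.coeff_map] using this

/-- Homogenisation of a polynomial in the quotients `L₁/L₀` and `L₂/L₀` of linear forms. -/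
theorem exists_homogenization {Q τ : Type*} [Field Q] {L : Fin 3 → MvPolynomial τ Q}
    (hL : ∀ i, (L i).IsHomogeneous 1) (g : Polynomial (Polynomial Q)) :
    ∃ d, ∃ f : MvPolynomial τ Q, f.IsHomogeneous d ∧
      ∀ {E : Type u} [Field E] [Algebra Q E] (v : τ → E), MvPolynomial.aeval v (L 0) ≠ 0 →
        MvPolynomial.aeval v f = MvPolynomial.aeval v (L 0) ^ d *
          Polynomial.eval₂ (Polynomial.eval₂RingHom (algebraMap Q E)
            (MvPolynomial.aeval v (L 1) / MvPolynomial.aeval v (L 0)))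
            (MvPolynomial.aeval v (L 2) / MvPolynomial.aeval v (L 0)) g := by
  -- All large degrees are claimed at once, so that two summands can be homogenised to the same
  -- degree.
  suffices ∃ d₀, ∀ d, d₀ ≤ d → ∃ f : MvPolynomial τ Q, f.IsHomogeneous d ∧
      ∀ {E : Type u} [Field E] [Algebra Q E] (v : τ → E), MvPolynomial.aeval v (L 0) ≠ 0 →
        MvPolynomial.aeval v f = MvPolynomial.aeval v (L 0) ^ d *
          Polynomial.eval₂ (Polynomial.eval₂RingHom (algebraMap Q E)
            (MvPolynomial.aeval v (L 1) / MvPolynomial.aeval v (L 0)))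
            (MvPolynomial.aeval v (L 2) / MvPolynomial.aeval v (L 0)) g by
    obtain ⟨d₀, h⟩ := this
    exact ⟨d₀, h d₀ le_rfl⟩
  induction g using Polynomial.induction_on' with
  | add p q hp hq =>
    obtain ⟨d₁, h1⟩ := hp
    obtain ⟨d₂, h2⟩ := hq
    refine ⟨max d₁ d₂, fun d hd => ?_⟩
    obtain ⟨f₁, hf₁, h1⟩ := h1 d (le_trans (le_max_left _ _) hd)
    obtain ⟨f₂, hf₂, h2⟩ := h2 d (le_trans (le_max_right _ _) hd)
    refine ⟨f₁ + f₂, hf₁.add hf₂, fun v hv => ?_⟩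
    rw [map_add, h1 v hv, h2 v hv, Polynomial.eval₂_add, mul_add]
  | monomial j p =>
    induction p using Polynomial.induction_on' with
    | add p q hp hq =>
      obtain ⟨d₁, h1⟩ := hp
      obtain ⟨d₂, h2⟩ := hq
      refine ⟨max d₁ d₂, fun d hd => ?_⟩
      obtain ⟨f₁, hf₁, h1⟩ := h1 d (le_trans (le_max_left _ _) hd)
      obtain ⟨f₂, hf₂, h2⟩ := h2 d (le_trans (le_max_right _ _) hd)
      refine ⟨f₁ + f₂, hf₁.add hf₂, fun v hv => ?_⟩
      rw [map_add, h1 v hv, h2 v hv, map_add, Polynomial.eval₂_add, mul_add]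
    | monomial i c =>
      refine ⟨i + j, fun d hd => ⟨MvPolynomial.C c * L 1 ^ i * L 2 ^ j * L 0 ^ (d - (i + j)),
        ?_, fun v hv => ?_⟩⟩
      · have := ((((MvPolynomial.isHomogeneous_C τ c).mul ((hL 1).pow i)).mul ((hL 2).pow j)).mul
          ((hL 0).pow (d - (i + j))))
        convert this using 1
        omega
      · obtain ⟨e, rfl⟩ := Nat.exists_eq_add_of_le hd
        simp only [map_mul, map_pow, MvPolynomial.aeval_C, Nat.add_sub_cancel_left,
          Polynomial.eval₂_monomial, Polynomial.coe_eval₂RingHom]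
        rw [div_pow, div_pow, pow_add, pow_add]
        field_simp

end Bivariate

/-- A polynomial over an infinite field `k` that vanishes at all `k`-rational points with some
prescribed coordinates vanishes at all points with these coordinates. -/
theorem aeval_eq_zero_of_forall_eval {k E τ : Type*} [Field k] [Infinite k] [Field E] [Algebra k E]
    (J : Set τ) {G : MvPolynomial τ k} {p : τ → E} (hp : ∀ c ∈ J, ∃ a, algebraMap k E a = p c)
    (h : ∀ p' : τ → k, (∀ c ∈ J, algebraMap k E (p' c) = p c) → MvPolynomial.eval p' G = 0) :
    MvPolynomial.aeval p G = 0 := by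
  classical
  choose! a ha using hp
  let s : MvPolynomial τ k →ₐ[k] MvPolynomial τ k := MvPolynomial.aeval fun c =>
    if c ∈ J then MvPolynomial.C (a c) else MvPolynomial.X c
  have h0 : s G = 0 := by
    refine MvPolynomial.funext fun p' => ?_
    rw [map_zero, ← MvPolynomial.aeval_eq_eval, ← AlgHom.comp_apply, MvPolynomial.comp_aeval,
      MvPolynomial.aeval_eq_eval]
    refine h _ fun c hc => ?_
    simp [hc, ha c hc]
  have h1 : MvPolynomial.aeval p (s G) = MvPolynomial.aeval p G := by
    rw [← AlgHom.comp_apply, MvPolynomial.comp_aeval]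
    congr 2
    funext c
    by_cases hc : c ∈ J <;> simp [hc, ha]
  rw [← h1, h0, map_zero]

end
end ChowForms

namespace ChowForms
noncomputable section

/-! ### Hypersurfaces through a point of transcendence degree two -/

section
variable {K : Type v₁} {E : Type u} [Field K] [Field E] [Algebra K E] {n : ℕ}

/-- The value of a linear form over `K` at a vector over `E`. -/
def formVal (l : Fin (n + 1) → K) (v : Fin (n + 1) → E) : E := ∑ k, algebraMap K E (l k) * v k

theorem formVal_smul (l : Fin (n + 1) → K) (c : E) (v : Fin (n + 1) → E) :
    formVal l (c • v) = c * formVal l v := by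
  rw [formVal, formVal, Finset.mul_sum]
  exact Finset.sum_congr rfl fun k _ => by rw [Pi.smul_apply, smul_eq_mul]; ring

theorem formVal_div (l : Fin (n + 1) → K) (c : E) (v : Fin (n + 1) → E) :
    formVal l (fun k => v k / c) = formVal l v / c := by
  rw [formVal, formVal, Finset.sum_div]
  exact Finset.sum_congr rfl fun k _ => by rw [mul_div_assoc]

theorem formVal_mem {F : IntermediateField K E} (l : Fin (n + 1) → K) {v : Fin (n + 1) → E}
    (hv : ∀ k, v k ∈ F) : formVal l v ∈ F :=
  sum_mem fun k _ => mul_mem (F.algebraMap_mem _) (hv k)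

theorem injective_eval₂RingHom_of_notMem_cl {R : Type*} [CommRing R] {S : Set E} {φ : R →+* E}
    (hφ : Function.Injective φ) (hφS : ∀ r, φ r ∈ cl K S) {y : E} (hy : y ∉ cl K S) :
    Function.Injective (Polynomial.eval₂RingHom φ y) := by
  let _ : Algebra R E := φ.toAlgebra
  rw [injective_iff_map_eq_zero]
  intro p hp
  by_contra h0
  refine hy (mem_cl_of_isAlgebraic (IsAlgebraic.of_range_subset (A := R) hφ
    (algebraMap (cl K S) E).injective (fun r => ⟨⟨φ r, hφS r⟩, rfl⟩) ⟨p, h0, ?_⟩))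
  exact hp

theorem eval₂RingHom_mem_cl {R : Type*} [CommRing R] {S : Set E} {φ : R →+* E}
    (hφS : ∀ r, φ r ∈ cl K S) {y : E} (hy : y ∈ cl K S) (p : Polynomial R) :
    Polynomial.eval₂RingHom φ y p ∈ cl K S := by
  rw [Polynomial.coe_eval₂RingHom, Polynomial.eval₂_eq_sum_range]
  exact sum_mem fun _ _ => mul_mem (hφS _) (pow_mem hy _)

/-- Independence of `x` and `y` makes evaluation at them injective over `cl K S`, so the dependence
of `q` can be written with polynomial coefficients. -/
theorem exists_eval₃_eq_zero_of_mem_cl {S : Set E} {x y q : E} (hx : x ∉ cl K S)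
    (hy : y ∉ cl K (insert x S)) (hq : q ∈ cl K (insert y (insert x S))) (hq0 : q ∉ cl K S) :
    ∃ Γ : Polynomial (Polynomial (Polynomial (cl K S))),
      eval₃ (algebraMap (cl K S) E) x y q Γ = 0 ∧
      ∃ B : Polynomial (cl K S), B ≠ 0 ∧ ∀ x' y' : cl K S,
        eval₃ (algebraMap (cl K S) E) x' y' q Γ = 0 → B.eval x' = 0 := by
  have hinj : Function.Injective (Polynomial.eval₂RingHom
      (Polynomial.eval₂RingHom (algebraMap (cl K S) E) x) y) := by
    refine injective_eval₂RingHom_of_notMem_cl (injective_eval₂RingHom_of_notMem_cl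
      (algebraMap (cl K S) E).injective (fun r => r.2) hx) ?_ hy
    exact eval₂RingHom_mem_cl (fun r => cl_mono (Set.subset_insert _ _) r.2)
      (mem_cl_of_mem (Set.mem_insert _ _))
  refine exists_eval₃_eq_zero hinj ?_ fun h => hq0 (mem_cl_of_isAlgebraic h)
  have h1 : insert y (insert x S) = S ∪ {y, x} := by
    ext
    simp only [Set.mem_insert_iff, Set.mem_union, Set.mem_singleton_iff]
    tauto
  rw [h1] at hq
  let _ : Algebra (Polynomial (Polynomial (cl K S))) E := RingHom.toAlgebra
    (Polynomial.eval₂RingHom (Polynomial.eval₂RingHom (algebraMap (cl K S) E) x) y)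
  have h2 : IsAlgebraic (Polynomial (Polynomial (cl K S))) q := by
    refine (isAlgebraic_of_mem_cl_union hq).of_range_subset Subtype.val_injective hinj ?_
    rintro ⟨e, he⟩
    change ∃ b, Polynomial.eval₂RingHom (Polynomial.eval₂RingHom (algebraMap (cl K S) E) x) y b = e
    induction he using Algebra.adjoin_induction with
    | mem e he =>
      rcases he with rfl | rfl
      · exact ⟨Polynomial.X, by simp⟩
      · exact ⟨Polynomial.C Polynomial.X, by simp⟩
    | algebraMap r => exact ⟨Polynomial.C (Polynomial.C r), by simp⟩
    | add a b _ _ ha hb =>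
      obtain ⟨a', rfl⟩ := ha
      obtain ⟨b', rfl⟩ := hb
      exact ⟨a' + b', map_add _ _ _⟩
    | mul a b _ _ ha hb =>
      obtain ⟨a', rfl⟩ := ha
      obtain ⟨b', rfl⟩ := hb
      exact ⟨a' * b', map_mul _ _ _⟩
  obtain ⟨Γ, h0, hΓ⟩ := h2
  exact ⟨Γ, h0, hΓ⟩

theorem mul_notMem_cl {S : Set E} {a b : E} (ha : a ∉ cl K S) (hb : b ∉ cl K (insert a S)) :
    a * b ∉ cl K S := by
  intro h
  have ha0 : a ≠ 0 := fun h0 => ha (h0 ▸ zero_mem _)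
  apply hb
  have : b = a * b / a := by field_simp
  rw [this]
  exact div_mem (cl_mono (Set.subset_insert _ _) h) (mem_cl_of_mem (Set.mem_insert _ _))

/-- Independent elements `a` and `b` satisfy no linear relation over the closure of their
product. -/
theorem eq_zero_of_linear_relation {S : Set E} {a b α β γ : E} (ha : a ∉ cl K S)
    (hb : b ∉ cl K (insert a S)) (hα : α ∈ cl K (insert (a * b) S))
    (hβ : β ∈ cl K (insert (a * b) S)) (hγ : γ ∈ cl K (insert (a * b) S))
    (h : α * a + β * b + γ = 0) : α = 0 ∧ β = 0 := by
  have ha0 : a ≠ 0 := fun h0 => ha (h0 ▸ zero_mem _)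
  have hb0 : b ≠ 0 := fun h0 => hb (h0 ▸ zero_mem _)
  have hq : a * b ∈ cl K (insert (a * b) S) := mem_cl_of_mem (Set.mem_insert _ _)
  have key : a ∉ cl K (insert (a * b) S) := by
    intro h1
    have h2 : a * b ∈ cl K (insert a S) := cl_exchange ha h1
    apply hb
    have : b = a * b / a := by field_simp
    rw [this]
    exact div_mem h2 (mem_cl_of_mem (Set.mem_insert _ _))
  -- Multiplied by `a`, the relation becomes `α a² + γ a + β (ab) = 0`, which would make `a`
  -- algebraic over the closure of `ab`.
  have hα0 : α = 0 := by
    by_contra hα0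
    apply key
    refine mem_cl_of_isAlgebraic ⟨Polynomial.C ⟨α, hα⟩ * Polynomial.X ^ 2 +
      Polynomial.C ⟨γ, hγ⟩ * Polynomial.X + Polynomial.C (⟨β, hβ⟩ * ⟨a * b, hq⟩), ?_, ?_⟩
    · intro h0
      have := congr_arg (fun p => p.coeff 2) h0
      simp at this
      exact hα0 (congr_arg Subtype.val this)
    · simp only [map_add, map_mul, map_pow, Polynomial.aeval_C, Polynomial.aeval_X]
      change α * a ^ 2 + γ * a + β * (a * b) = 0
      linear_combination a * h
  refine ⟨hα0, ?_⟩
  by_contra hβ0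
  apply key
  have h1 : a = a * b * β / (-γ) := by
    have : γ ≠ 0 := by
      rintro rfl
      rw [hα0] at h
      simp [hβ0, hb0] at h
    rw [eq_div_iff (neg_ne_zero.2 this)]
    rw [hα0] at h
    linear_combination (-a) * h
  have h2 := div_mem (mul_mem hq hβ) (neg_mem hγ)
  rwa [← h1] at h2

/-- If the points of a finite family are not rational over `cl K S`, and one of them generates an
extension of transcendence degree two, with basis `a, b`, then there is a hypersurface through it
that is defined over the closure of `a b` and whose points over `cl K S` lie in finitely many
members of a pencil of hyperplanes, none of which contains a point of the family. -/
theorem exists_hypersurface [Infinite K] {S : Set E} {a b : E} (ha : a ∉ cl K S)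
    (hb : b ∉ cl K (insert a S)) {T : Type*} [Finite T] (ξ : T → Fin (n + 1) → E)
    (hξ : ∀ t, ξ t ≠ 0) (hrat : ∀ t, ∀ c : E, c ≠ 0 → ∃ k, ξ t k / c ∉ cl K S) (t₀ : T)
    {z : Fin (n + 1) → E} {e : E} (he : e ≠ 0) (hez : ξ t₀ = e • z) {c₀ : Fin (n + 1)}
    (hz : z c₀ = 1) (hzab : ∀ k, z k ∈ cl K (insert a (insert b S)))
    (haz : a ∈ cl K (S ∪ Set.range z)) (hbz : b ∈ cl K (S ∪ Set.range z)) :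
    ∃ l₀ l₁ : Fin (n + 1) → K, (∀ t, formVal l₀ (ξ t) ≠ 0) ∧
      (∀ t, formVal l₁ (ξ t) / formVal l₀ (ξ t) ∉ cl K S) ∧
      ∃ B : Polynomial (cl K S), B ≠ 0 ∧
      ∃ d, ∃ f : MvPolynomial (Fin (n + 1)) (cl K (insert (a * b) S)), f.IsHomogeneous d ∧
        MvPolynomial.aeval (ξ t₀) f = 0 ∧
        ∀ v : Fin (n + 1) → cl K S, MvPolynomial.aeval (fun k => (v k : E)) f = 0 →
          formVal l₀ v = 0 ∨ B.eval (formVal l₁ v / formVal l₀ v) = 0 := by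
  obtain ⟨s₀, hs₀⟩ := (finite_setOf_exists_sum_pow_mem (fun _ : T => (⊥ : Submodule K E)) ξ
    fun t => by
      by_contra! h
      exact hξ t (funext fun k => (Submodule.mem_bot K).1 (h k))).infinite_compl.nonempty
  let l₀ : Fin (n + 1) → K := fun k => s₀ ^ (k : ℕ)
  have hl₀ : ∀ t, formVal l₀ (ξ t) ≠ 0 := by
    intro t h
    exact hs₀ ⟨t, (Submodule.mem_bot K).2 h⟩
  -- `l₁` is chosen so that the pencil parameter `l₁ / l₀` is not in `cl K S` at any point of the
  -- family; then the point lies on no rational member of the pencil.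
  obtain ⟨s₁, hs₁⟩ := (finite_setOf_exists_sum_pow_mem
    (fun _ : T => (cl K S).toSubalgebra.toSubmodule)
    (fun t k => ξ t k / formVal l₀ (ξ t)) fun t => hrat t _ (hl₀ t)).infinite_compl.nonempty
  let l₁ : Fin (n + 1) → K := fun k => s₁ ^ (k : ℕ)
  have hl₁ : ∀ t, formVal l₁ (ξ t) / formVal l₀ (ξ t) ∉ cl K S := by
    intro t h
    rw [← formVal_div] at h
    exact hs₁ ⟨t, h⟩
  refine ⟨l₀, l₁, hl₀, hl₁, ?_⟩
  set x := formVal l₁ (ξ t₀) / formVal l₀ (ξ t₀) with hxdef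
  have hlz : formVal l₀ z ≠ 0 := by
    have := hl₀ t₀
    rw [hez, formVal_smul] at this
    exact right_ne_zero_of_mul this
  have hxz : x = formVal l₁ z / formVal l₀ z := by
    rw [hxdef, hez, formVal_smul, formVal_smul, mul_div_mul_left _ _ he]
  have hx : x ∉ cl K S := hl₁ t₀
  -- Otherwise all of `z` is algebraic over `x`: the coordinate `c₀`, where `z` is `1`, first gives
  -- `1 / l₀(z)`. But `z` determines the independent elements `a` and `b`.
  obtain ⟨c, hc⟩ : ∃ c, z c / formVal l₀ z ∉ cl K (insert x S) := by
    by_contra! hcon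
    have hz' : ∀ k, z k ∈ cl K (insert x S) := by
      intro k
      have h0 := hcon c₀
      rw [hz] at h0
      have h1 := div_mem (hcon k) h0
      rwa [div_div_div_cancel_right₀ hlz, div_one] at h1
    have hle : cl K (S ∪ Set.range z) ≤ cl K (insert x S) := by
      refine cl_le (Set.union_subset (fun s hs => mem_cl_of_mem (Or.inr hs)) ?_)
      rintro _ ⟨k, rfl⟩
      exact hz' k
    have hxa := cl_exchange ha (hle haz)
    refine hb (cl_le (Set.insert_subset hxa ?_) (hle hbz))
    exact fun s hs => mem_cl_of_mem (Or.inr hs)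
  have hq : a * b ∈ cl K (insert (z c / formVal l₀ z) (insert x S)) := by
    refine cl_insert_insert_le (a := a) (b := b) ?_ ?_ hx hc (mul_mem (mem_cl_of_mem (Or.inl rfl))
      (mem_cl_of_mem (Or.inr (Or.inl rfl))))
    · rw [hxz]
      exact div_mem (formVal_mem _ hzab) (formVal_mem _ hzab)
    · exact div_mem (hzab c) (formVal_mem _ hzab)
  obtain ⟨Γ, hΓ, B, hB, hΓB⟩ := exists_eval₃_eq_zero_of_mem_cl hx hc hq (mul_notMem_cl ha hb)
  let Q := cl K (insert (a * b) S)
  let ι : cl K S →+* Q := (IntermediateField.inclusion (cl_mono (Set.subset_insert _ _))).toRingHom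
  let q : Q := ⟨a * b, mem_cl_of_mem (Set.mem_insert _ _)⟩
  -- Inserting `ab` for the third variable gives a plane curve over `Q` in the coordinates `l₁ / l₀`
  -- and `X c / l₀`; its homogenisation is the hypersurface.
  let g : Polynomial (Polynomial Q) := Polynomial.eval₂RingHom
    (Polynomial.mapRingHom (Polynomial.mapRingHom ι)) (Polynomial.C (Polynomial.C q)) Γ
  have hg : ∀ x y : E, Polynomial.eval₂ (Polynomial.eval₂RingHom (algebraMap Q E) x) y g =
      eval₃ (algebraMap (cl K S) E) x y (a * b) Γ := by
    intro x y
    have : (Polynomial.eval₂RingHom (Polynomial.eval₂RingHom (algebraMap Q E) x) y).comp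
        (Polynomial.eval₂RingHom (Polynomial.mapRingHom (Polynomial.mapRingHom ι))
          (Polynomial.C (Polynomial.C q))) = eval₃ (algebraMap (cl K S) E) x y (a * b) := by
      refine Polynomial.ringHom_ext' (Polynomial.ringHom_ext' (Polynomial.ringHom_ext' ?_ ?_) ?_) ?_
      · ext r
        simp [eval₃]
        rfl
      · simp [eval₃]
      · simp [eval₃]
      · simp [eval₃]
        rfl
    exact DFunLike.congr_fun this Γ
  let L : Fin 3 → MvPolynomial (Fin (n + 1)) Q :=
    ![∑ k, MvPolynomial.C (algebraMap K Q (l₀ k)) * MvPolynomial.X k,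
      ∑ k, MvPolynomial.C (algebraMap K Q (l₁ k)) * MvPolynomial.X k, MvPolynomial.X c]
  have hlin : ∀ l : Fin (n + 1) → K, (∑ k, MvPolynomial.C (algebraMap K Q (l k)) *
      MvPolynomial.X k : MvPolynomial (Fin (n + 1)) Q).IsHomogeneous 1 := fun l =>
    isHomogeneous_linearForm Finset.univ fun k => algebraMap K Q (l k)
  obtain ⟨d, f, hf, hfv⟩ := exists_homogenization.{u} (L := L) (by
    intro i
    fin_cases i
    · exact hlin l₀
    · exact hlin l₁
    · exact MvPolynomial.isHomogeneous_X _ _) g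
  have hL : ∀ (l : Fin (n + 1) → K) (v : Fin (n + 1) → E), MvPolynomial.aeval v (∑ k,
      MvPolynomial.C (algebraMap K Q (l k)) * MvPolynomial.X k : MvPolynomial (Fin (n + 1)) Q) =
      formVal l v := by
    intro l v
    simp only [map_sum, map_mul, MvPolynomial.aeval_C, MvPolynomial.aeval_X, formVal]
    rfl
  have hL0 : ∀ v : Fin (n + 1) → E, MvPolynomial.aeval v (L 0) = formVal l₀ v := hL l₀
  have hL1 : ∀ v : Fin (n + 1) → E, MvPolynomial.aeval v (L 1) = formVal l₁ v := hL l₁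
  have hL2 : ∀ v : Fin (n + 1) → E, MvPolynomial.aeval v (L 2) = v c :=
    fun v => MvPolynomial.aeval_X _ _
  have hfv' : ∀ v : Fin (n + 1) → E, formVal l₀ v ≠ 0 → MvPolynomial.aeval v f =
      formVal l₀ v ^ d * eval₃ (algebraMap (cl K S) E) (formVal l₁ v / formVal l₀ v)
        (v c / formVal l₀ v) (a * b) Γ := by
    intro v hv
    rw [hfv v (by rwa [hL0]), hg, hL0, hL1, hL2]
  refine ⟨B, hB, d, f, hf, ?_, fun v hv => ?_⟩
  · rw [hfv' _ (hl₀ t₀)]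
    have : ξ t₀ c / formVal l₀ (ξ t₀) = z c / formVal l₀ z := by
      rw [hez, formVal_smul, Pi.smul_apply, smul_eq_mul, mul_div_mul_left _ _ he]
    rw [this, hΓ, mul_zero]
  · by_cases h0 : formVal l₀ v = 0
    · exact Or.inl h0
    · right
      have hval : ∀ l : Fin (n + 1) → K, formVal l (fun k => (v k : E)) = (formVal l v : cl K S) := by
        intro l
        rw [formVal, formVal, AddSubmonoidClass.coe_finsetSum]
        rfl
      have h0' : formVal l₀ (fun k => (v k : E)) ≠ 0 := by
        rw [hval]
        exact fun h => h0 (Subtype.ext h)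
      rw [hfv' _ h0', mul_eq_zero] at hv
      refine hΓB _ (v c / formVal l₀ v) ?_
      rw [hval, hval] at hv
      exact hv.resolve_left (pow_ne_zero _ (fun h => h0 (Subtype.ext h)))

end
end
end ChowForms

namespace ChowForms
noncomputable section

/-! ### Splittings and wedges at points -/

section
variable {ℓ n : ℕ}

/-- Replace the `i`-th linear form. -/
def setGroup {E : Type*} (i : Fin (ℓ + 1)) (ν : Fin (n + 1) → E) (u : Idx ℓ n → E) : Idx ℓ n → E :=
  fun p => if p.1 = i then ν p.2 else u p

theorem setGroup_setGroup {E : Type*} (i : Fin (ℓ + 1)) (ν ν' : Fin (n + 1) → E) (u : Idx ℓ n → E) :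
    setGroup i ν (setGroup i ν' u) = setGroup i ν u := by
  funext p
  by_cases h : p.1 = i <;> simp [setGroup, h]

theorem setGroup_self {E : Type*} {i : Fin (ℓ + 1)} {ν : Fin (n + 1) → E} {u : Idx ℓ n → E}
    (h : ∀ k, u (i, k) = ν k) : setGroup i ν u = u := by
  funext ⟨a, k⟩
  by_cases ha : a = i
  · subst ha
    simp [setGroup, h]
  · simp [setGroup, ha]

theorem eval_map_asPolyIn {A L : Type u} [CommRing A] [CommRing L] [Algebra A L] (i : Fin (ℓ + 1))
    (R : MvPolynomial (Idx ℓ n) A) (u : Idx ℓ n → L) (ν : Fin (n + 1) → L) :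
    MvPolynomial.eval ν (MvPolynomial.map (MvPolynomial.aeval u : _ →ₐ[A] L).toRingHom
      (asPolyIn i R)) = MvPolynomial.aeval (setGroup i ν u) R := by
  have : (((MvPolynomial.eval ν).comp (MvPolynomial.map
      (MvPolynomial.aeval u : _ →ₐ[A] L).toRingHom)).comp
      (MvPolynomial.aeval (fun p : Idx ℓ n => if p.1 = i then MvPolynomial.X p.2 else
        (MvPolynomial.C (MvPolynomial.X p) : MvPolynomial (Fin (n + 1)) (MvPolynomial (Idx ℓ n) A)))
        : _ →ₐ[A] _).toRingHom) = (MvPolynomial.aeval (setGroup i ν u) : _ →ₐ[A] L).toRingHom := by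
    refine MvPolynomial.ringHom_ext (fun r => ?_) fun p => ?_
    · simp [MvPolynomial.algebraMap_apply, MvPolynomial.algebraMap_eq]
    · by_cases h : p.1 = i <;> simp [setGroup, h]
  exact DFunLike.congr_fun this R

/-- When the other groups take values in an algebraically closed subfield `F`, the points of the
splitting can already be found over `F`. -/
theorem IsResultantOn.exists_splitting_aeval {A F E : Type u} [CommRing A] [IsReduced A] [Field F]
    [IsAlgClosed F] [Field E] [Algebra A F] [Algebra A E] [Algebra F E] [IsScalarTower A F E]
    {I : Finset (Fin (ℓ + 1))} {D : Fin (ℓ + 1) → ℕ} {R : MvPolynomial (Idx ℓ n) A}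
    (h : IsResultantOn I D A R) {i : Fin (ℓ + 1)} (hi : i ∈ I) {u : Idx ℓ n → E}
    (hu : ∀ p : Idx ℓ n, p.1 ≠ i → ∃ a, algebraMap F E a = u p) :
    ∃ (y : F) (x : Fin (D i) → Fin (n + 1) → F), ∀ ν : Fin (n + 1) → E,
      MvPolynomial.aeval (setGroup i ν u) R =
        algebraMap F E y * ∏ t, ∑ k, algebraMap F E (x t k) * ν k := by
  choose! a ha using hu
  obtain ⟨y, x, hx⟩ := h.exists_splitting hi F (MvPolynomial.aeval a : _ →ₐ[A] F).toRingHom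
  refine ⟨y, x, fun ν => ?_⟩
  have h1 : (MvPolynomial.map (algebraMap F E) (MvPolynomial.map
      (MvPolynomial.aeval a : _ →ₐ[A] F).toRingHom (asPolyIn i R))) = MvPolynomial.map
      (MvPolynomial.aeval (fun p => algebraMap F E (a p)) : _ →ₐ[A] E).toRingHom (asPolyIn i R) := by
    have h0 : (algebraMap F E).comp (MvPolynomial.aeval a : _ →ₐ[A] F).toRingHom =
        (MvPolynomial.aeval (fun p => algebraMap F E (a p)) : _ →ₐ[A] E).toRingHom := by
      refine MvPolynomial.ringHom_ext (fun r => ?_) fun p => ?_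
      · simp [← IsScalarTower.algebraMap_apply]
      · simp
    rw [MvPolynomial.map_map, h0]
  have h2 := congr_arg (MvPolynomial.eval ν) h1
  rw [eval_map_asPolyIn, hx, map_mul, MvPolynomial.map_C, map_prodLinear, map_mul,
    MvPolynomial.eval_C, eval_prodLinear] at h2
  rw [h2]
  congr 2
  funext p
  by_cases hp : p.1 = i
  · simp [setGroup, hp]
  · simp [setGroup, hp, ha]

/-- The wedge can be computed from any splitting at `u`, not just from the one supplied by its
definition. -/
theorem IsWedgeAt.aeval_eq {A E : Type u} [CommRing A] [Field E] [IsAlgClosed E] [Algebra A E]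
    {i : Fin (ℓ + 1)} {d D : ℕ} {f : MvPolynomial (Fin (n + 1)) A} {R w : MvPolynomial (Idx ℓ n) A}
    (h : IsWedgeAt i d D f R w) (hf : f.IsHomogeneous d) (u : Idx ℓ n → E) {y : E}
    {x : Fin D → Fin (n + 1) → E} (hx : ∀ ν : Fin (n + 1) → E,
      MvPolynomial.aeval (setGroup i ν u) R = y * ∏ t, ∑ k, x t k * ν k) :
    MvPolynomial.aeval u w = y ^ d * ∏ t, MvPolynomial.aeval (x t) f := by
  obtain ⟨y', x', hx', hw⟩ := h E (MvPolynomial.aeval u : _ →ₐ[A] E).toRingHom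
  have h1 : MvPolynomial.C y' * prodLinear D x' = MvPolynomial.C y * prodLinear D x := by
    rw [← hx']
    refine MvPolynomial.funext fun ν => ?_
    rw [eval_map_asPolyIn, hx, map_mul, MvPolynomial.eval_C, eval_prodLinear]
  have hmap : MvPolynomial.map (MvPolynomial.aeval u : _ →ₐ[A] E).toRingHom
      (MvPolynomial.map MvPolynomial.C f) = MvPolynomial.map (algebraMap A E) f := by
    have h0 : (MvPolynomial.aeval u : _ →ₐ[A] E).toRingHom.comp MvPolynomial.C =
        algebraMap A E := RingHom.ext fun r => by simp
    rw [MvPolynomial.map_map, h0]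
  rw [hmap] at hw
  have h2 := wedge_value_unique (hf.map (algebraMap A E)) h1
  refine (hw.trans h2).trans ?_
  congr 1
  exact Finset.prod_congr rfl fun t _ => by rw [MvPolynomial.eval_map, MvPolynomial.aeval_def]

theorem IsAlternating.map {A B : Type u} [CommRing A] [CommRing B] (φ : A →+* B)
    {R : MvPolynomial (Idx ℓ n) A} (h : IsAlternating R) : IsAlternating (MvPolynomial.map φ R) := by
  intro i j hij
  have := congr_arg (Polynomial.map (MvPolynomial.map φ)) (h i j hij)
  rw [Polynomial.map_C] at this
  rw [← this]
  have : (MvPolynomial.aeval (fun p : Idx ℓ n =>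
      if p.1 = i then
        Polynomial.C (MvPolynomial.X p) + Polynomial.X * Polynomial.C (MvPolynomial.X (j, p.2))
      else (Polynomial.C (MvPolynomial.X p) : Polynomial (MvPolynomial (Idx ℓ n) B))) :
        _ →ₐ[B] _).toRingHom.comp (MvPolynomial.map φ) =
      (Polynomial.mapRingHom (MvPolynomial.map φ)).comp (MvPolynomial.aeval (fun p : Idx ℓ n =>
      if p.1 = i then
        Polynomial.C (MvPolynomial.X p) + Polynomial.X * Polynomial.C (MvPolynomial.X (j, p.2))
      else (Polynomial.C (MvPolynomial.X p) : Polynomial (MvPolynomial (Idx ℓ n) A))) :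
        _ →ₐ[A] _).toRingHom := by
    refine MvPolynomial.ringHom_ext (fun r => ?_) fun p => ?_
    · simp [IsScalarTower.algebraMap_apply A (MvPolynomial (Idx ℓ n) A) (Polynomial _),
        IsScalarTower.algebraMap_apply B (MvPolynomial (Idx ℓ n) B) (Polynomial _),
        MvPolynomial.algebraMap_eq]
    · by_cases hp : p.1 = i <;> simp [hp]
  exact DFunLike.congr_fun this R

end
end
end ChowForms

namespace ChowForms
noncomputable section

/-! ### The transcendence degree of the points of a resultant -/

section
variable {K : Type u} {E : Type u} [Field K] [Field E] [Algebra K E] {ℓ n : ℕ}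

/-- The combination of the rows of `M` with coefficients `p`. -/
def rowComb (M : Fin (n + 1) → Fin (n + 1) → K) (p : Fin (n + 1) → E) : Fin (n + 1) → E :=
  fun k => ∑ c, algebraMap K E (M c k) * p c

theorem sum_mul_rowComb (M : Fin (n + 1) → Fin (n + 1) → K) (v p : Fin (n + 1) → E) :
    ∑ k, v k * rowComb M p k = ∑ c, formVal (M c) v * p c := by
  simp_rw [rowComb, formVal, Finset.mul_sum, Finset.sum_mul]
  rw [Finset.sum_comm]
  exact Finset.sum_congr rfl fun _ _ => Finset.sum_congr rfl fun _ _ => by ring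

theorem sum_eq_add_add_sum {τ M : Type*} [Fintype τ] [DecidableEq τ] [AddCommMonoid M] {a b : τ}
    (hab : a ≠ b) (g : τ → M) :
    ∑ c, g c = g a + g b + ∑ c ∈ (Finset.univ.erase a).erase b, g c := by
  rw [add_assoc, Finset.add_sum_erase _ _ (Finset.mem_erase.2 ⟨hab.symm, Finset.mem_univ b⟩),
    Finset.add_sum_erase _ _ (Finset.mem_univ a)]

/-- If a resultant vanishes at `l₀` and at finitely many members of the pencil of `l₀` and `l₁`
whenever two of the coordinates are specialised to elements of `k`, then it does so generically. -/
theorem exists_aeval_setGroup_eq_zero {k : Type u} [Field k] [Infinite k] [Algebra K k] [Algebra k E]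
    [IsScalarTower K k E] {C : MvPolynomial (Idx ℓ n) K} {i j : Fin (ℓ + 1)} (hij : i ≠ j)
    {m : Idx ℓ n → k} {M : Fin (n + 1) → Fin (n + 1) → K} {p : Fin (n + 1) → E}
    {J : Set (Fin (n + 1))} (hpJ : ∀ c ∈ J, ∃ r, algebraMap k E r = p c)
    (N : Finset (Fin (n + 1) → k))
    (h : ∀ p' : Fin (n + 1) → k, (∀ c ∈ J, algebraMap k E (p' c) = p c) → ∃ ν ∈ N,
      MvPolynomial.aeval (setGroup i ν (setGroup j (rowComb M p') m)) C = 0) :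
    ∃ ν ∈ N, MvPolynomial.aeval (setGroup i (fun c => algebraMap k E (ν c))
      (setGroup j (rowComb M p) fun r => algebraMap k E (m r))) C = 0 := by
  let G : (Fin (n + 1) → k) → MvPolynomial (Fin (n + 1)) k := fun ν =>
    MvPolynomial.aeval (setGroup i (fun c => MvPolynomial.C (ν c)) (setGroup j
      (fun c => ∑ c', MvPolynomial.C (algebraMap K k (M c' c)) * MvPolynomial.X c')
      fun r => MvPolynomial.C (m r))) C
  have hG : ∀ (F : Type u) [Field F] [Algebra K F] [Algebra k F] [IsScalarTower K k F]
      (p' : Fin (n + 1) → F) (ν : Fin (n + 1) → k), MvPolynomial.aeval p' (G ν) =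
      MvPolynomial.aeval (setGroup i (fun c => algebraMap k F (ν c))
        (setGroup j (rowComb M p') fun r => algebraMap k F (m r))) C := by
    intro F _ _ _ _ p' ν
    have : ((MvPolynomial.aeval p' : _ →ₐ[k] F).restrictScalars K).comp
        (MvPolynomial.aeval (setGroup i (fun c => MvPolynomial.C (ν c)) (setGroup j
        (fun c => ∑ c', MvPolynomial.C (algebraMap K k (M c' c)) * MvPolynomial.X c')
        fun r => MvPolynomial.C (m r)))) = MvPolynomial.aeval
        (setGroup i (fun c => algebraMap k F (ν c))
        (setGroup j (rowComb M p') fun r => algebraMap k F (m r))) := by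
      refine MvPolynomial.algHom_ext fun r => ?_
      simp only [AlgHom.comp_apply, MvPolynomial.aeval_X, AlgHom.restrictScalars_apply]
      by_cases hi : r.1 = i
      · simp [setGroup, hi]
      · by_cases hj : r.1 = j
        · simp [setGroup, hj, hij.symm, rowComb, ← IsScalarTower.algebraMap_apply]
        · simp [setGroup, hi, hj]
    exact DFunLike.congr_fun this C
  -- Which `ν` works depends on the specialisation, but the finite product vanishes at all of them,
  -- hence at `p`.
  have h0 : MvPolynomial.aeval p (∏ ν ∈ N, G ν) = 0 := by
    refine aeval_eq_zero_of_forall_eval J hpJ fun p' hp' => ?_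
    obtain ⟨ν, hν, hν0⟩ := h p' hp'
    rw [map_prod]
    refine Finset.prod_eq_zero hν ?_
    rw [← MvPolynomial.aeval_eq_eval, hG k p' ν]
    exact hν0
  rw [map_prod, Finset.prod_eq_zero_iff] at h0
  obtain ⟨ν, hν, hν0⟩ := h0
  exact ⟨ν, hν, by rwa [hG E p ν] at hν0⟩

/-- A point of a resultant does not generate an extension of transcendence degree two. -/
theorem false_of_transcendence_degree_two [IsAlgClosed K] [IsAlgClosed E]
    {C : MvPolynomial (Idx ℓ n) K} {D : Fin (ℓ + 1) → ℕ} (hC : IsResultantOn Finset.univ D K C)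
    {i j : Fin (ℓ + 1)} (hij : i ≠ j) {m : Idx ℓ n → E} {S : Set E}
    (hS : ∀ r : Idx ℓ n, r.1 ≠ i → r.1 ≠ j → m r ∈ cl K S)
    {M : Fin (n + 1) → Fin (n + 1) → K} {p : Fin (n + 1) → E}
    (hp : ∀ k, m (j, k) = rowComb M p k)
    {y : E} (hy : y ≠ 0) {ξ : Fin (D i) → Fin (n + 1) → E}
    (hsplit : ∀ ν : Fin (n + 1) → E,
      MvPolynomial.aeval (setGroup i ν m) C = y * ∏ t, ∑ k, ξ t k * ν k)
    (hξM : ∀ t c, formVal (M c) (ξ t) ≠ 0) (hξ : ∀ t, ∑ k, ξ t k * m (j, k) = 0)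
    {a b : Fin (n + 1)} (hab : a ≠ b) (hpJ : ∀ c, c ≠ a → c ≠ b → p c ∈ cl K S)
    (ha : p a ∉ cl K S) (hb : p b ∉ cl K (insert (p a) S)) (t₀ : Fin (D i))
    {z : Fin (n + 1) → E} {e : E} (he : e ≠ 0) (hez : ξ t₀ = e • z) {c₀ : Fin (n + 1)}
    (hz : z c₀ = 1) (hzab : ∀ k, z k ∈ cl K (insert (p a) (insert (p b) S)))
    (haz : p a ∈ cl K (S ∪ Set.range z)) (hbz : p b ∈ cl K (S ∪ Set.range z)) : False := by
  classical
  have hrel : ∀ t, ∑ c, formVal (M c) (ξ t) * p c = 0 := by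
    intro t
    rw [← sum_mul_rowComb, ← hξ t]
    exact Finset.sum_congr rfl fun k _ => by rw [hp]
  have hinf : Infinite K := IsAlgClosed.instInfinite
  -- No `ξ t` is rational over `cl K S` up to scaling: the relation `hrel`, in which `p b` has a
  -- nonzero coefficient, would express `p b` by `p a`.
  obtain ⟨l₀, l₁, hl₀, hl₁, B, hB, d, f, hf, hf0, hfk⟩ := exists_hypersurface ha hb ξ
    (fun t h => hξM t a (by rw [h]; simp [formVal])) (by
      intro t c hc
      by_contra! hcon
      have h1 : ∑ c', formVal (M c') (fun k => ξ t k / c) * p c' = 0 := by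
        simp_rw [formVal_div, div_mul_eq_mul_div, ← Finset.sum_div]
        rw [hrel t, zero_div]
      have h2 : ∀ c', formVal (M c') (fun k => ξ t k / c) ∈ cl K (insert (p a) S) :=
        fun c' => cl_mono (Set.subset_insert _ _) (formVal_mem _ hcon)
      have h3 : formVal (M b) (fun k => ξ t k / c) ≠ 0 := by
        rw [formVal_div]
        exact div_ne_zero (hξM t b) hc
      apply hb
      rw [← Finset.add_sum_erase _ _ (Finset.mem_univ b)] at h1
      have h4 : p b = -(∑ c' ∈ Finset.univ.erase b, formVal (M c') (fun k => ξ t k / c) * p c') /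
          formVal (M b) (fun k => ξ t k / c) := by
        rw [eq_div_iff h3]
        linear_combination h1
      rw [h4]
      refine div_mem (neg_mem (sum_mem fun c' hc' => mul_mem (h2 c') ?_)) (h2 b)
      by_cases hca : c' = a
      · rw [hca]
        exact mem_cl_of_mem (Set.mem_insert _ _)
      · exact cl_mono (Set.subset_insert _ _) (hpJ c' hca (Finset.ne_of_mem_erase hc')))
    t₀ he hez hz hzab haz hbz
  let Q := cl K (insert (p a * p b) S)
  have hSQ : ∀ x ∈ cl K S, x ∈ Q := fun x hx => cl_mono (Set.subset_insert _ _) hx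
  have hC' := hC
  rw [IsResultantOn] at hC'
  obtain ⟨⟨w, hw, hwres⟩, -⟩ := (hC' i (Finset.mem_univ i)).2 Q d f hf
  have hCQ : ∀ u : Idx ℓ n → E, MvPolynomial.aeval u (MvPolynomial.map (algebraMap K Q) C) =
      MvPolynomial.aeval u C := fun u => MvPolynomial.aeval_map_algebraMap _ _ _
  -- The value of the wedge does not depend on the `i`-th group; with zero there, all coordinates
  -- outside the `j`-th group lie in `cl K S`.
  let m₁ : Idx ℓ n → E := setGroup i 0 m
  have hm₁S : ∀ r : Idx ℓ n, r.1 ≠ j → m₁ r ∈ cl K S := by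
    intro r hr
    by_cases hri : r.1 = i
    · simp [m₁, setGroup, hri]
    · simpa [m₁, setGroup, hri] using hS r hri hr
  have hm₁ : setGroup j (rowComb M p) m₁ = m₁ := setGroup_self fun k => by
    simp [m₁, setGroup, hij.symm, hp]
  obtain ⟨ζ, η, hη⟩ := hwres.exists_splitting_aeval (F := Q) (E := E) (i := j)
    (Finset.mem_erase.2 ⟨hij.symm, Finset.mem_univ j⟩) (u := m₁)
    (fun r hr => ⟨⟨m₁ r, hSQ _ (hm₁S r hr)⟩, rfl⟩)
  have hval : MvPolynomial.aeval m₁ w = 0 := by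
    rw [hw.aeval_eq hf m₁ (y := y) (x := ξ) fun ν => by
      rw [hCQ, setGroup_setGroup, hsplit], Finset.prod_eq_zero (Finset.mem_univ t₀) hf0, mul_zero]
  -- In `X*ⱼ` the wedge splits over `Q`. A linear factor vanishing at `p` is a linear relation
  -- between `p a` and `p b` over the closure of their product, so it involves neither of them.
  have hrestr : ∀ p' : Fin (n + 1) → E, (∀ c, c ≠ a → c ≠ b → p' c = p c) →
      MvPolynomial.aeval (setGroup j (rowComb M p') m₁) w = 0 := by
    intro p' hp'
    rw [← hm₁, hη, mul_eq_zero, Finset.prod_eq_zero_iff] at hval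
    rw [hη, mul_eq_zero, Finset.prod_eq_zero_iff]
    refine hval.imp_right ?_
    rintro ⟨s, -, hs⟩
    refine ⟨s, Finset.mem_univ s, ?_⟩
    rw [sum_mul_rowComb, sum_eq_add_add_sum hab] at hs ⊢
    have hηQ : ∀ c, formVal (M c) (fun k => algebraMap Q E (η s k)) ∈ Q :=
      fun c => formVal_mem _ fun k => (η s k).2
    obtain ⟨h1, h2⟩ := eq_zero_of_linear_relation ha hb (hηQ a) (hηQ b)
      (sum_mem fun c hc => mul_mem (hηQ c) (hSQ _ (hpJ c
        (Finset.ne_of_mem_erase (Finset.mem_of_mem_erase hc)) (Finset.ne_of_mem_erase hc)))) hs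
    rw [h1, h2] at hs ⊢
    simp only [zero_mul, zero_add] at hs ⊢
    rw [← hs]
    exact Finset.sum_congr rfl fun c hc => by
      rw [hp' c (Finset.ne_of_mem_erase (Finset.mem_of_mem_erase hc)) (Finset.ne_of_mem_erase hc)]
  let k := cl K S
  let ν₀ : Fin (n + 1) → k := fun c => algebraMap K k (l₀ c)
  let ν₁ : k → Fin (n + 1) → k := fun r c => algebraMap K k (l₁ c) - r * algebraMap K k (l₀ c)
  let mk : Idx ℓ n → k := fun r => if hr : r.1 ≠ j then ⟨m₁ r, hm₁S r hr⟩ else 0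
  have hmk : ∀ μ : Fin (n + 1) → E, setGroup j μ (fun r => algebraMap k E (mk r)) =
      setGroup j μ m₁ := by
    intro μ
    funext r
    by_cases hr : r.1 = j
    · simp [setGroup, hr]
    · simp only [setGroup, hr, if_false, mk, ne_eq, not_false_eq_true, dif_pos]
      rfl
  have hν₁ : ∀ (r : k) (x : Fin (n + 1) → E), ∑ c, x c * algebraMap k E (ν₁ r c) =
      formVal l₁ x - algebraMap k E r * formVal l₀ x := by
    intro r x
    simp only [ν₁, formVal, Finset.mul_sum, ← Finset.sum_sub_distrib, map_sub, map_mul,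
      ← IsScalarTower.algebraMap_apply]
    exact Finset.sum_congr rfl fun c _ => by ring
  have hν₀ : ∀ (x : Fin (n + 1) → E), ∑ c, x c * algebraMap k E (ν₀ c) = formVal l₀ x := by
    intro x
    simp only [ν₀, formVal, ← IsScalarTower.algebraMap_apply]
    exact Finset.sum_congr rfl fun c _ => by ring
  -- For values of `p a`, `p b` in `k = cl K S` the points of the splitting are rational over `k`.
  -- Either the constant of the splitting vanishes, or one of the points lies on `f`, hence on the
  -- hyperplane `ν₀` or on one of those given by the roots of `B`.
  obtain ⟨ν, hν, hν0⟩ := exists_aeval_setGroup_eq_zero (k := k) (C := C) hij (m := mk) (M := M)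
    (p := p) (J := {a, b}ᶜ) (fun c hc => by
      rw [Set.mem_compl_iff, Set.mem_insert_iff, Set.mem_singleton_iff, not_or] at hc
      exact ⟨⟨p c, hpJ c hc.1 hc.2⟩, rfl⟩) (insert ν₀ (B.roots.toFinset.image ν₁)) (by
    intro p' hp'
    let pE : Fin (n + 1) → E := fun c => algebraMap k E (p' c)
    let u : Idx ℓ n → E := setGroup j (rowComb M pE) m₁
    suffices ∃ ν ∈ insert ν₀ (B.roots.toFinset.image ν₁),
        MvPolynomial.aeval (setGroup i (fun c => algebraMap k E (ν c)) u) C = 0 by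
      obtain ⟨ν, hν, hν0⟩ := this
      refine ⟨ν, hν, (algebraMap k E).injective ?_⟩
      rw [map_zero, ← hν0, ← MvPolynomial.aeval_algebraMap_apply]
      congr 2
      rw [show u = _ from (hmk _).symm]
      funext r
      by_cases hri : r.1 = i
      · simp [setGroup, hri]
      · by_cases hrj : r.1 = j
        · simp [setGroup, hrj, hij.symm, rowComb, pE]
        · simp [setGroup, hri, hrj]
    have hu : ∀ r : Idx ℓ n, ∃ x, algebraMap k E x = u r := by
      intro r
      by_cases hrj : r.1 = j
      · refine ⟨⟨u r, ?_⟩, rfl⟩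
        simp only [u, setGroup, hrj, if_true]
        exact sum_mem fun c _ => mul_mem (IntermediateField.algebraMap_mem _ _) (p' c).2
      · refine ⟨⟨u r, ?_⟩, rfl⟩
        simp only [u, setGroup, hrj, if_false]
        exact hm₁S r hrj
    obtain ⟨y', ξ', hξ'⟩ := hC.exists_splitting_aeval (F := k) (E := E) (Finset.mem_univ i)
      (u := u) fun r _ => hu r
    have hwu : MvPolynomial.aeval u w = 0 := by
      refine hrestr pE fun c hca hcb => hp' c ?_
      simp [hca, hcb]
    rw [hw.aeval_eq hf u (fun ν => by rw [hCQ, hξ'])] at hwu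
    rcases mul_eq_zero.1 hwu with h0 | h0
    · refine ⟨ν₀, Finset.mem_insert_self _ _, ?_⟩
      rw [hξ', eq_zero_of_pow_eq_zero h0, zero_mul]
    · obtain ⟨t, -, ht⟩ := Finset.prod_eq_zero_iff.1 h0
      have hval' : ∀ l : Fin (n + 1) → K, formVal l (fun c => algebraMap k E (ξ' t c)) =
          algebraMap k E (formVal l (ξ' t)) := by
        intro l
        simp only [formVal, map_sum, map_mul, ← IsScalarTower.algebraMap_apply]
      by_cases h3 : formVal l₀ (ξ' t) = 0
      · refine ⟨ν₀, Finset.mem_insert_self _ _, ?_⟩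
        rw [hξ', Finset.prod_eq_zero (Finset.mem_univ t), mul_zero]
        rw [hν₀, hval', h3, map_zero]
      · have h4 := (hfk (ξ' t) ht).resolve_left h3
        refine ⟨ν₁ (formVal l₁ (ξ' t) / formVal l₀ (ξ' t)), Finset.mem_insert_of_mem
          (Finset.mem_image_of_mem _ (Multiset.mem_toFinset.2
            ((Polynomial.mem_roots hB).2 h4))), ?_⟩
        rw [hξ', Finset.prod_eq_zero (Finset.mem_univ t), mul_zero]
        rw [hν₁, hval', hval', ← map_mul, div_mul_cancel₀ _ h3, sub_self])
  have hm₂ : setGroup i (fun c => algebraMap k E (ν c)) (setGroup j (rowComb M p) fun r =>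
      algebraMap k E (mk r)) = setGroup i (fun c => algebraMap k E (ν c)) m := by
    rw [hmk, hm₁, setGroup_setGroup]
  -- Back at `m`: some `ξ t` would lie on a member of the pencil that avoids all of them.
  rw [hm₂, hsplit, mul_eq_zero, or_iff_right hy, Finset.prod_eq_zero_iff] at hν0
  obtain ⟨t, -, ht⟩ := hν0
  rcases Finset.mem_insert.1 hν with rfl | hν
  · exact hl₀ t ((hν₀ _).symm.trans ht)
  · obtain ⟨r, -, rfl⟩ := Finset.mem_image.1 hν
    rw [hν₁, sub_eq_zero] at ht
    apply hl₁ t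
    rw [ht, mul_div_cancel_right₀ _ (hl₀ t)]
    exact r.2

end
end
end ChowForms

namespace ChowForms
noncomputable section

/-! ### Generic linear forms through a point of a resultant -/

section
variable {K : Type u} {E : Type u} [Field K] [Field E] [Algebra K E] {ℓ n : ℕ}

/-- There are linear coordinates that vanish at none of finitely many points. -/
theorem exists_coordinates [Infinite K] {T : Type*} [Finite T] {ξ : T → Fin (n + 1) → E}
    (hξ : ∀ t, ξ t ≠ 0) : ∃ M : Matrix (Fin (n + 1)) (Fin (n + 1)) K,
      IsUnit M.det ∧ ∀ t c, formVal (M c) (ξ t) ≠ 0 := by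
  obtain ⟨F, hF, hcard⟩ := (finite_setOf_exists_sum_pow_mem (fun _ : T => (⊥ : Submodule K E)) ξ
    fun t => by
      by_contra! h
      exact hξ t (funext fun k => (Submodule.mem_bot K).1
        (h k))).infinite_compl.exists_subset_card_eq (n + 1)
  let e := F.equivFinOfCardEq hcard
  refine ⟨Matrix.vandermonde fun c => (e.symm c : K), isUnit_iff_ne_zero.2
    (Matrix.det_vandermonde_ne_zero_iff.2 (Subtype.val_injective.comp e.symm.injective)),
    fun t c h => hF (e.symm c).2 ⟨t, (Submodule.mem_bot K).2 ?_⟩⟩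
  rw [← h]
  rfl

theorem rowComb_nonsing_inv {M : Matrix (Fin (n + 1)) (Fin (n + 1)) K} (hM : IsUnit M.det)
    (μ : Fin (n + 1) → E) : rowComb M (fun c => ∑ k, algebraMap K E (M⁻¹ k c) * μ k) = μ := by
  funext k
  simp_rw [rowComb, Finset.mul_sum, ← mul_assoc, ← map_mul]
  rw [Finset.sum_comm]
  simp_rw [← Finset.sum_mul, ← map_sum]
  have : ∀ k', ∑ c, M c k * M⁻¹ k' c = if k' = k then 1 else 0 := fun k' => by
    have h1 := congr_fun (congr_fun (Matrix.nonsing_inv_mul M hM) k') k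
    rw [Matrix.mul_apply, Matrix.one_apply] at h1
    rw [← h1]
    exact Finset.sum_congr rfl fun _ _ => mul_comm _ _
  simp [this]

theorem formVal_algebraMap {F : Type*} [Field F] [Algebra K F] [Algebra F E] [IsScalarTower K F E]
    (l : Fin (n + 1) → K) (v : Fin (n + 1) → F) :
    formVal l (fun c => algebraMap F E (v c)) = algebraMap F E (formVal l v) := by
  simp only [formVal, map_sum, map_mul, ← IsScalarTower.algebraMap_apply]

/-- If all but one of the coordinates `p` of a vector on a hyperplane are algebraically
independent, then the vector is a generic point of the hyperplane. -/
theorem aeval_eq_zero_of_algebraicIndependent {N : Type u} [Field N] [Algebra K N] [Algebra N E]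
    [IsScalarTower K N E] (M : Matrix (Fin (n + 1)) (Fin (n + 1)) K) {z : Fin (n + 1) → N}
    {a : Fin (n + 1)} (hMz : formVal (M a) z ≠ 0) {p : Fin (n + 1) → E}
    (hp : ∑ c, formVal (M c) (fun k => algebraMap N E (z k)) * p c = 0)
    (hpi : AlgebraicIndependent N fun c : {c // c ≠ a} => p c)
    {H : MvPolynomial (Fin (n + 1)) N} (hH : MvPolynomial.aeval (rowComb M p) H = 0)
    {p' : Fin (n + 1) → E}
    (hp' : ∑ c, formVal (M c) (fun k => algebraMap N E (z k)) * p' c = 0) :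
    MvPolynomial.aeval (rowComb M p') H = 0 := by
  classical
  -- The equation of the hyperplane solved for the `a`-th coordinate, which parametrises it by the
  -- others.
  let P : Fin (n + 1) → MvPolynomial {c // c ≠ a} N := fun c => if h : c ≠ a then
    MvPolynomial.X ⟨c, h⟩ else
      -∑ c : {c // c ≠ a}, MvPolynomial.C (formVal (M c) z / formVal (M a) z) * MvPolynomial.X c
  have hP : ∀ p : Fin (n + 1) → E, ∑ c, formVal (M c) (fun k => algebraMap N E (z k)) * p c = 0 →
      ∀ c, MvPolynomial.aeval (fun c : {c // c ≠ a} => p c) (P c) = p c := by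
    intro p hp c
    by_cases h : c = a
    · subst h
      simp only [P, ne_eq, not_true_eq_false, dite_false, map_neg, map_sum, map_mul,
        MvPolynomial.aeval_C, MvPolynomial.aeval_X]
      simp_rw [formVal_algebraMap] at hp
      have h0 : algebraMap N E (formVal (M c) z) ≠ 0 := (map_ne_zero _).2 hMz
      rw [← Finset.add_sum_erase _ _ (Finset.mem_univ c)] at hp
      have h1 : ∑ c' : {c' // c' ≠ c}, algebraMap N E (formVal (M c') z / formVal (M c) z) * p c' =
          (∑ c' ∈ Finset.univ.erase c, algebraMap N E (formVal (M c') z) * p c') /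
            algebraMap N E (formVal (M c) z) := by
        rw [Finset.sum_div, ← Finset.sum_subtype (p := fun c' => c' ≠ c) (Finset.univ.erase c)
          (by simp) (fun c' => algebraMap N E (formVal (M c') z / formVal (M c) z) * p c')]
        refine Finset.sum_congr rfl fun c' _ => ?_
        rw [map_div₀]
        ring
      rw [h1, neg_eq_iff_eq_neg, div_eq_iff h0]
      linear_combination hp
    · simp [P, h]
  let s : MvPolynomial (Fin (n + 1)) N →ₐ[N] MvPolynomial {c // c ≠ a} N :=
    MvPolynomial.aeval fun k => ∑ c, MvPolynomial.C (algebraMap K N (M c k)) * P c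
  have hs : ∀ p : Fin (n + 1) → E, ∑ c, formVal (M c) (fun k => algebraMap N E (z k)) * p c = 0 →
      MvPolynomial.aeval (fun c : {c // c ≠ a} => p c) (s H) =
        MvPolynomial.aeval (rowComb M p) H := by
    intro p hp
    rw [← AlgHom.comp_apply, MvPolynomial.comp_aeval]
    congr 2
    funext k
    simp only [map_sum, map_mul, MvPolynomial.aeval_C, hP p hp, rowComb,
      ← IsScalarTower.algebraMap_apply]
  rw [← hs p hp] at hH
  have : s H = 0 := hpi (hH.trans (map_zero _).symm)
  rw [← hs p' hp', this, map_zero]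

/-- The linear form `X*ⱼ` is generic among the linear forms through the normalised point `z` of the
resultant. -/
theorem aeval_eq_zero_of_sum_mul_eq_zero [IsAlgClosed K] [IsAlgClosed E]
    {C : MvPolynomial (Idx ℓ n) K} {D : Fin (ℓ + 1) → ℕ} (hC : IsResultantOn Finset.univ D K C)
    {i j : Fin (ℓ + 1)} (hij : i ≠ j) {m : Idx ℓ n → E} {S : Set E}
    (hS : ∀ r : Idx ℓ n, r.1 ≠ i → r.1 ≠ j → m r ∈ cl K S)
    (hμ : AlgebraicIndependent (cl K S) fun k => m (j, k))
    {y : E} (hy : y ≠ 0) {ξ : Fin (D i) → Fin (n + 1) → E}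
    (hsplit : ∀ ν : Fin (n + 1) → E,
      MvPolynomial.aeval (setGroup i ν m) C = y * ∏ t, ∑ k, ξ t k * ν k)
    (hξ0 : ∀ t, ξ t ≠ 0) (hξS : ∀ t k, ξ t k ∈ cl K (S ∪ Set.range fun k => m (j, k)))
    (hξ : ∀ t, ∑ k, ξ t k * m (j, k) = 0) (t₀ : Fin (D i))
    {z : Fin (n + 1) → E} {e : E} (he : e ≠ 0) (hez : ξ t₀ = e • z) {c₀ : Fin (n + 1)}
    (hz : z c₀ = 1) {H : MvPolynomial (Fin (n + 1)) (cl K (S ∪ Set.range z))}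
    (hH : MvPolynomial.aeval (fun k => m (j, k)) H = 0) {ν : Fin (n + 1) → E}
    (hν : ∑ k, z k * ν k = 0) : MvPolynomial.aeval ν H = 0 := by
  have hinf : Infinite K := IsAlgClosed.instInfinite
  obtain ⟨M, hM, hξM⟩ := exists_coordinates (K := K) hξ0
  set μ : Fin (n + 1) → E := fun k => m (j, k) with hμdef
  let p : Fin (n + 1) → E := fun c => ∑ k, algebraMap K E (M⁻¹ k c) * μ k
  have hpμ : rowComb M p = μ := rowComb_nonsing_inv hM μ
  have hpi : ∀ b, p b ∉ cl K (S ∪ p '' {b}ᶜ) := by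
    rw [← algebraicIndependent_cl_iff]
    have h1 : (M⁻¹.transpose.map (algebraMap K (cl K S))) * (M.transpose.map (algebraMap K (cl K S)))
        = 1 := by
      rw [← Matrix.map_mul, ← Matrix.transpose_mul, Matrix.mul_nonsing_inv M hM,
        Matrix.transpose_one, Matrix.map_one _ (map_zero _) (map_one _)]
    have h2 : p = fun c => ∑ d, algebraMap (cl K S) E
        ((M⁻¹.transpose.map (algebraMap K (cl K S))) c d) * μ d := by
      funext c
      simp only [p, Matrix.map_apply, Matrix.transpose_apply, ← IsScalarTower.algebraMap_apply]
    rw [h2]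
    exact hμ.mulVec h1
  have hze : ∀ k, z k = ξ t₀ k / e := fun k => by
    rw [hez, Pi.smul_apply, smul_eq_mul, mul_div_cancel_left₀ _ he]
  have hec : e = ξ t₀ c₀ := by
    rw [hez, Pi.smul_apply, hz, smul_eq_mul, mul_one]
  have hMz : ∀ c, formVal (M c) z ≠ 0 := fun c h => hξM t₀ c (by
    rw [hez, formVal_smul, h, mul_zero])
  have hrel : ∑ c, formVal (M c) z * p c = 0 := by
    refine (sum_mul_rowComb M z p).symm.trans ?_
    rw [hpμ]
    simp_rw [hze, div_mul_eq_mul_div, ← Finset.sum_div]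
    rw [hξ t₀, zero_div]
  let zN : Fin (n + 1) → cl K (S ∪ Set.range z) := fun k =>
    ⟨z k, mem_cl_of_mem (Or.inr ⟨k, rfl⟩)⟩
  have hzN : (fun k => algebraMap (cl K (S ∪ Set.range z)) E (zN k)) = z := rfl
  -- Suppose `p b` depends on the others over `z`. Adding to `S` all coordinates except `p 0` and `p
  -- b`, both become algebraic over `z`, `p 0` by the linear relation. So `z` has transcendence
  -- degree two, which is impossible.
  have hind : AlgebraicIndependent (cl K (S ∪ Set.range z))
      fun c : {c : Fin (n + 1) // c ≠ 0} => p c := by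
    rw [algebraicIndependent_cl_iff]
    rintro ⟨b, hb0⟩ hb
    let S' : Set E := S ∪ p '' {0, b}ᶜ
    have hS' : S ⊆ S' := Set.subset_union_left
    have hpJ : ∀ c, c ≠ 0 → c ≠ b → p c ∈ cl K S' := fun c h0 h1 =>
      mem_cl_of_mem (Or.inr ⟨c, by simp [h0, h1], rfl⟩)
    have hbz : p b ∈ cl K (S' ∪ Set.range z) := by
      refine cl_mono ?_ hb
      rintro x ((hx | hx) | ⟨⟨c, hc⟩, hcb, rfl⟩)
      · exact Or.inl (hS' hx)
      · exact Or.inr hx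
      · refine Or.inl (Or.inr ⟨c, ?_, rfl⟩)
        have hcb' : c ≠ b := fun h => hcb (Subtype.ext h)
        simp [hc, hcb']
    have haz : p 0 ∈ cl K (S' ∪ Set.range z) := by
      have hmem : ∀ c, formVal (M c) z ∈ cl K (S' ∪ Set.range z) := fun c =>
        formVal_mem _ fun k => mem_cl_of_mem (Or.inr ⟨k, rfl⟩)
      have h1 := hrel
      rw [← Finset.add_sum_erase _ _ (Finset.mem_univ (0 : Fin (n + 1)))] at h1
      have h2 : p 0 = -(∑ c ∈ Finset.univ.erase 0, formVal (M c) z * p c) / formVal (M 0) z := by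
        rw [eq_div_iff (hMz 0)]
        linear_combination h1
      rw [h2]
      refine div_mem (neg_mem (sum_mem fun c hc => mul_mem (hmem c) ?_)) (hmem 0)
      by_cases hcb : c = b
      · rwa [hcb]
      · exact cl_mono Set.subset_union_left (hpJ c (Finset.ne_of_mem_erase hc) hcb)
    have hle : cl K (S ∪ Set.range μ) ≤ cl K (insert (p 0) (insert (p b) S')) := by
      refine cl_le (Set.union_subset (fun x hx => mem_cl_of_mem (Or.inr (Or.inr (hS' hx)))) ?_)
      rintro _ ⟨k, rfl⟩
      rw [← hpμ]
      refine sum_mem fun c _ => mul_mem (IntermediateField.algebraMap_mem _ _) ?_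
      by_cases h0 : c = 0
      · rw [h0]
        exact mem_cl_of_mem (Or.inl rfl)
      · by_cases hcb : c = b
        · rw [hcb]
          exact mem_cl_of_mem (Or.inr (Or.inl rfl))
        · exact cl_mono (fun x hx => Or.inr (Or.inr hx)) (hpJ c h0 hcb)
    refine false_of_transcendence_degree_two hC hij (S := S') (fun r h1 h2 =>
      cl_mono hS' (hS r h1 h2)) (M := M) (p := p) (fun k => ?_) hy hsplit hξM hξ (a := 0) (b := b)
      (Ne.symm hb0) hpJ (fun h => hpi 0 (cl_mono ?_ h)) (fun h => hpi b (cl_mono ?_ h)) t₀ he hez hz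
      (fun k => ?_) haz hbz
    · exact (congr_fun hpμ k).symm
    · refine Set.union_subset_union_right _ (Set.image_mono ?_)
      intro c hc
      simp at hc
      simp [hc.1]
    · rintro x (rfl | hx | ⟨c, hc, rfl⟩)
      · exact Or.inr ⟨0, by simpa using Ne.symm hb0, rfl⟩
      · exact Or.inl hx
      · simp at hc
        exact Or.inr ⟨c, by simp [hc.2], rfl⟩
    · rw [hze, hec]
      exact div_mem (hle (hξS t₀ k)) (hle (hξS t₀ c₀))
  have hνp := rowComb_nonsing_inv hM ν
  rw [← hνp]
  refine aeval_eq_zero_of_algebraicIndependent M (z := zN) (a := 0) ?_ (p := p) ?_ hind ?_ ?_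
  · intro h
    apply hMz 0
    rw [← hzN, formVal_algebraMap, h, map_zero]
  · rw [hzN]
    exact hrel
  · rw [hpμ]
    exact hH
  · refine (sum_mul_rowComb M z _).symm.trans ?_
    rw [hνp]
    exact hν

end
end
end ChowForms

namespace ChowForms
noncomputable section

/-! ### Abstract Chow forms are Chow forms of algebraic sets -/

section
variable {K : Type u} [Field K] {ℓ n : ℕ}

/-- The linear form that an alternating bilinear form associates with a point. -/
def altForm {E : Type*} [CommRing E] [Algebra K E] (B : Fin (n + 1) → Fin (n + 1) → K)
    (x : Fin (n + 1) → E) : Fin (n + 1) → E :=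
  fun k => ∑ k', algebraMap K E (B k k' - B k' k) * x k'

theorem sum_mul_altForm {E : Type*} [CommRing E] [Algebra K E] (B : Fin (n + 1) → Fin (n + 1) → K)
    (x : Fin (n + 1) → E) : ∑ k, x k * altForm B x k = 0 := by
  simp_rw [altForm, map_sub, sub_mul, Finset.sum_sub_distrib, mul_sub, Finset.sum_sub_distrib,
    Finset.mul_sum]
  rw [sub_eq_zero, Finset.sum_comm]
  exact Finset.sum_congr rfl fun _ _ => Finset.sum_congr rfl fun _ _ => by ring

/-- Every linear form through `x` is the contraction of `x` with an alternating matrix: place `v / x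
c` in one column, where `x c ≠ 0`. -/
theorem exists_altForm_eq {x : Fin (n + 1) → K} (hx : x ≠ 0) {v : Fin (n + 1) → K}
    (hv : ∑ k, v k * x k = 0) : ∃ B : Fin (n + 1) → Fin (n + 1) → K, altForm B x = v := by
  obtain ⟨c, hc⟩ := Function.ne_iff.1 hx
  rw [Pi.zero_apply] at hc
  refine ⟨fun k k' => if k' = c then v k / x c else 0, ?_⟩
  funext k
  simp only [altForm, Algebra.algebraMap_self, RingHom.id_apply, sub_mul, Finset.sum_sub_distrib,
    ite_mul, zero_mul, Finset.sum_ite_eq', Finset.mem_univ, if_true]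
  rw [div_mul_cancel₀ _ hc]
  by_cases hk : k = c
  · simp only [hk, if_true, div_mul_eq_mul_div]
    rw [← Finset.sum_div, hv, zero_div, sub_zero]
  · simp [hk]

/-- The equations of the algebraic set that belongs to an abstract Chow form. -/
def altPoly (C : MvPolynomial (Idx ℓ n) K) (B : Fin (ℓ + 1) → Fin (n + 1) → Fin (n + 1) → K) :
    MvPolynomial (Fin (n + 1)) K :=
  MvPolynomial.aeval (fun r : Idx ℓ n => altForm (B r.1) MvPolynomial.X r.2) C

theorem aeval_altPoly {E : Type*} [CommRing E] [Algebra K E] (C : MvPolynomial (Idx ℓ n) K)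
    (B : Fin (ℓ + 1) → Fin (n + 1) → Fin (n + 1) → K) (x : Fin (n + 1) → E) :
    MvPolynomial.aeval x (altPoly C B) =
      MvPolynomial.aeval (fun r : Idx ℓ n => altForm (B r.1) x r.2) C := by
  rw [altPoly, ← AlgHom.comp_apply, MvPolynomial.comp_aeval]
  congr 2
  funext r
  simp only [altForm, map_sum, map_mul, MvPolynomial.aeval_X, AlgHom.commutes]

theorem altForm_smul {E : Type*} [CommRing E] [Algebra K E] (B : Fin (n + 1) → Fin (n + 1) → K)
    (c : K) (x : Fin (n + 1) → E) :
    altForm (c • B) x = fun k => algebraMap K E c * altForm B x k := by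
  funext k
  simp only [altForm, Pi.smul_apply, smul_eq_mul, ← mul_sub, map_mul, Finset.mul_sum, mul_assoc]

/-- A common zero of the `altPoly C B` is a common zero of their homogeneous components. -/
theorem aeval_homogeneousComponent_altPoly [Infinite K] {E : Type*} [Field E] [Algebra K E]
    {C : MvPolynomial (Idx ℓ n) K} {x : Fin (n + 1) → E}
    (h : ∀ B : Fin (ℓ + 1) → Fin (n + 1) → Fin (n + 1) → K,
      MvPolynomial.aeval (fun r : Idx ℓ n => altForm (B r.1) x r.2) C = 0)
    (B : Fin (ℓ + 1) → Fin (n + 1) → Fin (n + 1) → K) (d : ℕ) :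
    MvPolynomial.aeval x (MvPolynomial.homogeneousComponent d (altPoly C B)) = 0 := by
  set f := altPoly C B with hf
  let q : Polynomial E := ∑ j ∈ Finset.range (f.totalDegree + 1),
    Polynomial.monomial j (MvPolynomial.aeval x (MvPolynomial.homogeneousComponent j f))
  have hq : ∀ c : K, q.eval (algebraMap K E c) = 0 := by
    intro c
    have h1 := h fun i => c • B i
    have h2 : MvPolynomial.aeval (fun k => algebraMap K E c * x k) f = 0 := by
      rw [hf, aeval_altPoly, ← h1]
      congr 2
      funext r
      rw [altForm_smul]
      simp only [altForm, Finset.mul_sum]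
      exact Finset.sum_congr rfl fun _ _ => by ring
    rw [← f.sum_homogeneousComponent, map_sum] at h2
    rw [← h2, Polynomial.eval_finsetSum]
    refine Finset.sum_congr rfl fun j _ => ?_
    rw [Polynomial.eval_monomial, MvPolynomial.aeval_def, MvPolynomial.aeval_def,
      ← MvPolynomial.eval_map, ← MvPolynomial.eval_map, mul_comm]
    exact (eval_smul_of_isHomogeneous
      ((MvPolynomial.homogeneousComponent_isHomogeneous j f).map _) _ x).symm
  have hq0 : q = 0 := by
    refine Polynomial.eq_zero_of_infinite_isRoot q (Set.Infinite.mono ?_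
      (Set.infinite_range_of_injective (algebraMap K E).injective))
    rintro _ ⟨c, rfl⟩
    exact hq c
  by_cases hd : d ≤ f.totalDegree
  · have := congr_arg (fun p => p.coeff d) hq0
    simp only [q, Polynomial.finsetSum_coeff, Polynomial.coeff_monomial, Polynomial.coeff_zero,
      Finset.sum_ite_eq'] at this
    simpa [Nat.lt_succ_iff, hd] using this
  · rw [MvPolynomial.homogeneousComponent_eq_zero _ _ (not_le.1 hd), map_zero]

/-- The set of points `x` such that `C` vanishes at all families of linear forms through `x`. -/
def chowSet (C : MvPolynomial (Idx ℓ n) K) : Set (ProjSpace K n) :=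
  zeroLocus {f | ∃ B d, f = MvPolynomial.homogeneousComponent d (altPoly C B)}

theorem isHomogeneous_of_mem_chowSet_equations {C : MvPolynomial (Idx ℓ n) K} :
    ∀ f ∈ {f | ∃ B d, f = MvPolynomial.homogeneousComponent d (altPoly C B)},
      ∃ d, f.IsHomogeneous d := by
  rintro _ ⟨B, d, rfl⟩
  exact ⟨d, MvPolynomial.homogeneousComponent_isHomogeneous d _⟩

theorem isClosed_chowSet (C : MvPolynomial (Idx ℓ n) K) : IsClosed (chowSet C) :=
  isClosed_zeroLocus isHomogeneous_of_mem_chowSet_equations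

theorem eval_eq_zero_of_mem_chowSet {C : MvPolynomial (Idx ℓ n) K} {x : ProjSpace K n}
    (hx : x ∈ chowSet C) {lam : Fin (ℓ + 1) → Fin (n + 1) → K}
    (h : ∀ i, ∑ k, lam i k * x.coords k = 0) :
    MvPolynomial.eval (fun p : Idx ℓ n => lam p.1 p.2) C = 0 := by
  choose B hB using fun i => exists_altForm_eq x.coords_ne_zero (h i)
  have h1 : MvPolynomial.aeval x.coords (altPoly C B) = 0 := by
    rw [← (altPoly C B).sum_homogeneousComponent, map_sum]
    refine Finset.sum_eq_zero fun d _ => ?_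
    rw [MvPolynomial.aeval_eq_eval]
    exact hx _ ⟨B, d, rfl⟩
  rw [aeval_altPoly, MvPolynomial.aeval_eq_eval] at h1
  rw [← h1]
  simp only [hB]

end
end
end ChowForms

namespace ChowForms
noncomputable section

/-! ### Generic zeros of irreducible factors -/

section
variable {K : Type u} [Field K] {ℓ n : ℕ}

/-- At a generic zero of an irreducible polynomial involving a variable of the `i`-th group, the
other groups of variables are independent. -/
theorem algebraicIndependent_of_degreeOf_ne_zero {E : Type*} [Field E] [Algebra K E]
    {C₁ : MvPolynomial (Idx ℓ n) K} {m : Idx ℓ n → E}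
    (hm : ∀ P, MvPolynomial.aeval m P = 0 ↔ C₁ ∣ P) {r₀ : Idx ℓ n} (hr₀ : C₁.degreeOf r₀ ≠ 0) :
    AlgebraicIndependent K fun r : {r : Idx ℓ n // r.1 ≠ r₀.1} => m r := by
  classical
  rw [algebraicIndependent_iff]
  intro P hP
  by_contra h0
  have h1 : MvPolynomial.aeval m (MvPolynomial.rename Subtype.val P) = 0 := by
    rw [MvPolynomial.aeval_rename]
    exact hP
  obtain ⟨Q, hQ⟩ := (hm _).1 h1
  have hne : MvPolynomial.rename Subtype.val P ≠ 0 :=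
    (map_ne_zero_iff _ (MvPolynomial.rename_injective _ Subtype.val_injective)).2 h0
  rw [hQ] at hne
  have h2 := MvPolynomial.degreeOf_mul_eq (n := r₀) (left_ne_zero_of_mul hne)
    (right_ne_zero_of_mul hne)
  rw [← hQ] at h2
  have h3 : r₀ ∈ (MvPolynomial.rename Subtype.val P).vars := by
    rw [MvPolynomial.mem_vars_iff_degreeOf_ne_zero]
    omega
  obtain ⟨t, -, ht⟩ := Finset.mem_image.1 (MvPolynomial.vars_rename _ P h3)
  exact t.2 (congr_arg Prod.fst ht)

/-- Specialise the `i`-th group to a `K`-point at which `C` does not vanish identically in the other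
groups; these are independent in `m`. -/
theorem exists_aeval_setGroup_ne_zero {E : Type*} [Field E] [Algebra K E] [Infinite K]
    {C : MvPolynomial (Idx ℓ n) K} (hC : C ≠ 0) {i : Fin (ℓ + 1)} {m : Idx ℓ n → E}
    (hm : AlgebraicIndependent K fun r : {r : Idx ℓ n // r.1 ≠ i} => m r) :
    ∃ ν : Fin (n + 1) → E, MvPolynomial.aeval (setGroup i ν m) C ≠ 0 := by
  obtain ⟨x, hx⟩ := exists_eval_ne_zero hC
  refine ⟨fun k => algebraMap K E (x (i, k)), fun h => hx ?_⟩
  let P : MvPolynomial {r : Idx ℓ n // r.1 ≠ i} K := MvPolynomial.aeval (fun r =>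
    if h : r.1 ≠ i then MvPolynomial.X ⟨r, h⟩ else MvPolynomial.C (x (i, r.2))) C
  have hP : MvPolynomial.aeval (fun r : {r : Idx ℓ n // r.1 ≠ i} => m r) P = 0 := by
    rw [← h, ← AlgHom.comp_apply, MvPolynomial.comp_aeval]
    congr 2
    funext r
    by_cases hr : r.1 = i <;> simp [setGroup, hr]
  have hP0 : P = 0 := hm (hP.trans (map_zero _).symm)
  have h1 : MvPolynomial.aeval (fun r : {r : Idx ℓ n // r.1 ≠ i} => x r) P =
      MvPolynomial.aeval x C := by
    rw [← AlgHom.comp_apply, MvPolynomial.comp_aeval]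
    congr 2
    funext ⟨a, k⟩
    by_cases hr : a = i
    · subst hr
      simp
    · simp [hr]
  rw [← MvPolynomial.aeval_eq_eval, ← h1, hP0, map_zero]

/-- A generic zero of an irreducible factor of an abstract Chow form has a point of the associated
algebraic set in common. -/
theorem IsChowForm.exists_point [IsAlgClosed K] {E : Type u} [Field E] [IsAlgClosed E] [Algebra K E]
    {C C₁ : MvPolynomial (Idx ℓ n) K} (hC : IsChowForm C) (hC0 : C ≠ 0) (hC₁ : Irreducible C₁)
    (hdvd : C₁ ∣ C) {m : Idx ℓ n → E} (hm : ∀ P, MvPolynomial.aeval m P = 0 ↔ C₁ ∣ P) :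
    ∃ z : Fin (n + 1) → E, z ≠ 0 ∧ (∀ j, ∑ k, z k * m (j, k) = 0) ∧
      ∀ B : Fin (ℓ + 1) → Fin (n + 1) → Fin (n + 1) → K,
        MvPolynomial.aeval (fun r : Idx ℓ n => altForm (B r.1) z r.2) C = 0 := by
  classical
  have hinf : Infinite K := IsAlgClosed.instInfinite
  obtain ⟨halt, D, hres⟩ := hC
  obtain ⟨r₀, hr₀⟩ := exists_degreeOf_ne_zero hC₁
  set i := r₀.1 with hi
  have hind : AlgebraicIndependent K fun r : {r : Idx ℓ n // r.1 ≠ i} => m r :=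
    algebraicIndependent_of_degreeOf_ne_zero hm hr₀
  let S₀ : Set E := m '' {r | r.1 ≠ i}
  obtain ⟨y, ξ', hsplit'⟩ := hres.exists_splitting_aeval (F := cl K S₀) (Finset.mem_univ i) (u := m)
    fun r hr => ⟨⟨m r, mem_cl_of_mem ⟨r, hr, rfl⟩⟩, rfl⟩
  let ξ : Fin (D i) → Fin (n + 1) → E := fun t k => ξ' t k
  have hsplit : ∀ ν : Fin (n + 1) → E, MvPolynomial.aeval (setGroup i ν m) C =
      y * ∏ t, ∑ k, ξ t k * ν k := hsplit'
  obtain ⟨ν₀, hν₀⟩ := exists_aeval_setGroup_ne_zero hC0 hind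
  have hν₀' := hν₀
  rw [hsplit, mul_ne_zero_iff, Finset.prod_ne_zero_iff] at hν₀'
  obtain ⟨hy, hξν⟩ := hν₀'
  have hξ0 : ∀ t, ξ t ≠ 0 := fun t h => hξν t (Finset.mem_univ t) (by simp [h])
  have hCm : MvPolynomial.aeval m C = 0 := (hm C).2 hdvd
  obtain ⟨t₀, ht₀⟩ : ∃ t, ∑ k, ξ t k * m (i, k) = 0 := by
    have h1 := hsplit fun k => m (i, k)
    rw [setGroup_self fun k => rfl, hCm, eq_comm, mul_eq_zero, or_iff_right hy,
      Finset.prod_eq_zero_iff] at h1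
    obtain ⟨t, -, ht⟩ := h1
    exact ⟨t, ht⟩
  -- By alternation, adding `c * m j` to the `i`-th form leaves the nonzero value of `C` unchanged.
  -- If `ξ t` were not on `m j`, a suitable `c` would make the `t`-th factor vanish.
  have hξ : ∀ j, j ≠ i → ∀ t, ∑ k, ξ t k * m (j, k) = 0 := by
    intro j hj t
    by_contra hne
    have h1 : ∀ c : E, MvPolynomial.aeval (setGroup i (fun k => ν₀ k + c * m (j, k)) m) C =
        MvPolynomial.aeval (setGroup i ν₀ m) C := by
      intro c
      have := (halt.map (algebraMap K E)).eval_shear hj.symm c (setGroup i ν₀ m)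
      rw [MvPolynomial.eval_map, MvPolynomial.eval_map, ← MvPolynomial.aeval_def,
        ← MvPolynomial.aeval_def] at this
      rw [← this]
      congr 2
      funext r
      by_cases hr : r.1 = i
      · simp [setGroup, shear, hr, hj]
      · simp [setGroup, shear, hr]
    have h2 := h1 (-(∑ k, ξ t k * ν₀ k) / ∑ k, ξ t k * m (j, k))
    apply hν₀
    rw [← h2, hsplit, Finset.prod_eq_zero (Finset.mem_univ t), mul_zero]
    have h3 : ∀ c : E, ∑ k, ξ t k * (ν₀ k + c * m (j, k)) =
        ∑ k, ξ t k * ν₀ k + c * ∑ k, ξ t k * m (j, k) := by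
      intro c
      rw [Finset.mul_sum, ← Finset.sum_add_distrib]
      exact Finset.sum_congr rfl fun k _ => by ring
    rw [h3, div_mul_cancel₀ _ hne, add_neg_cancel]
  obtain ⟨c₀, hc₀⟩ := Function.ne_iff.1 (hξ0 t₀)
  rw [Pi.zero_apply] at hc₀
  let z : Fin (n + 1) → E := fun k => ξ t₀ k / ξ t₀ c₀
  have hez : ξ t₀ = ξ t₀ c₀ • z := by
    funext k
    rw [Pi.smul_apply, smul_eq_mul, mul_div_cancel₀ _ hc₀]
  have hzc : z c₀ = 1 := div_self hc₀
  have hzm : ∀ j, ∑ k, z k * m (j, k) = 0 := by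
    intro j
    have h1 : ∑ k, ξ t₀ k * m (j, k) = 0 := by
      by_cases hj : j = i
      · rw [hj]
        exact ht₀
      · exact hξ j hj t₀
    simp only [z, div_mul_eq_mul_div]
    rw [← Finset.sum_div, h1, zero_div]
  refine ⟨z, fun h => by simp [h] at hzc, hzm, fun B => ?_⟩
  let ν : Fin (ℓ + 1) → Fin (n + 1) → E := fun j => altForm (B j) z
  have hν : ∀ j, ∑ k, z k * ν j k = 0 := fun j => sum_mul_altForm (B j) z
  have hνz : ∀ j k, ν j k ∈ cl K (Set.range z) := fun j k => sum_mem fun k' _ =>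
    mul_mem (IntermediateField.algebraMap_mem _ _) (mem_cl_of_mem ⟨k', rfl⟩)
  -- The groups of `m` are replaced one at a time by forms through `z`. The group `i` comes first,
  -- where the splitting shows at once that `C` vanishes.
  suffices ∀ T : Finset (Fin (ℓ + 1)), MvPolynomial.aeval (fun r : Idx ℓ n =>
      if r.1 ∈ insert i T then ν r.1 r.2 else m r) C = 0 by
    have h1 := this Finset.univ
    simpa using h1
  intro T
  induction T using Finset.induction_on with
  | empty =>
    have h1 : (fun r : Idx ℓ n => if r.1 ∈ insert i (∅ : Finset _) then ν r.1 r.2 else m r) =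
        setGroup i (ν i) m := by
      funext r
      by_cases hr : r.1 = i <;> simp [setGroup, hr]
    rw [h1, hsplit, Finset.prod_eq_zero (Finset.mem_univ t₀), mul_zero]
    rw [hez]
    simp only [Pi.smul_apply, smul_eq_mul, mul_assoc, ← Finset.mul_sum, hν i, mul_zero]
  | insert j T hj ih =>
    by_cases hji : j = i
    · rw [hji, Finset.insert_idem]
      exact ih
    let u : Idx ℓ n → E := fun r => if r.1 ∈ insert i T then ν r.1 r.2 else m r
    have hset : (fun r : Idx ℓ n => if r.1 ∈ insert i (insert j T) then ν r.1 r.2 else m r) =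
        setGroup j (ν j) u := by
      funext r
      by_cases hr : r.1 = j
      · simp [setGroup, hr]
      · simp [setGroup, hr, u]
    rw [hset]
    let S : Set E := m '' {r | r.1 ≠ i ∧ r.1 ≠ j}
    have hS : ∀ r : Idx ℓ n, r.1 ≠ i → r.1 ≠ j → m r ∈ cl K S :=
      fun r h1 h2 => mem_cl_of_mem ⟨r, ⟨h1, h2⟩, rfl⟩
    have hμ : AlgebraicIndependent (cl K S) fun k => m (j, k) := by
      rw [algebraicIndependent_cl_iff]
      intro k hk
      have h1 := ((AlgebraicIndependent.iff_transcendental_adjoin_image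
        (⟨(j, k), hji⟩ : {r : Idx ℓ n // r.1 ≠ i})).1 hind).2
      refine h1 (mem_cl.1 (cl_mono ?_ hk))
      rintro _ (⟨r, ⟨hr1, hr2⟩, rfl⟩ | ⟨k', hk', rfl⟩)
      · exact ⟨⟨r, hr1⟩, fun h => hr2 (congr_arg (fun s => s.1.1) h), rfl⟩
      · refine ⟨⟨(j, k'), hji⟩, fun h => hk' ?_, rfl⟩
        exact congr_arg (fun s => s.1.2) h
    have hξS : ∀ t k, ξ t k ∈ cl K (S ∪ Set.range fun k => m (j, k)) := by
      intro t k
      refine cl_mono ?_ (ξ' t k).2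
      rintro _ ⟨r, hr, rfl⟩
      by_cases hrj : r.1 = j
      · exact Or.inr ⟨r.2, by rw [← hrj]⟩
      · exact Or.inl ⟨r, ⟨hr, hrj⟩, rfl⟩
    have hu : ∀ r : Idx ℓ n, r.1 ≠ j → u r ∈ cl K (S ∪ Set.range z) := by
      intro r hr
      by_cases hrT : r.1 ∈ insert i T
      · simp only [u, hrT, if_true]
        exact cl_mono Set.subset_union_right (hνz _ _)
      · simp only [u, hrT, if_false]
        exact cl_mono Set.subset_union_left
          (hS r (fun h => hrT (h ▸ Finset.mem_insert_self _ _)) hr)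
    -- `C` as a polynomial in the `j`-th group: the groups already replaced are algebraic over `z`,
    -- the others are in `S`. It vanishes at `m j`, hence at all forms through `z`.
    let H : MvPolynomial (Fin (n + 1)) (cl K (S ∪ Set.range z)) := MvPolynomial.aeval (fun r =>
      if h : r.1 ≠ j then MvPolynomial.C ⟨u r, hu r h⟩ else MvPolynomial.X r.2) C
    have hH : ∀ μ : Fin (n + 1) → E, MvPolynomial.aeval μ H =
        MvPolynomial.aeval (setGroup j μ u) C := by
      intro μ
      have h1 : ((MvPolynomial.aeval μ : _ →ₐ[cl K (S ∪ Set.range z)] E).restrictScalars K).comp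
          (MvPolynomial.aeval (fun r => if h : r.1 ≠ j then MvPolynomial.C ⟨u r, hu r h⟩ else
            MvPolynomial.X r.2)) = MvPolynomial.aeval (setGroup j μ u) := by
        refine MvPolynomial.algHom_ext fun r => ?_
        simp only [AlgHom.comp_apply, MvPolynomial.aeval_X, AlgHom.restrictScalars_apply]
        by_cases hr : r.1 = j
        · simp [setGroup, hr]
        · simp only [setGroup, hr, ne_eq, not_false_eq_true, dite_true, if_false,
            MvPolynomial.aeval_C]
          rfl
      exact DFunLike.congr_fun h1 C
    rw [← hH]
    refine aeval_eq_zero_of_sum_mul_eq_zero hres (Ne.symm hji) hS hμ hy hsplit hξ0 hξS (hξ j hji) t₀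
      hc₀ hez hzc ?_ (hν j)
    rw [hH, setGroup_self fun k => ?_]
    · exact ih
    · simp [u, hji, hj]

/-- An abstract Chow form is the Chow form of the associated algebraic set. -/
theorem IsChowForm.isChowFormFor [IsAlgClosed K] {C : MvPolynomial (Idx ℓ n) K}
    (hC : IsChowForm C) (hC0 : C ≠ 0) : IsChowFormFor (chowSet C) C := by
  classical
  have hinf : Infinite K := IsAlgClosed.instInfinite
  intro lam
  refine ⟨fun h => ?_, fun ⟨x, hx, h⟩ => eval_eq_zero_of_mem_chowSet hx h⟩
  set u : Idx ℓ n → K := fun p => lam p.1 p.2 with hu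
  -- A factor of `C` vanishing at the given system; `m` will be a generic zero of it.
  obtain ⟨C₁, hC₁, hdvd, hC₁u⟩ := exists_irreducible_factor_mem
    (RingHom.ker_isPrime (MvPolynomial.eval u)) (RingHom.mem_ker.2 h) hC0
  rw [RingHom.mem_ker] at hC₁u
  have hprime : (Ideal.span {C₁}).IsPrime :=
    (Ideal.span_singleton_prime hC₁.ne_zero).2 hC₁.prime
  obtain ⟨E, _, _, φ, hφ⟩ := exists_ringHom_isAlgClosed (Ideal.span {C₁})
  let _ : Algebra K E := (φ.comp MvPolynomial.C).toAlgebra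
  let m : Idx ℓ n → E := fun r => φ (MvPolynomial.X r)
  have hmφ : (MvPolynomial.aeval m : _ →ₐ[K] E).toRingHom = φ := by
    refine MvPolynomial.ringHom_ext (fun r => ?_) fun r => ?_
    · simp only [AlgHom.toRingHom_eq_coe, RingHom.coe_coe, MvPolynomial.aeval_C]
      rfl
    · simp [m]
  have hm : ∀ P, MvPolynomial.aeval m P = 0 ↔ C₁ ∣ P := fun P => by
    rw [← Ideal.mem_span_singleton, ← hφ, ← hmφ]
    rfl
  obtain ⟨z, hz0, hzm, hzB⟩ := hC.exists_point hC0 hC₁ hdvd hm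
  let S : Set (MvPolynomial (Fin (n + 1)) K) :=
    {f | ∃ B d, f = MvPolynomial.homogeneousComponent d (altPoly C B)}
  let T : Set (MvPolynomial (Fin (n + 1)) (MvPolynomial (Idx ℓ n) K)) :=
    MvPolynomial.map MvPolynomial.C '' S ∪
      Set.range fun i => linearForm Finset.univ fun k => MvPolynomial.X (i, k)
  have hT : ∀ t ∈ T, ∃ d, t.IsHomogeneous d := by
    rintro _ (⟨f, hf, rfl⟩ | ⟨i, rfl⟩)
    · obtain ⟨d, hd⟩ := isHomogeneous_of_mem_chowSet_equations f hf
      exact ⟨d, hd.map _⟩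
    · exact ⟨1, isHomogeneous_linearForm _ _⟩
  by_contra hcon
  -- If the given system had no zero on the closed set, an eliminant `P` would be nonzero there. But
  -- `P` vanishes at `m` because of the point `z`, so `C₁` divides it, and `C₁` vanishes at the
  -- given system.
  obtain ⟨P, hP, N, hN⟩ := exists_elimination T hT (MvPolynomial.eval u) (by
    intro x hx
    by_contra hx0
    apply hcon
    have hxS : x ∈ cone (chowSet C) := by
      rw [chowSet, mem_cone_zeroLocus isHomogeneous_of_mem_chowSet_equations]
      refine ⟨hx0, fun f hf => ?_⟩
      have := hx _ (Or.inl ⟨f, hf, rfl⟩)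
      rw [MvPolynomial.eval₂_map] at this
      have h1 : (MvPolynomial.eval u).comp MvPolynomial.C = RingHom.id K := by
        ext
        simp
      rwa [h1] at this
    obtain ⟨h0, hxW⟩ := hxS
    obtain ⟨c, hc, hcx⟩ := exists_smul_eq_coords x h0
    refine ⟨_, hxW, fun i => ?_⟩
    have := hx _ (Or.inr ⟨i, rfl⟩)
    simp only [linearForm, MvPolynomial.eval₂_sum, MvPolynomial.eval₂_mul, MvPolynomial.eval₂_C,
      MvPolynomial.eval₂_X, MvPolynomial.eval_X, hu] at this
    rw [hcx]
    simp only [Pi.smul_apply, smul_eq_mul, mul_left_comm _ c, ← Finset.mul_sum, this, mul_zero])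
  apply hP
  have hPm : MvPolynomial.aeval m P = 0 := by
    obtain ⟨k, hk⟩ := Function.ne_iff.1 hz0
    have h1 : Ideal.span T ≤ RingHom.ker (MvPolynomial.eval₂Hom
        (MvPolynomial.aeval m : _ →ₐ[K] E).toRingHom z) := by
      rw [Ideal.span_le]
      rintro _ (⟨_, ⟨B, d, rfl⟩, rfl⟩ | ⟨i, rfl⟩)
      · rw [SetLike.mem_coe, RingHom.mem_ker, MvPolynomial.coe_eval₂Hom, MvPolynomial.eval₂_map]
        have h2 : (MvPolynomial.aeval m : _ →ₐ[K] E).toRingHom.comp MvPolynomial.C =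
            algebraMap K E := RingHom.ext fun r => by simp
        rw [h2, ← MvPolynomial.aeval_def]
        exact aeval_homogeneousComponent_altPoly hzB B d
      · rw [SetLike.mem_coe, RingHom.mem_ker]
        simp only [linearForm, map_sum, map_mul, MvPolynomial.eval₂Hom_C, MvPolynomial.eval₂Hom_X']
        rw [← hzm i]
        exact Finset.sum_congr rfl fun k _ => by
          rw [mul_comm]
          congr 1
          exact MvPolynomial.aeval_X _ _
    have h3 := h1 (hN k)
    rw [RingHom.mem_ker, map_mul, map_pow, MvPolynomial.eval₂Hom_C, MvPolynomial.eval₂Hom_X'] at h3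
    exact (mul_eq_zero.1 h3).resolve_right (pow_ne_zero _ hk)
  obtain ⟨P', rfl⟩ := (hm P).1 hPm
  rw [map_mul, hC₁u, zero_mul]

end
end
end ChowForms

/-! ### The theorem -/

theorem mainTheorem2 (K : Type u) [Field K] [IsAlgClosed K] (n ℓ : ℕ)
    (C : MvPolynomial (ChowForms.Idx ℓ n) K) (hC : C ≠ 0) :
    (ChowForms.IsChowForm C ↔
      ∃ W : Set (ChowForms.ProjSpace K n), IsClosed W ∧ ChowForms.IsChowFormFor W C) ∧
    ∀ W : Set (ChowForms.ProjSpace K n), IsClosed W → ChowForms.IsChowFormFor W C →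
      (∀ U ∈ ChowForms.componentsOf W,
        ∃ P : MvPolynomial (ChowForms.Idx ℓ n) K, ChowForms.IsIrredChowFormFor U P) ∧
      (∀ P : MvPolynomial (ChowForms.Idx ℓ n) K,
        (Irreducible P ∧ P ∣ C) ↔
          ∃ U ∈ ChowForms.componentsOf W, ChowForms.IsIrredChowFormFor U P) ∧
      (∀ W' : Set (ChowForms.ProjSpace K n),
        IsClosed W' → ChowForms.IsChowFormFor W' C → W' = W) ∧
      ChowForms.HasPureDimension W ℓ := by
  refine ⟨⟨fun h => ⟨_, ChowForms.isClosed_chowSet C, h.isChowFormFor hC⟩,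
    fun ⟨W, hW, hWC⟩ => ChowForms.isChowForm_of_isChowFormFor hW hC hWC⟩,
    fun W hW hWC => ⟨fun U hU => ?_, fun P => ChowForms.isIrredChowFormFor_iff hW hC hWC P,
      fun W' hW' hWC' => ChowForms.isChowFormFor_unique hC hW hWC hW' hWC',
      ChowForms.hasPureDimension_of_isChowFormFor hW hC hWC⟩⟩
  obtain ⟨P, hP, -⟩ := ChowForms.exists_isIrredChowFormFor_of_mem_componentsOf hW hC hWC hU
  exact ⟨P, hP⟩
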